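/- Let $s>1$, let $A_n=\frac{\Gamma(sn+1)}{\Gamma((s-1)n+2)\Gamma(n+1)}$, $f_n=\sqrt{A_n}$, $g_n=f_n/\sqrt{\tfrac{s-1}{2}n+1}$, $x_c=\frac{(s-1)^{s-1}}{s^s}$, $F_c=\frac1{s-1}$ and $F(x)=\sum_{n\ge1}f_n^2x^n$; then $F(x_c)=F_c$. The Y-Hamiltonian system is $$ i\,\dot\alpha_n=\sum_{\substack{m,k,j\ge0\\ n+m=k+j}}C_{nmkj}\,\bar\alpha_m\alpha_k\alpha_j,\qquad n\ge 0, $$ with $C_{nmkj}=\sqrt{((s-1)n+2)((s-1)m+2)((s-1)k+2)((s-1)j+2)}\,\frac{f_nf_mf_kf_j}{4f_{n+m}^2}$ if $nmkj=0$ and $C_{nmkj}=0$ otherwise. Write $N=\sum|\alpha_n|^2$, $E=\sum n|\alpha_n|^2$, $\mathcal H=\frac12\sum_{n+m=k+j}C_{nmkj}\bar\alpha_n\bar\alpha_m\alpha_k\alpha_j$ and $H^\xi=\sum(n+1)^{2\xi}|\alpha_n|^2$. A solution on an interval means one for which $H^\xi$ is bounded on compact subintervals for some $\xi>2$. **(1)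 Invariant manifold.** If a solution satisfies $\alpha_0=b$, $\alpha_n=g_ncp^{n-1}$ ($n\ge1$) with $|p|^2<x_c$ at one time, then it has this form with $|p(t)|^2<x_c$ at all times of its interval of existence. Writing $F=F(|p(t)|^2)\in[0,F_c)$ and $F/|p|^2=(F+1)^s$ (also at $p=0$), $$ i\dot p=p\,\frac{2(F+1)N+(\frac F{F_c}-2)E}{2(F+1)F_c}+\frac{(F+1)^s}{F_c}b\bar cp^2+\bar bc,\qquad i\dot b=b\Big(N+\frac{E(2s+F/F_c)}{2(F+1)}\Big)+\frac{(s+1)(F+1)^s}{2(F+1)}E\,c\bar p, $$ $$ i\dot c=c\Big((s+1)N+\frac{s+1}{2(F+1)}\big(\tfrac F{F_c}-2\big)E\Big)+bp\,\frac{(s+1)^2}{2(F+1)}E . $$ Conversely, if $b,c,p$ with $|p|^2<x_c$ solve these equations and the numbers $N,E$ in them are the particle number and the energy of the corresponding state at every time, then $\alpha$ solves the Y-Hamiltonian system. Along such solutions $N$, $E$ and $$ S=\frac{E(\frac F{F_c}-2)(\frac F{F_c}+4s+2)}{4(F+1)^2}+\frac{N(\frac F{F_c}+2s)}{F+1}+(s+1)(F+1)^{s-1}(\bar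 bc\bar p+b\bar cp) $$ are conserved, $\mathcal H=\frac12(N^2+ES)$, $|b|^2=N-\frac{2-F/F_c}{2(F+1)}E$, $|c|^2=\frac{s+1}{2(F+1)^{s+1}}E$, $|p|^2=\frac{F}{(F+1)^s}$, and $\dot F^2+V(F)=0$ with $V(F)=C_0+C_1F+C_2F^2+C_3F^3+C_4F^4$. With $D=E(2s+1)-2Ns+S$, $P=E(s-1)s+N(3s-1)-2S$, $Q=E(s-1)^2+4N(s-1)-4S$, $$C_0=\tfrac{D^2}{(s+1)^2},\quad C_1=-\tfrac{2DP}{(s+1)^2}+2E(s+1)(E-N),\quad C_2=\tfrac{P^2}{(s+1)^2}-\tfrac{QD+2E(s+1)^3(E(s-1)+2N)}{2(s+1)^2},\quad C_3=\tfrac{QP}{2(s+1)^2},\quad C_4=\tfrac{Q^2}{16(s+1)^2}.$$ **(2) Range of $S$.** Let $E_c=\frac{2sN}{s-1}$ and $$S_\pm=\frac{s-1}{s^2}\Big(s(2s+1)N+\frac{-4s^2+s+3}{4}E\pm\sqrt{\tfrac{(s+1)^3}{F_c}E(E_c-E)}\Big).$$ For $0\le E\le E_c$, $V(F_c)=0$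 iff $S\in\{S_-,S_+\}$, and $V(F_c)<0$ iff $S\in(S_-,S_+)$. **(3) Cascades.** Take initial data at $t=0$ on the manifold with $|p|^2<x_c$. Suppose that either $S\in(S_-,S_+)$, or $S\in\{S_-,S_+\}$ and $V'(F_c)>0$. Then $0<E<E_c$, and there is a unique maximal forward solution; it exists exactly on $[0,T)$ for some finite $T>0$, and as $t\to T^-$: $F\to F_c$, $|p|^2\to x_c$, $F(t)=F_c-\sqrt{-V(F_c)}(T-t)-\frac14V'(F_c)(T-t)^2+o((T-t)^2)$, $$|\alpha_0|^2\to N\Big(1-\frac E{E_c}\Big),\qquad |\alpha_n|^2\to(s^2-1)N\frac E{E_c}g_n^2x_c^n\quad(n\ge1),$$ where the limit spectrum is asymptotic to $\frac{s+1}{2s}E\sqrt{\frac{E_c}{\pi N}}\,n^{-5/2}$ as $n\to\infty$. For $t<T$ all $H^\xi$ are finite. For $\xi<\frac34$, $H^\xi$ stays bounded on $[0,T)$. For $\xi>\frac34$, $H^\xi/(T-t)^{3-4\xi}$ has a limit in $(0,\infty)$ as $t\to T^-$ if $S\in(S_-,S_+)$, and $H^\xi/(T-t)^{6-8\xi}$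 has one in the endpoint case. In both cases $H^{3/4}/\log\frac1{T-t}$ has a limit in $(0,\infty)$. If neither condition on $S$ holds, the solution is unique and exists for all $t\ge0$, $\sup_{t\ge0}F<F_c$, and every $H^\xi$ is bounded on $[0,\infty)$. **(4) Explicit solution.** Let $N>0$, $\alpha_0(0)=\sqrt{\frac{s+1}{s+5}N}$, $\alpha_1(0)=\sqrt{\frac{4N}{s+5}}$, $\alpha_n(0)=0$ for $n\ge2$. The maximal forward solution lies on the manifold, with particle number $N$, $E=\frac{4}{5+s}N$, $S=2N\frac{(s-1)(2+s)}{5+s}\in(S_-,S_+)$, $V(F)=-4\Omega^2(\frac8{15}+F)F$ where $\Omega=\frac{\sqrt{15}(s+1)}{2(s+5)}N$. It is a cascade as in (3) with $T=\Omega^{-1}\operatorname{arcsinh}\sqrt{\tfrac{15}8F_c}$, and on $[0,T)$ $$F(t)=\tfrac8{15}\sinh^2(\Omega t),$$ $b=|b|e^{i\phi_b}$, $c=|c|e^{i\phi_c}$, $p=|p|e^{i\phi_p}$ with, for $a(t)=\frac1{\sqrt7}\operatorname{arctanh}\big(\sqrt{\tfrac7{15}}\tanh\Omega t\big)$, $\phi_c=-\sqrt{\tfrac35}(s+1)\Omega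 t+(s+1)a$, $\phi_p=-\frac\pi2-\sqrt{\tfrac35}(s-1)\Omega t+(s+2)a$, $\phi_b=-2\sqrt{\tfrac35}\Omega t-a-\arctan\big(\sqrt{\tfrac35}\tanh\Omega t\big)$. -/

import Mathlib

open Filter Topology Asymptotics

namespace YHamiltonian

noncomputable section

/-! ### The Y-Hamiltonian systems -/

/-- The Fuss-Catalan numbers with real parameter `s`. -/
def fussCatalan (s : ℝ) (n : ℕ) : ℝ :=
  Real.Gamma (s * n + 1) / (Real.Gamma ((s - 1) * n + 2) * Real.Gamma (n + 1))

/-- The sequence `f_n`. -/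
def fSeq (s : ℝ) (n : ℕ) : ℝ := √(fussCatalan s n)

/-- The sequence `g_n`. -/
def gSeq (s : ℝ) (n : ℕ) : ℝ := fSeq s n / √((s - 1) / 2 * n + 1)

/-- The couplings of the Y-Hamiltonian system. -/
def coupling (s : ℝ) (n m k j : ℕ) : ℝ :=
  if n * m * k * j = 0 then
    √(((s - 1) * n + 2) * ((s - 1) * m + 2) * ((s - 1) * k + 2) * ((s - 1) * j + 2)) *
      (fSeq s n * fSeq s m * fSeq s k * fSeq s j / (4 * fSeq s (n + m) ^ 2))
  else 0

/-- For fixed `n` and `m`, the finite sum over all `k, j` with `k + j = n + m` of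
`C_{nmkj} conj(a_m) a_k a_j`. -/
def resonantSum (s : ℝ) (a : ℕ → ℂ) (n m : ℕ) : ℂ :=
  ∑ q ∈ Finset.HasAntidiagonal.antidiagonal (n + m),
    (coupling s n m q.1 q.2 : ℂ) * (starRingEnd ℂ) (a m) * a q.1 * a q.2

/-- `α` solves `i dα_n/dt = ∑_{m, k, j, n + m = k + j} C_{nmkj} conj(α_m) α_k α_j` on `I`, for
every `n`; the series has to converge. -/
def IsSolutionOn (s : ℝ) (α : ℝ → ℕ → ℂ) (I : Set ℝ) : Prop :=
  ∀ t ∈ I, ∀ n : ℕ, Summable (fun m => resonantSum s (α t) n m) ∧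
    HasDerivWithinAt (fun τ => α τ n) (-Complex.I * ∑' m, resonantSum s (α t) n m) I t

/-- The terms of the Sobolev sum `∑ (n + 1)^{2ξ} |a_n|^2`. -/
def sobolevTerm (ξ : ℝ) (a : ℕ → ℂ) (n : ℕ) : ℝ := ((n : ℝ) + 1) ^ (2 * ξ) * ‖a n‖ ^ 2

/-- The Sobolev sum `H^ξ = ∑ (n + 1)^{2ξ} |a_n|^2`. -/
def sobolev (ξ : ℝ) (a : ℕ → ℂ) : ℝ := ∑' n, sobolevTerm ξ a n

/-- The class of solutions in which the system is well posed: for some `ξ > 2` the Sobolev sum is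
finite and bounded on compact time intervals. -/
def IsStrongSolutionOn (s : ℝ) (α : ℝ → ℕ → ℂ) (I : Set ℝ) : Prop :=
  IsSolutionOn s α I ∧ ∃ ξ : ℝ, 2 < ξ ∧ ∀ K ⊆ I, IsCompact K →
    ∃ R : ℝ, ∀ t ∈ K, Summable (sobolevTerm ξ (α t)) ∧ sobolev ξ (α t) ≤ R

/-- `α` is the unique strong solution on `[0, T)` with initial value `a`, and no strong solution
with this initial value exists on a longer interval `[0, T')`. -/
structure IsMaximalSolution (s : ℝ) (a : ℕ → ℂ) (T : ℝ) (α : ℝ → ℕ → ℂ) : Prop where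
  pos : 0 < T
  solves : IsStrongSolutionOn s α (Set.Ico 0 T)
  init : α 0 = a
  maximal : ∀ (T' : ℝ) (β : ℝ → ℕ → ℂ), 0 < T' → IsStrongSolutionOn s β (Set.Ico 0 T') → β 0 = a →
    T' ≤ T ∧ ∀ t ∈ Set.Ico 0 T', β t = α t

/-- `α` is a strong solution on `[0, ∞)` with initial value `a`, and every strong solution on an
interval `[0, T')` with this initial value agrees with it. -/
structure IsGlobalSolution (s : ℝ) (a : ℕ → ℂ) (α : ℝ → ℕ → ℂ) : Prop where
  solves : IsStrongSolutionOn s α (Set.Ici 0)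
  init : α 0 = a
  unique : ∀ (T' : ℝ) (β : ℝ → ℕ → ℂ), 0 < T' → IsStrongSolutionOn s β (Set.Ico 0 T') → β 0 = a →
    ∀ t ∈ Set.Ico 0 T', β t = α t

/-- The particle number `N = ∑ |a_n|^2`. -/
def particleNumber (a : ℕ → ℂ) : ℝ := ∑' n, ‖a n‖ ^ 2

/-- The energy `E = ∑ n |a_n|^2`. -/
def energy (a : ℕ → ℂ) : ℝ := ∑' n : ℕ, (n : ℝ) * ‖a n‖ ^ 2

/-- The `(n, m)` term of the Hamiltonian
`(1/2) ∑_{n, m, k, j, n + m = k + j} C_{nmkj} conj(a_n) conj(a_m) a_k a_j`. -/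
def hamiltonianTerm (s : ℝ) (a : ℕ → ℂ) (q : ℕ × ℕ) : ℂ :=
  1 / 2 * ((starRingEnd ℂ) (a q.1) * resonantSum s a q.1 q.2)

/-! ### The invariant manifold and the reduced dynamics -/

/-- The point `a_0 = b`, `a_n = g_n c p^{n-1}` for `n ≥ 1`. -/
def manifoldState (s : ℝ) (b c p : ℂ) : ℕ → ℂ
  | 0 => b
  | n + 1 => (gSeq s (n + 1) : ℂ) * c * p ^ n

/-- The critical value `x_c`. -/
def xCrit (s : ℝ) : ℝ := (s - 1) ^ (s - 1) / s ^ s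

/-- The critical value `F_c`. -/
def FCrit (s : ℝ) : ℝ := 1 / (s - 1)

/-- The generating function `F(x) = ∑_{n ≥ 1} f_n^2 x^n`. -/
def genF (s x : ℝ) : ℝ := ∑' n : ℕ, fSeq s (n + 1) ^ 2 * x ^ (n + 1)

/-- `F` at the point of the manifold with parameter `p`, that is, `F(|p|^2)`. -/
def bigF (s : ℝ) (p : ℂ) : ℝ := genF s (‖p‖ ^ 2)

/-- The conserved quantity `S` in terms of `N`, `E` and the parameters of the manifold. -/
def quantityS (s N E : ℝ) (b c p : ℂ) : ℝ :=
  E * (bigF s p / FCrit s - 2) * (bigF s p / FCrit s + 4 * s + 2) / (4 * (bigF s p + 1) ^ 2) +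
    N * (bigF s p / FCrit s + 2 * s) / (bigF s p + 1) +
    (s + 1) * (bigF s p + 1) ^ (s - 1) *
      ((starRingEnd ℂ) b * c * (starRingEnd ℂ) p + b * (starRingEnd ℂ) c * p).re

/-- The three reduced equations for `b, c, p` on `I`. With `x = |p|^2`, the factor `F / x` is
written as `(F + 1)^s`, which is its value also at `p = 0`; likewise `p * conj p / x` is `1`. -/
structure ReducedEquations (s N E : ℝ) (I : Set ℝ) (b c p : ℝ → ℂ) : Prop where
  deriv_p : ∀ t ∈ I, HasDerivWithinAt p (-Complex.I *
    (p t * ((2 * (bigF s (p t) + 1) * N + (bigF s (p t) / FCrit s - 2) * E) /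
        (2 * (bigF s (p t) + 1) * FCrit s) : ℝ) +
      b t * (starRingEnd ℂ) (c t) * p t ^ 2 * ((bigF s (p t) + 1) ^ s / FCrit s : ℝ) +
      (starRingEnd ℂ) (b t) * c t)) I t
  deriv_b : ∀ t ∈ I, HasDerivWithinAt b (-Complex.I *
    (b t * (N + E / (2 * (bigF s (p t) + 1)) * (2 * s + bigF s (p t) / FCrit s) : ℝ) +
      c t * (starRingEnd ℂ) (p t) *
        ((bigF s (p t) + 1) ^ s * (s + 1) / (2 * (bigF s (p t) + 1)) * E : ℝ))) I t
  deriv_c : ∀ t ∈ I, HasDerivWithinAt c (-Complex.I *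
    (c t * ((s + 1) * N +
        (s + 1) / (2 * (bigF s (p t) + 1)) * (bigF s (p t) / FCrit s - 2) * E : ℝ) +
      b t * p t * ((s + 1) ^ 2 / (2 * (bigF s (p t) + 1)) * E : ℝ))) I t

/-- The coefficients `C_0, …, C_4` of the potential. -/
def potCoeff (s N E S : ℝ) : Fin 5 → ℝ :=
  ![(E * (2 * s + 1) - 2 * N * s + S) ^ 2 / (s + 1) ^ 2,
    2 * (E * (2 * s + 1) - 2 * N * s + S) * (-E * (s - 1) * s + N * (1 - 3 * s) + 2 * S) /
        (s + 1) ^ 2 + 2 * E * (s + 1) * (E - N),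
    (E * (s - 1) * s + N * (3 * s - 1) - 2 * S) ^ 2 / (s + 1) ^ 2 -
      ((E * (s - 1) ^ 2 + 4 * N * (s - 1) - 4 * S) * (E * (2 * s + 1) - 2 * N * s + S) +
        2 * E * (s + 1) ^ 3 * (E * (s - 1) + 2 * N)) / (2 * (s + 1) ^ 2),
    (E * (s - 1) ^ 2 + 4 * N * (s - 1) - 4 * S) *
      (E * (s - 1) * s + N * (3 * s - 1) - 2 * S) / (2 * (s + 1) ^ 2),
    (E * (s - 1) ^ 2 + 4 * N * (s - 1) - 4 * S) ^ 2 / (16 * (s + 1) ^ 2)]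

/-- The quartic potential `V`. -/
def potential (s N E S : ℝ) : Polynomial ℝ :=
  ∑ i : Fin 5, Polynomial.C (potCoeff s N E S i) * Polynomial.X ^ (i : ℕ)

/-- On `I` the trajectory `α` lies on the manifold, with parameters `b, c, p` that satisfy the
reduced equations; `N`, `E`, `S` are conserved and `F` moves in the potential `V`. -/
structure ReducedDynamics (s N E S : ℝ) (I : Set ℝ) (α : ℝ → ℕ → ℂ) (b c p : ℝ → ℂ) : Prop where
  state_eq : ∀ t ∈ I, α t = manifoldState s (b t) (c t) (p t)
  p_lt : ∀ t ∈ I, ‖p t‖ ^ 2 < xCrit s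
  equations : ReducedEquations s N E I b c p
  number_eq : ∀ t ∈ I, HasSum (fun n : ℕ => ‖α t n‖ ^ 2) N
  energy_eq : ∀ t ∈ I, HasSum (fun n : ℕ => (n : ℝ) * ‖α t n‖ ^ 2) E
  S_eq : ∀ t ∈ I, quantityS s N E (b t) (c t) (p t) = S
  hamiltonian_eq : ∀ t ∈ I,
    HasSum (hamiltonianTerm s (α t)) ((1 / 2 * (N ^ 2 + E * S) : ℝ) : ℂ)
  F_mem : ∀ t ∈ I, bigF s (p t) ∈ Set.Ico 0 (FCrit s)
  b_sq : ∀ t ∈ I,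
    ‖b t‖ ^ 2 = N - (2 - bigF s (p t) / FCrit s) / (2 * (bigF s (p t) + 1)) * E
  c_sq : ∀ t ∈ I, ‖c t‖ ^ 2 = (s + 1) / (2 * (bigF s (p t) + 1) ^ (s + 1)) * E
  p_sq : ∀ t ∈ I, ‖p t‖ ^ 2 = bigF s (p t) / (bigF s (p t) + 1) ^ s
  F_deriv : ∀ t ∈ I, ∃ v : ℝ, HasDerivWithinAt (fun τ => bigF s (p τ)) v I t ∧
    v ^ 2 + (potential s N E S).eval (bigF s (p t)) = 0

/-! ### Cascades -/

/-- The upper bound `E_c` for the energy. -/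
def ECrit (s N : ℝ) : ℝ := 2 * s * N / (s - 1)

/-- The endpoint `S_-`. -/
def SMinus (s N E : ℝ) : ℝ :=
  (s - 1) / s ^ 2 * (s * (2 * s + 1) * N + (-4 * s ^ 2 + s + 3) / 4 * E -
    √((s + 1) ^ 3 / FCrit s * E * (ECrit s N - E)))

/-- The endpoint `S_+`. -/
def SPlus (s N E : ℝ) : ℝ :=
  (s - 1) / s ^ 2 * (s * (2 * s + 1) * N + (-4 * s ^ 2 + s + 3) / 4 * E +
    √((s + 1) ^ 3 / FCrit s * E * (ECrit s N - E)))

/-- `S` is one of the endpoints `S_-`, `S_+`, and `V'(F_c) > 0`. -/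
def EndpointCondition (s N E S : ℝ) : Prop :=
  (S = SMinus s N E ∨ S = SPlus s N E) ∧
    0 < (potential s N E S).derivative.eval (FCrit s)

/-- The condition on the conserved quantities for a cascade. -/
def CascadeCondition (s N E S : ℝ) : Prop :=
  S ∈ Set.Ioo (SMinus s N E) (SPlus s N E) ∨ EndpointCondition s N E S

/-- The limit of `|α_n|^2`, `n ≥ 1`, at the time of the cascade. -/
def limitSpectrum (s N E : ℝ) (n : ℕ) : ℝ :=
  (s ^ 2 - 1) * N * (E / ECrit s N) * gSeq s n ^ 2 * xCrit s ^ n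

/-- A `-5/2`-cascade at the finite time `T`: `F` reaches `F_c`, the spectrum develops the power law
`n^{-5/2}`, and the Sobolev sums with `ξ ≥ 3/4`, and only these, blow up, at the given rates. -/
structure IsCascade (s N E S T : ℝ) (α : ℝ → ℕ → ℂ) (p : ℝ → ℂ) : Prop where
  energy_pos : 0 < E
  energy_lt : E < ECrit s N
  F_tendsto : Tendsto (fun t => bigF s (p t)) (𝓝[<] T) (𝓝 (FCrit s))
  x_tendsto : Tendsto (fun t => ‖p t‖ ^ 2) (𝓝[<] T) (𝓝 (xCrit s))
  F_expansion : (fun t => bigF s (p t) - (FCrit s -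
      √(-(potential s N E S).eval (FCrit s)) * (T - t) -
      (potential s N E S).derivative.eval (FCrit s) * (T - t) ^ 2 / 4)) =o[𝓝[<] T]
    fun t => (T - t) ^ 2
  mode_zero : Tendsto (fun t => ‖α t 0‖ ^ 2) (𝓝[<] T) (𝓝 (N * (1 - E / ECrit s N)))
  modes : ∀ n : ℕ, 1 ≤ n →
    Tendsto (fun t => ‖α t n‖ ^ 2) (𝓝[<] T) (𝓝 (limitSpectrum s N E n))
  power_law : (fun n : ℕ => limitSpectrum s N E n) ~[atTop] fun n : ℕ =>
    (s + 1) / (2 * s) * E * √(ECrit s N / (Real.pi * N)) * (n : ℝ) ^ (-(5 / 2) : ℝ)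
  sobolev_summable : ∀ t ∈ Set.Ico 0 T, ∀ ξ : ℝ, Summable (sobolevTerm ξ (α t))
  sobolev_bounded : ∀ ξ : ℝ, ξ < 3 / 4 → ∃ R : ℝ, ∀ t ∈ Set.Ico 0 T, sobolev ξ (α t) ≤ R
  sobolev_interior : S ∈ Set.Ioo (SMinus s N E) (SPlus s N E) → ∀ ξ : ℝ, 3 / 4 < ξ →
    ∃ C : ℝ, 0 < C ∧
      Tendsto (fun t => sobolev ξ (α t) / (T - t) ^ (3 - 4 * ξ)) (𝓝[<] T) (𝓝 C)
  sobolev_endpoint : EndpointCondition s N E S → ∀ ξ : ℝ, 3 / 4 < ξ →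
    ∃ C : ℝ, 0 < C ∧
      Tendsto (fun t => sobolev ξ (α t) / (T - t) ^ (6 - 8 * ξ)) (𝓝[<] T) (𝓝 C)
  sobolev_log : ∃ C : ℝ, 0 < C ∧
    Tendsto (fun t => sobolev (3 / 4) (α t) / Real.log (1 / (T - t))) (𝓝[<] T) (𝓝 C)

/-! ### Two-mode initial data -/

/-- The initial condition with `N` the particle number and only the modes `0` and `1` excited. -/
def twoModeData (s N : ℝ) : ℕ → ℂ
  | 0 => (√((s + 1) / (s + 5) * N) : ℝ)
  | 1 => (√(4 * N / (s + 5)) : ℝ)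
  | _ => 0

/-- The rate `Ω`. -/
def rateΩ (s N : ℝ) : ℝ := √15 * (s + 1) / (2 * (s + 5)) * N

/-- The time `T` at which the explicit solution reaches `F_c`. -/
def explicitT (s N : ℝ) : ℝ := (rateΩ s N)⁻¹ * Real.arsinh (√(15 / 8 * FCrit s))

/-- The explicit phase of `b`. -/
def phaseB (s N t : ℝ) : ℝ :=
  -2 * √(3 / 5) * rateΩ s N * t -
    1 / √7 * Real.artanh (√(7 / 15) * Real.tanh (rateΩ s N * t)) -
    Real.arctan (√(3 / 5) * Real.tanh (rateΩ s N * t))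

/-- The explicit phase of `c`. -/
def phaseC (s N t : ℝ) : ℝ :=
  -√(3 / 5) * (s + 1) * rateΩ s N * t +
    (s + 1) / √7 * Real.artanh (√(7 / 15) * Real.tanh (rateΩ s N * t))

/-- The explicit phase of `p`. -/
def phaseP (s N t : ℝ) : ℝ :=
  -(Real.pi / 2) - √(3 / 5) * (s - 1) * rateΩ s N * t +
    (s + 2) / √7 * Real.artanh (√(7 / 15) * Real.tanh (rateΩ s N * t))

end

end YHamiltonian

/-!
# Turbulent cascades in the Y-Hamiltonian systems

**The manifold is closed.** Multiplied by their weights, the modes of a point of the manifold are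
`b` and `A_n c p ^ (n - 1)`, so the nonlinearity turns into convolutions of Fuss-Catalan numbers.
The identity `sum_fussCatalan_mul_fussCatalan`, which follows from the coefficient identities for
`∑ A_k y ^ k (1 + y) ^ (-s k)`, evaluates them in closed form. Hence the resonant sums on the
manifold are again tangent to it (`hasSum_resonantSum_zero`, `hasSum_resonantSum_succ`), and the
system restricts to a vector field in `b, c, p`. The same identity is a differential equation for the
generating function `F`; its solution is `F = x (1 + F) ^ s` (`invF_genF`). So `F` is the inverse of
`y / (1 + y) ^ s`, which is increasing up to the nondegenerate maximum `x_c` at `F_c`.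

**Uniqueness.** For two strong solutions with difference `δ` and mean `w`, the imaginary part of the
difference of the nonlinear terms paired with `δ` is that of `∑ C conj(δ_n) conj(δ_m) w_k w_j`, all
other terms being real. This form is bounded on `ℓ²`, as its kernel in `(n, m)` is square summable
(`norm_tsum_quarticTerm_le`); Gronwall's lemma gives `IsStrongSolutionOn.eq_of_eq`.

**Desingularization.** In `q = p (F + 1) ^ (s / 2)` and `d = c (F + 1) ^ ((s + 1) / 2) / κ` the vector
field on the manifold is smooth on all of `ℂ³`, also beyond the critical point, and `F = |q| ^ 2`,
`E = |d| ^ 2`. The conservation of `N`, `E` and `S` bounds the trajectories, so that each point of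
the manifold lies on a global trajectory of the field with a cutoff that acts only for
`F > F_c + 1` (`exists_coveringFlow`). Real and imaginary part of `conj b d conj q` are, up to a
common factor, a quadratic polynomial in `F` and the velocity of `F`, and the modulus is a function
of `F`: this is `F' ^ 2 + V(F) = 0` (`velocity_sq`). A trajectory is a strong solution exactly while
`F < F_c`, since at `F_c` the spectrum decays only like `n ^ (-5 / 2)`
(`IsCoveringFlow.lt_of_isStrongSolutionOn`). With uniqueness, this gives the invariance of the
manifold, and it makes the first time at which `F = F_c` the maximal time of existence.

**Reaching `F_c`.** The quartic `V` has a nonnegative leading coefficient, `V(-1) < 0` and `V(0) ≥ 0`.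
If `V(F_c) ≤ 0`, there is therefore no room for a further change of sign between a point with
`V < 0` and `F_c` (`potential_neg_of_lt`), nor for a double root below `F_c` (`not_double_root`).
Hence, if `V(F_c) < 0`, or `V(F_c) = 0 < V'(F_c)`, then `F` cannot stay below `F_c`: either it
increases at some time and goes on to `F_c` in finite time, by `exists_potential_le`, or it decreases
forever to a double root (`IsCoveringFlow.exists_first_time`). In the remaining cases `V > 0`
immediately below `F_c` (`exists_potential_pos`), which keeps `F` away from `F_c`
(`IsCoveringFlow.exists_bound`). The sign of `V(F_c)` in terms of `S` is `potential_sign`.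

**Rates.** Since the desingularized flow is regular at the time of the cascade, `F` has a Taylor
expansion there (`IsCoveringFlow.expansion`), and `x_c - |p| ^ 2` is of the order of
`(F_c - F) ^ 2`. By Stirling's formula `A_n x_c ^ n` is asymptotic to a multiple of `n ^ (-3 / 2)`, so
that an Abelian theorem (`tendsto_tsum_div_tsum`) gives the growth of the Sobolev sums as
`|p| ^ 2 → x_c` (`IsCoveringFlow.tendsto_sobolev`, `IsCoveringFlow.tendsto_sobolev_log`).

**The explicit solution.** For the two-mode data `V` is quadratic, so that `F` solves a linear
equation (`eq_sinh_of_hasDerivAt`). The logarithmic derivatives of `b` and `d` are functions of `F`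
and `F'`, which integrate to the stated phases (`eq_norm_mul_exp`), and the phase of `p` follows from
the argument of `conj b d conj q` (`IsCoveringFlow.explicit_phase_q`).
-/

open Finset.HasAntidiagonal (antidiagonal)

namespace YHamiltonian


/-! ### The Fuss-Catalan convolution -/

theorem Gamma_add_one_eq_prod_mul (x : ℝ) (n : ℕ) (h : (n : ℝ) < x + 1) :
    Real.Gamma (x + 1) = (∏ i ∈ Finset.range n, (x - i)) * Real.Gamma (x + 1 - n) := by
  induction n with
  | zero => simp
  | succ n ih =>
    push_cast at h
    rw [ih (by linarith), Finset.prod_range_succ, mul_assoc]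
    have : x + 1 - (n : ℝ) = (x - n) + 1 := by ring
    rw [this, Real.Gamma_add_one (by linarith)]
    congr 3
    push_cast
    ring

theorem choose_eq_prod (r : ℝ) (n : ℕ) :
    Ring.choose r n = (∏ i ∈ Finset.range n, (r - i)) / n.factorial := by
  rw [Ring.choose_eq_smul, smul_eq_mul, inv_mul_eq_div]
  congr 1
  induction n with
  | zero => simp
  | succ n ih =>
    rw [Finset.prod_range_succ, ← ih, descPochhammer_succ_right, Polynomial.smeval_mul,
      Polynomial.smeval_sub, Polynomial.smeval_X, Polynomial.smeval_natCast]
    simp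

theorem fussCatalan_zero (s : ℝ) : fussCatalan s 0 = 1 := by
  simp [fussCatalan]

theorem fussCatalan_pos {s : ℝ} (hs : 1 < s) (n : ℕ) : 0 < fussCatalan s n := by
  have h : 0 ≤ (s - 1) * n := mul_nonneg (by linarith) n.cast_nonneg
  have h' : 0 ≤ s * n := mul_nonneg (by linarith) n.cast_nonneg
  unfold fussCatalan
  have h1 := Real.Gamma_pos_of_pos (show 0 < s * n + 1 by linarith)
  have h2 := Real.Gamma_pos_of_pos (show 0 < (s - 1) * n + 2 by linarith)
  have h3 := Real.Gamma_pos_of_pos (show (0 : ℝ) < n + 1 by positivity)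
  positivity

theorem choose_mul_self {s : ℝ} (hs : 1 < s) (n : ℕ) :
    Ring.choose (s * n) n = ((s - 1) * n + 1) * fussCatalan s n := by
  have h : 0 ≤ (s - 1) * n := mul_nonneg (by linarith) n.cast_nonneg
  have h0 : (n : ℝ) < s * n + 1 := by linarith
  have h1 := Real.Gamma_pos_of_pos (show 0 < (s - 1) * n + 1 by linarith)
  rw [choose_eq_prod, fussCatalan, Gamma_add_one_eq_prod_mul _ n h0, Real.Gamma_nat_eq_factorial,
    show (s - 1) * n + 2 = ((s - 1) * n + 1) + 1 by ring, Real.Gamma_add_one (by linarith),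
    show s * n + 1 - n = (s - 1) * n + 1 by ring]
  have : (n.factorial : ℝ) ≠ 0 := by positivity
  have : (s - 1) * n + 1 ≠ 0 := by linarith
  have := h1.ne'
  generalize Real.Gamma ((s - 1) * n + 1) = y at *
  generalize (s - 1) * n + 1 = z at *
  field_simp

theorem fussCatalan_succ_eq_prod {s : ℝ} (hs : 1 < s) (n : ℕ) :
    fussCatalan s (n + 1) =
      (∏ i ∈ Finset.range n, (s * (n + 1 : ℕ) - i)) / (n + 1).factorial := by
  have h : 0 ≤ (s - 1) * (n + 1) := mul_nonneg (by linarith) (by positivity)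
  have h0 : (n : ℝ) < s * (n + 1 : ℕ) + 1 := by push_cast; linarith
  have h1 := Real.Gamma_pos_of_pos (show 0 < (s - 1) * (n + 1 : ℕ) + 2 by push_cast; linarith)
  rw [fussCatalan, Gamma_add_one_eq_prod_mul _ n h0, Real.Gamma_nat_eq_factorial,
    show s * (n + 1 : ℕ) + 1 - n = (s - 1) * (n + 1 : ℕ) + 2 by push_cast; ring]
  have : ((n + 1).factorial : ℝ) ≠ 0 := by positivity
  have := h1.ne'
  generalize Real.Gamma ((s - 1) * (n + 1 : ℕ) + 2) = y at *
  field_simp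

theorem choose_mul_succ {s : ℝ} (hs : 1 < s) (n : ℕ) :
    Ring.choose (s * (n + 1 : ℕ)) n = (n + 1) * fussCatalan s (n + 1) := by
  rw [choose_eq_prod, fussCatalan_succ_eq_prod hs, Nat.factorial_succ]
  have : (n.factorial : ℝ) ≠ 0 := by positivity
  push_cast
  field_simp

theorem prod_sub_mul_prod_add (x : ℝ) {k m M : ℕ} (h : k + m = M + 1) :
    (∏ i ∈ Finset.range k, (x - i)) * ∏ i ∈ Finset.range m, (x + i) =
      x * ∏ j ∈ Finset.range M, (x - k + 1 + j) := by
  rcases k with _ | k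
  · obtain rfl : m = M + 1 := by omega
    rw [Finset.prod_range_succ']
    simp only [Finset.range_zero, Finset.prod_empty, one_mul, Nat.cast_zero, add_zero, sub_zero]
    rw [mul_comm]
    congr 1
    refine Finset.prod_congr rfl fun i _ => ?_
    push_cast
    ring
  · obtain rfl : M = k + m := by omega
    rw [Finset.prod_range_succ', Finset.prod_range_add, ← Finset.prod_range_reflect]
    simp only [Nat.cast_zero, sub_zero]
    rw [mul_comm _ x, mul_assoc]
    congr 2
    · refine Finset.prod_congr rfl fun i hi => ?_
      have : i + 1 ≤ k := Finset.mem_range.1 hi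
      have e : k - 1 - i = k - (i + 1) := by omega
      rw [e]
      push_cast [Nat.cast_sub this]
      ring
    · refine Finset.prod_congr rfl fun i _ => ?_
      push_cast
      ring

/-- The coefficient of `y ^ (N + 1)` in `∑ A_k y ^ k (1 + y) ^ (-s k)`: up to a factor it is an
`N`-th finite difference of a polynomial of degree `N - 1`. -/
theorem sum_fussCatalan_mul_choose_neg {s : ℝ} (hs : 1 < s) (N : ℕ) :
    ∑ q ∈ antidiagonal N,
      fussCatalan s (q.1 + 1) * Ring.choose (-(s * (q.1 + 1 : ℕ))) q.2 = if N = 0 then 1 else 0 := by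
  rcases N with _ | M
  · simp [fussCatalan_succ_eq_prod hs]
  rw [if_neg (by omega)]
  let P : Polynomial ℝ := ∏ j ∈ Finset.range M,
    (Polynomial.C (s - 1) * Polynomial.X + Polynomial.C ((s - 1) + 2 + j))
  have hP : P.natDegree < M + 1 := by
    refine lt_of_le_of_lt (Polynomial.natDegree_prod_le _ _) ?_
    refine lt_of_le_of_lt (Finset.sum_le_card_nsmul _ _ 1 fun j _ => ?_) ?_
    · exact Polynomial.natDegree_linear_le
    · simp
  have key := congrFun (Polynomial.fwdDiff_iter_eq_zero_of_degree_lt hP) 0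
  rw [fwdDiff_iter_eq_sum_shift] at key
  rw [Finset.Nat.sum_antidiagonal_eq_sum_range_succ_mk]
  have : ∀ k ∈ Finset.range (M + 1).succ,
      fussCatalan s (k + 1) * Ring.choose (-(s * (k + 1 : ℕ))) (M + 1 - k) =
      s / (M + 1).factorial *
        (((-1 : ℤ) ^ (M + 1 - k) * ((M + 1).choose k : ℤ)) • P.eval (0 + k • (1 : ℝ))) := by
    intro k hk
    have hk' : k ≤ M + 1 := Nat.lt_succ_iff.1 (Finset.mem_range.1 hk)
    obtain ⟨m, hm⟩ := Nat.exists_eq_add_of_le hk'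
    have hm' : M + 1 - k = m := by omega
    have e1 : ∏ i ∈ Finset.range m, (-(s * (k + 1 : ℕ)) - (i : ℝ)) =
        (-1) ^ m * ∏ i ∈ Finset.range m, (s * (k + 1 : ℕ) + (i : ℝ)) := by
      rw [← Finset.card_range m, ← Finset.prod_const, Finset.card_range, ← Finset.prod_mul_distrib]
      exact Finset.prod_congr rfl fun i _ => by ring
    have e2 := prod_sub_mul_prod_add (s * (k + 1 : ℕ)) hm.symm
    have e3 : P.eval (0 + k • (1 : ℝ)) =
        ∏ j ∈ Finset.range M, (s * (k + 1 : ℕ) - k + 1 + (j : ℝ)) := by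
      simp only [P, Polynomial.eval_prod]
      refine Finset.prod_congr rfl fun j _ => ?_
      simp
      ring
    have e4 : ((M + 1).choose k : ℝ) = (M + 1).factorial / (k.factorial * m.factorial) := by
      rw [hm]
      exact Nat.cast_add_choose ℝ
    rw [hm', choose_eq_prod, fussCatalan_succ_eq_prod hs, e1, e3, zsmul_eq_mul]
    push_cast [e4, Nat.factorial_succ]
    push_cast at e2
    have : (k.factorial : ℝ) ≠ 0 := by positivity
    have : (m.factorial : ℝ) ≠ 0 := by positivity
    have : (M.factorial : ℝ) ≠ 0 := by positivity
    have : (k + 1 : ℝ) ≠ 0 := by positivity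
    field_simp
    rw [e2]
  rw [Finset.sum_congr rfl this, ← Finset.mul_sum, key]
  simp

/-- The coefficient of `y ^ (N + 1)` in `∑ A_k y ^ k (1 + y) ^ (q - s k) = y (1 + y) ^ q`. -/
theorem sum_fussCatalan_mul_choose {s : ℝ} (hs : 1 < s) (q : ℝ) (N : ℕ) :
    ∑ a ∈ antidiagonal N,
      fussCatalan s (a.1 + 1) * Ring.choose (q - s * (a.1 + 1 : ℕ)) a.2 = Ring.choose q N := by
  have h1 : ∀ a ∈ antidiagonal N,
      fussCatalan s (a.1 + 1) * Ring.choose (q - s * (a.1 + 1 : ℕ)) a.2 =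
      ∑ b ∈ antidiagonal a.2, fussCatalan s (a.1 + 1) *
        (Ring.choose (-(s * (a.1 + 1 : ℕ))) b.1 * Ring.choose q b.2) := by
    intro a _
    rw [show q - s * (a.1 + 1 : ℕ) = -(s * (a.1 + 1 : ℕ)) + q by ring,
      Ring.add_choose_eq _ (Commute.all _ _), Finset.mul_sum]
  have h2 : ∀ a ∈ antidiagonal N, (∑ b ∈ antidiagonal a.1, fussCatalan s (b.1 + 1) *
      Ring.choose (-(s * (b.1 + 1 : ℕ))) b.2) * Ring.choose q a.2 =
      if a = (0, N) then Ring.choose q N else 0 := by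
    rintro ⟨i, j⟩ ha
    have hij : i + j = N := Finset.HasAntidiagonal.mem_antidiagonal.1 ha
    rw [sum_fussCatalan_mul_choose_neg hs]
    rcases i with _ | i
    · obtain rfl : j = N := by simpa using hij
      simp
    · simp
  have h3 : ∑ a ∈ antidiagonal N, (∑ b ∈ antidiagonal a.1, fussCatalan s (b.1 + 1) *
      Ring.choose (-(s * (b.1 + 1 : ℕ))) b.2) * Ring.choose q a.2 = Ring.choose q N := by
    rw [Finset.sum_congr rfl h2, Finset.sum_ite_eq', if_pos]
    simp
  rw [Finset.sum_congr rfl h1, ← h3]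
  simp only [Finset.sum_mul]
  rw [Finset.sum_sigma', Finset.sum_sigma']
  refine Finset.sum_nbij' (fun x => ⟨(x.1.1 + x.2.1, x.2.2), (x.1.1, x.2.1)⟩)
    (fun x => ⟨(x.2.1, x.2.2 + x.1.2), (x.2.2, x.1.2)⟩) ?_ ?_ ?_ ?_ ?_
  · rintro ⟨⟨i, j⟩, k, l⟩ h
    simp only [Finset.mem_sigma, Finset.HasAntidiagonal.mem_antidiagonal] at h ⊢
    exact ⟨by omega, trivial⟩
  · rintro ⟨⟨i, j⟩, k, l⟩ h
    simp only [Finset.mem_sigma, Finset.HasAntidiagonal.mem_antidiagonal] at h ⊢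
    exact ⟨by omega, trivial⟩
  · rintro ⟨⟨i, j⟩, k, l⟩ h
    simp only [Finset.mem_sigma, Finset.HasAntidiagonal.mem_antidiagonal] at h ⊢
    obtain ⟨_, rfl⟩ := h
    rfl
  · rintro ⟨⟨i, j⟩, k, l⟩ h
    simp only [Finset.mem_sigma, Finset.HasAntidiagonal.mem_antidiagonal] at h ⊢
    obtain ⟨_, rfl⟩ := h
    rfl
  · rintro ⟨⟨i, j⟩, k, l⟩ h
    simp only
    ring

theorem sum_fussCatalan_mul_weighted {s : ℝ} (hs : 1 < s) (N : ℕ) :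
    ∑ a ∈ antidiagonal N,
      fussCatalan s (a.1 + 1) * (((s - 1) * a.2 + 1) * fussCatalan s a.2) =
      (N + 1) * fussCatalan s (N + 1) := by
  rw [← choose_mul_succ hs, ← sum_fussCatalan_mul_choose hs]
  refine Finset.sum_congr rfl fun a ha => ?_
  rw [← choose_mul_self hs]
  congr 2
  rw [← Finset.HasAntidiagonal.mem_antidiagonal.1 ha]
  push_cast
  ring

/-- The convolution identity for the Fuss-Catalan numbers. It is what makes the manifold
invariant. -/
theorem sum_fussCatalan_mul_fussCatalan {s : ℝ} (hs : 1 < s) (L : ℕ) :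
    ((s - 1) / 2 * (L + 2) + 1) * ∑ a ∈ antidiagonal L,
      fussCatalan s (a.1 + 1) * fussCatalan s (a.2 + 1) = (L + 1) * fussCatalan s (L + 2) := by
  have h := sum_fussCatalan_mul_weighted hs (L + 1)
  rw [Finset.Nat.sum_antidiagonal_succ'] at h
  simp only [Nat.cast_zero, mul_zero, zero_add, fussCatalan_zero, mul_one] at h
  have h2 := h
  rw [← Finset.Nat.sum_antidiagonal_swap] at h2
  have h3 : ((s - 1) / 2 * (L + 2) + 1) * ∑ a ∈ antidiagonal L,
      fussCatalan s (a.1 + 1) * fussCatalan s (a.2 + 1) =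
      (∑ a ∈ antidiagonal L, fussCatalan s (a.1 + 1) *
        (((s - 1) * (a.2 + 1 : ℕ) + 1) * fussCatalan s (a.2 + 1)) +
      ∑ a ∈ antidiagonal L, fussCatalan s (a.swap.1 + 1) *
        (((s - 1) * (a.swap.2 + 1 : ℕ) + 1) * fussCatalan s (a.swap.2 + 1))) / 2 := by
    rw [← Finset.sum_add_distrib, Finset.mul_sum, Finset.sum_div]
    refine Finset.sum_congr rfl fun a ha => ?_
    rw [← Finset.HasAntidiagonal.mem_antidiagonal.1 ha]
    push_cast [Prod.fst_swap, Prod.snd_swap]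
    ring
  rw [h3]
  push_cast at h h2 ⊢
  linarith


/-! ### Stirling's formula and the growth of the Fuss-Catalan numbers -/

/-- The logarithm of the ratio of `Γ (x + 1)` and `√x (x / e) ^ x`. -/
noncomputable def logStirlingRatio (x : ℝ) : ℝ :=
  Real.log (Real.Gamma (x + 1)) - Real.log x / 2 - x * Real.log x + x

theorem tendsto_logStirlingRatio_nat :
    Tendsto (fun n : ℕ => logStirlingRatio n) atTop (𝓝 (Real.log (2 * Real.pi) / 2)) := by
  have h := Stirling.tendsto_stirlingSeq_sqrt_pi.log (by positivity)
  have h2 := h.add_const (Real.log 2 / 2)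
  have e : Real.log √Real.pi + Real.log 2 / 2 = Real.log (2 * Real.pi) / 2 := by
    rw [Real.log_sqrt Real.pi_pos.le, Real.log_mul two_ne_zero Real.pi_ne_zero]
    ring
  rw [e] at h2
  refine h2.congr' ?_
  filter_upwards [eventually_gt_atTop 0] with n hn
  have hn' : (n : ℝ) ≠ 0 := by positivity
  rw [Stirling.log_stirlingSeq_formula, logStirlingRatio, Real.Gamma_nat_eq_factorial,
    Real.log_mul two_ne_zero hn', Real.log_div hn' (Real.exp_ne_zero 1), Real.log_exp]
  ring

theorem log_Gamma_add_le {n : ℕ} (hn : 0 < n) {θ : ℝ} (h0 : 0 ≤ θ) (h1 : θ ≤ 1) :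
    Real.log (Real.Gamma (n + θ + 1)) ≤
      Real.log (Real.Gamma (n + 1)) + θ * Real.log (n + 1) := by
  rcases h0.eq_or_lt with rfl | h0
  · simp
  have h := Real.BohrMollerup.f_add_nat_le (f := Real.log ∘ Real.Gamma) (n := n + 1) (x := θ)
    Real.convexOn_log_Gamma (fun {y} hy => by
      rw [Function.comp_apply, Real.Gamma_add_one hy.ne',
        Real.log_mul hy.ne' (Real.Gamma_pos_of_pos hy).ne', add_comm, Function.comp_apply])
    (by omega) h0 h1
  simp only [Function.comp_apply] at h
  push_cast at h
  rwa [show (n : ℝ) + θ + 1 = n + 1 + θ by ring]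

theorem le_log_Gamma_add {n : ℕ} (hn : 0 < n) {θ : ℝ} (h0 : 0 ≤ θ) :
    Real.log (Real.Gamma (n + 1)) + θ * Real.log n ≤ Real.log (Real.Gamma (n + θ + 1)) := by
  rcases h0.eq_or_lt with rfl | h0
  · simp
  have h := Real.BohrMollerup.f_add_nat_ge (f := Real.log ∘ Real.Gamma) (n := n + 1) (x := θ)
    Real.convexOn_log_Gamma (fun {y} hy => by
      rw [Function.comp_apply, Real.Gamma_add_one hy.ne',
        Real.log_mul hy.ne' (Real.Gamma_pos_of_pos hy).ne', add_comm, Function.comp_apply])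
    (by omega) h0
  simp only [Function.comp_apply] at h
  push_cast at h
  rw [show (n : ℝ) + θ + 1 = n + 1 + θ by ring]
  simpa using h

theorem abs_logStirlingRatio_sub_le {n : ℕ} (hn : 0 < n) {θ : ℝ} (h0 : 0 ≤ θ) (h1 : θ ≤ 1) :
    |logStirlingRatio (n + θ) - logStirlingRatio n| ≤ 3 / n := by
  have hn' : (0 : ℝ) < n := by positivity
  have hA := log_Gamma_add_le hn h0 h1
  have hB := le_log_Gamma_add hn h0
  have e1 : Real.log (n + θ) = Real.log n + Real.log (1 + θ / n) := by
    rw [← Real.log_mul hn'.ne' (by positivity)]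
    congr 1
    field_simp
  have e2 : Real.log (n + 1) = Real.log n + Real.log (1 + 1 / n) := by
    rw [← Real.log_mul hn'.ne' (by positivity)]
    congr 1
    field_simp
  have b1 : Real.log (1 + θ / n) ≤ θ / n := by
    have := Real.log_le_sub_one_of_pos (show 0 < 1 + θ / n by positivity)
    linarith
  have b2 : θ / n / (1 + θ / n) ≤ Real.log (1 + θ / n) := by
    have := Real.one_sub_inv_le_log_of_pos (show 0 < 1 + θ / n by positivity)
    refine le_trans (le_of_eq ?_) this
    field_simp
    ring
  have b3 : Real.log (1 + 1 / n) ≤ 1 / n := by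
    have := Real.log_le_sub_one_of_pos (show (0 : ℝ) < 1 + 1 / n by positivity)
    linarith
  have b4 : 0 ≤ Real.log (1 + 1 / (n : ℝ)) := Real.log_nonneg (by
    have : (0 : ℝ) ≤ 1 / n := by positivity
    linarith)
  have b5 : 0 ≤ Real.log (1 + θ / n) := Real.log_nonneg (by
    have : (0 : ℝ) ≤ θ / n := by positivity
    linarith)
  have c1 : θ ≤ (n + θ) * Real.log (1 + θ / n) := by
    calc θ = (n + θ) * (θ / n / (1 + θ / n)) := by field_simp
      _ ≤ _ := by gcongr
  have c2 : (n + θ) * Real.log (1 + θ / n) ≤ θ + 1 / n := by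
    calc (n + θ) * Real.log (1 + θ / n) ≤ (n + θ) * (θ / n) := by gcongr
      _ = θ + θ ^ 2 / n := by field_simp
      _ ≤ _ := by
        gcongr
        nlinarith
  have c3 : θ * Real.log (1 + 1 / n) ≤ 1 / n := by nlinarith
  have c4 : θ / n ≤ 1 / n := by gcongr
  have c5 : 3 / (n : ℝ) = 1 / n + 1 / n + 1 / n := by ring
  have c6 : 0 ≤ θ * Real.log (1 + 1 / n) := by positivity
  rw [e2] at hA
  unfold logStirlingRatio
  rw [e1, abs_le]
  constructor <;> nlinarith

/-- Stirling's formula at real arguments. -/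
theorem tendsto_logStirlingRatio :
    Tendsto logStirlingRatio atTop (𝓝 (Real.log (2 * Real.pi) / 2)) := by
  have h1 := tendsto_logStirlingRatio_nat.comp (tendsto_nat_floor_atTop (α := ℝ))
  have h2 : Tendsto (fun x : ℝ => 3 / ((⌊x⌋₊ : ℕ) : ℝ)) atTop (𝓝 0) :=
    (tendsto_const_nhds.div_atTop tendsto_natCast_atTop_atTop).comp
      (tendsto_nat_floor_atTop (α := ℝ))
  have h3 : Tendsto (fun x : ℝ => logStirlingRatio x - logStirlingRatio (⌊x⌋₊ : ℕ)) atTop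
      (𝓝 0) := by
    refine squeeze_zero_norm' ?_ h2
    filter_upwards [eventually_ge_atTop 1] with x hx
    have hfl : 0 < ⌊x⌋₊ := Nat.floor_pos.2 hx
    have := abs_logStirlingRatio_sub_le hfl (θ := x - ⌊x⌋₊)
      (sub_nonneg.2 (Nat.floor_le (by linarith))) (by linarith [Nat.lt_floor_add_one x])
    rwa [add_sub_cancel] at this
  simpa using h3.add h1

/-- The constant in the growth law of the Fuss-Catalan numbers. -/
noncomputable def growthConst (s : ℝ) : ℝ := √(s / (2 * Real.pi * (s - 1))) / (s - 1)

theorem growthConst_pos {s : ℝ} (hs : 1 < s) : 0 < growthConst s := by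
  have h1 : 0 < s - 1 := by linarith
  have h2 : 0 < s := by linarith
  unfold growthConst
  positivity

theorem xCrit_pos {s : ℝ} (hs : 1 < s) : 0 < xCrit s := by
  have h1 : 0 < s - 1 := by linarith
  have h2 : 0 < s := by linarith
  unfold xCrit
  positivity

theorem log_xCrit {s : ℝ} (hs : 1 < s) :
    Real.log (xCrit s) = (s - 1) * Real.log (s - 1) - s * Real.log s := by
  have h1 : 0 < s - 1 := by linarith
  have h2 : 0 < s := by linarith
  rw [xCrit, Real.log_div (by positivity) (by positivity), Real.log_rpow h1, Real.log_rpow h2]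

theorem log_fussCatalan_mul {s : ℝ} (hs : 1 < s) {n : ℕ} (hn : 0 < n) :
    Real.log (fussCatalan s n * xCrit s ^ n * (n : ℝ) ^ (3 / 2 : ℝ)) =
      logStirlingRatio (s * n) - logStirlingRatio ((s - 1) * n) - logStirlingRatio n +
        (Real.log s - Real.log (s - 1)) / 2 - Real.log ((s - 1) + 1 / n) := by
  have h1 : 0 < s - 1 := by linarith
  have h2 : 0 < s := by linarith
  have hn' : (0 : ℝ) < n := by positivity
  have g1 := Real.Gamma_pos_of_pos (show 0 < s * n + 1 by positivity)
  have g2 := Real.Gamma_pos_of_pos (show 0 < (s - 1) * n + 1 by positivity)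
  have g3 := Real.Gamma_pos_of_pos (show (0 : ℝ) < n + 1 by positivity)
  have e : (s - 1) * n + 1 = n * ((s - 1) + 1 / n) := by field_simp
  rw [Real.log_mul (mul_pos (fussCatalan_pos hs n) (pow_pos (xCrit_pos hs) n)).ne'
    (by positivity), Real.log_mul (fussCatalan_pos hs n).ne' (pow_pos (xCrit_pos hs) n).ne',
    Real.log_pow, log_xCrit hs, Real.log_rpow hn', fussCatalan,
    show (s - 1) * n + 2 = ((s - 1) * n + 1) + 1 by ring,
    Real.Gamma_add_one (s := (s - 1) * n + 1) (by positivity),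
    Real.log_div g1.ne' (by positivity), Real.log_mul (by positivity) g3.ne',
    Real.log_mul (by positivity) g2.ne']
  nth_rw 1 [e]
  rw [Real.log_mul hn'.ne' (by positivity)]
  unfold logStirlingRatio
  rw [Real.log_mul h2.ne' hn'.ne', Real.log_mul h1.ne' hn'.ne']
  ring

/-- `A_n x_c ^ n n ^ (3 / 2)` converges. -/
theorem tendsto_fussCatalan_mul {s : ℝ} (hs : 1 < s) :
    Tendsto (fun n : ℕ => fussCatalan s n * xCrit s ^ n * (n : ℝ) ^ (3 / 2 : ℝ)) atTop
      (𝓝 (growthConst s)) := by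
  have h1 : 0 < s - 1 := by linarith
  have h2 : 0 < s := by linarith
  have hnat : Tendsto (fun n : ℕ => (n : ℝ)) atTop atTop := tendsto_natCast_atTop_atTop
  have t1 := tendsto_logStirlingRatio.comp (hnat.const_mul_atTop h2)
  have t2 := tendsto_logStirlingRatio.comp (hnat.const_mul_atTop h1)
  have t3 := tendsto_logStirlingRatio.comp hnat
  have t4 : Tendsto (fun n : ℕ => Real.log ((s - 1) + 1 / n)) atTop (𝓝 (Real.log (s - 1))) := by
    have : Tendsto (fun n : ℕ => (s - 1) + 1 / (n : ℝ)) atTop (𝓝 ((s - 1) + 0)) :=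
      tendsto_const_nhds.add (tendsto_const_nhds.div_atTop hnat)
    rw [add_zero] at this
    exact this.log h1.ne'
  have t5 := (((t1.sub t2).sub t3).add_const ((Real.log s - Real.log (s - 1)) / 2)).sub t4
  have t6 := (Real.continuous_exp.tendsto _).comp t5
  have e : Real.exp (Real.log (2 * Real.pi) / 2 - Real.log (2 * Real.pi) / 2 -
      Real.log (2 * Real.pi) / 2 + (Real.log s - Real.log (s - 1)) / 2 - Real.log (s - 1)) =
      growthConst s := by
    rw [← Real.exp_log (growthConst_pos hs)]
    congr 1
    have hp := Real.pi_pos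
    rw [growthConst, Real.log_div (by positivity) h1.ne', Real.log_sqrt (by positivity),
      Real.log_div h2.ne' (by positivity), Real.log_mul (by positivity) h1.ne']
    ring
  rw [e] at t6
  refine t6.congr' ?_
  filter_upwards [eventually_gt_atTop 0] with n hn
  have : 0 < fussCatalan s n * xCrit s ^ n * (n : ℝ) ^ (3 / 2 : ℝ) :=
    mul_pos (mul_pos (fussCatalan_pos hs n) (pow_pos (xCrit_pos hs) n)) (by positivity)
  rw [← Real.exp_log this, log_fussCatalan_mul hs hn]
  rfl


/-! ### The generating function -/

theorem hasSum_of_eq {ι M : Type*} [AddCommMonoid M] [TopologicalSpace M] {f g : ι → M} {a b : M}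
    (h : HasSum f a) (hfg : ∀ i, g i = f i) (hab : b = a) : HasSum g b := by
  rwa [hab, funext hfg]

theorem fSeq_sq {s : ℝ} (hs : 1 < s) (n : ℕ) : fSeq s n ^ 2 = fussCatalan s n :=
  Real.sq_sqrt (fussCatalan_pos hs n).le

theorem gSeq_sq {s : ℝ} (hs : 1 < s) (n : ℕ) :
    gSeq s n ^ 2 = fussCatalan s n / ((s - 1) / 2 * n + 1) := by
  have : 0 ≤ (s - 1) / 2 * n := mul_nonneg (by linarith) n.cast_nonneg
  rw [gSeq, div_pow, fSeq_sq hs, Real.sq_sqrt (by linarith)]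

theorem gSeq_pos {s : ℝ} (hs : 1 < s) (n : ℕ) : 0 < gSeq s n := by
  have : 0 ≤ (s - 1) / 2 * n := mul_nonneg (by linarith) n.cast_nonneg
  exact div_pos (Real.sqrt_pos.2 (fussCatalan_pos hs n)) (Real.sqrt_pos.2 (by linarith))

theorem FCrit_pos {s : ℝ} (hs : 1 < s) : 0 < FCrit s := by
  have : 0 < s - 1 := by linarith
  unfold FCrit
  positivity

theorem summable_fussCatalan_mul_rpow_of_lt {s : ℝ} (hs : 1 < s) {e : ℝ} (he : e < 1 / 2) :
    Summable fun n : ℕ => fussCatalan s n * xCrit s ^ n * (n : ℝ) ^ e := by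
  have h1 : (fun n : ℕ => fussCatalan s n * xCrit s ^ n * (n : ℝ) ^ (3 / 2 : ℝ)) =O[atTop]
      fun _ => (1 : ℝ) := (tendsto_fussCatalan_mul hs).isBigO_one ℝ
  have h2 : (fun n : ℕ => fussCatalan s n * xCrit s ^ n * (n : ℝ) ^ e) =O[atTop]
      fun n : ℕ => (n : ℝ) ^ (e - 3 / 2) := by
    have h3 := h1.mul (isBigO_refl (fun n : ℕ => (n : ℝ) ^ (e - 3 / 2)) atTop)
    simp only [one_mul] at h3
    refine h3.congr' ?_ EventuallyEq.rfl
    filter_upwards [eventually_gt_atTop 0] with n hn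
    have hn' : (0 : ℝ) < n := by positivity
    rw [mul_assoc _ ((n : ℝ) ^ (3 / 2 : ℝ)), ← Real.rpow_add hn']
    congr 2
    ring
  exact summable_of_isBigO_nat (Real.summable_nat_rpow.2 (by linarith)) h2

theorem summable_fussCatalan_xCrit {s : ℝ} (hs : 1 < s) :
    Summable fun n : ℕ => fussCatalan s n * xCrit s ^ n := by
  simpa using summable_fussCatalan_mul_rpow_of_lt hs (e := 0) (by norm_num)

/-- Inside the disc of convergence the terms decay faster than every power. -/
theorem summable_rpow_mul_fussCatalan {s : ℝ} (hs : 1 < s) {x : ℝ} (hx0 : 0 ≤ x)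
    (hx : x < xCrit s) (e : ℝ) :
    Summable fun n : ℕ => ((n : ℝ) + 1) ^ e * (fussCatalan s n * x ^ n) := by
  have hxc := xCrit_pos hs
  set r := x / xCrit s with hr
  have hr0 : 0 ≤ r := by positivity
  have hr1 : r < 1 := (div_lt_one hxc).2 hx
  obtain ⟨k, hk⟩ := exists_nat_ge e
  have ht : Tendsto (fun n : ℕ => ((n : ℝ) + 1) ^ k * r ^ n) atTop (𝓝 0) := by
    rcases hr0.eq_or_lt with h0 | h0
    · refine tendsto_const_nhds.congr' ?_
      filter_upwards [eventually_gt_atTop 0] with n hn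
      rw [← h0, zero_pow hn.ne', mul_zero]
    have h1 := (tendsto_pow_const_mul_const_pow_of_lt_one k hr0 hr1).comp (tendsto_add_atTop_nat 1)
    have h2 := h1.mul_const r⁻¹
    rw [zero_mul] at h2
    refine h2.congr fun n => ?_
    simp only [Function.comp_apply, pow_succ]
    push_cast
    field_simp
  have hO : (fun n : ℕ => ((n : ℝ) + 1) ^ e * (fussCatalan s n * x ^ n)) =O[atTop]
      fun n : ℕ => fussCatalan s n * xCrit s ^ n := by
    have h1 : (fun n : ℕ => ((n : ℝ) + 1) ^ e * r ^ n) =O[atTop] fun _ => (1 : ℝ) := by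
      refine IsBigO.trans (IsBigO.of_bound 1 (Eventually.of_forall fun n => ?_)) (ht.isBigO_one ℝ)
      rw [one_mul, Real.norm_of_nonneg (by positivity), Real.norm_of_nonneg (by positivity)]
      gcongr
      rw [← Real.rpow_natCast]
      exact Real.rpow_le_rpow_of_exponent_le (by linarith [(Nat.cast_nonneg n : 0 ≤ (n : ℝ))]) hk
    have h2 := h1.mul (isBigO_refl (fun n : ℕ => fussCatalan s n * xCrit s ^ n) atTop)
    simp only [one_mul] at h2
    refine h2.congr_left fun n => ?_
    rw [hr, div_pow]
    field_simp
  exact summable_of_isBigO_nat (summable_fussCatalan_xCrit hs) hO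

theorem summable_fussCatalan {s : ℝ} (hs : 1 < s) {x : ℝ} (hx0 : 0 ≤ x) (hx : x ≤ xCrit s) :
    Summable fun n : ℕ => fussCatalan s n * x ^ n := by
  refine (summable_fussCatalan_xCrit hs).of_nonneg_of_le (fun n => ?_) fun n => ?_
  · have := fussCatalan_pos hs n
    positivity
  · have := fussCatalan_pos hs n
    gcongr

theorem hasSum_genF {s : ℝ} (hs : 1 < s) {x : ℝ} (hx0 : 0 ≤ x) (hx : x ≤ xCrit s) :
    HasSum (fun n : ℕ => fussCatalan s (n + 1) * x ^ (n + 1)) (genF s x) := by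
  have := ((summable_nat_add_iff 1).2 (summable_fussCatalan hs hx0 hx)).hasSum
  simpa only [genF, fSeq_sq hs] using this

theorem genF_zero (s : ℝ) : genF s 0 = 0 := by simp [genF]

theorem genF_nonneg {s : ℝ} {x : ℝ} (hx0 : 0 ≤ x) : 0 ≤ genF s x :=
  tsum_nonneg fun n => by positivity

theorem genF_strictMonoOn {s : ℝ} (hs : 1 < s) :
    StrictMonoOn (genF s) (Set.Icc 0 (xCrit s)) := by
  intro x hx y hy hxy
  have hle : ∀ n : ℕ, fussCatalan s (n + 1) * x ^ (n + 1) ≤ fussCatalan s (n + 1) * y ^ (n + 1) :=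
    fun n => by
      have := fussCatalan_pos hs (n + 1)
      have := hx.1
      gcongr
  refine hasSum_lt hle (i := 0) ?_ (hasSum_genF hs hx.1 hx.2) (hasSum_genF hs hy.1 hy.2)
  have := fussCatalan_pos hs (0 + 1)
  simpa using mul_lt_mul_of_pos_left hxy this

/-- The derivative of the generating function. -/
noncomputable def genFDeriv (s x : ℝ) : ℝ := ∑' n : ℕ, fussCatalan s (n + 1) * ((n + 1) * x ^ n)

theorem summable_genFDeriv {s : ℝ} (hs : 1 < s) {x : ℝ} (hx0 : 0 ≤ x) (hx : x < xCrit s) :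
    Summable fun n : ℕ => fussCatalan s (n + 1) * ((n + 1) * x ^ n) := by
  rcases hx0.eq_or_lt with rfl | h0
  · refine summable_of_ne_finset_zero (s := {0}) fun n hn => ?_
    simp at hn
    simp [hn]
  · have h := (summable_nat_add_iff 1).2 (summable_rpow_mul_fussCatalan hs hx0 hx 1)
    refine (h.mul_left x⁻¹).of_nonneg_of_le (fun n => ?_) fun n => ?_
    · have := fussCatalan_pos hs (n + 1)
      positivity
    · have := fussCatalan_pos hs (n + 1)
      rw [Real.rpow_one, pow_succ]
      push_cast
      have e : x⁻¹ * (((n : ℝ) + 1 + 1) * (fussCatalan s (n + 1) * (x ^ n * x))) =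
        fussCatalan s (n + 1) * (((n : ℝ) + 1 + 1) * x ^ n) := by field_simp
      rw [e]
      gcongr
      linarith

theorem hasDerivAt_genF {s : ℝ} (hs : 1 < s) {x : ℝ} (hx0 : 0 ≤ x) (hx : x < xCrit s) :
    HasDerivAt (genF s) (genFDeriv s x) x := by
  obtain ⟨r, hxr, hr⟩ := exists_between hx
  have hr0 : 0 < r := hx0.trans_lt hxr
  unfold genF genFDeriv
  simp only [fSeq_sq hs]
  refine hasDerivAt_tsum_of_isPreconnected
    (g := fun (n : ℕ) (z : ℝ) => fussCatalan s (n + 1) * z ^ (n + 1))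
    (g' := fun (n : ℕ) (z : ℝ) => fussCatalan s (n + 1) * ((n + 1) * z ^ n))
    (summable_genFDeriv hs hr0.le hr)
    (isOpen_Ioo (a := -r) (b := r)) isPreconnected_Ioo (fun n y _ => ?_) (fun n y hy => ?_)
    (y₀ := 0) ⟨by linarith, hr0⟩ ?_ ⟨by linarith, hxr⟩
  · have := (hasDerivAt_pow (n + 1) y).const_mul (fussCatalan s (n + 1))
    simpa using this
  · have := fussCatalan_pos hs (n + 1)
    have hy' : |y| ≤ r := abs_le.2 ⟨hy.1.le, hy.2.le⟩
    rw [norm_mul, norm_mul, norm_pow, Real.norm_of_nonneg this.le,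
      Real.norm_of_nonneg (by positivity : (0 : ℝ) ≤ n + 1), Real.norm_eq_abs]
    gcongr
  · exact (summable_zero : Summable fun _ : ℕ => (0 : ℝ)).congr fun n => by simp

/-- The differential equation of the generating function; a form of the convolution identity. -/
theorem genF_mul_eq {s : ℝ} (hs : 1 < s) {x : ℝ} (hx0 : 0 ≤ x) (hx : x < xCrit s) :
    genF s x * (1 + genF s x + (s - 1) * (x * genFDeriv s x)) = x * genFDeriv s x := by
  have h1 := hasSum_genF hs hx0 hx.le
  have h2 := (summable_genFDeriv hs hx0 hx).hasSum.mul_left x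
  have h2' : HasSum (fun n : ℕ => (n + 1) * fussCatalan s (n + 1) * x ^ (n + 1))
      (x * genFDeriv s x) := by
    exact hasSum_of_eq h2 (fun n => by ring) rfl
  have h3 : HasSum (fun n : ℕ => ((s - 1) * n + 1) * fussCatalan s n * x ^ n)
      (1 + genF s x + (s - 1) * (x * genFDeriv s x)) := by
    rw [← hasSum_nat_add_iff' 1]
    have := (h2'.mul_left (s - 1)).add h1
    refine hasSum_of_eq this (fun n => by push_cast; ring) ?_
    simp [fussCatalan_zero]
    ring
  have h4 := tsum_mul_tsum_eq_tsum_sum_antidiagonal_of_summable_norm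
    (f := fun n : ℕ => fussCatalan s (n + 1) * x ^ (n + 1))
    (g := fun n : ℕ => ((s - 1) * n + 1) * fussCatalan s n * x ^ n)
    h1.summable.norm h3.summable.norm
  rw [h1.tsum_eq, h3.tsum_eq] at h4
  rw [h4, ← h2'.tsum_eq]
  refine tsum_congr fun N => ?_
  rw [← sum_fussCatalan_mul_weighted hs, Finset.sum_mul]
  refine Finset.sum_congr rfl fun a ha => ?_
  rw [← Finset.HasAntidiagonal.mem_antidiagonal.1 ha]
  ring

/-- The inverse `y / (1 + y) ^ s` of the generating function. -/
noncomputable def invF (s y : ℝ) : ℝ := y / (1 + y) ^ s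

theorem hasDerivAt_invF (s : ℝ) {y : ℝ} (hy : -1 < y) :
    HasDerivAt (invF s) ((1 - (s - 1) * y) / (1 + y) ^ (s + 1)) y := by
  have h0 : 0 < 1 + y := by linarith
  have h1 := (hasDerivAt_id y).div (((hasDerivAt_id y).const_add 1).rpow_const (p := s)
    (Or.inl h0.ne')) (Real.rpow_pos_of_pos h0 s).ne'
  refine h1.congr_deriv ?_
  have := Real.rpow_pos_of_pos h0 s
  simp only [id]
  rw [Real.rpow_sub_one h0.ne', Real.rpow_add_one h0.ne']
  field_simp
  ring

theorem invF_strictMonoOn {s : ℝ} (hs : 1 < s) : StrictMonoOn (invF s) (Set.Icc 0 (FCrit s)) := by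
  refine strictMonoOn_of_deriv_pos (convex_Icc _ _) (fun y hy =>
    (hasDerivAt_invF s (by linarith [hy.1])).continuousAt.continuousWithinAt) fun y hy => ?_
  rw [interior_Icc] at hy
  have h0 : 0 < 1 + y := by linarith [hy.1]
  have h1 : 0 < s - 1 := by linarith
  rw [(hasDerivAt_invF s (by linarith [hy.1])).deriv]
  have : (s - 1) * y < 1 := by
    have := hy.2
    rw [FCrit, lt_div_iff₀ h1] at this
    linarith
  have := Real.rpow_pos_of_pos h0 (s + 1)
  exact div_pos (by linarith) this

theorem invF_strictAntiOn {s : ℝ} (hs : 1 < s) : StrictAntiOn (invF s) (Set.Ici (FCrit s)) := by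
  have hF := FCrit_pos hs
  refine strictAntiOn_of_deriv_neg (convex_Ici _) (fun y hy =>
    (hasDerivAt_invF s (by linarith [Set.mem_Ici.1 hy])).continuousAt.continuousWithinAt)
    fun y hy => ?_
  rw [interior_Ici] at hy
  have hy' : FCrit s < y := hy
  have h0 : 0 < 1 + y := by linarith
  have h1 : 0 < s - 1 := by linarith
  rw [(hasDerivAt_invF s (by linarith)).deriv]
  have : 1 < (s - 1) * y := by
    rw [FCrit, div_lt_iff₀ h1] at hy'
    linarith
  have := Real.rpow_pos_of_pos h0 (s + 1)
  exact div_neg_of_neg_of_pos (by linarith) this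

theorem invF_FCrit {s : ℝ} (hs : 1 < s) : invF s (FCrit s) = xCrit s := by
  have h1 : 0 < s - 1 := by linarith
  have h2 : 0 < s := by linarith
  rw [invF, FCrit, xCrit, show 1 + 1 / (s - 1) = s / (s - 1) by field_simp; ring,
    Real.div_rpow h2.le h1.le, Real.rpow_sub_one h1.ne']
  have := Real.rpow_pos_of_pos h1 s
  have := Real.rpow_pos_of_pos h2 s
  field_simp

theorem invF_genF_of_lt {s : ℝ} (hs : 1 < s) {x : ℝ} (hx0 : 0 < x) (hx : x < xCrit s) :
    invF s (genF s x) = x := by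
  have hxc := xCrit_pos hs
  have hpos : ∀ y ∈ Set.Ioo 0 (xCrit s), 0 < genF s y := fun y hy => by
    rw [← genF_zero s]
    exact genF_strictMonoOn hs ⟨le_rfl, hxc.le⟩ ⟨hy.1.le, hy.2.le⟩ hy.1
  -- `log (F / (x (1 + F) ^ s))` is constant, and tends to `0` as `x → 0`.
  let φ : ℝ → ℝ := fun y => Real.log (genF s y / y) - s * Real.log (1 + genF s y)
  have hφ : ∀ y ∈ Set.Ioo 0 (xCrit s), HasDerivAt φ 0 y := by
    intro y hy
    have hF := hpos y hy
    have hd := hasDerivAt_genF hs hy.1.le hy.2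
    have hode := genF_mul_eq hs hy.1.le hy.2
    have hy0 := hy.1
    have h1 := ((hd.div (hasDerivAt_id y) hy0.ne').log (div_pos hF hy0).ne').sub
      (((hd.const_add 1).log (by linarith)).const_mul s)
    refine h1.congr_deriv ?_
    simp only [Pi.div_apply, id]
    have h2 : 1 + genF s y ≠ 0 := by linarith
    field_simp
    linear_combination -hode
  have hconst : ∀ y ∈ Set.Ioo 0 (xCrit s), φ y = φ x := fun y hy =>
    (isOpen_Ioo.is_const_of_deriv_eq_zero isPreconnected_Ioo
      (fun z hz => (hφ z hz).differentiableAt.differentiableWithinAt)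
      (fun z hz => (hφ z hz).deriv) hy ⟨hx0, hx⟩)
  have hlim : Tendsto φ (𝓝[>] 0) (𝓝 0) := by
    have hd := hasDerivAt_genF hs le_rfl hxc
    have hd0 : genFDeriv s 0 = 1 := by
      rw [genFDeriv, tsum_eq_single 0 (fun n hn => by simp [hn])]
      simp [fussCatalan_succ_eq_prod hs]
    have h1 : Tendsto (fun y => genF s y / y) (𝓝[>] 0) (𝓝 1) := by
      have := hd.tendsto_slope_zero_right
      rw [hd0] at this
      refine this.congr fun y => ?_
      simp [genF_zero, div_eq_inv_mul]
    have h2 : Tendsto (fun y => 1 + genF s y) (𝓝[>] 0) (𝓝 1) := by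
      have := (hd.continuousAt.tendsto.const_add 1).mono_left (nhdsWithin_le_nhds (s := Set.Ioi 0))
      simpa [genF_zero] using this
    have := (h1.log one_ne_zero).sub ((h2.log one_ne_zero).const_mul s)
    simpa using this
  have hφx : φ x = 0 := by
    refine tendsto_nhds_unique (tendsto_const_nhds.congr' ?_) hlim
    filter_upwards [Ioo_mem_nhdsGT hxc] with y hy
    exact (hconst y hy).symm
  have hF := hpos x ⟨hx0, hx⟩
  have h3 : Real.log (genF s x / x) = Real.log ((1 + genF s x) ^ s) := by
    rw [Real.log_rpow (by linarith)]
    exact sub_eq_zero.1 hφx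
  have hG := Real.rpow_pos_of_pos (show 0 < 1 + genF s x by linarith) s
  have h4 := Real.log_injOn_pos (Set.mem_Ioi.2 (div_pos hF hx0)) (Set.mem_Ioi.2 hG) h3
  rw [invF, ← h4]
  field_simp

theorem continuousOn_genF {s : ℝ} (hs : 1 < s) : ContinuousOn (genF s) (Set.Icc 0 (xCrit s)) := by
  have h := hasSum_genF hs (xCrit_pos hs).le le_rfl
  unfold genF
  simp only [fSeq_sq hs]
  refine continuousOn_tsum (fun n => by fun_prop) h.summable fun n x hx => ?_
  have := fussCatalan_pos hs (n + 1)
  have := hx.1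
  rw [Real.norm_of_nonneg (by positivity)]
  gcongr
  exact hx.2

/-- The generating function solves `F = x (1 + F) ^ s`. -/
theorem invF_genF {s : ℝ} (hs : 1 < s) {x : ℝ} (hx : x ∈ Set.Icc 0 (xCrit s)) :
    invF s (genF s x) = x := by
  have hxc := xCrit_pos hs
  have h1 : Set.EqOn (fun x => invF s (genF s x)) id (Set.Ioo 0 (xCrit s)) := fun x hx =>
    invF_genF_of_lt hs hx.1 hx.2
  have h2 : ContinuousOn (fun x => invF s (genF s x)) (Set.Icc 0 (xCrit s)) := fun x hx =>
    (hasDerivAt_invF s (by linarith [genF_nonneg (s := s) hx.1])).continuousAt.comp_continuousWithinAt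
      (continuousOn_genF hs x hx)
  exact h1.of_subset_closure h2 continuousOn_id Set.Ioo_subset_Icc_self
    (by rw [closure_Ioo hxc.ne]) hx

theorem genF_xCrit {s : ℝ} (hs : 1 < s) : genF s (xCrit s) = FCrit s := by
  have hxc := xCrit_pos hs
  have h := invF_genF hs (x := xCrit s) ⟨hxc.le, le_rfl⟩
  have h0 := genF_nonneg (s := s) hxc.le
  rw [← invF_FCrit hs] at h
  rcases le_total (genF s (invF s (FCrit s))) (FCrit s) with h1 | h1
  · rw [← invF_FCrit hs] at h0 ⊢
    exact (invF_strictMonoOn hs).injOn ⟨h0, h1⟩ ⟨(FCrit_pos hs).le, le_rfl⟩ h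
  · rw [← invF_FCrit hs]
    exact (invF_strictAntiOn hs).injOn h1 (Set.self_mem_Ici) h

theorem genF_invF {s : ℝ} (hs : 1 < s) {y : ℝ} (hy : y ∈ Set.Icc 0 (FCrit s)) :
    genF s (invF s y) = y := by
  have hm := invF_strictMonoOn hs
  have h0 : 0 ≤ invF s y := div_nonneg hy.1 (Real.rpow_nonneg (by linarith [hy.1]) s)
  have h1 : invF s y ≤ xCrit s := by
    rw [← invF_FCrit hs]
    exact hm.monotoneOn hy ⟨(FCrit_pos hs).le, le_rfl⟩ hy.2
  refine hm.injOn ⟨genF_nonneg h0, ?_⟩ hy (invF_genF hs ⟨h0, h1⟩)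
  rw [← genF_xCrit hs]
  exact (genF_strictMonoOn hs).monotoneOn ⟨h0, h1⟩ ⟨(xCrit_pos hs).le, le_rfl⟩ h1

theorem genF_lt_FCrit {s : ℝ} (hs : 1 < s) {x : ℝ} (hx0 : 0 ≤ x) (hx : x < xCrit s) :
    genF s x < FCrit s := by
  rw [← genF_xCrit hs]
  exact genF_strictMonoOn hs ⟨hx0, hx.le⟩ ⟨(xCrit_pos hs).le, le_rfl⟩ hx

theorem invF_lt_xCrit {s : ℝ} (hs : 1 < s) {y : ℝ} (h0 : 0 ≤ y) (h1 : y < FCrit s) :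
    invF s y < xCrit s := by
  rw [← invF_FCrit hs]
  exact invF_strictMonoOn hs ⟨h0, h1.le⟩ ⟨(FCrit_pos hs).le, le_rfl⟩ h1

theorem genF_eq_mul {s : ℝ} (hs : 1 < s) {x : ℝ} (hx0 : 0 ≤ x) (hx : x ≤ xCrit s) :
    genF s x = x * (1 + genF s x) ^ s := by
  have h := invF_genF hs ⟨hx0, hx⟩
  have := Real.rpow_pos_of_pos (show 0 < 1 + genF s x by linarith [genF_nonneg (s := s) hx0]) s
  rw [invF, div_eq_iff this.ne'] at h
  exact h

/-! ### Sums over the manifold -/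

theorem hasSum_genF_sq {s : ℝ} (hs : 1 < s) {x : ℝ} (hx0 : 0 ≤ x) (hx : x ≤ xCrit s) :
    HasSum (fun n : ℕ => n * gSeq s (n + 1) ^ 2 * x ^ (n + 1)) (genF s x ^ 2) := by
  have h1 := hasSum_genF hs hx0 hx
  have h4 := tsum_mul_tsum_eq_tsum_sum_antidiagonal_of_summable_norm h1.summable.norm
    h1.summable.norm
  have h5 := summable_norm_sum_mul_antidiagonal_of_summable_norm h1.summable.norm h1.summable.norm
  rw [h1.tsum_eq] at h4
  rw [← hasSum_nat_add_iff' 1]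
  have h6 := h5.of_norm.hasSum
  rw [← h4] at h6
  simp only [Finset.range_one, Finset.sum_singleton, Nat.cast_zero, zero_mul, sub_zero, sq (genF s x)]
  refine hasSum_of_eq h6 (fun L => ?_) rfl
  have h7 := sum_fussCatalan_mul_fussCatalan hs L
  have h8 : (0 : ℝ) < (s - 1) / 2 * (L + 2) + 1 := by
    have : 0 < s - 1 := by linarith
    positivity
  have h9 : ∑ a ∈ antidiagonal L, fussCatalan s (a.1 + 1) * x ^ (a.1 + 1) *
      (fussCatalan s (a.2 + 1) * x ^ (a.2 + 1)) =
      (∑ a ∈ antidiagonal L, fussCatalan s (a.1 + 1) * fussCatalan s (a.2 + 1)) * x ^ (L + 2) := by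
    rw [Finset.sum_mul]
    refine Finset.sum_congr rfl fun a ha => ?_
    rw [← Finset.HasAntidiagonal.mem_antidiagonal.1 ha]
    ring
  rw [h9, gSeq_sq hs]
  have h10 : ∑ a ∈ antidiagonal L, fussCatalan s (a.1 + 1) * fussCatalan s (a.2 + 1) =
      (L + 1) * fussCatalan s (L + 2) / ((s - 1) / 2 * (L + 2) + 1) := by
    rw [eq_div_iff h8.ne']
    linarith
  rw [h10]
  push_cast
  ring

/-- The particle number of the modes `n ≥ 1`, up to the factor `|c| ^ 2`. -/
theorem hasSum_gSeq_sq {s : ℝ} (hs : 1 < s) {x : ℝ} (hx0 : 0 ≤ x) (hx : x ≤ xCrit s) :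
    HasSum (fun n : ℕ => gSeq s (n + 1) ^ 2 * x ^ n)
      ((1 + genF s x) ^ s * (2 - (s - 1) * genF s x) / (s + 1)) := by
  have h0 : 0 < s - 1 := by linarith
  rcases hx0.eq_or_lt with rfl | hx0'
  · refine hasSum_of_eq (hasSum_ite_eq (0 : ℕ) (2 / (s + 1))) (fun n => ?_) ?_
    · rcases n with _ | n
      · rw [gSeq_sq hs, fussCatalan_succ_eq_prod hs]
        simp
        field_simp
        ring
      · simp
    · simp [genF_zero]
  · have h1 := hasSum_genF hs hx0 hx
    have h2 := hasSum_genF_sq hs hx0 hx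
    have h3 := ((h1.mul_left 2).sub (h2.mul_left (s - 1))).mul_left ((s + 1)⁻¹ * x⁻¹)
    refine hasSum_of_eq h3 (fun n => ?_) ?_
    · have : (0 : ℝ) < (s - 1) / 2 * (n + 1) + 1 := by positivity
      rw [gSeq_sq hs]
      push_cast
      field_simp
      ring
    · have := genF_eq_mul hs hx0 hx
      have e : 2 * genF s x - (s - 1) * genF s x ^ 2 =
        genF s x * (2 - (s - 1) * genF s x) := by ring
      rw [e]
      nth_rw 3 [this]
      field_simp

/-- The energy of the manifold states, up to the factor `|c| ^ 2`. -/
theorem hasSum_mul_gSeq_sq {s : ℝ} (hs : 1 < s) {x : ℝ} (hx0 : 0 ≤ x) (hx : x ≤ xCrit s) :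
    HasSum (fun n : ℕ => (n + 1) * gSeq s (n + 1) ^ 2 * x ^ n)
      (2 * (1 + genF s x) ^ (s + 1) / (s + 1)) := by
  have h0 : 0 < s - 1 := by linarith
  rcases hx0.eq_or_lt with rfl | hx0'
  · refine hasSum_of_eq (hasSum_ite_eq (0 : ℕ) (2 / (s + 1))) (fun n => ?_) ?_
    · rcases n with _ | n
      · rw [gSeq_sq hs, fussCatalan_succ_eq_prod hs]
        simp
        field_simp
        ring
      · simp
    · simp [genF_zero]
  · have h1 := hasSum_gSeq_sq hs hx0 hx
    have h2 := hasSum_genF_sq hs hx0 hx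
    refine hasSum_of_eq ((h2.mul_left x⁻¹).add h1) (fun n => ?_) ?_
    · field_simp
      ring
    · have := genF_eq_mul hs hx0 hx
      have h3 := genF_nonneg (s := s) hx0
      have e : x⁻¹ * genF s x ^ 2 = (1 + genF s x) ^ s * genF s x := by
        rw [sq]
        nth_rw 1 [this]
        field_simp
      rw [e, Real.rpow_add_one (by linarith)]
      field_simp
      ring


/-! ### The couplings -/

theorem fussCatalan_mul_le {s : ℝ} (hs : 1 < s) (n m : ℕ) :
    fussCatalan s n * fussCatalan s m ≤ (1 + 2 / (s - 1)) * fussCatalan s (n + m) := by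
  have h0 : 0 < s - 1 := by linarith
  have hc : 0 ≤ 2 / (s - 1) := by positivity
  rcases n with _ | n
  · have := fussCatalan_pos hs (0 + m)
    rw [fussCatalan_zero, zero_add] at *
    nlinarith
  rcases m with _ | m
  · have := fussCatalan_pos hs (n + 1 + 0)
    rw [fussCatalan_zero, add_zero] at *
    nlinarith
  have h1 := sum_fussCatalan_mul_fussCatalan hs (n + m)
  have h2 : fussCatalan s (n + 1) * fussCatalan s (m + 1) ≤ ∑ a ∈ antidiagonal (n + m),
      fussCatalan s (a.1 + 1) * fussCatalan s (a.2 + 1) :=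
    Finset.single_le_sum (f := fun a : ℕ × ℕ => fussCatalan s (a.1 + 1) * fussCatalan s (a.2 + 1))
      (fun a _ => (mul_pos (fussCatalan_pos hs _) (fussCatalan_pos hs _)).le)
      (Finset.HasAntidiagonal.mem_antidiagonal.2 (rfl : (n, m).1 + (n, m).2 = n + m))
  have h3 := fussCatalan_pos hs (n + m + 2)
  rw [show n + 1 + (m + 1) = n + m + 2 by ring]
  have h4 : (0 : ℝ) < (s - 1) / 2 * ((n + m : ℕ) + 2) + 1 := by positivity
  have h5 : ((n + m : ℕ) + 1) * fussCatalan s (n + m + 2) ≤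
      ((s - 1) / 2 * ((n + m : ℕ) + 2) + 1) * ((1 + 2 / (s - 1)) * fussCatalan s (n + m + 2)) := by
    have e : ((s - 1) / 2 * ((n + m : ℕ) + 2) + 1) * ((1 + 2 / (s - 1)) * fussCatalan s (n + m + 2))
        = ((n + m : ℕ) + 2 + 2 / (s - 1) + (s - 1) / 2 * ((n + m : ℕ) + 2) + 1) *
          fussCatalan s (n + m + 2) := by
      field_simp
      ring
    rw [e]
    gcongr
    have : 0 ≤ (s - 1) / 2 * (((n + m : ℕ) : ℝ) + 2) := by positivity
    linarith
  exact h2.trans (le_of_mul_le_mul_left (h1.le.trans h5) h4)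

theorem fSeq_mul_le {s : ℝ} (hs : 1 < s) (n m : ℕ) :
    fSeq s n * fSeq s m / fSeq s (n + m) ≤ √(1 + 2 / (s - 1)) := by
  have hf : 0 < fSeq s (n + m) := Real.sqrt_pos.2 (fussCatalan_pos hs _)
  rw [div_le_iff₀ hf, fSeq, fSeq, fSeq,
    ← Real.sqrt_mul (fussCatalan_pos hs n).le, ← Real.sqrt_mul' _ (fussCatalan_pos hs (n + m)).le]
  exact Real.sqrt_le_sqrt (fussCatalan_mul_le hs n m)

/-- The couplings as a function on the set of all quadruples `((n, m), (k, j))`, with value `0` off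
the resonant set `n + m = k + j`. -/
noncomputable def resonantCoupling (s : ℝ) (x : (ℕ × ℕ) × ℕ × ℕ) : ℝ :=
  if x.1.1 + x.1.2 = x.2.1 + x.2.2 then coupling s x.1.1 x.1.2 x.2.1 x.2.2 else 0

theorem coupling_nonneg (s : ℝ) (n m k j : ℕ) : 0 ≤ coupling s n m k j := by
  unfold coupling fSeq
  split_ifs <;> positivity

theorem resonantCoupling_nonneg (s : ℝ) (x : (ℕ × ℕ) × ℕ × ℕ) : 0 ≤ resonantCoupling s x := by
  unfold resonantCoupling
  split_ifs
  exacts [coupling_nonneg _ _ _ _ _, le_rfl]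

theorem resonantCoupling_swap (s : ℝ) (x : (ℕ × ℕ) × ℕ × ℕ) :
    resonantCoupling s x.swap = resonantCoupling s x := by
  obtain ⟨⟨n, m⟩, k, j⟩ := x
  simp only [resonantCoupling, Prod.swap]
  by_cases h : n + m = k + j
  · rw [if_pos h, if_pos h.symm]
    unfold coupling
    rw [h, show k * j * n * m = n * m * k * j by ring]
    congr 2
    · congr 1
      ring
    · ring
  · rw [if_neg h, if_neg (Ne.symm h)]

theorem resonantCoupling_swap_swap (s : ℝ) (x : (ℕ × ℕ) × ℕ × ℕ) :
    resonantCoupling s (x.1.swap, x.2.swap) = resonantCoupling s x := by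
  obtain ⟨⟨n, m⟩, k, j⟩ := x
  simp only [resonantCoupling, Prod.swap]
  rw [add_comm m n, add_comm j k]
  congr 1
  unfold coupling
  rw [add_comm m n, show m * n * j * k = n * m * k * j by ring]
  congr 2
  · congr 1
    ring
  · ring

/-- The constant in the bound for the couplings. -/
noncomputable def couplingConst (s : ℝ) : ℝ := (s + 1) ^ 2 * (1 + 2 / (s - 1)) / 4

theorem couplingConst_pos {s : ℝ} (hs : 1 < s) : 0 < couplingConst s := by
  have h0 : 0 < s - 1 := by linarith
  unfold couplingConst
  positivity

theorem coupling_le {s : ℝ} (hs : 1 < s) {n m k j : ℕ} (h : n + m = k + j) :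
    coupling s n m k j ≤
      couplingConst s * (√(n + 1) * √(m + 1) * √(k + 1) * √(j + 1)) := by
  have h0 : 0 < s - 1 := by linarith
  have hK := couplingConst_pos hs
  unfold coupling
  split_ifs with hz
  swap
  · positivity
  have hf : ∀ i, 0 < fSeq s i := fun i => Real.sqrt_pos.2 (fussCatalan_pos hs i)
  have h1 : √(((s - 1) * n + 2) * ((s - 1) * m + 2) * ((s - 1) * k + 2) * ((s - 1) * j + 2)) ≤
      (s + 1) ^ 2 * (√(n + 1) * √(m + 1) * √(k + 1) * √(j + 1)) := by
    have hi : ∀ i : ℕ, (s - 1) * i + 2 ≤ (s + 1) * (i + 1) := fun i => by nlinarith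
    rw [← Real.sqrt_mul (by positivity), ← Real.sqrt_mul (by positivity),
      ← Real.sqrt_mul (by positivity)]
    have e : (s + 1) ^ 2 = √((s + 1) ^ 4) := by
      rw [show (s + 1) ^ 4 = ((s + 1) ^ 2) ^ 2 by ring, Real.sqrt_sq (by positivity)]
    rw [e, ← Real.sqrt_mul (by positivity)]
    refine Real.sqrt_le_sqrt ?_
    calc ((s - 1) * n + 2) * ((s - 1) * m + 2) * ((s - 1) * k + 2) * ((s - 1) * j + 2) ≤
        ((s + 1) * (n + 1)) * ((s + 1) * (m + 1)) * ((s + 1) * (k + 1)) * ((s + 1) * (j + 1)) := by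
          gcongr <;> exact hi _
      _ = _ := by ring
  have h2 : fSeq s n * fSeq s m * fSeq s k * fSeq s j / (4 * fSeq s (n + m) ^ 2) ≤
      (1 + 2 / (s - 1)) / 4 := by
    have e : fSeq s n * fSeq s m * fSeq s k * fSeq s j / (4 * fSeq s (n + m) ^ 2) =
        (fSeq s n * fSeq s m / fSeq s (n + m)) * (fSeq s k * fSeq s j / fSeq s (k + j)) / 4 := by
      rw [← h]
      have := (hf (n + m)).ne'
      field_simp
    rw [e]
    gcongr
    have hc : 0 ≤ 1 + 2 / (s - 1) := by positivity
    calc _ ≤ √(1 + 2 / (s - 1)) * √(1 + 2 / (s - 1)) := by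
          refine mul_le_mul (fSeq_mul_le hs n m) (fSeq_mul_le hs k j) ?_ (by positivity)
          have := hf k; have := hf j; have := hf (k + j)
          positivity
      _ = _ := Real.mul_self_sqrt hc
  calc _ ≤ ((s + 1) ^ 2 * (√(n + 1) * √(m + 1) * √(k + 1) * √(j + 1))) *
        ((1 + 2 / (s - 1)) / 4) := by
        refine mul_le_mul h1 h2 ?_ (by positivity)
        have := hf n; have := hf m; have := hf k; have := hf j; have := hf (n + m)
        positivity
    _ = _ := by unfold couplingConst; ring

/-- The weight `(n + 1) ^ (-3 / 2)`. -/
noncomputable def weight (n : ℕ) : ℝ := √(n + 1) / ((n : ℝ) + 1) ^ 2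

theorem weight_pos (n : ℕ) : 0 < weight n := by
  unfold weight
  positivity

theorem summable_weight : Summable weight := by
  have h : Summable fun n : ℕ => (n : ℝ) ^ (-(3 / 2) : ℝ) :=
    Real.summable_nat_rpow.2 (by norm_num)
  refine ((summable_nat_add_iff 1).2 h).congr fun n => ?_
  have : (0 : ℝ) < n + 1 := by positivity
  push_cast
  rw [weight, Real.sqrt_eq_rpow, ← Real.rpow_natCast, ← Real.rpow_sub this]
  norm_num

/-- The product weight on quadruples. -/
noncomputable def weight4 (x : (ℕ × ℕ) × ℕ × ℕ) : ℝ :=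
  weight x.1.1 * weight x.1.2 * (weight x.2.1 * weight x.2.2)

theorem summable_weight4 : Summable weight4 := by
  have h2 : Summable fun q : ℕ × ℕ => weight q.1 * weight q.2 :=
    summable_weight.mul_of_nonneg summable_weight (fun n => (weight_pos n).le)
      (fun n => (weight_pos n).le)
  exact h2.mul_of_nonneg h2 (fun q => (mul_pos (weight_pos _) (weight_pos _)).le)
    (fun q => (mul_pos (weight_pos _) (weight_pos _)).le)

/-- The condition `|a_n| ≤ R (n + 1) ^ (-2)`. -/
def QuadDecay (R : ℝ) (a : ℕ → ℂ) : Prop := ∀ n : ℕ, ‖a n‖ ≤ R / ((n : ℝ) + 1) ^ 2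

theorem QuadDecay.sqrt_mul_le {R : ℝ} {a : ℕ → ℂ} (h : QuadDecay R a) (n : ℕ) :
    √(n + 1) * ‖a n‖ ≤ R * weight n := by
  calc √(n + 1) * ‖a n‖ ≤ √(n + 1) * (R / ((n : ℝ) + 1) ^ 2) := by gcongr; exact h n
    _ = _ := by unfold weight; ring

theorem QuadDecay.conj {R : ℝ} {a : ℕ → ℂ} (h : QuadDecay R a) :
    QuadDecay R fun n => (starRingEnd ℂ) (a n) := fun n => by
  rw [RCLike.norm_conj]
  exact h n

/-- The terms of the quartic form of the couplings. -/
noncomputable def quarticTerm (s : ℝ) (a b c d : ℕ → ℂ) (x : (ℕ × ℕ) × ℕ × ℕ) : ℂ :=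
  resonantCoupling s x * (a x.1.1 * b x.1.2 * c x.2.1 * d x.2.2)

theorem norm_quarticTerm_le {s : ℝ} (hs : 1 < s) {R : ℝ} {a b c d : ℕ → ℂ} (ha : QuadDecay R a)
    (hb : QuadDecay R b) (hc : QuadDecay R c) (hd : QuadDecay R d) (x : (ℕ × ℕ) × ℕ × ℕ) :
    ‖quarticTerm s a b c d x‖ ≤ couplingConst s * R ^ 4 * weight4 x := by
  obtain ⟨⟨n, m⟩, k, j⟩ := x
  have hR : 0 ≤ R := by simpa using (norm_nonneg _).trans (ha 0)
  have hK := couplingConst_pos hs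
  have hw := fun i => (weight_pos i).le
  simp only [quarticTerm, weight4, norm_mul, Complex.norm_real,
    Real.norm_of_nonneg (resonantCoupling_nonneg s _)]
  have h1 : resonantCoupling s ((n, m), k, j) ≤
      couplingConst s * (√(n + 1) * √(m + 1) * √(k + 1) * √(j + 1)) := by
    unfold resonantCoupling
    split_ifs with h
    · exact coupling_le hs h
    · positivity
  calc _ ≤ couplingConst s * (√(n + 1) * √(m + 1) * √(k + 1) * √(j + 1)) *
        (‖a n‖ * ‖b m‖ * ‖c k‖ * ‖d j‖) := by gcongr
    _ = couplingConst s * ((√(n + 1) * ‖a n‖) * (√(m + 1) * ‖b m‖) * (√(k + 1) * ‖c k‖) *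
        (√(j + 1) * ‖d j‖)) := by ring
    _ ≤ couplingConst s * ((R * weight n) * (R * weight m) * (R * weight k) * (R * weight j)) := by
      have := hw n; have := hw m; have := hw k; have := hw j
      refine mul_le_mul_of_nonneg_left ?_ hK.le
      exact mul_le_mul (mul_le_mul (mul_le_mul (ha.sqrt_mul_le n) (hb.sqrt_mul_le m)
        (by positivity) (by positivity)) (hc.sqrt_mul_le k) (by positivity) (by positivity))
        (hd.sqrt_mul_le j) (by positivity) (by positivity)
    _ = _ := by ring

theorem summable_quarticTerm {s : ℝ} (hs : 1 < s) {R : ℝ} {a b c d : ℕ → ℂ} (ha : QuadDecay R a)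
    (hb : QuadDecay R b) (hc : QuadDecay R c) (hd : QuadDecay R d) :
    Summable (quarticTerm s a b c d) :=
  (summable_weight4.mul_left _).of_norm_bounded (norm_quarticTerm_le hs ha hb hc hd)

theorem im_tsum_eq_zero_of_conj {ι : Type*} (σ : ι ≃ ι) {g : ι → ℂ}
    (h : ∀ x, (starRingEnd ℂ) (g x) = g (σ x)) : (∑' x, g x).im = 0 := by
  rw [← Complex.conj_eq_iff_im, Complex.conj_tsum, tsum_congr h, σ.tsum_eq]

theorem im_tsum_quarticTerm_conj (s : ℝ) (a b : ℕ → ℂ) :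
    (∑' x, quarticTerm s (fun n => (starRingEnd ℂ) (a n)) (fun n => (starRingEnd ℂ) (b n)) a b
      x).im = 0 := by
  refine im_tsum_eq_zero_of_conj (Equiv.prodComm _ _) fun x => ?_
  rw [Equiv.prodComm_apply, quarticTerm, quarticTerm, resonantCoupling_swap]
  simp only [map_mul, Complex.conj_ofReal, Complex.conj_conj, Prod.fst_swap, Prod.snd_swap]
  ring

theorem im_tsum_quarticTerm_conj' (s : ℝ) (a b : ℕ → ℂ) :
    (∑' x, quarticTerm s (fun n => (starRingEnd ℂ) (a n)) (fun n => (starRingEnd ℂ) (b n)) b a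
      x).im = 0 := by
  refine im_tsum_eq_zero_of_conj
    ((Equiv.prodComm _ _).trans ((Equiv.prodComm _ _).prodCongr (Equiv.prodComm _ _))) fun x => ?_
  have : resonantCoupling s (((Equiv.prodComm (ℕ × ℕ) (ℕ × ℕ)).trans
    ((Equiv.prodComm ℕ ℕ).prodCongr (Equiv.prodComm ℕ ℕ))) x) = resonantCoupling s x := by
    rw [← resonantCoupling_swap s x]
    exact resonantCoupling_swap_swap s x.swap
  rw [quarticTerm, quarticTerm, this]
  simp only [map_mul, Complex.conj_ofReal, Complex.conj_conj, Equiv.trans_apply,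
    Equiv.prodComm_apply, Equiv.prodCongr_apply, Prod.map_fst, Prod.map_snd, Prod.fst_swap,
    Prod.snd_swap]
  ring

theorem hasSum_resonantSum (s : ℝ) (z : ℂ) (a : ℕ → ℂ) (n m : ℕ) :
    HasSum (fun q : ℕ × ℕ => resonantCoupling s ((n, m), q) *
      (z * (starRingEnd ℂ) (a m) * a q.1 * a q.2)) (z * resonantSum s a n m) := by
  have h : z * resonantSum s a n m = ∑ q ∈ antidiagonal (n + m), (resonantCoupling s ((n, m), q) *
      (z * (starRingEnd ℂ) (a m) * a q.1 * a q.2)) := by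
    rw [resonantSum, Finset.mul_sum]
    refine Finset.sum_congr rfl fun q hq => ?_
    have : n + m = q.1 + q.2 := (Finset.HasAntidiagonal.mem_antidiagonal.1 hq).symm
    rw [resonantCoupling, if_pos this]
    ring
  rw [h]
  refine hasSum_sum_of_ne_finset_zero fun q hq => ?_
  have : ¬ (n + m = q.1 + q.2) := fun h => hq (Finset.HasAntidiagonal.mem_antidiagonal.2 h.symm)
  rw [resonantCoupling, if_neg this]
  simp


/-! ### Estimates for the quartic form -/

theorem hasSum_prod_mul_of_nonneg {f g : ℕ → ℝ} {a b : ℝ} (hf : HasSum f a) (hg : HasSum g b)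
    (hf0 : ∀ n, 0 ≤ f n) (hg0 : ∀ n, 0 ≤ g n) :
    HasSum (fun q : ℕ × ℕ => f q.1 * g q.2) (a * b) :=
  hf.mul hg (hf.summable.mul_of_nonneg hg.summable hf0 hg0)

theorem hasSum_mul_tsum_resonantSum {s : ℝ} (hs : 1 < s) {R : ℝ} {a u : ℕ → ℂ}
    (ha : QuadDecay R a) (hu : QuadDecay R u) :
    HasSum (fun n => a n * ∑' m, resonantSum s u n m)
      (∑' x, quarticTerm s a (fun n => (starRingEnd ℂ) (u n)) u u x) := by
  have h1 := (summable_quarticTerm hs ha hu.conj hu hu).hasSum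
  have h2 := h1.prod_fiberwise fun p => (hasSum_of_eq (hasSum_resonantSum s (a p.1) u p.1 p.2)
    (fun q => by rw [quarticTerm]) rfl)
  refine hasSum_of_eq (h2.prod_fiberwise fun n => (h2.summable.prod_factor n).hasSum)
    (fun n => ?_) rfl
  exact tsum_mul_left.symm

theorem norm_mul_tsum_resonantSum_le {s : ℝ} (hs : 1 < s) {R : ℝ} {a u : ℕ → ℂ}
    (ha : QuadDecay R a) (hu : QuadDecay R u) (n : ℕ) :
    ‖a n * ∑' m, resonantSum s u n m‖ ≤
      couplingConst s * R ^ 4 * (∑' i, weight i) ^ 3 * weight n := by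
  have hw := summable_weight.hasSum
  have h2 := hasSum_prod_mul_of_nonneg hw hw (fun n => (weight_pos n).le)
    (fun n => (weight_pos n).le)
  rw [← tsum_mul_left]
  have h3 : ∀ m, ‖a n * resonantSum s u n m‖ ≤ couplingConst s * R ^ 4 * weight n * weight m *
      ((∑' i, weight i) * ∑' i, weight i) := fun m => by
    rw [← (hasSum_resonantSum s (a n) u n m).tsum_eq]
    refine tsum_of_norm_bounded (h2.mul_left _) fun q => ?_
    have := norm_quarticTerm_le hs ha hu.conj hu hu ((n, m), q)
    rw [quarticTerm, weight4] at this
    refine le_trans (le_of_eq ?_) (this.trans (le_of_eq ?_))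
    · simp only [mul_assoc]
    · ring
  refine (tsum_of_norm_bounded ((hw.mul_left (couplingConst s * R ^ 4 * weight n)).mul_right _)
    h3).trans (le_of_eq ?_)
  ring

/-- The bound for the Sobolev sum with `ξ = 2`. -/
def SobolevTwoBound (R : ℝ) (a : ℕ → ℂ) : Prop :=
  Summable (fun n : ℕ => ((n : ℝ) + 1) ^ 4 * ‖a n‖ ^ 2) ∧
    ∑' n : ℕ, ((n : ℝ) + 1) ^ 4 * ‖a n‖ ^ 2 ≤ R

theorem SobolevTwoBound.nonneg {R : ℝ} {a : ℕ → ℂ} (h : SobolevTwoBound R a) : 0 ≤ R :=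
  (tsum_nonneg fun n => by positivity).trans h.2

theorem SobolevTwoBound.term_le {R : ℝ} {a : ℕ → ℂ} (h : SobolevTwoBound R a) (n : ℕ) :
    ((n : ℝ) + 1) ^ 4 * ‖a n‖ ^ 2 ≤ R :=
  (h.1.le_tsum n fun m _ => by positivity).trans h.2

theorem SobolevTwoBound.quadDecay {R : ℝ} {a : ℕ → ℂ} (h : SobolevTwoBound R a) :
    QuadDecay (√R) a := fun n => by
  rw [le_div_iff₀ (by positivity)]
  refine Real.le_sqrt_of_sq_le ?_
  refine le_trans (le_of_eq ?_) (h.term_le n)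
  ring

theorem SobolevTwoBound.average {R : ℝ} {u v : ℕ → ℂ} (hu : SobolevTwoBound R u)
    (hv : SobolevTwoBound R v) : SobolevTwoBound R fun n => (u n + v n) / 2 := by
  have hle : ∀ n : ℕ, ((n : ℝ) + 1) ^ 4 * ‖(u n + v n) / 2‖ ^ 2 ≤
      ((n : ℝ) + 1) ^ 4 * ‖u n‖ ^ 2 / 2 + ((n : ℝ) + 1) ^ 4 * ‖v n‖ ^ 2 / 2 := fun n => by
    have h1 : ‖(u n + v n) / 2‖ ≤ (‖u n‖ + ‖v n‖) / 2 := by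
      rw [norm_div]
      norm_num
      gcongr
      exact norm_add_le _ _
    have h2 : ‖(u n + v n) / 2‖ ^ 2 ≤ ‖u n‖ ^ 2 / 2 + ‖v n‖ ^ 2 / 2 := by
      nlinarith [sq_nonneg (‖u n‖ - ‖v n‖), norm_nonneg ((u n + v n) / 2)]
    calc _ ≤ ((n : ℝ) + 1) ^ 4 * (‖u n‖ ^ 2 / 2 + ‖v n‖ ^ 2 / 2) := by gcongr
      _ = _ := by ring
  have hS := (hu.1.div_const 2).add (hv.1.div_const 2)
  have hS' := hS.of_nonneg_of_le (fun n => by positivity) hle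
  refine ⟨hS', (hS'.tsum_le_tsum hle hS).trans ?_⟩
  rw [(hu.1.div_const 2).tsum_add (hv.1.div_const 2), tsum_div_const, tsum_div_const]
  linarith [hu.2, hv.2]

theorem hasSum_antidiagonal_of_nonneg {φ : ℕ → ℝ} (h0 : ∀ n, 0 ≤ φ n) {r : ℝ}
    (h : HasSum (fun M : ℕ => ((M : ℝ) + 1) * φ M) r) :
    HasSum (fun q : ℕ × ℕ => φ (q.1 + q.2)) r := by
  have e := (Finset.HasAntidiagonal.sigmaAntidiagonalEquivProd (A := ℕ)).hasSum_iff
    (f := fun q : ℕ × ℕ => φ (q.1 + q.2)) (a := r)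
  rw [← e]
  have h1 : ∀ M : ℕ, HasSum (fun q : antidiagonal M => φ (q.1.1 + q.1.2)) ((M + 1) * φ M) :=
    fun M => by
      have : ((M : ℝ) + 1) * φ M = ∑ q : antidiagonal M, φ (q.1.1 + q.1.2) := by
        rw [Finset.sum_coe_sort (antidiagonal M) fun q : ℕ × ℕ => φ (q.1 + q.2),
          Finset.sum_congr rfl (g := fun _ => φ M) fun q hq => by
            rw [Finset.HasAntidiagonal.mem_antidiagonal.1 hq]]
        simp
      rw [this]
      exact hasSum_fintype _
  have hS : Summable ((fun q : ℕ × ℕ => φ (q.1 + q.2)) ∘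
      Finset.HasAntidiagonal.sigmaAntidiagonalEquivProd) := by
    rw [summable_sigma_of_nonneg fun x => by exact h0 _]
    refine ⟨fun M => (h1 M).summable, h.summable.congr fun M => ?_⟩
    exact (h1 M).tsum_eq.symm
  have h2 := hS.hasSum.sigma h1
  rw [← h2.unique h]
  exact hS.hasSum

/-- The Hankel-type kernel of the quadratic form `∑ C conj(δ_n) conj(δ_m) w_k w_j` in `δ`. -/
noncomputable def hankelKernel (s : ℝ) (w : ℕ → ℂ) (p : ℕ × ℕ) : ℝ :=
  ∑ q ∈ antidiagonal (p.1 + p.2), coupling s p.1 p.2 q.1 q.2 * (‖w q.1‖ * ‖w q.2‖)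

theorem hankelKernel_nonneg (s : ℝ) (w : ℕ → ℂ) (p : ℕ × ℕ) : 0 ≤ hankelKernel s w p :=
  Finset.sum_nonneg fun q _ => mul_nonneg (coupling_nonneg _ _ _ _ _) (by positivity)

theorem sum_antidiagonal_add_two {M : Type*} [AddCommMonoid M] (f : ℕ × ℕ → M) (n : ℕ) :
    ∑ q ∈ antidiagonal (n + 2), f q =
      f (0, n + 2) + f (n + 2, 0) + ∑ q ∈ antidiagonal n, f (q.1 + 1, q.2 + 1) := by
  rw [Finset.Nat.sum_antidiagonal_succ, Finset.Nat.sum_antidiagonal_succ', ← add_assoc]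

theorem hankelKernel_succ_succ_le {s : ℝ} (hs : 1 < s) (w : ℕ → ℂ) (n m : ℕ) :
    hankelKernel s w (n + 1, m + 1) ^ 2 ≤ 4 * couplingConst s ^ 2 * ‖w 0‖ ^ 2 *
      (((n + 1 + (m + 1) : ℕ) + 1) ^ 3 * ‖w (n + 1 + (m + 1))‖ ^ 2) := by
  have hK := couplingConst_pos hs
  obtain ⟨M, hM⟩ : ∃ M, M = n + m + 2 := ⟨_, rfl⟩
  have e : n + 1 + (m + 1) = n + m + 2 := by ring
  have hz : ∀ q ∈ antidiagonal (n + m), coupling s (n + 1) (m + 1) (q.1 + 1) (q.2 + 1) *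
      (‖w (q.1 + 1)‖ * ‖w (q.2 + 1)‖) = 0 := fun q _ => by
    rw [coupling, if_neg (by positivity), zero_mul]
  have hn : √((n + 1 : ℕ) + 1) ≤ √((M : ℝ) + 1) := Real.sqrt_le_sqrt (by
    rw [hM]; push_cast; linarith [(Nat.cast_nonneg m : 0 ≤ (m : ℝ))])
  have hm : √((m + 1 : ℕ) + 1) ≤ √((M : ℝ) + 1) := Real.sqrt_le_sqrt (by
    rw [hM]; push_cast; linarith [(Nat.cast_nonneg n : 0 ≤ (n : ℝ))])
  have h1 : hankelKernel s w (n + 1, m + 1) ≤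
      2 * couplingConst s * ‖w 0‖ * (√((M : ℝ) + 1) ^ 3 * ‖w M‖) := by
    simp only [hankelKernel]
    rw [e, sum_antidiagonal_add_two, Finset.sum_eq_zero hz, add_zero, ← hM]
    have c1 := coupling_le hs (show n + 1 + (m + 1) = 0 + M by omega)
    have c2 := coupling_le hs (show n + 1 + (m + 1) = M + 0 by omega)
    have c3 : couplingConst s * (√((n + 1 : ℕ) + 1) * √((m + 1 : ℕ) + 1) * √((0 : ℕ) + 1) *
        √((M : ℝ) + 1)) ≤ couplingConst s * √((M : ℝ) + 1) ^ 3 := by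
      rw [Nat.cast_zero, zero_add, Real.sqrt_one, mul_one, pow_three', ]
      gcongr
    have c4 : couplingConst s * (√((n + 1 : ℕ) + 1) * √((m + 1 : ℕ) + 1) * √((M : ℝ) + 1) *
        √((0 : ℕ) + 1)) ≤ couplingConst s * √((M : ℝ) + 1) ^ 3 := by
      rw [Nat.cast_zero, zero_add, Real.sqrt_one, mul_one, pow_three']
      gcongr
    calc _ ≤ couplingConst s * √((M : ℝ) + 1) ^ 3 * (‖w 0‖ * ‖w M‖) +
          couplingConst s * √((M : ℝ) + 1) ^ 3 * (‖w M‖ * ‖w 0‖) := by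
          gcongr
          exacts [c1.trans c3, c2.trans c4]
      _ = _ := by ring
  rw [e, ← hM]
  calc hankelKernel s w (n + 1, m + 1) ^ 2 ≤
        (2 * couplingConst s * ‖w 0‖ * (√((M : ℝ) + 1) ^ 3 * ‖w M‖)) ^ 2 := by
        have := hankelKernel_nonneg s w (n + 1, m + 1)
        gcongr
    _ = 4 * couplingConst s ^ 2 * ‖w 0‖ ^ 2 * ((√((M : ℝ) + 1) ^ 2) ^ 3 * ‖w M‖ ^ 2) := by ring
    _ = _ := by rw [Real.sq_sqrt (by positivity)]

/-- The self-convolution of `(k + 1) |w_k|`. -/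
noncomputable def selfConv (w : ℕ → ℂ) (M : ℕ) : ℝ :=
  ∑ q ∈ antidiagonal M, ((q.1 : ℝ) + 1) * ‖w q.1‖ * (((q.2 : ℝ) + 1) * ‖w q.2‖)

theorem hankelKernel_le_selfConv {s : ℝ} (hs : 1 < s) (w : ℕ → ℂ) {n m : ℕ} (h : n = 0 ∨ m = 0) :
    hankelKernel s w (n, m) ≤ couplingConst s * selfConv w (n + m) := by
  have hK := couplingConst_pos hs
  rw [hankelKernel, selfConv, Finset.mul_sum]
  refine Finset.sum_le_sum fun q hq => ?_
  have hq' : q.1 + q.2 = n + m := Finset.HasAntidiagonal.mem_antidiagonal.1 hq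
  have e : √((n : ℝ) + 1) * √((m : ℝ) + 1) = √((q.1 : ℝ) + q.2 + 1) := by
    have : (q.1 : ℝ) + q.2 = n + m := by exact_mod_cast hq'
    rw [this]
    rcases h with rfl | rfl <;> simp
  have h1 : √((q.1 : ℝ) + q.2 + 1) ≤ √(q.1 + 1) * √(q.2 + 1) := by
    rw [← Real.sqrt_mul (by positivity)]
    refine Real.sqrt_le_sqrt ?_
    have : (0 : ℝ) ≤ q.1 * q.2 := by positivity
    linarith
  have h2 := coupling_le hs hq'.symm
  rw [e] at h2
  calc coupling s n m q.1 q.2 * (‖w q.1‖ * ‖w q.2‖) ≤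
        couplingConst s * (√(q.1 + 1) * √(q.2 + 1) * √(q.1 + 1) * √(q.2 + 1)) *
          (‖w q.1‖ * ‖w q.2‖) := by
        gcongr
        refine h2.trans ?_
        gcongr
    _ = couplingConst s * (√(q.1 + 1) ^ 2 * ‖w q.1‖ * (√(q.2 + 1) ^ 2 * ‖w q.2‖)) := by ring
    _ = _ := by rw [Real.sq_sqrt (by positivity), Real.sq_sqrt (by positivity)]

theorem selfConv_nonneg (w : ℕ → ℂ) (M : ℕ) : 0 ≤ selfConv w M :=
  Finset.sum_nonneg fun q _ => by positivity

theorem mul_le_sq_add_sq (x y : ℝ) : x * y ≤ x ^ 2 + y ^ 2 := by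
  nlinarith [sq_nonneg (x - y), sq_nonneg x, sq_nonneg y]

theorem summable_one_div_succ_sq : Summable fun n : ℕ => 1 / ((n : ℝ) + 1) ^ 2 := by
  have := (summable_nat_add_iff 1).2 (Real.summable_one_div_nat_pow.2 (show 1 < 2 by norm_num))
  exact_mod_cast this

theorem SobolevTwoBound.hasSum_succ_mul {R : ℝ} {w : ℕ → ℂ} (hw : SobolevTwoBound R w) :
    ∃ S ≤ R + ∑' n : ℕ, 1 / ((n : ℝ) + 1) ^ 2, 0 ≤ S ∧
      HasSum (fun n : ℕ => ((n : ℝ) + 1) * ‖w n‖) S := by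
  have hle : ∀ n : ℕ, ((n : ℝ) + 1) * ‖w n‖ ≤ ((n : ℝ) + 1) ^ 4 * ‖w n‖ ^ 2 +
      1 / ((n : ℝ) + 1) ^ 2 := fun n => by
    have h1 : ((n : ℝ) + 1) * ‖w n‖ = (((n : ℝ) + 1) ^ 2 * ‖w n‖) * (1 / ((n : ℝ) + 1)) := by
      field_simp
    rw [h1]
    refine (mul_le_sq_add_sq _ _).trans (le_of_eq ?_)
    rw [div_pow, one_pow, mul_pow, ← pow_mul]
  have hsum := hw.1.add summable_one_div_succ_sq
  have hs1 : Summable fun n : ℕ => ((n : ℝ) + 1) * ‖w n‖ :=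
    hsum.of_nonneg_of_le (fun n => by positivity) hle
  refine ⟨_, (hs1.tsum_le_tsum hle hsum).trans ?_, tsum_nonneg fun n => by positivity, hs1.hasSum⟩
  rw [hw.1.tsum_add summable_one_div_succ_sq]
  linarith [hw.2]

theorem SobolevTwoBound.hasSum_selfConv_sq {R : ℝ} {w : ℕ → ℂ} (hw : SobolevTwoBound R w) :
    ∃ S ≤ (R + ∑' n : ℕ, 1 / ((n : ℝ) + 1) ^ 2) ^ 4,
      HasSum (fun M => selfConv w M ^ 2) S := by
  obtain ⟨S1, hS1, hS10, hs1⟩ := hw.hasSum_succ_mul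
  have hconv : HasSum (selfConv w) (S1 ^ 2) := by
    have h1 := (summable_norm_sum_mul_antidiagonal_of_summable_norm hs1.summable.norm
      hs1.summable.norm).of_norm
    have h2 := tsum_mul_tsum_eq_tsum_sum_antidiagonal_of_summable_norm hs1.summable.norm
      hs1.summable.norm
    rw [hs1.tsum_eq] at h2
    rw [sq, h2]
    exact h1.hasSum
  have hcle : ∀ M, selfConv w M ≤ S1 ^ 2 := fun M =>
    le_hasSum hconv M fun i _ => selfConv_nonneg w i
  have hc2le : ∀ M, selfConv w M ^ 2 ≤ S1 ^ 2 * selfConv w M := fun M => by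
    rw [sq]
    exact mul_le_mul_of_nonneg_right (hcle M) (selfConv_nonneg w M)
  have hc2 : Summable fun M => selfConv w M ^ 2 :=
    (hconv.summable.mul_left _).of_nonneg_of_le (fun M => sq_nonneg _) hc2le
  refine ⟨_, (hasSum_le hc2le hc2.hasSum (hconv.mul_left _)).trans ?_, hc2.hasSum⟩
  calc S1 ^ 2 * S1 ^ 2 = S1 ^ 4 := by ring
    _ ≤ _ := by gcongr

/-- The kernel is square summable, with a bound that depends only on the bound for `w`. -/
theorem exists_hankelKernel_bound {s : ℝ} (hs : 1 < s) (R : ℝ) :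
    ∃ Θ : ℝ, 0 ≤ Θ ∧ ∀ w : ℕ → ℂ, SobolevTwoBound R w → ∃ J : ℕ × ℕ → ℝ, ∃ θ ≤ Θ, HasSum J θ ∧
      ∀ p, hankelKernel s w p ^ 2 ≤ J p := by
  have hK := couplingConst_pos hs
  generalize hKdef : couplingConst s = K at hK
  refine ⟨4 * K ^ 2 * R ^ 2 + 2 * K ^ 2 * (R + ∑' n : ℕ, 1 / ((n : ℝ) + 1) ^ 2) ^ 4,
    by positivity, fun w hw => ?_⟩
  have hR := hw.nonneg
  have hw0 : ‖w 0‖ ^ 2 ≤ R := by simpa using hw.term_le 0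
  obtain ⟨S, hS, hsum⟩ := hw.hasSum_selfConv_sq
  -- the part of the kernel away from the axes
  have hA : HasSum (fun q : ℕ × ℕ => 4 * K ^ 2 * ‖w 0‖ ^ 2 *
      (((q.1 + q.2 : ℕ) + 1) ^ 3 * ‖w (q.1 + q.2)‖ ^ 2))
      (4 * K ^ 2 * ‖w 0‖ ^ 2 * ∑' n : ℕ, ((n : ℝ) + 1) ^ 4 * ‖w n‖ ^ 2) := by
    refine HasSum.mul_left _ ?_
    refine hasSum_antidiagonal_of_nonneg (φ := fun M : ℕ => ((M : ℝ) + 1) ^ 3 * ‖w M‖ ^ 2)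
      (fun n => by positivity) (hasSum_of_eq hw.1.hasSum (fun n => by ring) rfl)
  -- the part on the axes
  have hi : ∀ n : ℕ, (0 : ℝ) ≤ if n = 0 then 1 else 0 := fun n => by split_ifs <;> norm_num
  have hB1 := hasSum_prod_mul_of_nonneg (hasSum_ite_eq (0 : ℕ) (1 : ℝ)) (hsum.mul_left (K ^ 2))
    hi fun n => by positivity
  have hB2 := hasSum_prod_mul_of_nonneg (hsum.mul_left (K ^ 2)) (hasSum_ite_eq (0 : ℕ) (1 : ℝ))
    (fun n => by positivity) hi
  refine ⟨_, _, ?_, hA.add (hB1.add hB2), ?_⟩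
  · have h1 : 4 * K ^ 2 * ‖w 0‖ ^ 2 * ∑' n : ℕ, ((n : ℝ) + 1) ^ 4 * ‖w n‖ ^ 2 ≤
        4 * K ^ 2 * R * R := by
      gcongr
      exact hw.2
    have h2 := mul_le_mul_of_nonneg_left hS (sq_nonneg K)
    linarith
  · have haxis : ∀ n m, n = 0 ∨ m = 0 →
        hankelKernel s w (n, m) ^ 2 ≤ K ^ 2 * selfConv w (n + m) ^ 2 := fun n m h => by
      have h1 := hankelKernel_le_selfConv hs w h
      have h2 := pow_le_pow_left₀ (hankelKernel_nonneg s w _) h1 2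
      rwa [mul_pow, hKdef] at h2
    rintro ⟨n, m⟩
    have hn0 : 0 ≤ 4 * K ^ 2 * ‖w 0‖ ^ 2 * (((n + m : ℕ) + 1) ^ 3 * ‖w (n + m)‖ ^ 2) := by
      positivity
    have hn1 : 0 ≤ (if n = 0 then 1 else 0) * (K ^ 2 * selfConv w m ^ 2) :=
      mul_nonneg (hi n) (by positivity)
    have hn2 : 0 ≤ K ^ 2 * selfConv w n ^ 2 * (if m = 0 then 1 else 0) :=
      mul_nonneg (by positivity) (hi m)
    by_cases hn : n = 0
    · refine (haxis n m (Or.inl hn)).trans ?_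
      subst hn
      simp only [if_true, one_mul, zero_add] at hn0 hn1 hn2 ⊢
      linarith
    by_cases hm : m = 0
    · refine (haxis n m (Or.inr hm)).trans ?_
      subst hm
      simp only [if_true, mul_one, add_zero] at hn0 hn1 hn2 ⊢
      linarith
    · obtain ⟨n, rfl⟩ := Nat.exists_eq_succ_of_ne_zero hn
      obtain ⟨m, rfl⟩ := Nat.exists_eq_succ_of_ne_zero hm
      have h1 := hankelKernel_succ_succ_le hs w n m
      rw [hKdef] at h1
      exact h1.trans (le_add_of_nonneg_right (add_nonneg hn1 hn2))

/-- The quadratic form `∑ C conj(δ_n) conj(δ_m) w_k w_j` is bounded on `ℓ²`. -/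
theorem norm_tsum_quarticTerm_le {s : ℝ} (hs : 1 < s) {R' : ℝ} {δ w : ℕ → ℂ} (hδ : QuadDecay R' δ)
    (hw : QuadDecay R' w) {J : ℕ × ℕ → ℝ} {Θ D : ℝ} (hJ : HasSum J Θ)
    (hwJ : ∀ p, hankelKernel s w p ^ 2 ≤ J p) (hD : HasSum (fun n => ‖δ n‖ ^ 2) D) :
    ‖∑' x, quarticTerm s (fun n => (starRingEnd ℂ) (δ n)) (fun n => (starRingEnd ℂ) (δ n)) w w x‖ ≤
      D * (1 + Θ) / 2 := by
  have hD0 : 0 ≤ D := hD.nonneg fun n => by positivity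
  rcases hD0.eq_or_lt with h0 | hDpos
  · have : ∀ n, δ n = 0 := fun n => by
      have h1 := (hasSum_zero_iff_of_nonneg (fun n => by positivity)).1 (h0 ▸ hD)
      have h2 := congrFun h1 n
      simpa using h2
    simp [quarticTerm, this, ← h0]
  have hsum := (summable_quarticTerm hs hδ.conj hδ.conj hw hw).norm
  have hfib : ∀ p : ℕ × ℕ, HasSum (fun q => ‖quarticTerm s (fun n => (starRingEnd ℂ) (δ n))
      (fun n => (starRingEnd ℂ) (δ n)) w w (p, q)‖) (‖δ p.1‖ * ‖δ p.2‖ * hankelKernel s w p) := by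
    rintro ⟨n, m⟩
    rw [hankelKernel, Finset.mul_sum]
    have h : ∑ q ∈ antidiagonal (n + m), ‖δ n‖ * ‖δ m‖ * (coupling s n m q.1 q.2 *
        (‖w q.1‖ * ‖w q.2‖)) = ∑ q ∈ antidiagonal (n + m),
        ‖quarticTerm s (fun n => (starRingEnd ℂ) (δ n)) (fun n => (starRingEnd ℂ) (δ n)) w w
          ((n, m), q)‖ := by
      refine Finset.sum_congr rfl fun q hq => ?_
      have : n + m = q.1 + q.2 := (Finset.HasAntidiagonal.mem_antidiagonal.1 hq).symm
      rw [quarticTerm, resonantCoupling, if_pos this]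
      simp only [norm_mul, Complex.norm_real, Real.norm_of_nonneg (coupling_nonneg s _ _ _ _),
        RCLike.norm_conj]
      ring
    simp only
    rw [h]
    refine hasSum_sum_of_ne_finset_zero fun q hq => ?_
    have : ¬ (n + m = q.1 + q.2) := fun h => hq (Finset.HasAntidiagonal.mem_antidiagonal.2 h.symm)
    rw [quarticTerm, resonantCoupling, if_neg this]
    simp
  refine (norm_tsum_le_tsum_norm hsum).trans ?_
  have h1 := hsum.hasSum.prod_fiberwise hfib
  have h2 : HasSum (fun p : ℕ × ℕ => (‖δ p.1‖ ^ 2 * ‖δ p.2‖ ^ 2 * D⁻¹ + D * J p) * (1 / 2))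
      ((D * D * D⁻¹ + D * Θ) * (1 / 2)) :=
    (((hasSum_prod_mul_of_nonneg hD hD (fun n => sq_nonneg _) (fun n => sq_nonneg _)).mul_right D⁻¹).add
      (hJ.mul_left D)).mul_right (1 / 2)
  refine (hasSum_le (fun p => ?_) h1 h2).trans (le_of_eq ?_)
  · have h3 := mul_le_mul_of_nonneg_left (hwJ p) hDpos.le
    have h4 : ‖δ p.1‖ ^ 2 * ‖δ p.2‖ ^ 2 * D⁻¹ = D * (‖δ p.1‖ * ‖δ p.2‖ * D⁻¹) ^ 2 := by
      field_simp
    have h5 : ‖δ p.1‖ * ‖δ p.2‖ * hankelKernel s w p =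
        D * ((‖δ p.1‖ * ‖δ p.2‖ * D⁻¹) * hankelKernel s w p) := by field_simp
    rw [h4, h5]
    nlinarith [mul_nonneg hDpos.le
      (sq_nonneg (‖δ p.1‖ * ‖δ p.2‖ * D⁻¹ - hankelKernel s w p))]
  · field_simp


/-! ### Uniqueness of strong solutions -/

theorem QuadDecay.mono {R R' : ℝ} {a : ℕ → ℂ} (h : QuadDecay R a) (hR : R ≤ R') :
    QuadDecay R' a := fun n => (h n).trans (by gcongr)

theorem SobolevTwoBound.quadDecay_sub {R : ℝ} {u v : ℕ → ℂ} (hu : SobolevTwoBound R u)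
    (hv : SobolevTwoBound R v) : QuadDecay (2 * √R) fun n => u n - v n := fun n => by
  refine (norm_sub_le _ _).trans ((add_le_add (hu.quadDecay n) (hv.quadDecay n)).trans
    (le_of_eq ?_))
  ring

/-- In the difference of the two nonlinear terms, paired with the difference `δ` of the solutions,
the terms of first order that act on `δ` are symmetric, and the cubic term is real; only the term
with two conjugate factors `δ` has an imaginary part. -/
theorem im_tsum_quarticTerm_sub {s : ℝ} (hs : 1 < s) {R : ℝ} {u v : ℕ → ℂ}
    (hu : SobolevTwoBound R u) (hv : SobolevTwoBound R v) :
    ((∑' x, quarticTerm s (fun n => (starRingEnd ℂ) (u n - v n)) (fun n => (starRingEnd ℂ) (u n))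
        u u x) -
      ∑' x, quarticTerm s (fun n => (starRingEnd ℂ) (u n - v n)) (fun n => (starRingEnd ℂ) (v n))
        v v x).im =
    (∑' x, quarticTerm s (fun n => (starRingEnd ℂ) (u n - v n))
      (fun n => (starRingEnd ℂ) (u n - v n)) (fun n => (u n + v n) / 2)
      (fun n => (u n + v n) / 2) x).im := by
  have hR : √R ≤ 2 * √R := by linarith [Real.sqrt_nonneg R]
  have hδ := hu.quadDecay_sub hv
  have hu' := hu.quadDecay.mono hR
  have hv' := hv.quadDecay.mono hR
  have hw := (hu.average hv).quadDecay.mono hR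
  set δ : ℕ → ℂ := fun n => u n - v n with hδd
  set w : ℕ → ℂ := fun n => (u n + v n) / 2 with hwd
  have s1 := (summable_quarticTerm hs hδ.conj hu'.conj hu' hu').hasSum
  have s2 := (summable_quarticTerm hs hδ.conj hv'.conj hv' hv').hasSum
  have s3 := (summable_quarticTerm hs hδ.conj hδ.conj hw hw).hasSum
  have s4 := (summable_quarticTerm hs hδ.conj hw.conj hδ hw).hasSum
  have s5 := (summable_quarticTerm hs hδ.conj hw.conj hw hδ).hasSum
  have s6 := (summable_quarticTerm hs hδ.conj hδ.conj hδ hδ).hasSum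
  have key := (s1.sub s2).unique (hasSum_of_eq
    (((s3.add s4).add s5).add (s6.mul_left ((1 / 4 : ℝ) : ℂ))) (fun x => by
      simp only [quarticTerm, hδd, hwd, map_sub, map_add, map_div₀, Complex.conj_ofNat]
      push_cast
      ring) rfl)
  have r4 := im_tsum_quarticTerm_conj s δ w
  have r5 := im_tsum_quarticTerm_conj' s δ w
  have r6 := im_tsum_quarticTerm_conj s δ δ
  rw [key]
  simp only [Complex.add_im, Complex.im_ofReal_mul]
  rw [r4, r5, r6]
  ring

theorem IsStrongSolutionOn.exists_sobolevTwoBound {s : ℝ} {α : ℝ → ℕ → ℂ} {I : Set ℝ}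
    (h : IsStrongSolutionOn s α I) {K : Set ℝ} (hK : K ⊆ I) (hc : IsCompact K) :
    ∃ R, ∀ t ∈ K, SobolevTwoBound R (α t) := by
  obtain ⟨_, ξ, hξ, h⟩ := h
  obtain ⟨R, hR⟩ := h K hK hc
  refine ⟨R, fun t ht => ?_⟩
  obtain ⟨h1, h2⟩ := hR t ht
  have hle : ∀ n : ℕ, ((n : ℝ) + 1) ^ 4 * ‖α t n‖ ^ 2 ≤ sobolevTerm ξ (α t) n := fun n => by
    unfold sobolevTerm
    gcongr
    rw [← Real.rpow_natCast]
    refine Real.rpow_le_rpow_of_exponent_le (by linarith [(Nat.cast_nonneg n : 0 ≤ (n : ℝ))]) ?_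
    push_cast
    linarith
  have hS := h1.of_nonneg_of_le (fun n => by positivity) hle
  exact ⟨hS, (hS.tsum_le_tsum hle h1).trans h2⟩

theorem hasDerivAt_norm_sq_sub {f g : ℝ → ℂ} {x y : ℂ} {t : ℝ}
    (hf : HasDerivAt f (-Complex.I * x) t) (hg : HasDerivAt g (-Complex.I * y) t) :
    HasDerivAt (fun τ => ‖f τ - g τ‖ ^ 2)
      (2 * ((starRingEnd ℂ) (f t - g t) * x - (starRingEnd ℂ) (f t - g t) * y).im) t := by
  refine ((hf.sub hg).norm_sq).congr_deriv ?_
  rw [Complex.inner, ← mul_sub, ← mul_sub, Pi.sub_apply]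
  simp [Complex.mul_re, Complex.mul_im]
  ring

/-- The squared `ℓ²`-distance of two solutions. -/
noncomputable def distSq (u v : ℝ → ℕ → ℂ) (t : ℝ) : ℝ := ∑' n, ‖u t n - v t n‖ ^ 2

theorem eq_iff_distSq_eq_zero {R : ℝ} {u v : ℝ → ℕ → ℂ} {t : ℝ} (hu : SobolevTwoBound R (u t))
    (hv : SobolevTwoBound R (v t)) : u t = v t ↔ distSq u v t = 0 := by
  have hS : Summable fun n => ‖u t n - v t n‖ ^ 2 := by
    refine (summable_one_div_succ_sq.mul_left ((2 * √R) ^ 2)).of_nonneg_of_le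
      (fun n => by positivity) fun n => ?_
    have h1 := hu.quadDecay_sub hv n
    have h2 : 2 * √R / ((n : ℝ) + 1) ^ 2 ≤ 2 * √R / ((n : ℝ) + 1) := by
      gcongr
      nlinarith [(Nat.cast_nonneg n : 0 ≤ (n : ℝ))]
    calc _ ≤ (2 * √R / ((n : ℝ) + 1)) ^ 2 := by
          have := h1.trans h2
          gcongr
      _ = _ := by field_simp
  refine ⟨fun h => by simp [distSq, h], fun h => ?_⟩
  have h0 : HasSum (fun n => ‖u t n - v t n‖ ^ 2) 0 := by
    rw [← h]
    exact hS.hasSum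
  have h1 := (hasSum_zero_iff_of_nonneg (fun n => by positivity)).1 h0
  ext n
  have h2 := congrFun h1 n
  rw [← sub_eq_zero]
  simpa using h2

/-- The squared distance `D` of two strong solutions satisfies `|D'| ≤ C D` on compact intervals.
The terms of the nonlinearity that are not bounded on `ℓ²` drop out of `D'`, being real. -/
theorem distSq_estimates {s : ℝ} (hs : 1 < s) {I : Set ℝ} {u v : ℝ → ℕ → ℂ}
    (hu : IsStrongSolutionOn s u I) (hv : IsStrongSolutionOn s v I) {a b : ℝ}
    (hab : Set.Icc a b ⊆ I) :
    ∃ C, ContinuousOn (distSq u v) (Set.Icc a b) ∧ ∀ t ∈ Set.Ioo a b, ∃ D',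
      HasDerivAt (distSq u v) D' t ∧ |D'| ≤ C * distSq u v t := by
  obtain ⟨R1, hR1⟩ := hu.exists_sobolevTwoBound hab isCompact_Icc
  obtain ⟨R2, hR2⟩ := hv.exists_sobolevTwoBound hab isCompact_Icc
  set R := max R1 R2
  have hbu : ∀ t ∈ Set.Icc a b, SobolevTwoBound R (u t) := fun t ht =>
    ⟨(hR1 t ht).1, (hR1 t ht).2.trans (le_max_left _ _)⟩
  have hbv : ∀ t ∈ Set.Icc a b, SobolevTwoBound R (v t) := fun t ht =>
    ⟨(hR2 t ht).1, (hR2 t ht).2.trans (le_max_right _ _)⟩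
  obtain ⟨Θ, hΘ, hJ⟩ := exists_hankelKernel_bound hs R
  have hR : √R ≤ 2 * √R := by linarith [Real.sqrt_nonneg R]
  have hle : ∀ t ∈ Set.Icc a b, ∀ n, ‖u t n - v t n‖ ^ 2 ≤
      (2 * √R) ^ 2 * (1 / ((n : ℝ) + 1) ^ 2) := fun t ht n => by
    have h1 := (hbu t ht).quadDecay_sub (hbv t ht) n
    have h2 : 2 * √R / ((n : ℝ) + 1) ^ 2 ≤ 2 * √R / ((n : ℝ) + 1) := by
      gcongr
      nlinarith [(Nat.cast_nonneg n : 0 ≤ (n : ℝ))]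
    calc _ ≤ (2 * √R / ((n : ℝ) + 1)) ^ 2 := by
          have := h1.trans h2
          gcongr
      _ = _ := by field_simp
  have hsumle : Summable fun n : ℕ => (2 * √R) ^ 2 * (1 / ((n : ℝ) + 1) ^ 2) :=
    summable_one_div_succ_sq.mul_left _
  refine ⟨1 + Θ, ?_, ?_⟩
  · refine continuousOn_tsum (fun n t ht => ?_) hsumle fun n t ht => ?_
    · have h1 := ((hu.1 t (hab ht) n).2.mono hab).continuousWithinAt
      have h2 := ((hv.1 t (hab ht) n).2.mono hab).continuousWithinAt
      exact (h1.sub h2).norm.pow 2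
    · rw [Real.norm_of_nonneg (by positivity)]
      exact hle t ht n
  · intro t ht
    have hd : ∀ n, ∀ τ ∈ Set.Ioo a b, HasDerivAt (fun τ => ‖u τ n - v τ n‖ ^ 2)
        (2 * ((starRingEnd ℂ) (u τ n - v τ n) * ∑' m, resonantSum s (u τ) n m -
          (starRingEnd ℂ) (u τ n - v τ n) * ∑' m, resonantSum s (v τ) n m).im) τ := fun n τ hτ => by
      have hI : I ∈ 𝓝 τ := mem_of_superset (Icc_mem_nhds hτ.1 hτ.2) hab
      exact hasDerivAt_norm_sq_sub
        ((hu.1 τ (hab (Set.Ioo_subset_Icc_self hτ)) n).2.hasDerivAt hI)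
        ((hv.1 τ (hab (Set.Ioo_subset_Icc_self hτ)) n).2.hasDerivAt hI)
    have hb : ∀ n, ∀ τ ∈ Set.Ioo a b,
        ‖2 * ((starRingEnd ℂ) (u τ n - v τ n) * ∑' m, resonantSum s (u τ) n m -
          (starRingEnd ℂ) (u τ n - v τ n) * ∑' m, resonantSum s (v τ) n m).im‖ ≤
        4 * (couplingConst s * (2 * √R) ^ 4 * (∑' i, weight i) ^ 3) * weight n := fun n τ hτ => by
      have hτ' := Set.Ioo_subset_Icc_self hτ
      have hδ := ((hbu τ hτ').quadDecay_sub (hbv τ hτ')).conj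
      have h1 := norm_mul_tsum_resonantSum_le hs hδ ((hbu τ hτ').quadDecay.mono hR) n
      have h2 := norm_mul_tsum_resonantSum_le hs hδ ((hbv τ hτ').quadDecay.mono hR) n
      rw [norm_mul, Real.norm_ofNat, Real.norm_eq_abs]
      have h3 := (Complex.abs_im_le_norm _).trans ((norm_sub_le _ _).trans (add_le_add h1 h2))
      linarith
    have htI := Set.Ioo_subset_Icc_self ht
    have hder := hasDerivAt_tsum_of_isPreconnected (summable_weight.mul_left _)
      (isOpen_Ioo (a := a) (b := b)) isPreconnected_Ioo hd hb ht
      (hsumle.of_nonneg_of_le (fun n => by positivity) (hle t htI)) ht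
    refine ⟨_, hder, ?_⟩
    have hδ := (hbu t htI).quadDecay_sub (hbv t htI)
    have e1 := (hasSum_mul_tsum_resonantSum hs hδ.conj ((hbu t htI).quadDecay.mono hR)).sub
      (hasSum_mul_tsum_resonantSum hs hδ.conj ((hbv t htI).quadDecay.mono hR))
    have e2 := (Complex.hasSum_im e1).mul_left 2
    rw [e2.tsum_eq, im_tsum_quarticTerm_sub hs (hbu t htI) (hbv t htI)]
    have hw := (hbu t htI).average (hbv t htI)
    obtain ⟨J, θ, hθ, hJs, hwJ⟩ := hJ _ hw
    have hD : HasSum (fun n => ‖u t n - v t n‖ ^ 2) (distSq u v t) :=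
      (hsumle.of_nonneg_of_le (fun n => by positivity) (hle t htI)).hasSum
    have h4 := norm_tsum_quarticTerm_le hs hδ (hw.quadDecay.mono hR) hJs hwJ hD
    have h5 := (Complex.abs_im_le_norm _).trans h4
    rw [abs_mul, abs_two]
    have hD0 : 0 ≤ distSq u v t := tsum_nonneg fun n => by positivity
    nlinarith

/-- Gronwall's lemma, in both directions of time. -/
theorem eq_zero_of_abs_deriv_le {D : ℝ → ℝ} {a b C : ℝ} (hab : a ≤ b)
    (hc : ContinuousOn D (Set.Icc a b)) (h0 : ∀ t, 0 ≤ D t)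
    (hd : ∀ t ∈ Set.Ioo a b, ∃ D', HasDerivAt D D' t ∧ |D'| ≤ C * D t) : D a = 0 ↔ D b = 0 := by
  have hexp : ∀ c t : ℝ, HasDerivAt (fun t => Real.exp (c * t)) (Real.exp (c * t) * c) t :=
    fun c t => by simpa using ((hasDerivAt_id t).const_mul c).exp
  have hcont : ∀ c : ℝ, ContinuousOn (fun t => Real.exp (c * t) * D t) (Set.Icc a b) := fun c =>
    (Continuous.continuousOn (by fun_prop)).mul hc
  have h1 : AntitoneOn (fun t => Real.exp (-C * t) * D t) (Set.Icc a b) := by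
    refine antitoneOn_of_deriv_nonpos (convex_Icc a b) (hcont _) ?_ ?_
    · intro t ht
      rw [interior_Icc] at ht
      obtain ⟨D', h, _⟩ := hd t ht
      exact ((hexp _ t).mul h).differentiableAt.differentiableWithinAt
    · intro t ht
      rw [interior_Icc] at ht
      obtain ⟨D', h, hle⟩ := hd t ht
      have hd' : HasDerivAt (fun t => Real.exp (-C * t) * D t) _ t := (hexp (-C) t).mul h
      rw [hd'.deriv]
      have := (abs_le.1 hle).2
      have := Real.exp_pos (-C * t)
      nlinarith
  have h2 : MonotoneOn (fun t => Real.exp (C * t) * D t) (Set.Icc a b) := by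
    refine monotoneOn_of_deriv_nonneg (convex_Icc a b) (hcont _) ?_ ?_
    · intro t ht
      rw [interior_Icc] at ht
      obtain ⟨D', h, _⟩ := hd t ht
      exact ((hexp _ t).mul h).differentiableAt.differentiableWithinAt
    · intro t ht
      rw [interior_Icc] at ht
      obtain ⟨D', h, hle⟩ := hd t ht
      have hd' : HasDerivAt (fun t => Real.exp (C * t) * D t) _ t := (hexp C t).mul h
      rw [hd'.deriv]
      have := (abs_le.1 hle).1
      have := Real.exp_pos (C * t)
      nlinarith
  have ha : a ∈ Set.Icc a b := ⟨le_rfl, hab⟩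
  have hb : b ∈ Set.Icc a b := ⟨hab, le_rfl⟩
  have h3 := h1 ha hb hab
  have h4 := h2 ha hb hab
  simp only at h3 h4
  constructor <;> intro h <;> refine le_antisymm ?_ (h0 _)
  · rw [h, mul_zero] at h3
    exact nonpos_of_mul_nonpos_right h3 (Real.exp_pos _)
  · rw [h, mul_zero] at h4
    exact nonpos_of_mul_nonpos_right h4 (Real.exp_pos _)

/-- Strong solutions are determined by their value at one time. -/
theorem IsStrongSolutionOn.eq_of_eq {s : ℝ} (hs : 1 < s) {I : Set ℝ} (hI : I.OrdConnected)
    {u v : ℝ → ℕ → ℂ} (hu : IsStrongSolutionOn s u I) (hv : IsStrongSolutionOn s v I) {t₀ : ℝ}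
    (ht₀ : t₀ ∈ I) (h : u t₀ = v t₀) {t : ℝ} (ht : t ∈ I) : u t = v t := by
  have key : ∀ a ∈ I, ∀ b ∈ I, a ≤ b → (u a = v a ↔ u b = v b) := fun a ha b hb hab => by
    obtain ⟨C, hc, hd⟩ := distSq_estimates hs hu hv (hI.out ha hb)
    obtain ⟨R1, hR1⟩ := hu.exists_sobolevTwoBound (hI.out ha hb) isCompact_Icc
    obtain ⟨R2, hR2⟩ := hv.exists_sobolevTwoBound (hI.out ha hb) isCompact_Icc
    have hbu : ∀ t ∈ Set.Icc a b, SobolevTwoBound (max R1 R2) (u t) := fun t ht =>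
      ⟨(hR1 t ht).1, (hR1 t ht).2.trans (le_max_left _ _)⟩
    have hbv : ∀ t ∈ Set.Icc a b, SobolevTwoBound (max R1 R2) (v t) := fun t ht =>
      ⟨(hR2 t ht).1, (hR2 t ht).2.trans (le_max_right _ _)⟩
    rw [eq_iff_distSq_eq_zero (hbu a ⟨le_rfl, hab⟩) (hbv a ⟨le_rfl, hab⟩),
      eq_iff_distSq_eq_zero (hbu b ⟨hab, le_rfl⟩) (hbv b ⟨hab, le_rfl⟩)]
    exact eq_zero_of_abs_deriv_le hab hc (fun t => tsum_nonneg fun n => by positivity) hd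
  rcases le_total t₀ t with h1 | h1
  · exact (key t₀ ht₀ t ht h1).1 h
  · exact (key t ht t₀ ht₀ h1).2 h


/-! ### The resonant sums on the manifold -/

/-- The weight `f_n ((s - 1) n / 2 + 1) ^ (1 / 2)` of the mode `n` in the couplings. -/
noncomputable def modeWeight (s : ℝ) (n : ℕ) : ℝ := √((s - 1) / 2 * n + 1) * fSeq s n

theorem half_mul_add_one_pos {s : ℝ} (hs : 1 < s) (n : ℕ) : 0 < (s - 1) / 2 * n + 1 := by
  have : 0 ≤ (s - 1) / 2 * n := mul_nonneg (by linarith) n.cast_nonneg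
  linarith

theorem modeWeight_zero (s : ℝ) : modeWeight s 0 = 1 := by
  simp [modeWeight, fSeq, fussCatalan_zero]

theorem modeWeight_eq {s : ℝ} (hs : 1 < s) (n : ℕ) :
    modeWeight s n = gSeq s n * ((s - 1) / 2 * n + 1) := by
  have h := half_mul_add_one_pos hs n
  have h1 := Real.mul_self_sqrt h.le
  have h2 := Real.sqrt_pos.2 h
  rw [modeWeight, gSeq]
  generalize √((s - 1) / 2 * n + 1) = r at h1 h2 ⊢
  rw [← h1]
  field_simp

theorem coupling_eq {s : ℝ} (hs : 1 < s) (n m k j : ℕ) :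
    coupling s n m k j = if n * m * k * j = 0 then
      modeWeight s n * modeWeight s m * modeWeight s k * modeWeight s j / fussCatalan s (n + m)
    else 0 := by
  have h := fun i => (half_mul_add_one_pos hs i).le
  rw [coupling, fSeq_sq hs]
  split_ifs with hz
  swap
  · rfl
  have e : √(((s - 1) * n + 2) * ((s - 1) * m + 2) * ((s - 1) * k + 2) * ((s - 1) * j + 2)) =
      4 * (√((s - 1) / 2 * n + 1) * √((s - 1) / 2 * m + 1) * √((s - 1) / 2 * k + 1) *
        √((s - 1) / 2 * j + 1)) := by
    have h4 : (4 : ℝ) = √(4 ^ 2) := by rw [Real.sqrt_sq (by norm_num)]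
    have := h n; have := h m; have := h k; have := h j
    rw [← Real.sqrt_mul (by positivity), ← Real.sqrt_mul (by positivity),
      ← Real.sqrt_mul (by positivity), h4, ← Real.sqrt_mul (by positivity)]
    congr 1
    ring
  rw [e]
  unfold modeWeight
  generalize √((s - 1) / 2 * n + 1) = r1
  generalize √((s - 1) / 2 * m + 1) = r2
  generalize √((s - 1) / 2 * k + 1) = r3
  generalize √((s - 1) / 2 * j + 1) = r4
  generalize fussCatalan s (n + m) = A
  ring

/-- The modes of a point of the manifold, multiplied by their weights: `b` and `A_n c p^{n-1}`. -/
noncomputable def weightedState (s : ℝ) (b c p : ℂ) : ℕ → ℂ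
  | 0 => b
  | n + 1 => (fussCatalan s (n + 1) : ℂ) * c * p ^ n

theorem modeWeight_mul_manifoldState {s : ℝ} (hs : 1 < s) (b c p : ℂ) (n : ℕ) :
    (modeWeight s n : ℂ) * manifoldState s b c p n = weightedState s b c p n := by
  rcases n with _ | n
  · simp [modeWeight_zero, manifoldState, weightedState]
  · have h := gSeq_sq hs (n + 1)
    rw [eq_div_iff (half_mul_add_one_pos hs _).ne'] at h
    simp only [manifoldState, weightedState]
    rw [modeWeight_eq hs, ← h]
    push_cast
    ring

theorem resonantSum_manifoldState {s : ℝ} (hs : 1 < s) (b c p : ℂ) (n m : ℕ) :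
    resonantSum s (manifoldState s b c p) n m = modeWeight s n *
      (starRingEnd ℂ) (weightedState s b c p m) / fussCatalan s (n + m) *
      ∑ q ∈ antidiagonal (n + m), if n * m * q.1 * q.2 = 0 then
        weightedState s b c p q.1 * weightedState s b c p q.2 else 0 := by
  rw [resonantSum, Finset.mul_sum]
  refine Finset.sum_congr rfl fun q _ => ?_
  rw [coupling_eq hs]
  split_ifs
  · simp only [← modeWeight_mul_manifoldState hs, map_mul, Complex.conj_ofReal]
    push_cast
    ring
  · simp

theorem sum_antidiagonal_weightedState {s : ℝ} (hs : 1 < s) (b c p : ℂ) (l : ℕ) :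
    ∑ q ∈ antidiagonal (l + 1), weightedState s b c p q.1 * weightedState s b c p q.2 =
      2 * b * weightedState s b c p (l + 1) +
        fussCatalan s (l + 1) * (c ^ 2 * (l * p ^ (l - 1) / ((s - 1) / 2 * (l + 1) + 1))) := by
  rcases l with _ | l
  · simp [Finset.Nat.sum_antidiagonal_succ, weightedState]
    ring
  · rw [sum_antidiagonal_add_two]
    have h := sum_fussCatalan_mul_fussCatalan hs l
    have e : ∑ q ∈ antidiagonal l, weightedState s b c p (q.1 + 1) * weightedState s b c p (q.2 + 1)
        = ((∑ q ∈ antidiagonal l, fussCatalan s (q.1 + 1) * fussCatalan s (q.2 + 1) : ℝ) : ℂ) *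
          (c ^ 2 * p ^ l) := by
      rw [Complex.ofReal_sum, Finset.sum_mul]
      refine Finset.sum_congr rfl fun q hq => ?_
      rw [← Finset.HasAntidiagonal.mem_antidiagonal.1 hq]
      simp only [weightedState]
      push_cast
      ring
    have h2 := half_mul_add_one_pos hs (l + 2)
    push_cast at h2
    have h2' : ((s : ℂ) - 1) / 2 * (l + 2) + 1 ≠ 0 := by exact_mod_cast h2.ne'
    have h' : (((s : ℂ) - 1) / 2 * (l + 2) + 1) *
        ((∑ q ∈ antidiagonal l, fussCatalan s (q.1 + 1) * fussCatalan s (q.2 + 1) : ℝ) : ℂ) =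
          (l + 1) * fussCatalan s (l + 2) := by exact_mod_cast h
    rw [e]
    simp only [weightedState, Nat.add_sub_cancel]
    rw [Nat.cast_succ, show (l : ℂ) + 1 + 1 = l + 2 by ring, show l + 1 + 1 = l + 2 by ring]
    generalize ((s : ℂ) - 1) / 2 * (l + 2) + 1 = D at h2' h' ⊢
    generalize ((∑ q ∈ antidiagonal l, fussCatalan s (q.1 + 1) * fussCatalan s (q.2 + 1) : ℝ) : ℂ)
      = σ at h' ⊢
    field_simp
    linear_combination c ^ 2 * p ^ l * h'

theorem sum_antidiagonal_ite_weightedState {s : ℝ} (b c p : ℂ) (n m : ℕ) :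
    (∑ q ∈ antidiagonal (n + 1 + (m + 1)), if (n + 1) * (m + 1) * q.1 * q.2 = 0 then
        weightedState s b c p q.1 * weightedState s b c p q.2 else 0) =
      2 * b * weightedState s b c p (n + 1 + (m + 1)) := by
  rw [show n + 1 + (m + 1) = (n + m) + 2 by ring, sum_antidiagonal_add_two,
    Finset.sum_eq_zero (fun q _ => by simp)]
  simp [weightedState]
  ring

/-- `∑ A_{n+1} x^n = F / x`, written so as to include `x = 0`. -/
theorem hasSum_fussCatalan_succ {s : ℝ} (hs : 1 < s) {x : ℝ} (hx0 : 0 ≤ x) (hx : x ≤ xCrit s) :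
    HasSum (fun n : ℕ => fussCatalan s (n + 1) * x ^ n) ((1 + genF s x) ^ s) := by
  have hF := genF_nonneg (s := s) hx0
  have h1 := (hasSum_mul_gSeq_sq hs hx0 hx).mul_left ((s - 1) / 2)
  refine hasSum_of_eq (h1.add (hasSum_gSeq_sq hs hx0 hx)) (fun n => ?_) ?_
  · have h := gSeq_sq hs (n + 1)
    rw [eq_div_iff (half_mul_add_one_pos hs _).ne'] at h
    rw [← h]
    push_cast
    ring
  · rw [Real.rpow_add_one (by positivity)]
    field_simp
    ring

/-- `∑ n g_{n+1} ^ 2 x^{n-1} = (F / x) ^ 2`, written so as to include `x = 0`. -/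
theorem hasSum_succ_mul_gSeq_sq {s : ℝ} (hs : 1 < s) {x : ℝ} (hx0 : 0 ≤ x) (hx : x ≤ xCrit s) :
    HasSum (fun n : ℕ => (n + 1) * gSeq s (n + 2) ^ 2 * x ^ n) (((1 + genF s x) ^ s) ^ 2) := by
  have h1 := hasSum_fussCatalan_succ hs hx0 hx
  have h4 := tsum_mul_tsum_eq_tsum_sum_antidiagonal_of_summable_norm h1.summable.norm
    h1.summable.norm
  have h5 := summable_norm_sum_mul_antidiagonal_of_summable_norm h1.summable.norm h1.summable.norm
  rw [h1.tsum_eq] at h4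
  refine hasSum_of_eq h5.of_norm.hasSum (fun n => ?_) (by rw [← h4, sq])
  have h := sum_fussCatalan_mul_fussCatalan hs n
  have h2 := half_mul_add_one_pos hs (n + 2)
  rw [gSeq_sq hs]
  have e : ∑ q ∈ antidiagonal n, fussCatalan s (q.1 + 1) * x ^ q.1 *
      (fussCatalan s (q.2 + 1) * x ^ q.2) =
      (∑ q ∈ antidiagonal n, fussCatalan s (q.1 + 1) * fussCatalan s (q.2 + 1)) * x ^ n := by
    rw [Finset.sum_mul]
    refine Finset.sum_congr rfl fun q hq => ?_
    rw [← Finset.HasAntidiagonal.mem_antidiagonal.1 hq, pow_add]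
    ring
  rw [e]
  push_cast at h2 ⊢
  generalize (s - 1) / 2 * (n + 2) + 1 = D at h h2 ⊢
  field_simp
  linear_combination -x ^ n * h

theorem conj_mul_self (z : ℂ) : (starRingEnd ℂ) z * z = ((‖z‖ ^ 2 : ℝ) : ℂ) := by
  rw [Complex.conj_mul']
  push_cast
  rfl

/-- The right side of the equation for the mode `0`. -/
noncomputable def fieldB (s : ℝ) (b c p : ℂ) : ℂ :=
  (‖b‖ ^ 2 : ℝ) * b + 2 * (‖c‖ ^ 2 : ℝ) * ((1 + bigF s p) ^ s : ℝ) * b +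
    (‖c‖ ^ 2 : ℝ) * ((1 + bigF s p) ^ s : ℝ) ^ 2 * c * (starRingEnd ℂ) p

/-- The right side of the equation for `c`. -/
noncomputable def fieldC (s : ℝ) (b c p : ℂ) : ℂ :=
  (s + 1) * ((‖b‖ ^ 2 : ℝ) * c + (‖c‖ ^ 2 : ℝ) * ((1 + bigF s p) ^ s : ℝ) * b * p)

/-- The right side of the equation for `p`. -/
noncomputable def fieldP (s : ℝ) (b c p : ℂ) : ℂ :=
  (s - 1) * ((‖b‖ ^ 2 : ℝ) * p + ((1 + bigF s p) ^ s : ℝ) * b * (starRingEnd ℂ) c * p ^ 2) +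
    (starRingEnd ℂ) b * c

theorem hasSum_resonantSum_zero {s : ℝ} (hs : 1 < s) (b c p : ℂ) (hp : ‖p‖ ^ 2 ≤ xCrit s) :
    HasSum (fun m => resonantSum s (manifoldState s b c p) 0 m) (fieldB s b c p) := by
  have hx0 : 0 ≤ ‖p‖ ^ 2 := by positivity
  have h1 := Complex.hasSum_ofReal.2 (hasSum_fussCatalan_succ hs hx0 hp)
  have h2 := Complex.hasSum_ofReal.2 (hasSum_succ_mul_gSeq_sq hs hx0 hp)
  have h2' : HasSum (fun l : ℕ => (((l * gSeq s (l + 1) ^ 2 : ℝ) : ℂ) *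
      ((starRingEnd ℂ) p ^ l * p ^ (l - 1))))
      ((starRingEnd ℂ) p * (((1 + bigF s p) ^ s) ^ 2 : ℝ)) := by
    rw [← hasSum_nat_add_iff' 1]
    refine hasSum_of_eq (h2.mul_left ((starRingEnd ℂ) p)) (fun n => ?_) (by simp [bigF])
    push_cast
    rw [← Complex.conj_mul', mul_pow, pow_succ]
    ring
  rw [← hasSum_nat_add_iff' 1]
  refine hasSum_of_eq ((h1.mul_left (2 * (‖c‖ ^ 2 : ℝ) * b)).add
    (h2'.mul_left ((‖c‖ ^ 2 : ℝ) * c))) (fun l => ?_) ?_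
  · rw [resonantSum_manifoldState hs]
    simp only [zero_add, zero_mul, if_true]
    rw [sum_antidiagonal_weightedState hs, modeWeight_zero, gSeq_sq hs, ← conj_mul_self]
    have hA : (fussCatalan s (l + 1) : ℂ) ≠ 0 := by exact_mod_cast (fussCatalan_pos hs (l + 1)).ne'
    have h2' : ((s : ℂ) - 1) / 2 * (l + 1) + 1 ≠ 0 := by
      exact_mod_cast (half_mul_add_one_pos hs (l + 1)).ne'
    simp only [weightedState, map_mul, map_pow, Complex.conj_ofReal]
    push_cast
    rw [← Complex.conj_mul' p, mul_pow]
    generalize ((s : ℂ) - 1) / 2 * (l + 1) + 1 = D at h2' ⊢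
    field_simp
  · simp only [Finset.range_one, Finset.sum_singleton]
    rw [resonantSum_manifoldState hs]
    simp [weightedState, modeWeight_zero, fussCatalan_zero, fieldB, bigF]
    rw [← Complex.conj_mul' b]
    ring

theorem hasSum_resonantSum_succ {s : ℝ} (hs : 1 < s) (b c p : ℂ) (hp : ‖p‖ ^ 2 ≤ xCrit s) (n : ℕ) :
    HasSum (fun m => resonantSum s (manifoldState s b c p) (n + 1) m)
      (gSeq s (n + 1) * (fieldC s b c p * p ^ n + c * (n * p ^ (n - 1) * fieldP s b c p))) := by
  have hx0 : 0 ≤ ‖p‖ ^ 2 := by positivity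
  have h1 := Complex.hasSum_ofReal.2 (hasSum_fussCatalan_succ hs hx0 hp)
  rw [← hasSum_nat_add_iff' 1]
  refine hasSum_of_eq (h1.mul_left (2 * modeWeight s (n + 1) * b * (‖c‖ ^ 2 : ℝ) * p ^ (n + 1)))
    (fun l => ?_) ?_
  · rw [resonantSum_manifoldState hs, sum_antidiagonal_ite_weightedState]
    have hA : (fussCatalan s (n + 1 + (l + 1)) : ℂ) ≠ 0 := by
      exact_mod_cast (fussCatalan_pos hs _).ne'
    rw [show n + 1 + (l + 1) = (n + 1 + l) + 1 by ring] at hA ⊢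
    simp only [weightedState, map_mul, map_pow, Complex.conj_ofReal]
    push_cast
    rw [← Complex.conj_mul' p, ← Complex.conj_mul' c]
    field_simp
    ring
  · simp only [Finset.range_one, Finset.sum_singleton]
    rw [resonantSum_manifoldState hs]
    simp only [add_zero, mul_zero, zero_mul, if_true]
    rw [sum_antidiagonal_weightedState hs, modeWeight_eq hs, fieldC, fieldP, ← conj_mul_self,
      ← conj_mul_self]
    have hA : (fussCatalan s (n + 1) : ℂ) ≠ 0 := by exact_mod_cast (fussCatalan_pos hs (n + 1)).ne'
    have h2' : ((s : ℂ) - 1) / 2 * (n + 1) + 1 ≠ 0 := by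
      exact_mod_cast (half_mul_add_one_pos hs (n + 1)).ne'
    have hp' : (n : ℂ) * p ^ (n - 1) * p = n * p ^ n := by
      rcases n with _ | n
      · simp
      · rw [Nat.add_sub_cancel, pow_succ]
        ring
    simp only [weightedState, bigF]
    push_cast
    generalize (((1 + genF s (‖p‖ ^ 2)) ^ s : ℝ) : ℂ) = G
    generalize (starRingEnd ℂ) b = b'
    generalize (starRingEnd ℂ) c = c'
    have hD : ((s : ℂ) - 1) / 2 * (n + 1) + 1 = ((s - 1) * (n + 1) + 2) / 2 := by ring
    rw [hD] at h2' ⊢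
    have h2'' : ((s : ℂ) - 1) * (n + 1) + 2 ≠ 0 := fun h => h2' (by rw [h]; simp)
    generalize hD' : ((s : ℂ) - 1) * (n + 1) + 2 = D at h2'' ⊢
    field_simp
    linear_combination (gSeq s (n + 1) * c * (s - 1) * b * (b' + c' * G * p)) * hp' +
      gSeq s (n + 1) * c * b * (b' + c' * G * p) * p ^ n * hD'


/-! ### Particle number, energy, Hamiltonian and Sobolev sums on the manifold -/

theorem norm_manifoldState_succ_sq (s : ℝ) (b c p : ℂ) (n : ℕ) :
    ‖manifoldState s b c p (n + 1)‖ ^ 2 = ‖c‖ ^ 2 * (gSeq s (n + 1) ^ 2 * (‖p‖ ^ 2) ^ n) := by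
  simp only [manifoldState, norm_mul, norm_pow, Complex.norm_real, Real.norm_eq_abs]
  rw [mul_pow, mul_pow, sq_abs]
  ring

theorem hasSum_cons {M : Type*} [AddCommGroup M] [TopologicalSpace M] [IsTopologicalAddGroup M]
    {f : ℕ → M} {a : M} (h : HasSum (fun n => f (n + 1)) a) : HasSum f (f 0 + a) := by
  rw [← hasSum_nat_add_iff' 1]
  simpa using h

/-- The particle number of a point of the manifold. -/
noncomputable def manifoldNumber (s : ℝ) (b c p : ℂ) : ℝ :=
  ‖b‖ ^ 2 + ‖c‖ ^ 2 * ((1 + bigF s p) ^ s * (2 - (s - 1) * bigF s p) / (s + 1))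

/-- The energy of a point of the manifold. -/
noncomputable def manifoldEnergy (s : ℝ) (c p : ℂ) : ℝ :=
  ‖c‖ ^ 2 * (2 * (1 + bigF s p) ^ (s + 1) / (s + 1))

theorem bigF_nonneg (s : ℝ) (p : ℂ) : 0 ≤ bigF s p := genF_nonneg (by positivity)

theorem bigF_lt {s : ℝ} (hs : 1 < s) {p : ℂ} (hp : ‖p‖ ^ 2 < xCrit s) : bigF s p < FCrit s :=
  genF_lt_FCrit hs (by positivity) hp

theorem hasSum_number {s : ℝ} (hs : 1 < s) (b c p : ℂ) (hp : ‖p‖ ^ 2 ≤ xCrit s) :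
    HasSum (fun n : ℕ => ‖manifoldState s b c p n‖ ^ 2) (manifoldNumber s b c p) :=
  hasSum_cons <| hasSum_of_eq ((hasSum_gSeq_sq hs (by positivity) hp).mul_left (‖c‖ ^ 2))
    (fun n => norm_manifoldState_succ_sq s b c p n) rfl

theorem hasSum_energy {s : ℝ} (hs : 1 < s) (b c p : ℂ) (hp : ‖p‖ ^ 2 ≤ xCrit s) :
    HasSum (fun n : ℕ => (n : ℝ) * ‖manifoldState s b c p n‖ ^ 2) (manifoldEnergy s c p) := by
  have := hasSum_cons (f := fun n : ℕ => (n : ℝ) * ‖manifoldState s b c p n‖ ^ 2) <|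
    hasSum_of_eq ((hasSum_mul_gSeq_sq hs (by positivity) hp).mul_left (‖c‖ ^ 2))
    (fun n => by rw [norm_manifoldState_succ_sq]; push_cast; ring) rfl
  simpa [manifoldEnergy, bigF] using this

theorem sobolevTerm_succ (s ξ : ℝ) (b c p : ℂ) (n : ℕ) :
    sobolevTerm ξ (manifoldState s b c p) (n + 1) =
      ‖c‖ ^ 2 * (((n : ℝ) + 2) ^ (2 * ξ) * (gSeq s (n + 1) ^ 2 * (‖p‖ ^ 2) ^ n)) := by
  rw [sobolevTerm, norm_manifoldState_succ_sq]
  push_cast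
  rw [show (n : ℝ) + 1 + 1 = n + 2 by ring]
  ring

theorem gSeq_sq_le {s : ℝ} (hs : 1 < s) (n : ℕ) : gSeq s n ^ 2 ≤ fussCatalan s n := by
  have : 0 ≤ (s - 1) / 2 * n := mul_nonneg (by linarith) n.cast_nonneg
  rw [gSeq_sq hs]
  exact div_le_self (fussCatalan_pos hs n).le (by linarith)

theorem summable_sobolev_gSeq {s : ℝ} (hs : 1 < s) (ξ : ℝ) {x : ℝ} (hx0 : 0 ≤ x)
    (hx : x < xCrit s) :
    Summable fun n : ℕ => ((n : ℝ) + 2) ^ (2 * ξ) * (gSeq s (n + 1) ^ 2 * x ^ n) := by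
  obtain ⟨y, hy1, hy2⟩ := exists_between hx
  have hy0 : 0 < y := hx0.trans_lt hy1
  have h := ((summable_nat_add_iff 1).2
    (summable_rpow_mul_fussCatalan hs hy0.le hy2 (2 * ξ))).mul_left y⁻¹
  refine h.of_nonneg_of_le (fun n => by positivity) fun n => ?_
  have e : y⁻¹ * ((((n + 1 : ℕ) : ℝ) + 1) ^ (2 * ξ) * (fussCatalan s (n + 1) * y ^ (n + 1))) =
      ((n : ℝ) + 2) ^ (2 * ξ) * (fussCatalan s (n + 1) * y ^ n) := by
    push_cast
    rw [show (n : ℝ) + 1 + 1 = n + 2 by ring, pow_succ]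
    field_simp
  rw [e]
  have := gSeq_sq_le hs (n + 1)
  have := (fussCatalan_pos hs (n + 1)).le
  gcongr

theorem summable_sobolevTerm {s : ℝ} (hs : 1 < s) (ξ : ℝ) (b c p : ℂ) (hp : ‖p‖ ^ 2 < xCrit s) :
    Summable (sobolevTerm ξ (manifoldState s b c p)) := by
  rw [← summable_nat_add_iff 1]
  simp only [sobolevTerm_succ]
  exact (summable_sobolev_gSeq hs ξ (by positivity) hp).mul_left _

theorem sobolev_manifoldState {s : ℝ} (hs : 1 < s) (ξ : ℝ) (b c p : ℂ) (hp : ‖p‖ ^ 2 < xCrit s) :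
    sobolev ξ (manifoldState s b c p) = ‖b‖ ^ 2 + ‖c‖ ^ 2 *
      ∑' n : ℕ, ((n : ℝ) + 2) ^ (2 * ξ) * (gSeq s (n + 1) ^ 2 * (‖p‖ ^ 2) ^ n) := by
  rw [sobolev, (summable_sobolevTerm hs ξ b c p hp).tsum_eq_zero_add]
  simp only [sobolevTerm_succ, tsum_mul_left]
  simp [sobolevTerm, manifoldState]

theorem sobolev_manifoldState_le {s : ℝ} (hs : 1 < s) (ξ : ℝ) {b c p : ℂ} {B C x : ℝ}
    (hb : ‖b‖ ^ 2 ≤ B) (hc : ‖c‖ ^ 2 ≤ C) (hp : ‖p‖ ^ 2 ≤ x) (hx : x < xCrit s) :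
    sobolev ξ (manifoldState s b c p) ≤
      B + C * ∑' n : ℕ, ((n : ℝ) + 2) ^ (2 * ξ) * (gSeq s (n + 1) ^ 2 * x ^ n) := by
  rw [sobolev_manifoldState hs ξ b c p (hp.trans_lt hx)]
  have hx0 : 0 ≤ x := (by positivity : 0 ≤ ‖p‖ ^ 2).trans hp
  have h := (summable_sobolev_gSeq hs ξ (by positivity) (hp.trans_lt hx)).tsum_le_tsum
    (fun n => by gcongr) (summable_sobolev_gSeq hs ξ hx0 hx)
  have h0 : 0 ≤ ∑' n : ℕ, ((n : ℝ) + 2) ^ (2 * ξ) * (gSeq s (n + 1) ^ 2 * (‖p‖ ^ 2) ^ n) :=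
    tsum_nonneg fun n => by positivity
  have hC : 0 ≤ C := (by positivity : 0 ≤ ‖c‖ ^ 2).trans hc
  gcongr

theorem exists_quadDecay_manifoldState {s : ℝ} (hs : 1 < s) (b c p : ℂ) (hp : ‖p‖ ^ 2 < xCrit s) :
    ∃ R, QuadDecay R (manifoldState s b c p) := by
  have h := summable_sobolevTerm hs 2 b c p hp
  have e : ∀ n : ℕ, ((n : ℝ) + 1) ^ 4 * ‖manifoldState s b c p n‖ ^ 2 =
      sobolevTerm 2 (manifoldState s b c p) n := fun n => by
    rw [sobolevTerm, ← Real.rpow_natCast]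
    norm_num
  have hb : SobolevTwoBound _ (manifoldState s b c p) := ⟨by simpa only [e] using h, le_rfl⟩
  exact ⟨_, hb.quadDecay⟩

/-- The value of the Hamiltonian of a point of the manifold. -/
noncomputable def manifoldHamiltonian (s : ℝ) (b c p : ℂ) : ℝ :=
  1 / 2 * ((‖b‖ ^ 2) ^ 2 + 4 * ‖b‖ ^ 2 * ‖c‖ ^ 2 * (1 + bigF s p) ^ s +
    4 * ‖c‖ ^ 2 * ((1 + bigF s p) ^ s) ^ 2 * ((starRingEnd ℂ) b * c * (starRingEnd ℂ) p).re)

theorem hasSum_conj_mul_resonantSum {s : ℝ} (hs : 1 < s) (b c p : ℂ) (hp : ‖p‖ ^ 2 < xCrit s) :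
    HasSum (fun n => (starRingEnd ℂ) (manifoldState s b c p n) *
      ∑' m, resonantSum s (manifoldState s b c p) n m)
      ((2 * manifoldHamiltonian s b c p : ℝ) : ℂ) := by
  have hx0 : 0 ≤ ‖p‖ ^ 2 := by positivity
  have h1 := Complex.hasSum_ofReal.2 (hasSum_fussCatalan_succ hs hx0 hp.le)
  have h2 := Complex.hasSum_ofReal.2 (hasSum_succ_mul_gSeq_sq hs hx0 hp.le)
  have h3 : HasSum (fun l : ℕ => (((l * gSeq s (l + 1) ^ 2 : ℝ) : ℂ) *
      ((starRingEnd ℂ) p ^ l * p ^ (l - 1))))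
      ((starRingEnd ℂ) p * (((1 + bigF s p) ^ s) ^ 2 : ℝ)) := by
    rw [← hasSum_nat_add_iff' 1]
    refine hasSum_of_eq (h2.mul_left ((starRingEnd ℂ) p)) (fun n => ?_) (by simp [bigF])
    push_cast
    rw [← Complex.conj_mul', mul_pow, pow_succ]
    ring
  have h4 := hasSum_cons (f := fun n => (starRingEnd ℂ) (manifoldState s b c p n) *
      ∑' m, resonantSum s (manifoldState s b c p) n m) (hasSum_of_eq
    ((h1.mul_left (2 * (starRingEnd ℂ) c * ((starRingEnd ℂ) b * b * c + (starRingEnd ℂ) c * c *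
      ((1 + bigF s p) ^ s : ℝ) * b * p))).add
      (h3.mul_left ((starRingEnd ℂ) c * c * ((starRingEnd ℂ) b * c)))) (fun n => ?_) rfl)
  · refine hasSum_of_eq h4 (fun _ => rfl) ?_
    rw [(hasSum_resonantSum_zero hs b c p hp.le).tsum_eq]
    have hre : (((starRingEnd ℂ) b * c * (starRingEnd ℂ) p).re : ℂ) =
        ((starRingEnd ℂ) b * c * (starRingEnd ℂ) p + b * (starRingEnd ℂ) c * p) / 2 := by
      rw [Complex.re_eq_add_conj]
      simp
    simp only [manifoldHamiltonian, fieldB, manifoldState, Complex.ofReal_mul, Complex.ofReal_add,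
      Complex.ofReal_div, Complex.ofReal_ofNat, Complex.ofReal_one, hre, bigF,
      Complex.ofReal_pow]
    generalize ((1 + genF s (‖p‖ ^ 2)) ^ s : ℝ) = G
    rw [← Complex.conj_mul', ← Complex.conj_mul']
    ring
  · rw [(hasSum_resonantSum_succ hs b c p hp.le n).tsum_eq, fieldC, fieldP, ← conj_mul_self,
      ← conj_mul_self]
    have h := gSeq_sq hs (n + 1)
    rw [eq_div_iff (half_mul_add_one_pos hs _).ne'] at h
    have h' : (gSeq s (n + 1) : ℂ) ^ 2 * ((s - 1) / 2 * (n + 1) + 1) = fussCatalan s (n + 1) := by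
      exact_mod_cast h
    have hp' : (n : ℂ) * p ^ (n - 1) * p = n * p ^ n := by
      rcases n with _ | n
      · simp
      · rw [Nat.add_sub_cancel, pow_succ]
        ring
    simp only [manifoldState, map_mul, map_pow, Complex.conj_ofReal]
    push_cast
    rw [← h', ← Complex.conj_mul' p, mul_pow]
    generalize (((1 + bigF s p) ^ s : ℝ) : ℂ) = G
    generalize (starRingEnd ℂ) b = b'
    generalize (starRingEnd ℂ) c = c'
    generalize (starRingEnd ℂ) p = p'
    linear_combination (gSeq s (n + 1) ^ 2 * c' * p' ^ n * c * (s - 1) * b * (b' + c' * G * p)) *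
      hp'

/-- The Hamiltonian of a point of the manifold is the pairing of the state with the right side of
the system; absolute convergence allows the sum over quadruples to be taken mode by mode. -/
theorem hasSum_hamiltonianTerm {s : ℝ} (hs : 1 < s) (b c p : ℂ) (hp : ‖p‖ ^ 2 < xCrit s) :
    HasSum (hamiltonianTerm s (manifoldState s b c p))
      ((manifoldHamiltonian s b c p : ℝ) : ℂ) := by
  obtain ⟨R, hR⟩ := exists_quadDecay_manifoldState hs b c p hp
  have h1 := (summable_quarticTerm hs hR.conj hR.conj hR hR).hasSum
  have h2 := h1.prod_fiberwise fun q => (hasSum_of_eq (hasSum_resonantSum s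
    ((starRingEnd ℂ) (manifoldState s b c p q.1)) (manifoldState s b c p) q.1 q.2)
    (fun q => by rw [quarticTerm]) rfl)
  have h3 := (hasSum_mul_tsum_resonantSum hs hR.conj hR).unique
    (hasSum_conj_mul_resonantSum hs b c p hp)
  rw [h3] at h2
  refine hasSum_of_eq (h2.mul_left (1 / 2)) (fun q => rfl) ?_
  push_cast
  ring

/-! ### The flow on the manifold -/

/-- The parameters `b, c, p` move on `I` along the vector field to which the system restricts on the
manifold. -/
structure IsManifoldFlowOn (s : ℝ) (I : Set ℝ) (b c p : ℝ → ℂ) : Prop where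
  p_lt : ∀ t ∈ I, ‖p t‖ ^ 2 < xCrit s
  deriv_b : ∀ t ∈ I, HasDerivWithinAt b (-Complex.I * fieldB s (b t) (c t) (p t)) I t
  deriv_c : ∀ t ∈ I, HasDerivWithinAt c (-Complex.I * fieldC s (b t) (c t) (p t)) I t
  deriv_p : ∀ t ∈ I, HasDerivWithinAt p (-Complex.I * fieldP s (b t) (c t) (p t)) I t

theorem IsManifoldFlowOn.isSolutionOn {s : ℝ} (hs : 1 < s) {I : Set ℝ} {b c p : ℝ → ℂ}
    (h : IsManifoldFlowOn s I b c p) :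
    IsSolutionOn s (fun t => manifoldState s (b t) (c t) (p t)) I := by
  intro t ht n
  rcases n with _ | n
  · have h1 := hasSum_resonantSum_zero hs (b t) (c t) (p t) (h.p_lt t ht).le
    exact ⟨h1.summable, by rw [h1.tsum_eq]; exact h.deriv_b t ht⟩
  · have h1 := hasSum_resonantSum_succ hs (b t) (c t) (p t) (h.p_lt t ht).le n
    refine ⟨h1.summable, ?_⟩
    rw [h1.tsum_eq]
    have h2 := ((h.deriv_c t ht).mul ((h.deriv_p t ht).pow n)).const_mul (gSeq s (n + 1) : ℂ)
    refine (h2.congr_deriv ?_).congr_of_eventuallyEq (Eventually.of_forall fun τ => ?_) ?_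
    · simp only [Pi.pow_apply]
      ring
    · simp [manifoldState, mul_assoc]
    · simp [manifoldState, mul_assoc]

theorem IsManifoldFlowOn.isStrongSolutionOn {s : ℝ} (hs : 1 < s) {I : Set ℝ} {b c p : ℝ → ℂ}
    (h : IsManifoldFlowOn s I b c p) :
    IsStrongSolutionOn s (fun t => manifoldState s (b t) (c t) (p t)) I := by
  refine ⟨h.isSolutionOn hs, 3, by norm_num, fun K hK hc => ?_⟩
  rcases K.eq_empty_or_nonempty with rfl | hne
  · exact ⟨0, by simp⟩
  have cb : ContinuousOn (fun t => ‖b t‖ ^ 2) K :=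
    (fun t ht => ((h.deriv_b t (hK ht)).continuousWithinAt.mono hK).norm.pow 2)
  have cc : ContinuousOn (fun t => ‖c t‖ ^ 2) K :=
    (fun t ht => ((h.deriv_c t (hK ht)).continuousWithinAt.mono hK).norm.pow 2)
  have cp : ContinuousOn (fun t => ‖p t‖ ^ 2) K :=
    (fun t ht => ((h.deriv_p t (hK ht)).continuousWithinAt.mono hK).norm.pow 2)
  obtain ⟨t1, _, h1⟩ := hc.exists_isMaxOn hne cb
  obtain ⟨t2, _, h2⟩ := hc.exists_isMaxOn hne cc
  obtain ⟨t3, ht3, h3⟩ := hc.exists_isMaxOn hne cp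
  exact ⟨_, fun t ht => ⟨summable_sobolevTerm hs 3 _ _ _ (h.p_lt t (hK ht)),
    sobolev_manifoldState_le hs 3 (h1 ht) (h2 ht) (h3 ht) (h.p_lt t3 (hK ht3))⟩⟩

theorem one_div_FCrit (s F : ℝ) : F / FCrit s = (s - 1) * F := by
  rw [FCrit, div_div_eq_mul_div, div_one, mul_comm]

theorem fieldP_eq {s : ℝ} (hs : 1 < s) (b c p : ℂ) :
    p * ((2 * (bigF s p + 1) * manifoldNumber s b c p + (bigF s p / FCrit s - 2) *
        manifoldEnergy s c p) / (2 * (bigF s p + 1) * FCrit s) : ℝ) +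
      b * (starRingEnd ℂ) c * p ^ 2 * ((bigF s p + 1) ^ s / FCrit s : ℝ) +
      (starRingEnd ℂ) b * c = fieldP s b c p := by
  have hF := bigF_nonneg s p
  have e1 : (2 * (bigF s p + 1) * manifoldNumber s b c p + (bigF s p / FCrit s - 2) *
        manifoldEnergy s c p) / (2 * (bigF s p + 1) * FCrit s) = (s - 1) * ‖b‖ ^ 2 := by
    rw [one_div_FCrit, ← div_div, one_div_FCrit, manifoldNumber, manifoldEnergy, add_comm (bigF s p) (1 : ℝ),
      Real.rpow_add_one (by positivity)]
    have : s + 1 ≠ 0 := by linarith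
    field_simp
    ring
  rw [e1, one_div_FCrit, fieldP, add_comm (bigF s p) (1 : ℝ)]
  push_cast
  ring

theorem fieldB_eq {s : ℝ} (hs : 1 < s) (b c p : ℂ) :
    b * (manifoldNumber s b c p + manifoldEnergy s c p / (2 * (bigF s p + 1)) *
        (2 * s + bigF s p / FCrit s) : ℝ) +
      c * (starRingEnd ℂ) p *
        ((bigF s p + 1) ^ s * (s + 1) / (2 * (bigF s p + 1)) * manifoldEnergy s c p : ℝ) =
      fieldB s b c p := by
  have hF := bigF_nonneg s p
  have h1 : s + 1 ≠ 0 := by linarith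
  have e1 : manifoldNumber s b c p + manifoldEnergy s c p / (2 * (bigF s p + 1)) *
        (2 * s + bigF s p / FCrit s) = ‖b‖ ^ 2 + 2 * ‖c‖ ^ 2 * (1 + bigF s p) ^ s := by
    rw [one_div_FCrit, manifoldNumber, manifoldEnergy, add_comm (bigF s p) (1 : ℝ),
      Real.rpow_add_one (by positivity)]
    field_simp
    ring
  have e2 : (bigF s p + 1) ^ s * (s + 1) / (2 * (bigF s p + 1)) * manifoldEnergy s c p =
      ‖c‖ ^ 2 * ((1 + bigF s p) ^ s) ^ 2 := by
    rw [manifoldEnergy, add_comm (bigF s p) (1 : ℝ), Real.rpow_add_one (by positivity)]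
    field_simp
  rw [e1, e2, fieldB]
  push_cast
  ring

theorem fieldC_eq {s : ℝ} (hs : 1 < s) (b c p : ℂ) :
    c * ((s + 1) * manifoldNumber s b c p +
        (s + 1) / (2 * (bigF s p + 1)) * (bigF s p / FCrit s - 2) * manifoldEnergy s c p : ℝ) +
      b * p * ((s + 1) ^ 2 / (2 * (bigF s p + 1)) * manifoldEnergy s c p : ℝ) =
      fieldC s b c p := by
  have hF := bigF_nonneg s p
  have h1 : s + 1 ≠ 0 := by linarith
  have e1 : (s + 1) * manifoldNumber s b c p +
        (s + 1) / (2 * (bigF s p + 1)) * (bigF s p / FCrit s - 2) * manifoldEnergy s c p =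
      (s + 1) * ‖b‖ ^ 2 := by
    rw [one_div_FCrit, manifoldNumber, manifoldEnergy, add_comm (bigF s p) (1 : ℝ),
      Real.rpow_add_one (by positivity)]
    field_simp
    ring
  have e2 : (s + 1) ^ 2 / (2 * (bigF s p + 1)) * manifoldEnergy s c p =
      (s + 1) * (‖c‖ ^ 2 * (1 + bigF s p) ^ s) := by
    rw [manifoldEnergy, add_comm (bigF s p) (1 : ℝ), Real.rpow_add_one (by positivity)]
    field_simp
  rw [e1, e2, fieldC]
  push_cast
  ring

/-- Given the values of the particle number and the energy, the reduced equations are the flow on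
the manifold. -/
theorem reducedEquations_iff {s : ℝ} (hs : 1 < s) {I : Set ℝ} {N E : ℝ} {b c p : ℝ → ℂ}
    (hp : ∀ t ∈ I, ‖p t‖ ^ 2 < xCrit s) (hN : ∀ t ∈ I, manifoldNumber s (b t) (c t) (p t) = N)
    (hE : ∀ t ∈ I, manifoldEnergy s (c t) (p t) = E) :
    ReducedEquations s N E I b c p ↔ IsManifoldFlowOn s I b c p := by
  refine ⟨fun h => ⟨hp, fun t ht => ?_, fun t ht => ?_, fun t ht => ?_⟩,
    fun h => ⟨fun t ht => ?_, fun t ht => ?_, fun t ht => ?_⟩⟩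
  · rw [← fieldB_eq hs, hN t ht, hE t ht]
    exact h.deriv_b t ht
  · rw [← fieldC_eq hs, hN t ht, hE t ht]
    exact h.deriv_c t ht
  · rw [← fieldP_eq hs, hN t ht, hE t ht]
    exact h.deriv_p t ht
  · have := h.deriv_p t ht
    rwa [← fieldP_eq hs, hN t ht, hE t ht] at this
  · have := h.deriv_b t ht
    rwa [← fieldB_eq hs, hN t ht, hE t ht] at this
  · have := h.deriv_c t ht
    rwa [← fieldC_eq hs, hN t ht, hE t ht] at this

/-- Curves that solve the reduced equations, with the actual particle number and energy as
parameters, give strong solutions of the full system. -/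
theorem isStrongSolutionOn_of_reducedEquations {s : ℝ} (hs : 1 < s) (I : Set ℝ) (N E : ℝ)
    (b c p : ℝ → ℂ)
    (h : ∀ t ∈ I, ‖p t‖ ^ 2 < xCrit s ∧ particleNumber (manifoldState s (b t) (c t) (p t)) = N ∧
      energy (manifoldState s (b t) (c t) (p t)) = E)
    (hr : ReducedEquations s N E I b c p) :
    IsStrongSolutionOn s (fun t => manifoldState s (b t) (c t) (p t)) I := by
  refine ((reducedEquations_iff hs (fun t ht => (h t ht).1) (fun t ht => ?_)
    (fun t ht => ?_)).1 hr).isStrongSolutionOn hs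
  · exact (hasSum_number hs _ _ _ (h t ht).1.le).tsum_eq.symm.trans (h t ht).2.1
  · exact (hasSum_energy hs _ _ _ (h t ht).1.le).tsum_eq.symm.trans (h t ht).2.2


/-! ### Global flows of vector fields with a cutoff -/

open scoped NNReal in
theorem exists_integralCurve_Icc {V : Type*} [NormedAddCommGroup V] [NormedSpace ℝ V]
    [CompleteSpace V] {v : V → V} {K L : ℝ≥0} (hK : LipschitzWith K v) (hL : ∀ x, ‖v x‖ ≤ L)
    (t₀ : ℝ) (x₀ : V) {r : ℝ} (hr : 0 < r) :
    ∃ γ : ℝ → V, γ t₀ = x₀ ∧ ∀ t ∈ Set.Ioo (t₀ - r) (t₀ + r), HasDerivAt γ (v (γ t)) t := by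
  have ht : t₀ ∈ Set.Icc (t₀ - r) (t₀ + r) := ⟨by linarith, by linarith⟩
  have hPL : IsPicardLindelof (fun _ => v) ⟨t₀, ht⟩ x₀ (L * ⟨r, hr.le⟩) 0 L K :=
    { lipschitzOnWith := fun t _ => hK.lipschitzOnWith
      continuousOn := fun x _ => continuousOn_const
      norm_le := fun t _ x _ => hL x
      mul_max_le := le_of_eq (by simp; rfl) }
  obtain ⟨γ, h0, h⟩ := hPL.exists_eq_forall_mem_Icc_hasDerivWithinAt₀
  exact ⟨γ, h0, fun t ht => (h t (Set.Ioo_subset_Icc_self ht)).hasDerivAt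
    (Icc_mem_nhds ht.1 ht.2)⟩

open scoped NNReal in
theorem exists_integralCurve {V : Type*} [NormedAddCommGroup V] [NormedSpace ℝ V]
    [CompleteSpace V] {v : V → V} {K L : ℝ≥0} (hK : LipschitzWith K v) (hL : ∀ x, ‖v x‖ ≤ L)
    (t₀ : ℝ) (x₀ : V) : ∃ γ : ℝ → V, γ t₀ = x₀ ∧ ∀ t, HasDerivAt γ (v (γ t)) t := by
  have hpos : ∀ n : ℕ, (0 : ℝ) < n + 1 := fun n => by positivity
  choose γ h0 hγ using fun n : ℕ => exists_integralCurve_Icc hK hL t₀ x₀ (hpos n)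
  have hmem : ∀ n : ℕ, t₀ ∈ Set.Ioo (t₀ - (n + 1)) (t₀ + (n + 1)) := fun n =>
    ⟨by linarith [hpos n], by linarith [hpos n]⟩
  have hEq : ∀ n m : ℕ, n ≤ m → Set.EqOn (γ n) (γ m) (Set.Ioo (t₀ - (n + 1)) (t₀ + (n + 1))) := by
    intro n m hnm
    have hnm' : (n : ℝ) ≤ m := by exact_mod_cast hnm
    refine ODE_solution_unique_of_mem_Ioo (v := fun _ => v) (s := fun _ => Set.univ)
      (fun t _ => hK.lipschitzOnWith) (hmem n) (fun t ht => ⟨hγ n t ht, trivial⟩)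
      (fun t ht => ⟨hγ m t ⟨by linarith [ht.1], by linarith [ht.2]⟩, trivial⟩)
      ((h0 n).trans (h0 m).symm)
  have hin : ∀ t, t ∈ Set.Ioo (t₀ - ((⌊|t - t₀|⌋₊ : ℕ) + 1)) (t₀ + ((⌊|t - t₀|⌋₊ : ℕ) + 1)) := by
    intro t
    have h1 := Nat.lt_floor_add_one |t - t₀|
    have h2 := abs_lt.1 h1
    exact ⟨by linarith [h2.1], by linarith [h2.2]⟩
  refine ⟨fun t => γ ⌊|t - t₀|⌋₊ t, h0 _, fun t => ?_⟩
  refine (hγ _ t (hin t)).congr_of_eventuallyEq ?_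
  filter_upwards [Ioo_mem_nhds (hin t).1 (hin t).2] with τ hτ
  rcases le_total ⌊|t - t₀|⌋₊ ⌊|τ - t₀|⌋₊ with h | h
  · exact (hEq _ _ h hτ).symm
  · exact hEq _ _ h (hin τ)

/-- A smooth vector field becomes complete after multiplication by a cutoff function, which may be
taken to be `1` on any given ball. -/
theorem exists_cutoff_integralCurve {V : Type*} [NormedAddCommGroup V] [NormedSpace ℝ V]
    [FiniteDimensional ℝ V] {v : V → V} (hv : ContDiff ℝ 1 v) (r : ℝ) (t₀ : ℝ) (x₀ : V) :
    ∃ (γ : ℝ → V) (χ : ℝ → ℝ), γ t₀ = x₀ ∧ (∀ t, HasDerivAt γ (χ t • v (γ t)) t) ∧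
      ∀ t, ‖γ t‖ ≤ r → χ t = 1 := by
  have : CompleteSpace V := FiniteDimensional.complete ℝ V
  let φ : ContDiffBump (0 : V) :=
    { rIn := max r 1
      rOut := max r 1 + 1
      rIn_pos := lt_of_lt_of_le one_pos (le_max_right _ _)
      rIn_lt_rOut := by linarith }
  have hc : HasCompactSupport fun x => φ x • v x := φ.hasCompactSupport.smul_right
  have hd : ContDiff ℝ 1 fun x => φ x • v x := (φ.contDiff (n := 1)).smul hv
  obtain ⟨K, hK⟩ := ContDiff.lipschitzWith_of_hasCompactSupport hc hd one_ne_zero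
  obtain ⟨L, hL⟩ := hc.exists_bound_of_continuous hd.continuous
  obtain ⟨γ, h0, hγ⟩ := exists_integralCurve hK (L := ⟨max L 0, le_max_right _ _⟩)
    (fun x => (hL x).trans (le_max_left _ _)) t₀ x₀
  refine ⟨γ, fun t => φ (γ t), h0, hγ, fun t ht => φ.one_of_mem_closedBall ?_⟩
  rw [mem_closedBall_zero_iff]
  exact ht.trans (le_max_left _ _)

/-! ### The desingularized flow -/

/-- The factor `κ` in `d = c (F + 1) ^ ((s + 1) / 2) / κ`, chosen so that `|d| ^ 2 = E`. -/
noncomputable def scaleK (s : ℝ) : ℝ := √((s + 1) / 2)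

theorem scaleK_sq {s : ℝ} (hs : 1 < s) : scaleK s ^ 2 = (s + 1) / 2 :=
  Real.sq_sqrt (by linarith)

theorem scaleK_pos {s : ℝ} (hs : 1 < s) : 0 < scaleK s := Real.sqrt_pos.2 (by linarith)

/-- The factor `(1 + |q| ^ 2) ^ (-1 / 2)`. -/
noncomputable def damp (q : ℂ) : ℝ := (√(1 + ‖q‖ ^ 2))⁻¹

theorem damp_pos (q : ℂ) : 0 < damp q := inv_pos.2 (Real.sqrt_pos.2 (by positivity))

theorem damp_sq (q : ℂ) : damp q ^ 2 * (1 + ‖q‖ ^ 2) = 1 := by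
  have : 0 < 1 + ‖q‖ ^ 2 := by positivity
  rw [damp, inv_pow, Real.sq_sqrt this.le, inv_mul_cancel₀ this.ne']

/-- The product `conj b d conj q`, on which the coupling of the three phases depends. -/
noncomputable def phaseProd (b d q : ℂ) : ℂ := (starRingEnd ℂ) b * d * (starRingEnd ℂ) q

/-- The right side of the equation for `b`. -/
noncomputable def smoothB (s : ℝ) (b d q : ℂ) : ℂ :=
  (‖b‖ ^ 2 + 2 * scaleK s ^ 2 * damp q ^ 2 * ‖d‖ ^ 2 : ℝ) * b +
    (scaleK s ^ 3 * damp q ^ 3 * ‖d‖ ^ 2 : ℝ) * (d * (starRingEnd ℂ) q)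

/-- The right side of the equation for `d`. -/
noncomputable def smoothD (s : ℝ) (b d q : ℂ) : ℂ :=
  ((s + 1) * (‖b‖ ^ 2 + scaleK s * damp q * (phaseProd b d q).re) : ℝ) * d

/-- The right side of the equation for `q`. -/
noncomputable def smoothQ (s : ℝ) (b d q : ℂ) : ℂ :=
  ((s - 1) * (‖b‖ ^ 2 + scaleK s * damp q * (phaseProd b d q).re) : ℝ) * q +
    (scaleK s * damp q : ℝ) * ((starRingEnd ℂ) b * d) +
    Complex.I * ((scaleK s * damp q * (phaseProd b d q).im : ℝ) * q)

/-- The curve `(b, d, q)` moves along the desingularized field, multiplied by the cutoff `χ`.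
In the variables `q = p (F + 1) ^ (s / 2)` and `d = c (F + 1) ^ ((s + 1) / 2) / κ` the vector field
on the manifold extends to a smooth one on `ℂ³`, with `F = |q| ^ 2` and `E = |d| ^ 2`. The cutoff
only changes the speed, so the conserved quantities survive it; it makes the flow complete. -/
structure IsSmoothFlow (s : ℝ) (χ : ℝ → ℝ) (b d q : ℝ → ℂ) : Prop where
  deriv_b : ∀ t, HasDerivAt b (χ t * (-Complex.I * smoothB s (b t) (d t) (q t))) t
  deriv_d : ∀ t, HasDerivAt d (χ t * (-Complex.I * smoothD s (b t) (d t) (q t))) t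
  deriv_q : ∀ t, HasDerivAt q (χ t * (-Complex.I * smoothQ s (b t) (d t) (q t))) t

theorem contDiff_damp : ContDiff ℝ 1 damp := by
  have h : ContDiff ℝ 1 fun q : ℂ => 1 + ‖q‖ ^ 2 := contDiff_const.add (contDiff_norm_sq ℝ)
  exact (h.sqrt fun q => by positivity).inv fun q => (Real.sqrt_pos.2 (by positivity)).ne'

theorem exists_smoothFlow (s : ℝ) (r : ℝ) (t₀ : ℝ) (b₀ d₀ q₀ : ℂ) :
    ∃ (χ : ℝ → ℝ) (b d q : ℝ → ℂ), IsSmoothFlow s χ b d q ∧ b t₀ = b₀ ∧ d t₀ = d₀ ∧ q t₀ = q₀ ∧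
      ∀ t, ‖b t‖ ≤ r → ‖d t‖ ≤ r → ‖q t‖ ≤ r → χ t = 1 := by
  have hb : ContDiff ℝ 1 fun z : ℂ × ℂ × ℂ => z.1 := contDiff_fst
  have hd : ContDiff ℝ 1 fun z : ℂ × ℂ × ℂ => z.2.1 := contDiff_fst.comp contDiff_snd
  have hq : ContDiff ℝ 1 fun z : ℂ × ℂ × ℂ => z.2.2 := contDiff_snd.comp contDiff_snd
  have hcb := Complex.conjCLE.contDiff.comp hb
  have hcq := Complex.conjCLE.contDiff.comp hq
  have hX := hb.norm_sq ℝ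
  have he := hd.norm_sq ℝ
  have hh := contDiff_damp.comp hq
  have hω := (hcb.mul hd).mul hcq
  have hre := Complex.reCLM.contDiff.comp hω
  have him := Complex.imCLM.contDiff.comp hω
  have hof : ∀ {f : ℂ × ℂ × ℂ → ℝ}, ContDiff ℝ 1 f → ContDiff ℝ 1 fun z => (f z : ℂ) :=
    fun hf => Complex.ofRealCLM.contDiff.comp hf
  have hc : ∀ {x : ℝ}, ContDiff ℝ 1 fun _ : ℂ × ℂ × ℂ => x := contDiff_const
  have hI : ContDiff ℝ 1 fun _ : ℂ × ℂ × ℂ => Complex.I := contDiff_const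
  have hB : ContDiff ℝ 1 fun z : ℂ × ℂ × ℂ => smoothB s z.1 z.2.1 z.2.2 :=
    ((hof (hX.add (((hc (x := 2 * scaleK s ^ 2)).mul (hh.pow 2)).mul he))).mul hb).add
      ((hof (((hc (x := scaleK s ^ 3)).mul (hh.pow 3)).mul he)).mul (hd.mul hcq))
  have hM := hX.add (((hc (x := scaleK s)).mul hh).mul hre)
  have hD : ContDiff ℝ 1 fun z : ℂ × ℂ × ℂ => smoothD s z.1 z.2.1 z.2.2 :=
    (hof ((hc (x := s + 1)).mul hM)).mul hd
  have hQ : ContDiff ℝ 1 fun z : ℂ × ℂ × ℂ => smoothQ s z.1 z.2.1 z.2.2 :=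
    (((hof ((hc (x := s - 1)).mul hM)).mul hq).add
      ((hof ((hc (x := scaleK s)).mul hh)).mul (hcb.mul hd))).add
      (hI.mul ((hof (((hc (x := scaleK s)).mul hh).mul him)).mul hq))
  have hV : ContDiff ℝ 1 fun z : ℂ × ℂ × ℂ => (-Complex.I * smoothB s z.1 z.2.1 z.2.2,
      -Complex.I * smoothD s z.1 z.2.1 z.2.2, -Complex.I * smoothQ s z.1 z.2.1 z.2.2) :=
    (contDiff_const.mul hB).prodMk ((contDiff_const.mul hD).prodMk (contDiff_const.mul hQ))
  obtain ⟨γ, χ, h0, hγ, hχ⟩ := exists_cutoff_integralCurve hV r t₀ (b₀, d₀, q₀)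
  refine ⟨χ, fun t => (γ t).1, fun t => (γ t).2.1, fun t => (γ t).2.2,
    ⟨fun t => ?_, fun t => ?_, fun t => ?_⟩, by simp [h0], by simp [h0], by simp [h0],
    fun t h1 h2 h3 => hχ t ?_⟩
  · exact ((ContinuousLinearMap.fst ℝ ℂ (ℂ × ℂ)).hasFDerivAt.comp_hasDerivAt t
      (hγ t)).congr_deriv (by simp)
  · exact (((ContinuousLinearMap.fst ℝ ℂ ℂ).comp
      (ContinuousLinearMap.snd ℝ ℂ (ℂ × ℂ))).hasFDerivAt.comp_hasDerivAt t
      (hγ t)).congr_deriv (by simp)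
  · exact (((ContinuousLinearMap.snd ℝ ℂ ℂ).comp
      (ContinuousLinearMap.snd ℝ ℂ (ℂ × ℂ))).hasFDerivAt.comp_hasDerivAt t
      (hγ t)).congr_deriv (by simp)
  · rw [Prod.norm_def, Prod.norm_def]
    exact max_le h1 (max_le h2 h3)


/-! ### Conserved quantities of the desingularized flow -/

theorem hasDerivAt_normSq {f : ℝ → ℂ} {χ : ℝ} {x : ℂ} {t : ℝ}
    (hf : HasDerivAt f (χ * (-Complex.I * x)) t) :
    HasDerivAt (fun τ => ‖f τ‖ ^ 2) (2 * χ * ((starRingEnd ℂ) (f t) * x).im) t := by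
  refine hf.norm_sq.congr_deriv ?_
  rw [Complex.inner]
  simp [Complex.mul_re, Complex.mul_im]
  ring

theorem hasDerivAt_re {f : ℝ → ℂ} {f' : ℂ} {t : ℝ} (hf : HasDerivAt f f' t) :
    HasDerivAt (fun τ => (f τ).re) f'.re t :=
  Complex.reCLM.hasFDerivAt.comp_hasDerivAt t hf

theorem hasDerivAt_im {f : ℝ → ℂ} {f' : ℂ} {t : ℝ} (hf : HasDerivAt f f' t) :
    HasDerivAt (fun τ => (f τ).im) f'.im t :=
  Complex.imCLM.hasFDerivAt.comp_hasDerivAt t hf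

theorem normSq_phaseProd (b d q : ℂ) :
    (phaseProd b d q).re ^ 2 + (phaseProd b d q).im ^ 2 = ‖b‖ ^ 2 * ‖d‖ ^ 2 * ‖q‖ ^ 2 := by
  have h : ‖phaseProd b d q‖ ^ 2 = ‖b‖ ^ 2 * ‖d‖ ^ 2 * ‖q‖ ^ 2 := by
    simp only [phaseProd, norm_mul, RCLike.norm_conj]
    ring
  rw [← h, ← Complex.normSq_eq_norm_sq, Complex.normSq_apply]
  ring

namespace IsSmoothFlow

variable {s : ℝ} {χ : ℝ → ℝ} {b d q : ℝ → ℂ}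

theorem hasDerivAt_normSq_b (h : IsSmoothFlow s χ b d q) (t : ℝ) :
    HasDerivAt (fun τ => ‖b τ‖ ^ 2) (2 * χ t * (scaleK s ^ 3 * damp (q t) ^ 3 * ‖d t‖ ^ 2 *
      (phaseProd (b t) (d t) (q t)).im)) t := by
  refine (hasDerivAt_normSq (h.deriv_b t)).congr_deriv ?_
  have e : (starRingEnd ℂ) (b t) * smoothB s (b t) (d t) (q t) =
      ((‖b t‖ ^ 2 + 2 * scaleK s ^ 2 * damp (q t) ^ 2 * ‖d t‖ ^ 2 : ℝ) * (‖b t‖ ^ 2 : ℝ) : ℂ) +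
      (scaleK s ^ 3 * damp (q t) ^ 3 * ‖d t‖ ^ 2 : ℝ) * phaseProd (b t) (d t) (q t) := by
    rw [← conj_mul_self (b t), phaseProd, smoothB]
    ring
  rw [e, ← Complex.ofReal_mul, Complex.add_im, Complex.ofReal_im, Complex.im_ofReal_mul, zero_add]

theorem hasDerivAt_normSq_d (h : IsSmoothFlow s χ b d q) (t : ℝ) :
    HasDerivAt (fun τ => ‖d τ‖ ^ 2) 0 t := by
  refine (hasDerivAt_normSq (h.deriv_d t)).congr_deriv ?_
  rw [smoothD, mul_left_comm, conj_mul_self, ← Complex.ofReal_mul, Complex.ofReal_im, mul_zero]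

theorem hasDerivAt_normSq_q (h : IsSmoothFlow s χ b d q) (t : ℝ) :
    HasDerivAt (fun τ => ‖q τ‖ ^ 2) (2 * χ t * (scaleK s * damp (q t) * (1 + ‖q t‖ ^ 2) *
      (phaseProd (b t) (d t) (q t)).im)) t := by
  refine (hasDerivAt_normSq (h.deriv_q t)).congr_deriv ?_
  have e : (starRingEnd ℂ) (q t) * smoothQ s (b t) (d t) (q t) =
      (((s - 1) * (‖b t‖ ^ 2 + scaleK s * damp (q t) * (phaseProd (b t) (d t) (q t)).re) *
        ‖q t‖ ^ 2 : ℝ) : ℂ) +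
      (scaleK s * damp (q t) : ℝ) * phaseProd (b t) (d t) (q t) +
      Complex.I * ((scaleK s * damp (q t) * (phaseProd (b t) (d t) (q t)).im * ‖q t‖ ^ 2 : ℝ) : ℂ)
      := by
    simp only [Complex.ofReal_mul _ (‖q t‖ ^ 2)]
    rw [← conj_mul_self (q t), smoothQ]
    generalize (phaseProd (b t) (d t) (q t)).re = y1
    generalize (phaseProd (b t) (d t) (q t)).im = y2
    rw [phaseProd]
    ring
  rw [e, Complex.add_im, Complex.add_im, Complex.ofReal_im, Complex.im_ofReal_mul,
    Complex.I_mul_im, Complex.ofReal_re]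
  ring

theorem hasDerivAt_damp (h : IsSmoothFlow s χ b d q) (t : ℝ) :
    HasDerivAt (fun τ => damp (q τ))
      (-(χ t * (scaleK s * damp (q t) ^ 2 * (phaseProd (b t) (d t) (q t)).im))) t := by
  have h1 : 0 < 1 + ‖q t‖ ^ 2 := by positivity
  have h2 := Real.sqrt_pos.2 h1
  have h3 := ((((h.hasDerivAt_normSq_q t).const_add 1).sqrt h1.ne').inv h2.ne')
  refine h3.congr_deriv ?_
  have h4 := Real.sq_sqrt h1.le
  rw [damp]
  generalize √(1 + ‖q t‖ ^ 2) = r at h2 h4 ⊢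
  rw [← h4]
  field_simp

theorem hasDerivAt_phaseProd (h : IsSmoothFlow s χ b d q) (t : ℝ) :
    HasDerivAt (fun τ => phaseProd (b τ) (d τ) (q τ))
      (χ t * Complex.I * (((2 * scaleK s ^ 2 * damp (q t) ^ 2 * ‖d t‖ ^ 2 - ‖b t‖ ^ 2 -
        2 * scaleK s * damp (q t) * (phaseProd (b t) (d t) (q t)).re : ℝ) : ℂ) *
          phaseProd (b t) (d t) (q t) +
        (scaleK s ^ 3 * damp (q t) ^ 3 * (‖d t‖ ^ 2) ^ 2 * ‖q t‖ ^ 2 +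
          scaleK s * damp (q t) * ‖b t‖ ^ 2 * ‖d t‖ ^ 2 : ℝ) -
        Complex.I * (scaleK s * damp (q t) * (phaseProd (b t) (d t) (q t)).im : ℝ) *
          phaseProd (b t) (d t) (q t))) t := by
  have h1 := (h.deriv_b t).star
  have h2 := (h.deriv_q t).star
  have h3 := (h1.mul (h.deriv_d t)).mul h2
  refine h3.congr_deriv ?_
  simp only [Pi.mul_apply, ← starRingEnd_apply, map_mul, map_neg, Complex.conj_I, map_add,
    Complex.conj_ofReal, Complex.conj_conj, smoothB, smoothD, smoothQ]
  generalize hre : (phaseProd (b t) (d t) (q t)).re = y1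
  generalize him : (phaseProd (b t) (d t) (q t)).im = y2
  rw [phaseProd]
  push_cast
  rw [← Complex.conj_mul', ← Complex.conj_mul', ← Complex.conj_mul']
  generalize (starRingEnd ℂ) (b t) = b'
  generalize (starRingEnd ℂ) (d t) = d'
  generalize (starRingEnd ℂ) (q t) = q'
  ring

theorem hasDerivAt_re_phaseProd (h : IsSmoothFlow s χ b d q) (t : ℝ) :
    HasDerivAt (fun τ => (phaseProd (b τ) (d τ) (q τ)).re)
      (χ t * ((phaseProd (b t) (d t) (q t)).im * (‖b t‖ ^ 2 -
        2 * scaleK s ^ 2 * damp (q t) ^ 2 * ‖d t‖ ^ 2 +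
        3 * scaleK s * damp (q t) * (phaseProd (b t) (d t) (q t)).re))) t := by
  refine (hasDerivAt_re (h.hasDerivAt_phaseProd t)).congr_deriv ?_
  rw [mul_assoc (χ t : ℂ), Complex.re_ofReal_mul]
  simp only [Complex.I_mul_re, Complex.sub_im, Complex.add_im, Complex.im_ofReal_mul,
    Complex.ofReal_im, mul_assoc Complex.I, Complex.I_mul_im, Complex.re_ofReal_mul]
  ring

theorem hasDerivAt_im_phaseProd (h : IsSmoothFlow s χ b d q) (t : ℝ) :
    HasDerivAt (fun τ => (phaseProd (b τ) (d τ) (q τ)).im)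
      (χ t * ((2 * scaleK s ^ 2 * damp (q t) ^ 2 * ‖d t‖ ^ 2 - ‖b t‖ ^ 2 -
        2 * scaleK s * damp (q t) * (phaseProd (b t) (d t) (q t)).re) *
          (phaseProd (b t) (d t) (q t)).re +
        (scaleK s ^ 3 * damp (q t) ^ 3 * (‖d t‖ ^ 2) ^ 2 * ‖q t‖ ^ 2 +
          scaleK s * damp (q t) * ‖b t‖ ^ 2 * ‖d t‖ ^ 2) +
        scaleK s * damp (q t) * (phaseProd (b t) (d t) (q t)).im ^ 2)) t := by
  refine (hasDerivAt_im (h.hasDerivAt_phaseProd t)).congr_deriv ?_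
  rw [mul_assoc (χ t : ℂ), Complex.im_ofReal_mul]
  simp only [Complex.I_mul_im, Complex.sub_re, Complex.add_re, Complex.re_ofReal_mul,
    Complex.ofReal_re, mul_assoc Complex.I, Complex.I_mul_re, Complex.im_ofReal_mul]
  ring

end IsSmoothFlow

/-- The particle number in the desingularized variables. -/
noncomputable def smoothNumber (s : ℝ) (b d q : ℂ) : ℝ :=
  ‖b‖ ^ 2 + ‖d‖ ^ 2 * ((s + 1) * damp q ^ 2 - (s - 1)) / 2

/-- The quantity `S` in the desingularized variables. -/
noncomputable def smoothS (s N E : ℝ) (b d q : ℂ) : ℝ :=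
  E * ((s - 1) - (s + 1) * damp q ^ 2) * ((s - 1) + 3 * (s + 1) * damp q ^ 2) / 4 +
    N * ((s - 1) + (s + 1) * damp q ^ 2) +
    2 * (s + 1) * scaleK s * damp q ^ 3 * (phaseProd b d q).re

theorem eq_of_forall_hasDerivAt_zero {f : ℝ → ℝ} (h : ∀ t, HasDerivAt f 0 t) (t t₀ : ℝ) :
    f t = f t₀ :=
  is_const_of_deriv_eq_zero (fun t => (h t).differentiableAt) (fun t => (h t).deriv) t t₀

namespace IsSmoothFlow

variable {s : ℝ} {χ : ℝ → ℝ} {b d q : ℝ → ℂ}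

theorem energy_eq (h : IsSmoothFlow s χ b d q) (t t₀ : ℝ) : ‖d t‖ ^ 2 = ‖d t₀‖ ^ 2 :=
  eq_of_forall_hasDerivAt_zero h.hasDerivAt_normSq_d t t₀

theorem number_eq (hs : 1 < s) (h : IsSmoothFlow s χ b d q) (t t₀ : ℝ) :
    smoothNumber s (b t) (d t) (q t) = smoothNumber s (b t₀) (d t₀) (q t₀) := by
  refine eq_of_forall_hasDerivAt_zero (f := fun t => smoothNumber s (b t) (d t) (q t))
    (fun t => ?_) t t₀
  have h1 := (h.hasDerivAt_normSq_b t).add (((h.hasDerivAt_normSq_d t).mul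
    ((((h.hasDerivAt_damp t).pow 2).const_mul (s + 1)).sub_const (s - 1))).div_const 2)
  refine h1.congr_deriv ?_
  have hK : scaleK s ^ 3 = scaleK s * ((s + 1) / 2) := by rw [pow_succ', scaleK_sq hs]
  simp only [hK]
  push_cast
  ring

theorem S_eq (hs : 1 < s) (h : IsSmoothFlow s χ b d q) {N E : ℝ} (t₀ : ℝ)
    (hN : smoothNumber s (b t₀) (d t₀) (q t₀) = N) (hE : ‖d t₀‖ ^ 2 = E) (t : ℝ) :
    smoothS s N E (b t) (d t) (q t) = smoothS s N E (b t₀) (d t₀) (q t₀) := by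
  refine eq_of_forall_hasDerivAt_zero (f := fun t => smoothS s N E (b t) (d t) (q t))
    (fun t => ?_) t t₀
  have hN' := (h.number_eq hs t t₀).trans hN
  have hE' := (h.energy_eq t t₀).trans hE
  have hh := ((h.hasDerivAt_damp t).pow 2).const_mul (s + 1)
  have h1 := (((((hh.const_sub (s - 1)).const_mul E).mul
    ((((h.hasDerivAt_damp t).pow 2).const_mul (3 * (s + 1))).const_add (s - 1))).div_const 4).add
    ((hh.const_add (s - 1)).const_mul N)).add
    ((((h.hasDerivAt_damp t).pow 3).const_mul (2 * (s + 1) * scaleK s)).mul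
      (h.hasDerivAt_re_phaseProd t))
  refine h1.congr_deriv ?_
  rw [smoothNumber] at hN'
  rw [← hN', hE', scaleK_sq hs]
  simp only [Pi.pow_apply]
  push_cast
  ring

end IsSmoothFlow


/-! ### The motion in the potential -/

/-- The quadratic polynomial in `F` with `V = potR ^ 2 - potL`. On a trajectory `potL` is the squared
modulus, `potR` the real part and the velocity of `F` the imaginary part of one complex number, a
multiple of `conj b d conj q`. -/
noncomputable def potR (s N E S F : ℝ) : ℝ :=
  (E * (2 * s + 1) - 2 * N * s + S - (E * (s - 1) * s + N * (3 * s - 1) - 2 * S) * F -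
    (E * (s - 1) ^ 2 + 4 * N * (s - 1) - 4 * S) * F ^ 2 / 4) / (s + 1)

/-- The part of the potential that does not depend on `S`, with the opposite sign. -/
noncomputable def potL (s N E F : ℝ) : ℝ :=
  (s + 1) * E * F * (2 * (F + 1) * N - (2 - (s - 1) * F) * E)

/-- The derivative of `potR`. -/
noncomputable def potR' (s N E S F : ℝ) : ℝ :=
  (-(E * (s - 1) * s + N * (3 * s - 1) - 2 * S) -
    (E * (s - 1) ^ 2 + 4 * N * (s - 1) - 4 * S) * F / 2) / (s + 1)

/-- The derivative of `potL`. -/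
noncomputable def potL' (s N E F : ℝ) : ℝ :=
  (s + 1) * E * (2 * (2 * F + 1) * N - (2 - 2 * (s - 1) * F) * E)

theorem potential_eval_eq_sum (s N E S F : ℝ) : (potential s N E S).eval F =
    potCoeff s N E S 0 + potCoeff s N E S 1 * F + potCoeff s N E S 2 * F ^ 2 +
      potCoeff s N E S 3 * F ^ 3 + potCoeff s N E S 4 * F ^ 4 := by
  simp [potential, Fin.sum_univ_five]

theorem potential_eval {s : ℝ} (hs : 1 < s) (N E S F : ℝ) :
    (potential s N E S).eval F = potR s N E S F ^ 2 - potL s N E F := by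
  have : s + 1 ≠ 0 := by linarith
  rw [potential_eval_eq_sum]
  simp only [potCoeff, potR, potL, Matrix.cons_val]
  field_simp
  ring

theorem hasDerivAt_potential {s : ℝ} (hs : 1 < s) (N E S F : ℝ) :
    HasDerivAt (fun F => (potential s N E S).eval F)
      (2 * potR s N E S F * potR' s N E S F - potL' s N E F) F := by
  have e : (fun F => (potential s N E S).eval F) = fun F =>
      potR s N E S F ^ 2 - potL s N E F := funext (potential_eval hs N E S)
  have hi := hasDerivAt_id F
  have h1 : HasDerivAt (fun F => potR s N E S F) (potR' s N E S F) F := by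
    refine ((((hi.const_mul (E * (s - 1) * s + N * (3 * s - 1) - 2 * S)).const_sub
      (E * (2 * s + 1) - 2 * N * s + S)).sub (((hi.pow 2).const_mul
      (E * (s - 1) ^ 2 + 4 * N * (s - 1) - 4 * S)).div_const 4)).div_const (s + 1)).congr_deriv ?_
    simp only [potR', id]
    push_cast
    ring
  have h2 : HasDerivAt (fun F => potL s N E F) (potL' s N E F) F := by
    refine ((hi.const_mul ((s + 1) * E)).mul ((((hi.add_const 1).const_mul 2).mul_const N).sub
      (((hi.const_mul (s - 1)).const_sub 2).mul_const E))).congr_deriv ?_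
    simp only [potL', id, Pi.sub_apply]
    ring
  rw [e]
  refine ((h1.pow 2).sub h2).congr_deriv ?_
  push_cast
  ring

theorem potential_derivative_eval {s : ℝ} (hs : 1 < s) (N E S F : ℝ) :
    (potential s N E S).derivative.eval F =
      2 * potR s N E S F * potR' s N E S F - potL' s N E F :=
  ((potential s N E S).hasDerivAt F).unique (hasDerivAt_potential hs N E S F)

/-- The velocity of `F` along the desingularized flow. -/
noncomputable def smoothVelocity (s : ℝ) (b d q : ℂ) : ℝ :=
  2 * (scaleK s * damp q * (1 + ‖q‖ ^ 2) * (phaseProd b d q).im)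

/-- Solving the formula for the conserved quantity `S` for the cross term expresses the real part of
`conj b d conj q` through `F`. -/
theorem potR_smooth {s : ℝ} (hs : 1 < s) (b d q : ℂ) :
    potR s (smoothNumber s b d q) (‖d‖ ^ 2)
      (smoothS s (smoothNumber s b d q) (‖d‖ ^ 2) b d q) (‖q‖ ^ 2) =
      2 * (scaleK s * damp q * (1 + ‖q‖ ^ 2) * (phaseProd b d q).re) := by
  have h1 := damp_sq q
  have h2 := damp_pos q
  have hs1 : s + 1 ≠ 0 := by linarith
  rw [potR, smoothS, smoothNumber]
  have hF : ‖q‖ ^ 2 = (1 - damp q ^ 2) / damp q ^ 2 := by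
    rw [eq_div_iff (by positivity)]
    linarith
  rw [hF]
  generalize damp q = h at h2 ⊢
  have h3 := h2.ne'
  field_simp
  ring

/-- The equation `F' ^ 2 + V(F) = 0`: the squares of the real and imaginary parts of `conj b d conj q`
add up to `|b| ^ 2 |d| ^ 2 |q| ^ 2`, which is a function of `F`. -/
theorem velocity_sq {s : ℝ} (hs : 1 < s) (b d q : ℂ) :
    smoothVelocity s b d q ^ 2 + (potential s (smoothNumber s b d q) (‖d‖ ^ 2)
      (smoothS s (smoothNumber s b d q) (‖d‖ ^ 2) b d q)).eval (‖q‖ ^ 2) = 0 := by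
  rw [potential_eval hs, potR_smooth hs]
  have h1 := damp_sq q
  have h2 := damp_pos q
  have hK := scaleK_sq hs
  have hω := normSq_phaseProd b d q
  have hF : ‖q‖ ^ 2 = (1 - damp q ^ 2) / damp q ^ 2 := by
    rw [eq_div_iff (by positivity)]
    linarith
  have hL : potL s (smoothNumber s b d q) (‖d‖ ^ 2) (‖q‖ ^ 2) = 4 * scaleK s ^ 2 *
      (damp q ^ 2 * (1 + ‖q‖ ^ 2)) * (1 + ‖q‖ ^ 2) * (‖b‖ ^ 2 * ‖d‖ ^ 2 * ‖q‖ ^ 2) := by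
    rw [hK, h1, potL, smoothNumber, hF]
    generalize damp q = h at h2 ⊢
    have h3 := h2.ne'
    field_simp
    ring
  rw [hL, ← hω, smoothVelocity]
  ring

namespace IsSmoothFlow

variable {s : ℝ} {χ : ℝ → ℝ} {b d q : ℝ → ℂ}

theorem hasDerivAt_F (h : IsSmoothFlow s χ b d q) (t : ℝ) :
    HasDerivAt (fun τ => ‖q τ‖ ^ 2) (χ t * smoothVelocity s (b t) (d t) (q t)) t := by
  refine (h.hasDerivAt_normSq_q t).congr_deriv ?_
  rw [smoothVelocity]
  ring

/-- The equation of motion `F'' = -V'(F) / 2`. It does not follow from `F' ^ 2 + V(F) = 0` at the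
turning points, where it is needed as well. -/
theorem hasDerivAt_velocity (hs : 1 < s) (h : IsSmoothFlow s χ b d q) {N E S : ℝ} (t : ℝ)
    (hN : smoothNumber s (b t) (d t) (q t) = N) (hE : ‖d t‖ ^ 2 = E)
    (hS : smoothS s N E (b t) (d t) (q t) = S) :
    HasDerivAt (fun τ => smoothVelocity s (b τ) (d τ) (q τ))
      (χ t * (-(potential s N E S).derivative.eval (‖q t‖ ^ 2) / 2)) t := by
  have h1 := ((((h.hasDerivAt_damp t).const_mul (scaleK s)).mul
    ((h.hasDerivAt_normSq_q t).const_add 1)).mul (h.hasDerivAt_im_phaseProd t)).const_mul 2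
  refine h1.congr_deriv ?_
  rw [potential_derivative_eval hs]
  subst hN hE hS
  rw [potR_smooth hs]
  have h1 := damp_sq (q t)
  have h2 := damp_pos (q t)
  have hK := scaleK_sq hs
  have hK0 := scaleK_pos hs
  have hω := normSq_phaseProd (b t) (d t) (q t)
  have hF : ‖q t‖ ^ 2 = (1 - damp (q t) ^ 2) / damp (q t) ^ 2 := by
    rw [eq_div_iff (by positivity)]
    linarith
  simp only [Pi.mul_apply, potR', potL', smoothS, smoothNumber]
  rw [hF] at hω ⊢
  generalize damp (q t) = η at h2 hω ⊢
  generalize (phaseProd (b t) (d t) (q t)).re = y at hω ⊢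
  generalize (phaseProd (b t) (d t) (q t)).im = z at hω ⊢
  generalize ‖b t‖ ^ 2 = X at hω ⊢
  generalize ‖d t‖ ^ 2 = e at hω ⊢
  generalize χ t = c
  generalize scaleK s = κ at hK hK0 ⊢
  obtain rfl : s = 2 * κ ^ 2 - 1 := by linarith
  have h3 := h2.ne'
  have h4 := hK0.ne'
  have h5 : 2 * κ ^ 2 - 1 + 1 = 2 * κ ^ 2 := by ring
  rw [h5]
  field_simp at hω ⊢
  linear_combination (64 * c * κ ^ 3 * η) * hω

end IsSmoothFlow

/-! ### The manifold in the desingularized variables -/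

/-- The parameter `p` in terms of `q`. -/
noncomputable def toP (s : ℝ) (q : ℂ) : ℂ := ((damp q ^ s : ℝ) : ℂ) * q

/-- The parameter `c` in terms of `d` and `q`. -/
noncomputable def toC (s : ℝ) (d q : ℂ) : ℂ :=
  ((scaleK s * damp q * damp q ^ s : ℝ) : ℂ) * d

theorem damp_rpow_sq_mul (s : ℝ) (q : ℂ) : (damp q ^ s) ^ 2 * (1 + ‖q‖ ^ 2) ^ s = 1 := by
  have h := damp_pos q
  have e : (damp q ^ s) ^ 2 = (damp q ^ 2) ^ s := by
    rw [← Real.rpow_natCast, ← Real.rpow_natCast, ← Real.rpow_mul h.le, ← Real.rpow_mul h.le,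
      mul_comm]
  rw [e, ← Real.mul_rpow (by positivity) (by positivity), damp_sq, Real.one_rpow]

theorem norm_toP_sq (s : ℝ) (q : ℂ) : ‖toP s q‖ ^ 2 = invF s (‖q‖ ^ 2) := by
  have h := damp_rpow_sq_mul s q
  have h1 : (1 + ‖q‖ ^ 2) ^ s ≠ 0 := (Real.rpow_pos_of_pos (by positivity) s).ne'
  rw [toP, norm_mul, mul_pow, Complex.norm_real, Real.norm_eq_abs, sq_abs, invF, eq_div_iff h1]
  linear_combination ‖q‖ ^ 2 * h

theorem bigF_toP {s : ℝ} (hs : 1 < s) {q : ℂ} (hq : ‖q‖ ^ 2 ≤ FCrit s) :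
    bigF s (toP s q) = ‖q‖ ^ 2 := by
  rw [bigF, norm_toP_sq, genF_invF hs ⟨by positivity, hq⟩]

theorem norm_toP_sq_lt {s : ℝ} (hs : 1 < s) {q : ℂ} (hq : ‖q‖ ^ 2 < FCrit s) :
    ‖toP s q‖ ^ 2 < xCrit s := by
  rw [norm_toP_sq]
  exact invF_lt_xCrit hs (by positivity) hq

theorem norm_toC_sq {s : ℝ} (hs : 1 < s) (d q : ℂ) :
    ‖toC s d q‖ ^ 2 = (s + 1) / (2 * (‖q‖ ^ 2 + 1) ^ (s + 1)) * ‖d‖ ^ 2 := by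
  have h := damp_rpow_sq_mul s q
  have h2 := damp_sq q
  have h0 : 0 < 1 + ‖q‖ ^ 2 := by positivity
  have h1 := Real.rpow_pos_of_pos h0 s
  rw [toC, norm_mul, mul_pow, Complex.norm_real, Real.norm_eq_abs, sq_abs, mul_pow, mul_pow,
    scaleK_sq hs, add_comm (‖q‖ ^ 2), Real.rpow_add_one h0.ne']
  field_simp
  linear_combination ‖d‖ ^ 2 * (damp q ^ 2 * (1 + ‖q‖ ^ 2) * h + h2)

/-- Below the critical point, every `c, p` comes from desingularized variables `d, q`. -/
theorem exists_toP_toC {s : ℝ} (hs : 1 < s) (c : ℂ) {p : ℂ} (hp : ‖p‖ ^ 2 < xCrit s) :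
    ∃ d q, toP s q = p ∧ toC s d q = c ∧ ‖q‖ ^ 2 < FCrit s := by
  have hF := bigF_nonneg s p
  have h1 : 0 < 1 + bigF s p := by linarith
  have hG := Real.rpow_pos_of_pos h1 s
  obtain ⟨q, hqd⟩ : ∃ q : ℂ, q = ((√((1 + bigF s p) ^ s) : ℝ) : ℂ) * p := ⟨_, rfl⟩
  have hq : ‖q‖ ^ 2 = bigF s p := by
    rw [hqd, norm_mul, mul_pow, Complex.norm_real, Real.norm_eq_abs, sq_abs, Real.sq_sqrt hG.le]
    have := genF_eq_mul hs (show 0 ≤ ‖p‖ ^ 2 by positivity) hp.le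
    rw [bigF]
    linarith
  have hd := Real.rpow_pos_of_pos (damp_pos q) s
  have hdq : damp q ^ s * √((1 + bigF s p) ^ s) = 1 := by
    have h := damp_rpow_sq_mul s q
    rw [hq] at h
    rw [← Real.sqrt_sq hd.le, ← Real.sqrt_mul (by positivity), h, Real.sqrt_one]
  have hκ : scaleK s * damp q * damp q ^ s ≠ 0 :=
    (mul_pos (mul_pos (scaleK_pos hs) (damp_pos q)) hd).ne'
  refine ⟨((scaleK s * damp q * damp q ^ s : ℝ) : ℂ)⁻¹ * c, q, ?_, ?_, ?_⟩
  · rw [toP]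
    nth_rw 2 [hqd]
    rw [← mul_assoc, ← Complex.ofReal_mul, hdq, Complex.ofReal_one, one_mul]
  · rw [toC, mul_inv_cancel_left₀ (by exact_mod_cast hκ)]
  · rw [hq]
    exact bigF_lt hs hp

theorem IsSmoothFlow.hasDerivAt_damp_rpow {s : ℝ} {χ : ℝ → ℝ} {b d q : ℝ → ℂ}
    (h : IsSmoothFlow s χ b d q) (t : ℝ) :
    HasDerivAt (fun τ => damp (q τ) ^ s)
      (-(χ t * (s * scaleK s * damp (q t) * damp (q t) ^ s *
        (phaseProd (b t) (d t) (q t)).im))) t := by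
  have h0 := damp_pos (q t)
  refine ((h.hasDerivAt_damp t).rpow_const (p := s) (Or.inl h0.ne')).congr_deriv ?_
  rw [Real.rpow_sub_one h0.ne']
  field_simp

/-- Where the cutoff is `1` and `F < F_c`, the desingularized flow is the flow on the manifold. -/
theorem IsSmoothFlow.isManifoldFlowOn {s : ℝ} (hs : 1 < s) {χ : ℝ → ℝ} {b d q : ℝ → ℂ}
    (h : IsSmoothFlow s χ b d q) {I : Set ℝ} (hχ : ∀ t ∈ I, χ t = 1)
    (hq : ∀ t ∈ I, ‖q t‖ ^ 2 < FCrit s) :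
    IsManifoldFlowOn s I b (fun t => toC s (d t) (q t)) (fun t => toP s (q t)) := by
  have hω : ∀ t, b t * (starRingEnd ℂ) (d t) * q t = (phaseProd (b t) (d t) (q t)).re -
      Complex.I * (phaseProd (b t) (d t) (q t)).im := fun t => by
    have h1 : b t * (starRingEnd ℂ) (d t) * q t = (starRingEnd ℂ) (phaseProd (b t) (d t) (q t)) := by
      simp [phaseProd]
    rw [h1]
    apply Complex.ext <;> simp
  have hG : ∀ t ∈ I, ((damp (q t) ^ s : ℝ) : ℂ) ^ 2 *
      (((1 + bigF s (toP s (q t))) ^ s : ℝ) : ℂ) = 1 := fun t ht => by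
    rw [bigF_toP hs (hq t ht).le]
    exact_mod_cast damp_rpow_sq_mul s (q t)
  refine ⟨fun t ht => norm_toP_sq_lt hs (hq t ht), fun t ht => ?_, fun t ht => ?_, fun t ht => ?_⟩
  · refine (h.deriv_b t).hasDerivWithinAt.congr_deriv ?_
    rw [hχ t ht, Complex.ofReal_one, one_mul, smoothB, fieldB, toC, norm_mul, mul_pow,
      Complex.norm_real, Real.norm_eq_abs, sq_abs, toP]
    have hG' := hG t ht
    rw [toP] at hG'
    rw [map_mul, Complex.conj_ofReal]
    push_cast
    generalize (((1 + bigF s ((damp (q t) ^ s : ℝ) * q t)) ^ s : ℝ) : ℂ) = G at hG' ⊢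
    generalize ((damp (q t) ^ s : ℝ) : ℂ) = δ at hG' ⊢
    linear_combination (2 * Complex.I * scaleK s ^ 2 * damp (q t) ^ 2 * ‖d t‖ ^ 2 * b t +
      Complex.I * scaleK s ^ 3 * damp (q t) ^ 3 * ‖d t‖ ^ 2 * d t * (starRingEnd ℂ) (q t) *
        (δ ^ 2 * G + 1)) * hG'
  · have h1 := ((((h.hasDerivAt_damp t).const_mul (scaleK s)).mul
      (h.hasDerivAt_damp_rpow t)).ofReal_comp.mul (h.deriv_d t)).hasDerivWithinAt (s := I)
    refine h1.congr_deriv ?_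
    rw [hχ t ht, smoothD, fieldC, toC, norm_mul, mul_pow,
      Complex.norm_real, Real.norm_eq_abs, sq_abs, toP]
    have hG' := hG t ht
    rw [toP] at hG'
    have hω' := hω t
    simp only [Pi.mul_apply]
    push_cast
    rw [← Complex.conj_mul' (d t)]
    generalize (((1 + bigF s ((damp (q t) ^ s : ℝ) * q t)) ^ s : ℝ) : ℂ) = G at hG' ⊢
    generalize ((damp (q t) ^ s : ℝ) : ℂ) = δ at hG' ⊢
    generalize (((phaseProd (b t) (d t) (q t)).im : ℝ) : ℂ) = z at hω' ⊢
    linear_combination (Complex.I * (s + 1) * scaleK s ^ 2 * damp (q t) ^ 2 * δ * d t) *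
      (b t * (starRingEnd ℂ) (d t) * q t * hG' + hω') -
      ((s + 1) * scaleK s ^ 2 * damp (q t) ^ 2 * δ * d t) * z * Complex.I_sq
  · have h1 := ((h.hasDerivAt_damp_rpow t).ofReal_comp.mul (h.deriv_q t)).hasDerivWithinAt (s := I)
    refine h1.congr_deriv ?_
    rw [hχ t ht, smoothQ, fieldP, toC, toP]
    have hG' := hG t ht
    rw [toP] at hG'
    have hω' := hω t
    rw [map_mul, Complex.conj_ofReal]
    push_cast
    generalize (((1 + bigF s ((damp (q t) ^ s : ℝ) * q t)) ^ s : ℝ) : ℂ) = G at hG' ⊢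
    generalize ((damp (q t) ^ s : ℝ) : ℂ) = δ at hG' ⊢
    generalize (((phaseProd (b t) (d t) (q t)).im : ℝ) : ℂ) = z at hω' ⊢
    linear_combination (Complex.I * (s - 1) * scaleK s * damp (q t) * δ * q t) *
      (b t * (starRingEnd ℂ) (d t) * q t * hG' + hω') -
      (s * scaleK s * damp (q t) * δ * q t) * z * Complex.I_sq

theorem manifoldNumber_toP {s : ℝ} (hs : 1 < s) (b d : ℂ) {q : ℂ} (hq : ‖q‖ ^ 2 ≤ FCrit s) :
    manifoldNumber s b (toC s d q) (toP s q) = smoothNumber s b d q := by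
  have h0 : 0 < 1 + ‖q‖ ^ 2 := by positivity
  have h1 := Real.rpow_pos_of_pos h0 s
  have h2 := damp_sq q
  have h3 : s + 1 ≠ 0 := by linarith
  rw [manifoldNumber, norm_toC_sq hs, bigF_toP hs hq, smoothNumber, add_comm (‖q‖ ^ 2) 1,
    Real.rpow_add_one h0.ne']
  field_simp
  linear_combination -‖d‖ ^ 2 * (s + 1) * h2

theorem manifoldEnergy_toP {s : ℝ} (hs : 1 < s) (d : ℂ) {q : ℂ} (hq : ‖q‖ ^ 2 ≤ FCrit s) :
    manifoldEnergy s (toC s d q) (toP s q) = ‖d‖ ^ 2 := by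
  have h0 : 0 < 1 + ‖q‖ ^ 2 := by positivity
  have h1 := Real.rpow_pos_of_pos h0 (s + 1)
  have h3 : s + 1 ≠ 0 := by linarith
  rw [manifoldEnergy, norm_toC_sq hs, bigF_toP hs hq, add_comm (‖q‖ ^ 2) 1]
  field_simp

theorem quantityS_toP {s : ℝ} (hs : 1 < s) (N E : ℝ) (b d : ℂ) {q : ℂ} (hq : ‖q‖ ^ 2 ≤ FCrit s) :
    quantityS s N E b (toC s d q) (toP s q) = smoothS s N E b d q := by
  have h0 : 0 < 1 + ‖q‖ ^ 2 := by positivity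
  have h1 := Real.rpow_pos_of_pos h0 s
  have h2 := damp_sq q
  have hG := damp_rpow_sq_mul s q
  have hre : ((starRingEnd ℂ) b * toC s d q * (starRingEnd ℂ) (toP s q) +
      b * (starRingEnd ℂ) (toC s d q) * toP s q).re =
      2 * (scaleK s * damp q * (damp q ^ s) ^ 2) * (phaseProd b d q).re := by
    have e1 : (starRingEnd ℂ) b * toC s d q * (starRingEnd ℂ) (toP s q) =
        ((scaleK s * damp q * (damp q ^ s) ^ 2 : ℝ) : ℂ) * phaseProd b d q := by
      rw [toC, toP, phaseProd, map_mul, Complex.conj_ofReal]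
      push_cast
      ring
    have e2 : b * (starRingEnd ℂ) (toC s d q) * toP s q =
        (starRingEnd ℂ) ((starRingEnd ℂ) b * toC s d q * (starRingEnd ℂ) (toP s q)) := by
      simp
    rw [Complex.add_re, e2, Complex.conj_re, e1, Complex.re_ofReal_mul]
    ring
  have hd2 : damp q ^ 2 = 1 / (1 + ‖q‖ ^ 2) := by rw [eq_div_iff h0.ne', h2]
  have hd3 : damp q ^ 3 = damp q / (1 + ‖q‖ ^ 2) := by
    rw [pow_succ, hd2]
    ring
  rw [quantityS, hre, bigF_toP hs hq, one_div_FCrit, smoothS, hd3, hd2, add_comm (‖q‖ ^ 2) 1,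
    Real.rpow_sub_one h0.ne']
  field_simp
  generalize ‖q‖ ^ 2 = F at *
  linear_combination (8 * (s + 1) * (1 + F) * (phaseProd b d q).re * scaleK s * damp q) * hG

theorem manifoldHamiltonian_eq {s : ℝ} (hs : 1 < s) (b c p : ℂ) :
    manifoldHamiltonian s b c p = 1 / 2 * (manifoldNumber s b c p ^ 2 + manifoldEnergy s c p *
      quantityS s (manifoldNumber s b c p) (manifoldEnergy s c p) b c p) := by
  have hF := bigF_nonneg s p
  have h0 : 0 < 1 + bigF s p := by linarith
  have h3 : s + 1 ≠ 0 := by linarith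
  have hre : ((starRingEnd ℂ) b * c * (starRingEnd ℂ) p + b * (starRingEnd ℂ) c * p).re =
      2 * ((starRingEnd ℂ) b * c * (starRingEnd ℂ) p).re := by
    have e2 : b * (starRingEnd ℂ) c * p =
        (starRingEnd ℂ) ((starRingEnd ℂ) b * c * (starRingEnd ℂ) p) := by
      simp
    rw [Complex.add_re, e2, Complex.conj_re]
    ring
  rw [manifoldHamiltonian, quantityS, hre, one_div_FCrit, manifoldNumber, manifoldEnergy,
    add_comm (bigF s p) 1, Real.rpow_sub_one h0.ne', Real.rpow_add_one h0.ne']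
  field_simp
  ring

/-- The desingularized flow gives the reduced dynamics as long as `F < F_c`. -/
theorem IsSmoothFlow.reducedDynamics {s : ℝ} (hs : 1 < s) {χ : ℝ → ℝ} {b d q : ℝ → ℂ}
    (h : IsSmoothFlow s χ b d q) {I : Set ℝ} (hχ : ∀ t ∈ I, χ t = 1)
    (hq : ∀ t ∈ I, ‖q t‖ ^ 2 < FCrit s) {N E S t₀ : ℝ}
    (hN : smoothNumber s (b t₀) (d t₀) (q t₀) = N) (hE : ‖d t₀‖ ^ 2 = E)
    (hS : smoothS s N E (b t₀) (d t₀) (q t₀) = S) {α : ℝ → ℕ → ℂ}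
    (hα : ∀ t ∈ I, α t = manifoldState s (b t) (toC s (d t) (q t)) (toP s (q t))) :
    ReducedDynamics s N E S I α b (fun t => toC s (d t) (q t)) (fun t => toP s (q t)) := by
  have hm := h.isManifoldFlowOn hs hχ hq
  have hF : ∀ t ∈ I, bigF s (toP s (q t)) = ‖q t‖ ^ 2 := fun t ht => bigF_toP hs (hq t ht).le
  have hN' : ∀ t, smoothNumber s (b t) (d t) (q t) = N := fun t => (h.number_eq hs t t₀).trans hN
  have hE' : ∀ t, ‖d t‖ ^ 2 = E := fun t => (h.energy_eq t t₀).trans hE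
  have hS' : ∀ t, smoothS s N E (b t) (d t) (q t) = S := fun t =>
    (h.S_eq hs t₀ hN hE t).trans hS
  have hmN : ∀ t ∈ I, manifoldNumber s (b t) (toC s (d t) (q t)) (toP s (q t)) = N :=
    fun t ht => (manifoldNumber_toP hs _ _ (hq t ht).le).trans (hN' t)
  have hmE : ∀ t ∈ I, manifoldEnergy s (toC s (d t) (q t)) (toP s (q t)) = E :=
    fun t ht => (manifoldEnergy_toP hs _ (hq t ht).le).trans (hE' t)
  have hmS : ∀ t ∈ I, quantityS s N E (b t) (toC s (d t) (q t)) (toP s (q t)) = S :=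
    fun t ht => (quantityS_toP hs _ _ _ _ (hq t ht).le).trans (hS' t)
  refine ⟨hα, hm.p_lt, (reducedEquations_iff hs hm.p_lt hmN hmE).2 hm, fun t ht => ?_,
    fun t ht => ?_, hmS, fun t ht => ?_, fun t ht => ?_, fun t ht => ?_, fun t ht => ?_,
    fun t ht => ?_, fun t ht => ?_⟩
  · rw [hα t ht, ← hmN t ht]
    exact hasSum_number hs _ _ _ (hm.p_lt t ht).le
  · rw [hα t ht, ← hmE t ht]
    exact hasSum_energy hs _ _ _ (hm.p_lt t ht).le
  · rw [hα t ht, ← hmS t ht, ← hmN t ht, ← hmE t ht, ← manifoldHamiltonian_eq hs]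
    exact hasSum_hamiltonianTerm hs _ _ _ (hm.p_lt t ht)
  · rw [hF t ht]
    exact ⟨by positivity, hq t ht⟩
  · have h0 : 0 < 1 + ‖q t‖ ^ 2 := by positivity
    have h2 := damp_sq (q t)
    have hd2 : damp (q t) ^ 2 = 1 / (1 + ‖q t‖ ^ 2) := by rw [eq_div_iff h0.ne', h2]
    rw [hF t ht, one_div_FCrit, ← hN' t, ← hE' t, smoothNumber, hd2]
    field_simp
    ring
  · rw [hF t ht, norm_toC_sq hs, hE' t]
  · rw [hF t ht, norm_toP_sq, invF, add_comm]
  · refine ⟨smoothVelocity s (b t) (d t) (q t), ?_, ?_⟩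
    · have h1 := (h.hasDerivAt_F t).hasDerivWithinAt (s := I)
      rw [hχ t ht, one_mul] at h1
      exact h1.congr (fun τ hτ => hF τ hτ) (hF t ht)
    · rw [hF t ht, ← hS' t, ← hN' t, ← hE' t]
      exact velocity_sq hs _ _ _


/-! ### Invariance of the manifold -/

/-- A trajectory of the desingularized flow with the given values of the conserved quantities. The
cutoff has no effect as long as `F ≤ F_c + 1`, so that the trajectory passes through the critical
value `F_c` without a singularity. -/
structure IsCoveringFlow (s N E S : ℝ) (χ : ℝ → ℝ) (b d q : ℝ → ℂ) : Prop where
  flow : IsSmoothFlow s χ b d q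
  number : ∀ t, smoothNumber s (b t) (d t) (q t) = N
  energy : ∀ t, ‖d t‖ ^ 2 = E
  S_eq : ∀ t, smoothS s N E (b t) (d t) (q t) = S
  cutoff : ∀ t, ‖q t‖ ^ 2 ≤ FCrit s + 1 → χ t = 1

theorem le_of_sq_le {x r : ℝ} (hr : 1 ≤ r) (h : x ^ 2 ≤ r) : x ≤ r := by nlinarith

/-- Every point of the manifold lies on a trajectory of the desingularized flow that is defined for all
times: the conservation laws bound the trajectory as long as `F ≤ F_c + 1`, so that a cutoff outside
a large ball has no effect there. -/
theorem exists_coveringFlow {s : ℝ} (hs : 1 < s) (t₀ : ℝ) (b₀ c₀ : ℂ) {p₀ : ℂ}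
    (hp : ‖p₀‖ ^ 2 < xCrit s) {N E S : ℝ} (hN : manifoldNumber s b₀ c₀ p₀ = N)
    (hE : manifoldEnergy s c₀ p₀ = E) (hS : quantityS s N E b₀ c₀ p₀ = S) :
    ∃ (χ : ℝ → ℝ) (b d q : ℝ → ℂ), IsCoveringFlow s N E S χ b d q ∧ b t₀ = b₀ ∧
      toC s (d t₀) (q t₀) = c₀ ∧ toP s (q t₀) = p₀ ∧ ‖q t₀‖ ^ 2 < FCrit s := by
  obtain ⟨d₀, q₀, hq₀, hd₀, hlt⟩ := exists_toP_toC hs c₀ hp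
  rw [← hq₀, ← hd₀, manifoldNumber_toP hs _ _ hlt.le] at hN
  rw [← hq₀, ← hd₀, manifoldEnergy_toP hs _ hlt.le] at hE
  rw [← hq₀, ← hd₀, quantityS_toP hs _ _ _ _ hlt.le] at hS
  set r := 1 + |N| + |E| * (1 + (s - 1) / 2) + (FCrit s + 1) with hr
  have hFc := FCrit_pos hs
  have hs0 : 0 < s - 1 := by linarith
  have hr1 : 1 ≤ r := by
    have : 0 ≤ |N| + |E| * (1 + (s - 1) / 2) := by positivity
    linarith
  have hNr : |N| + |E| * ((s - 1) / 2) ≤ r := by nlinarith [abs_nonneg N, abs_nonneg E]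
  have hEr : |E| ≤ r := by
    have : 0 ≤ |E| * ((s - 1) / 2) := by positivity
    nlinarith [abs_nonneg N, abs_nonneg E]
  have hFr : FCrit s + 1 ≤ r := by
    have : 0 ≤ |N| + |E| * (1 + (s - 1) / 2) := by positivity
    linarith
  obtain ⟨χ, b, d, q, h, hb, hd, hq, hχ⟩ := exists_smoothFlow s r t₀ b₀ d₀ q₀
  rw [← hb, ← hd, ← hq] at hN
  rw [← hd] at hE
  rw [← hb, ← hd, ← hq] at hS
  have hN' : ∀ t, smoothNumber s (b t) (d t) (q t) = N := fun t => (h.number_eq hs t t₀).trans hN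
  have hE' : ∀ t, ‖d t‖ ^ 2 = E := fun t => (h.energy_eq t t₀).trans hE
  refine ⟨χ, b, d, q, ⟨h, hN', hE', fun t => (h.S_eq hs t₀ hN hE t).trans hS,
    fun t ht => hχ t (le_of_sq_le hr1 ?_) (le_of_sq_le hr1 ?_) (le_of_sq_le hr1 (ht.trans hFr))⟩,
    hb, by rw [hd, hq, hd₀], by rw [hq, hq₀], by rwa [hq]⟩
  · have h1 := hN' t
    have h2 := hE' t
    rw [smoothNumber, h2] at h1
    have h3 : 0 ≤ E := by rw [← h2]; positivity
    have h4 : 0 ≤ E * ((s + 1) * damp (q t) ^ 2) := by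
      have : 0 < s + 1 := by linarith
      positivity
    rw [abs_of_nonneg h3] at hNr
    nlinarith [le_abs_self N]
  · rw [hE' t]
    exact (le_abs_self E).trans hEr

namespace IsCoveringFlow

variable {s N E S : ℝ} {χ : ℝ → ℝ} {b d q : ℝ → ℂ}

theorem energy_nonneg (h : IsCoveringFlow s N E S χ b d q) : 0 ≤ E := by
  rw [← h.energy 0]
  positivity

theorem cutoff_of_lt (h : IsCoveringFlow s N E S χ b d q) {t : ℝ} (ht : ‖q t‖ ^ 2 < FCrit s) :
    χ t = 1 := h.cutoff t (by linarith)

theorem continuous_b (h : IsCoveringFlow s N E S χ b d q) : Continuous b :=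
  continuous_iff_continuousAt.2 fun t => (h.flow.deriv_b t).continuousAt

theorem continuous_d (h : IsCoveringFlow s N E S χ b d q) : Continuous d :=
  continuous_iff_continuousAt.2 fun t => (h.flow.deriv_d t).continuousAt

theorem continuous_q (h : IsCoveringFlow s N E S χ b d q) : Continuous q :=
  continuous_iff_continuousAt.2 fun t => (h.flow.deriv_q t).continuousAt

theorem continuous_F (h : IsCoveringFlow s N E S χ b d q) : Continuous fun t => ‖q t‖ ^ 2 :=
  h.continuous_q.norm.pow 2

theorem velocity_sq (hs : 1 < s) (h : IsCoveringFlow s N E S χ b d q) (t : ℝ) :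
    smoothVelocity s (b t) (d t) (q t) ^ 2 + (potential s N E S).eval (‖q t‖ ^ 2) = 0 := by
  rw [← h.S_eq t, ← h.number t, ← h.energy t]
  exact YHamiltonian.velocity_sq hs _ _ _

theorem norm_b_sq (h : IsCoveringFlow s N E S χ b d q) (t : ℝ) :
    ‖b t‖ ^ 2 = N - (2 - (s - 1) * ‖q t‖ ^ 2) / (2 * (‖q t‖ ^ 2 + 1)) * E := by
  have h0 : 0 < 1 + ‖q t‖ ^ 2 := by positivity
  have h2 := damp_sq (q t)
  have hd2 : damp (q t) ^ 2 = 1 / (1 + ‖q t‖ ^ 2) := by rw [eq_div_iff h0.ne', h2]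
  rw [← h.number t, ← h.energy t, smoothNumber, hd2]
  field_simp
  ring

theorem norm_c_sq (hs : 1 < s) (h : IsCoveringFlow s N E S χ b d q) (t : ℝ) :
    ‖toC s (d t) (q t)‖ ^ 2 = (s + 1) / (2 * (‖q t‖ ^ 2 + 1) ^ (s + 1)) * E := by
  rw [norm_toC_sq hs, h.energy t]

theorem isStrongSolutionOn (hs : 1 < s) (h : IsCoveringFlow s N E S χ b d q) {I : Set ℝ}
    (hI : ∀ t ∈ I, ‖q t‖ ^ 2 < FCrit s) : IsStrongSolutionOn s
      (fun t => manifoldState s (b t) (toC s (d t) (q t)) (toP s (q t))) I :=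
  (h.flow.isManifoldFlowOn hs (fun t ht => h.cutoff_of_lt (hI t ht)) hI).isStrongSolutionOn hs

theorem reducedDynamics (hs : 1 < s) (h : IsCoveringFlow s N E S χ b d q) {I : Set ℝ}
    (hI : ∀ t ∈ I, ‖q t‖ ^ 2 < FCrit s) {α : ℝ → ℕ → ℂ}
    (hα : ∀ t ∈ I, α t = manifoldState s (b t) (toC s (d t) (q t)) (toP s (q t))) :
    ReducedDynamics s N E S I α b (fun t => toC s (d t) (q t)) (fun t => toP s (q t)) :=
  h.flow.reducedDynamics hs (fun t ht => h.cutoff_of_lt (hI t ht)) hI (t₀ := 0) (h.number 0)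
    (h.energy 0) (h.S_eq 0) hα

/-- Without energy, `F` is constant. -/
theorem F_eq_of_energy_eq_zero (h : IsCoveringFlow s N 0 S χ b d q) (t t₀ : ℝ) :
    ‖q t‖ ^ 2 = ‖q t₀‖ ^ 2 := by
  refine eq_of_forall_hasDerivAt_zero (f := fun t => ‖q t‖ ^ 2) (fun t => ?_) t t₀
  refine (h.flow.hasDerivAt_F t).congr_deriv ?_
  have : d t = 0 := by simpa using h.energy t
  simp [smoothVelocity, phaseProd, this]

end IsCoveringFlow

theorem IsStrongSolutionOn.mono {s : ℝ} {α : ℝ → ℕ → ℂ} {I J : Set ℝ}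
    (h : IsStrongSolutionOn s α I) (hJ : J ⊆ I) : IsStrongSolutionOn s α J := by
  obtain ⟨h1, ξ, hξ, h2⟩ := h
  exact ⟨fun t ht n => ⟨(h1 t (hJ ht) n).1, (h1 t (hJ ht) n).2.mono hJ⟩, ξ, hξ,
    fun K hK hc => h2 K (hK.trans hJ) hc⟩

/-- A state with the critical power law `n ^ (-5 / 2)` is not in the Sobolev classes in which the
system is considered. -/
theorem not_summable_sobolevTerm_of_critical {s : ℝ} (hs : 1 < s) {ξ : ℝ} (hξ : 2 < ξ) {C : ℝ}
    (hC : 0 < C) {a : ℕ → ℂ}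
    (ha : ∀ n, ‖a (n + 1)‖ ^ 2 = C * (gSeq s (n + 1) ^ 2 * xCrit s ^ n)) :
    ¬ Summable (sobolevTerm ξ a) := by
  intro h
  have hs0 : 0 < s - 1 := by linarith
  have hx := xCrit_pos hs
  have h1 := ((summable_nat_add_iff 1).2 h).tendsto_atTop_zero
  have h2 := ((tendsto_add_atTop_iff_nat 1).2 (tendsto_fussCatalan_mul hs))
  have h3 := (h1.const_mul (xCrit s * ((s - 1) / 2 + 1) / C))
  rw [mul_zero] at h3
  refine (growthConst_pos hs).not_ge (le_of_tendsto_of_tendsto' h2 h3 fun n => ?_)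
  rw [sobolevTerm, ha, gSeq_sq hs]
  have hA := fussCatalan_pos hs (n + 1)
  push_cast
  have e1 : ((n : ℝ) + 1) ^ (3 / 2 : ℝ) * (n + 1) ≤ ((n : ℝ) + 1 + 1) ^ (2 * ξ) := by
    rw [← Real.rpow_add_one (by positivity)]
    refine (Real.rpow_le_rpow (by positivity) (by linarith : (n : ℝ) + 1 ≤ n + 1 + 1)
      (by norm_num)).trans (Real.rpow_le_rpow_of_exponent_le (by linarith [n.cast_nonneg (α := ℝ)])
      (by linarith))
  have e2 : (s - 1) / 2 * ((n : ℝ) + 1) + 1 ≤ ((s - 1) / 2 + 1) * (n + 1) := by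
    nlinarith [n.cast_nonneg (α := ℝ)]
  have e3 : 0 < (s - 1) / 2 * ((n : ℝ) + 1) + 1 := by positivity
  have e4 : xCrit s * ((s - 1) / 2 + 1) / C * (((n : ℝ) + 1 + 1) ^ (2 * ξ) *
      (C * (fussCatalan s (n + 1) / ((s - 1) / 2 * (n + 1) + 1) * xCrit s ^ n))) =
      fussCatalan s (n + 1) * xCrit s ^ (n + 1) * (((n : ℝ) + 1 + 1) ^ (2 * ξ) *
        ((s - 1) / 2 + 1) / ((s - 1) / 2 * (n + 1) + 1)) := by
    rw [pow_succ]
    field_simp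
  rw [e4]
  refine mul_le_mul_of_nonneg_left ?_ (by positivity)
  rw [le_div_iff₀ e3]
  calc _ ≤ ((n : ℝ) + 1) ^ (3 / 2 : ℝ) * (((s - 1) / 2 + 1) * (n + 1)) := by gcongr
    _ = ((n : ℝ) + 1) ^ (3 / 2 : ℝ) * (n + 1) * ((s - 1) / 2 + 1) := by ring
    _ ≤ _ := by gcongr

theorem continuous_damp : Continuous damp := contDiff_damp.continuous

theorem continuous_damp_rpow (s : ℝ) : Continuous fun q => damp q ^ s :=
  continuous_damp.rpow_const fun q => Or.inl (damp_pos q).ne'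

theorem IsCoveringFlow.continuous_toC {s N E S : ℝ} {χ : ℝ → ℝ} {b d q : ℝ → ℂ}
    (h : IsCoveringFlow s N E S χ b d q) : Continuous fun t => toC s (d t) (q t) := by
  have h1 := continuous_damp.comp h.continuous_q
  have h2 := (continuous_damp_rpow s).comp h.continuous_q
  exact (Complex.continuous_ofReal.comp ((continuous_const.mul h1).mul h2)).mul h.continuous_d

theorem IsCoveringFlow.continuous_toP {s N E S : ℝ} {χ : ℝ → ℝ} {b d q : ℝ → ℂ}
    (h : IsCoveringFlow s N E S χ b d q) : Continuous fun t => toP s (q t) := by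
  have h2 := (continuous_damp_rpow s).comp h.continuous_q
  exact (Complex.continuous_ofReal.comp h2).mul h.continuous_q

/-- A strong solution that starts on the manifold cannot reach `F = F_c`. -/
theorem IsCoveringFlow.lt_of_isStrongSolutionOn {s N E S : ℝ} (hs : 1 < s) {χ : ℝ → ℝ}
    {b d q : ℝ → ℂ} (h : IsCoveringFlow s N E S χ b d q) {I : Set ℝ} (hI : I.OrdConnected)
    {α : ℝ → ℕ → ℂ} (hα : IsStrongSolutionOn s α I) {t₀ : ℝ} (ht₀ : t₀ ∈ I)
    (h0 : α t₀ = manifoldState s (b t₀) (toC s (d t₀) (q t₀)) (toP s (q t₀)))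
    (hq0 : ‖q t₀‖ ^ 2 < FCrit s) {t : ℝ} (ht : t ∈ I) : ‖q t‖ ^ 2 < FCrit s := by
  by_contra! hge
  have hcont : Continuous fun θ : ℝ => ‖q (AffineMap.lineMap t₀ t θ)‖ ^ 2 :=
    h.continuous_F.comp AffineMap.lineMap_continuous
  -- the first parameter on the segment from `t₀` to `t` at which `F` reaches `F_c`
  obtain ⟨θ, ⟨⟨hθ0, hθ1⟩, hθ⟩, hmin⟩ :=
    (isCompact_Icc.inter_right (isClosed_le continuous_const hcont)).exists_isLeast
      (s := Set.Icc (0 : ℝ) 1 ∩ {θ | FCrit s ≤ ‖q (AffineMap.lineMap t₀ t θ)‖ ^ 2})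
      ⟨1, ⟨zero_le_one, le_rfl⟩, by simpa using hge⟩
  set T := AffineMap.lineMap t₀ t θ with hT
  have hTI : T ∈ I := hI.convex.lineMap_mem ht₀ ht ⟨hθ0, hθ1⟩
  set J : Set ℝ := AffineMap.lineMap t₀ t '' Set.Ico 0 θ with hJ
  have hθpos : 0 < θ := by
    rcases hθ0.eq_or_lt with h1 | h1
    · rw [← h1, Set.mem_ofPred_eq, AffineMap.lineMap_apply_zero] at hθ
      linarith
    · exact h1
  have hJo : J.OrdConnected := ((convex_Ico (0 : ℝ) θ).affine_image _).ordConnected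
  have hJI : J ⊆ I := by
    rintro _ ⟨τ, hτ, rfl⟩
    exact hI.convex.lineMap_mem ht₀ ht ⟨hτ.1, (hτ.2.le).trans hθ1⟩
  have hJq : ∀ τ ∈ J, ‖q τ‖ ^ 2 < FCrit s := by
    rintro _ ⟨τ, hτ, rfl⟩
    by_contra! hcon
    exact absurd (hmin ⟨⟨hτ.1, (hτ.2.le).trans hθ1⟩, hcon⟩) (not_le.2 hτ.2)
  have ht₀J : t₀ ∈ J := ⟨0, ⟨le_rfl, hθpos⟩, by simp⟩
  have hTJ : (𝓝[J] T).NeBot := by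
    rw [← mem_closure_iff_nhdsWithin_neBot]
    have h1 : θ ∈ closure (Set.Ico 0 θ) := by
      rw [closure_Ico hθpos.ne]
      exact ⟨hθ0, le_rfl⟩
    exact map_mem_closure (f := fun τ : ℝ => AffineMap.lineMap t₀ t τ)
      AffineMap.lineMap_continuous h1 fun x hx => ⟨x, hx, rfl⟩
  have heq : ∀ τ ∈ J, α τ = manifoldState s (b τ) (toC s (d τ) (q τ)) (toP s (q τ)) :=
    fun τ hτ => (hα.mono hJI).eq_of_eq hs hJo (h.isStrongSolutionOn hs hJq) ht₀J h0 hτ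
  have hFT : ‖q T‖ ^ 2 = FCrit s := by
    refine le_antisymm ?_ hθ
    exact le_of_tendsto (h.continuous_F.continuousWithinAt (s := J))
      (eventually_mem_nhdsWithin.mono fun τ hτ => (hJq τ hτ).le)
  have hE : 0 < E := by
    rcases h.energy_nonneg.eq_or_lt with h1 | h1
    · subst h1
      rw [h.F_eq_of_energy_eq_zero T t₀] at hFT
      linarith
    · exact h1
  have hlim : ∀ n, ‖α T (n + 1)‖ ^ 2 =
      ‖toC s (d T) (q T)‖ ^ 2 * (gSeq s (n + 1) ^ 2 * xCrit s ^ n) := fun n => by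
    have h1 : Tendsto (fun τ => ‖α τ (n + 1)‖ ^ 2) (𝓝[J] T) (𝓝 (‖α T (n + 1)‖ ^ 2)) :=
      (((hα.1 T hTI (n + 1)).2.continuousWithinAt.mono hJI).norm.pow 2)
    have h2 : Continuous fun τ => ‖toC s (d τ) (q τ)‖ ^ 2 *
        (gSeq s (n + 1) ^ 2 * (‖toP s (q τ)‖ ^ 2) ^ n) :=
      (h.continuous_toC.norm.pow 2).mul (continuous_const.mul
        ((h.continuous_toP.norm.pow 2).pow n))
    have h3 := (h2.continuousWithinAt (s := J) (x := T)).tendsto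
    have h4 := h3.congr' (f₂ := fun τ => ‖α τ (n + 1)‖ ^ 2)
      (eventually_mem_nhdsWithin.mono fun τ hτ => by
        simp only [heq τ hτ, norm_manifoldState_succ_sq])
    rw [tendsto_nhds_unique h1 h4, norm_toP_sq, hFT, invF_FCrit hs]
  have hc : 0 < ‖toC s (d T) (q T)‖ ^ 2 := by
    rw [h.norm_c_sq hs]
    have : 0 < s + 1 := by linarith
    have : 0 < (‖q T‖ ^ 2 + 1) ^ (s + 1) := Real.rpow_pos_of_pos (by positivity) _
    positivity
  obtain ⟨ξ, hξ, hsum⟩ := hα.2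
  obtain ⟨R, hR⟩ := hsum {T} (by simpa using hTI) isCompact_singleton
  exact not_summable_sobolevTerm_of_critical hs hξ hc hlim (hR T rfl).1

theorem particleNumber_manifoldState {s : ℝ} (hs : 1 < s) (b c : ℂ) {p : ℂ}
    (hp : ‖p‖ ^ 2 ≤ xCrit s) :
    particleNumber (manifoldState s b c p) = manifoldNumber s b c p :=
  (hasSum_number hs b c p hp).tsum_eq

theorem energy_manifoldState {s : ℝ} (hs : 1 < s) (b c : ℂ) {p : ℂ} (hp : ‖p‖ ^ 2 ≤ xCrit s) :
    energy (manifoldState s b c p) = manifoldEnergy s c p :=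
  (hasSum_energy hs b c p hp).tsum_eq

/-- The manifold is invariant. -/
theorem exists_reducedDynamics {s : ℝ} (hs : 1 < s) (I : Set ℝ) (t₀ : ℝ) (α : ℝ → ℕ → ℂ)
    (b₀ c₀ p₀ : ℂ) (hI : I.OrdConnected) (ht₀ : t₀ ∈ I) (hα : IsStrongSolutionOn s α I)
    (hp : ‖p₀‖ ^ 2 < xCrit s) (h0 : α t₀ = manifoldState s b₀ c₀ p₀) :
    ∃ b c p : ℝ → ℂ, b t₀ = b₀ ∧ c t₀ = c₀ ∧ p t₀ = p₀ ∧
      ReducedDynamics s (particleNumber (α t₀)) (energy (α t₀))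
        (quantityS s (particleNumber (α t₀)) (energy (α t₀)) b₀ c₀ p₀) I α b c p := by
  have hN : manifoldNumber s b₀ c₀ p₀ = particleNumber (α t₀) := by
    rw [h0, particleNumber_manifoldState hs _ _ hp.le]
  have hE : manifoldEnergy s c₀ p₀ = energy (α t₀) := by
    rw [h0, energy_manifoldState hs _ _ hp.le]
  obtain ⟨χ, b, d, q, h, hb, hc, hpq, hq⟩ := exists_coveringFlow hs t₀ b₀ c₀ hp hN hE rfl
  have h0' : α t₀ = manifoldState s (b t₀) (toC s (d t₀) (q t₀)) (toP s (q t₀)) := by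
    rw [h0, hb, hc, hpq]
  have hlt : ∀ t ∈ I, ‖q t‖ ^ 2 < FCrit s := fun t ht =>
    h.lt_of_isStrongSolutionOn hs hI hα ht₀ h0' hq ht
  exact ⟨b, _, _, hb, hc, hpq, h.reducedDynamics hs hlt fun t ht =>
    hα.eq_of_eq hs hI (h.isStrongSolutionOn hs hlt) ht₀ h0' ht⟩


/-! ### The sign of the potential -/

theorem FCrit_add_one {s : ℝ} (hs : 1 < s) : FCrit s + 1 = s / (s - 1) := by
  have : s - 1 ≠ 0 := by linarith
  rw [FCrit]
  field_simp
  ring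

/-- As a function of `S`, the critical value of the potential is a quadratic polynomial with the
roots `S_-` and `S_+`. -/
theorem potential_eval_FCrit {s : ℝ} (hs : 1 < s) {N E : ℝ} (S : ℝ) (hE : 0 ≤ E)
    (hEc : E ≤ ECrit s N) :
    (potential s N E S).eval (FCrit s) = (s ^ 2 / ((s - 1) ^ 2 * (s + 1))) ^ 2 *
      ((S - SMinus s N E) * (S - SPlus s N E)) := by
  have h0 : 0 < s - 1 := by linarith
  have hrad : 0 ≤ (s + 1) ^ 3 / FCrit s * E * (ECrit s N - E) := by
    have := FCrit_pos hs
    have : 0 ≤ ECrit s N - E := by linarith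
    have : 0 < s + 1 := by linarith
    positivity
  have hsq := Real.sq_sqrt hrad
  rw [potential_eval hs, SMinus, SPlus]
  generalize √((s + 1) ^ 3 / FCrit s * E * (ECrit s N - E)) = r at hsq ⊢
  have e : (S - (s - 1) / s ^ 2 * (s * (2 * s + 1) * N + (-4 * s ^ 2 + s + 3) / 4 * E - r)) *
      (S - (s - 1) / s ^ 2 * (s * (2 * s + 1) * N + (-4 * s ^ 2 + s + 3) / 4 * E + r)) =
      (S - (s - 1) / s ^ 2 * (s * (2 * s + 1) * N + (-4 * s ^ 2 + s + 3) / 4 * E)) ^ 2 -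
        ((s - 1) / s ^ 2) ^ 2 * r ^ 2 := by ring
  have hs0 : s ≠ 0 := by linarith
  have hs1 : s + 1 ≠ 0 := by linarith
  rw [e, hsq, potR, potL, FCrit, ECrit]
  field_simp
  ring

theorem SMinus_le_SPlus {s : ℝ} (hs : 1 < s) (N E : ℝ) : SMinus s N E ≤ SPlus s N E := by
  have h0 : 0 < s - 1 := by linarith
  unfold SMinus SPlus
  gcongr
  linarith [Real.sqrt_nonneg ((s + 1) ^ 3 / FCrit s * E * (ECrit s N - E))]

/-- The sign of `V(F_c)` in terms of `S`. -/
theorem potential_sign {s : ℝ} (hs : 1 < s) (N E S : ℝ) (hE : 0 ≤ E) (hEc : E ≤ ECrit s N) :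
    ((potential s N E S).eval (FCrit s) = 0 ↔ S = SMinus s N E ∨ S = SPlus s N E) ∧
      ((potential s N E S).eval (FCrit s) < 0 ↔ S ∈ Set.Ioo (SMinus s N E) (SPlus s N E)) := by
  have h0 : 0 < s - 1 := by linarith
  have hs1 : 0 < s + 1 := by linarith
  have hs2 : 0 < s := by linarith
  have hc : 0 < (s ^ 2 / ((s - 1) ^ 2 * (s + 1))) ^ 2 := by positivity
  have hle := SMinus_le_SPlus hs N E
  rw [potential_eval_FCrit hs S hE hEc]
  constructor
  · rw [mul_eq_zero, or_iff_right hc.ne', mul_eq_zero, sub_eq_zero, sub_eq_zero]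
  · rw [← neg_pos, ← mul_neg, mul_pos_iff_of_pos_left hc, neg_pos, Set.mem_Ioo, mul_neg_iff]
    constructor
    · rintro (⟨h1, h2⟩ | ⟨h1, h2⟩) <;> constructor <;> linarith
    · rintro ⟨h1, h2⟩
      exact Or.inl ⟨by linarith, by linarith⟩

/-- The unphysical point `F = -1` is a node at which the sign of `V` does not depend on the data. -/
theorem potential_eval_neg_one {s : ℝ} (hs : 1 < s) (N E S : ℝ) :
    (potential s N E S).eval (-1) = -(7 / 16 * (s + 1) ^ 2 * E ^ 2) := by
  have hs1 : s + 1 ≠ 0 := by linarith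
  rw [potential_eval hs, potR, potL]
  field_simp
  ring

/-- Together with the negative value at `-1`, the nonnegative value at `0` forces a root of `V` in
`(-1, 0]`, which leaves at most three roots above. -/
theorem potential_eval_zero {s : ℝ} (hs : 1 < s) (N E S : ℝ) :
    (potential s N E S).eval 0 = (E * (2 * s + 1) - 2 * N * s + S) ^ 2 / (s + 1) ^ 2 := by
  rw [potential_eval hs, potR, potL]
  have hs1 : s + 1 ≠ 0 := by linarith
  field_simp
  ring

/-- The factor `w` in `V(x) = V(f) + V'(f) (x - f) + (x - f) ^ 2 w(x)`. -/
noncomputable def potTail (s N E S f x : ℝ) : ℝ :=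
  potCoeff s N E S 4 * x ^ 2 + (potCoeff s N E S 3 + 2 * potCoeff s N E S 4 * f) * x +
    (potCoeff s N E S 2 + 2 * potCoeff s N E S 3 * f + 3 * potCoeff s N E S 4 * f ^ 2)

theorem potential_taylor (s N E S f x : ℝ) :
    (potential s N E S).eval x = (potential s N E S).eval f +
      (potential s N E S).derivative.eval f * (x - f) + (x - f) ^ 2 * potTail s N E S f x := by
  have h : (potential s N E S).derivative.eval f = potCoeff s N E S 1 +
      2 * potCoeff s N E S 2 * f + 3 * potCoeff s N E S 3 * f ^ 2 +
      4 * potCoeff s N E S 4 * f ^ 3 := by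
    simp [potential, Fin.sum_univ_five]
    ring
  rw [h, potential_eval_eq_sum, potential_eval_eq_sum, potTail]
  ring

theorem potCoeff_four_nonneg (s N E S : ℝ) : 0 ≤ potCoeff s N E S 4 := by
  simp only [potCoeff, Matrix.cons_val]
  positivity

/-- Convexity of the quadratic tail, at the nodes `-1`, `0`, `y`. -/
theorem potTail_convex (s N E S f : ℝ) {y : ℝ} (hy : 0 ≤ y) :
    (1 + y) * potTail s N E S f 0 ≤ y * potTail s N E S f (-1) + potTail s N E S f y := by
  have h := potCoeff_four_nonneg s N E S
  have : y * potTail s N E S f (-1) + potTail s N E S f y - (1 + y) * potTail s N E S f 0 =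
      potCoeff s N E S 4 * (y * (1 + y)) := by
    unfold potTail
    ring
  have : 0 ≤ potCoeff s N E S 4 * (y * (1 + y)) := by positivity
  linarith

/-- The potential is negative between a point where it is negative and `F_c`, if it is nonpositive
at `F_c`: otherwise its fourth divided difference at `-1`, `0`, `x`, `y`, `F_c` would be negative,
while it is the leading coefficient. -/
theorem potential_neg_of_lt {s : ℝ} (hs : 1 < s) {N E S x y z : ℝ} (hE : 0 < E) (hx0 : 0 ≤ x)
    (hx : (potential s N E S).eval x < 0) (hxy : x < y) (hyz : y < z)
    (hz : (potential s N E S).eval z ≤ 0) : (potential s N E S).eval y < 0 := by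
  by_contra! hy
  have hm : (potential s N E S).eval (-1) < 0 := by
    rw [potential_eval_neg_one hs]
    have : 0 < s + 1 := by linarith
    have : 0 < 7 / 16 * (s + 1) ^ 2 * E ^ 2 := by positivity
    linarith
  have h0 : 0 ≤ (potential s N E S).eval 0 := by
    rw [potential_eval_zero hs]
    positivity
  have hx0' : 0 < x := by
    rcases hx0.eq_or_lt with h | h
    · rw [← h] at hx
      linarith
    · exact h
  have hc := potCoeff_four_nonneg s N E S
  have hid : (potential s N E S).eval (-1) * (x * y * z * (y - x) * (z - x) * (z - y)) -
      (potential s N E S).eval 0 * ((1 + x) * (1 + y) * (1 + z) * (y - x) * (z - x) * (z - y)) +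
      (potential s N E S).eval x * ((1 + y) * (1 + z) * y * z * (z - y)) -
      (potential s N E S).eval y * ((1 + x) * (1 + z) * x * z * (z - x)) +
      (potential s N E S).eval z * ((1 + x) * (1 + y) * x * y * (y - x)) =
      potCoeff s N E S 4 * (x * y * z * (y - x) * (z - x) * (z - y) * (1 + x) * (1 + y) *
        (1 + z)) := by
    simp only [potential_eval_eq_sum]
    ring
  have hyx : 0 < y - x := by linarith
  have hzx : 0 < z - x := by linarith
  have hzy : 0 < z - y := by linarith
  have hy0 : 0 < y := by linarith
  have hz0 : 0 < z := by linarith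
  have a1 : (potential s N E S).eval (-1) * (x * y * z * (y - x) * (z - x) * (z - y)) < 0 :=
    mul_neg_of_neg_of_pos hm (by positivity)
  have a2 : 0 ≤ (potential s N E S).eval 0 *
      ((1 + x) * (1 + y) * (1 + z) * (y - x) * (z - x) * (z - y)) := by positivity
  have a3 : (potential s N E S).eval x * ((1 + y) * (1 + z) * y * z * (z - y)) ≤ 0 :=
    mul_nonpos_of_nonpos_of_nonneg hx.le (by positivity)
  have a4 : 0 ≤ (potential s N E S).eval y * ((1 + x) * (1 + z) * x * z * (z - x)) := by
    positivity
  have a5 : (potential s N E S).eval z * ((1 + x) * (1 + y) * x * y * (y - x)) ≤ 0 :=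
    mul_nonpos_of_nonpos_of_nonneg hz (by positivity)
  have a6 : 0 ≤ potCoeff s N E S 4 * (x * y * z * (y - x) * (z - x) * (z - y) * (1 + x) *
      (1 + y) * (1 + z)) := by positivity
  linarith

/-- The potential has no double root below `F_c`, if it is nonpositive at `F_c`. -/
theorem not_double_root {s : ℝ} (hs : 1 < s) {N E S f z : ℝ} (hE : 0 < E) (hf0 : 0 ≤ f)
    (hfz : f < z) (hz : (potential s N E S).eval z ≤ 0) (hf : (potential s N E S).eval f = 0) :
    (potential s N E S).derivative.eval f ≠ 0 := by
  intro hf'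
  have hs1 : 0 < s + 1 := by linarith
  have ht := fun x => potential_taylor s N E S f x
  simp only [hf, hf', zero_mul, add_zero, zero_add] at ht
  have hzf : 0 < (z - f) ^ 2 := by
    have : 0 < z - f := by linarith
    positivity
  have hwz : potTail s N E S f z ≤ 0 := by
    rw [ht z] at hz
    exact nonpos_of_mul_nonpos_right hz hzf
  rcases hf0.eq_or_lt with h | h
  · subst h
    have hD : E * (2 * s + 1) - 2 * N * s + S = 0 := by
      rw [potential_eval_zero hs, div_eq_zero_iff] at hf
      rcases hf with hf | hf
      · exact pow_eq_zero_iff (two_ne_zero) |>.1 hf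
      · exact absurd hf (by positivity)
    have hEN : E = N := by
      rw [potential_derivative_eval hs, potR, potL', hD] at hf'
      have h1 : (s + 1) * E * (E - N) = 0 := by linear_combination hf' / 2
      have h2 := (mul_eq_zero.1 h1).resolve_left (by positivity)
      linarith
    subst hEN
    obtain rfl : S = -E := by linarith
    have e : potTail s E E (-E) 0 z = (s + 1) ^ 2 * E ^ 2 * (z / 2 + z ^ 2 / 16) := by
      simp only [potTail, potCoeff, Matrix.cons_val]
      field_simp
      ring
    have : 0 < (s + 1) ^ 2 * E ^ 2 * (z / 2 + z ^ 2 / 16) := by positivity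
    linarith
  · have h1 := ht (-1)
    have h2 := ht 0
    rw [potential_eval_neg_one hs] at h1
    rw [potential_eval_zero hs] at h2
    have hw1 : potTail s N E S f (-1) < 0 := by
      by_contra! hcon
      have : 0 < 7 / 16 * (s + 1) ^ 2 * E ^ 2 := by positivity
      have : 0 ≤ (-1 - f) ^ 2 * potTail s N E S f (-1) := by positivity
      linarith
    have hw2 : 0 ≤ potTail s N E S f 0 := by
      have h3 : 0 ≤ (0 - f) ^ 2 * potTail s N E S f 0 := by
        rw [← h2]
        positivity
      exact nonneg_of_mul_nonneg_right h3 (by rw [zero_sub, neg_sq]; positivity)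
    have hz0 : 0 < z := by linarith
    have := potTail_convex s N E S f hz0.le
    nlinarith

/-- A double root at `F_c` is a local minimum. -/
theorem potTail_pos_of_double_root {s : ℝ} (hs : 1 < s) {N E S z : ℝ} (hE : 0 < E) (hz0 : 0 < z)
    (hz : (potential s N E S).eval z = 0)
    (hz' : (potential s N E S).derivative.eval z = 0) : 0 < potTail s N E S z z := by
  have hs1 : 0 < s + 1 := by linarith
  have ht := fun x => potential_taylor s N E S z x
  simp only [hz, hz', zero_mul, add_zero, zero_add] at ht
  have h1 := ht (-1)
  have h2 := ht 0
  rw [potential_eval_neg_one hs] at h1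
  rw [potential_eval_zero hs] at h2
  have hw1 : potTail s N E S z (-1) < 0 := by
    by_contra! hcon
    have : 0 < 7 / 16 * (s + 1) ^ 2 * E ^ 2 := by positivity
    have : 0 ≤ (-1 - z) ^ 2 * potTail s N E S z (-1) := by positivity
    linarith
  have hw2 : 0 ≤ potTail s N E S z 0 := by
    have h3 : 0 ≤ (0 - z) ^ 2 * potTail s N E S z 0 := by
      rw [← h2]
      positivity
    exact nonneg_of_mul_nonneg_right h3 (by rw [zero_sub, neg_sq]; positivity)
  have := potTail_convex s N E S z hz0.le
  nlinarith

/-- If the potential is positive at `F_c`, or vanishes there without being increasing, then it is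
positive immediately below `F_c`. -/
theorem exists_potential_pos {s : ℝ} (hs : 1 < s) {N E S z : ℝ} (hE : 0 < E) (hz0 : 0 < z)
    (h : 0 < (potential s N E S).eval z ∨ ((potential s N E S).eval z = 0 ∧
      (potential s N E S).derivative.eval z ≤ 0)) :
    ∃ ε > 0, ∀ x ∈ Set.Ioo (z - ε) z, 0 < (potential s N E S).eval x := by
  suffices h' : ∀ᶠ x in 𝓝[<] z, 0 < (potential s N E S).eval x by
    obtain ⟨l, hl, hl'⟩ := (mem_nhdsLT_iff_exists_Ioo_subset' (show z - 1 < z by linarith)).1 h'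
    rw [Set.mem_Iio] at hl
    exact ⟨z - l, by linarith, fun x hx => hl' (by simpa using hx)⟩
  have hcw : Continuous fun x => (potential s N E S).derivative.eval z +
      (x - z) * potTail s N E S z x := by
    unfold potTail
    fun_prop
  rcases h with h | ⟨h1, h2⟩
  · exact nhdsWithin_le_nhds ((potential s N E S).continuous.continuousAt.eventually_const_lt h)
  · have ht := fun x => potential_taylor s N E S z x
    rcases h2.eq_or_lt with h3 | h3
    · have hw := potTail_pos_of_double_root hs hE hz0 h1 h3
      have hcw' : Continuous fun x => potTail s N E S z x := by
        unfold potTail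
        fun_prop
      filter_upwards [nhdsWithin_le_nhds (hcw'.continuousAt.eventually_const_lt hw),
        self_mem_nhdsWithin] with x hx hxz
      rw [ht x, h1, h3]
      rw [Set.mem_Iio] at hxz
      have : 0 < (x - z) ^ 2 := by
        have : x - z ≠ 0 := by linarith
        positivity
      have := mul_pos this hx
      linarith
    · have h4 : (potential s N E S).derivative.eval z + (z - z) * potTail s N E S z z < 0 := by
        simpa using h3
      filter_upwards [nhdsWithin_le_nhds (hcw.continuousAt.eventually_lt_const h4),
        self_mem_nhdsWithin] with x hx hxz
      rw [ht x, h1]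
      rw [Set.mem_Iio] at hxz
      have : 0 < (z - x) * -((potential s N E S).derivative.eval z +
          (x - z) * potTail s N E S z x) := mul_pos (by linarith) (by linarith)
      linarith

/-- If the potential is negative at `F_c`, or vanishes there and is increasing, and is negative at a
point `x` below, then it is bounded by a negative multiple of the distance to `F_c`. -/
theorem exists_potential_le {s : ℝ} (hs : 1 < s) {N E S x z : ℝ} (hE : 0 < E) (hx0 : 0 ≤ x)
    (hx : (potential s N E S).eval x < 0) (hxz : x < z)
    (h : (potential s N E S).eval z < 0 ∨ ((potential s N E S).eval z = 0 ∧
      0 < (potential s N E S).derivative.eval z)) :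
    ∃ δ > 0, ∀ y ∈ Set.Icc x z, (potential s N E S).eval y ≤ -(δ * (z - y)) := by
  have hz : (potential s N E S).eval z ≤ 0 := by
    rcases h with h | h
    exacts [h.le, h.1.le]
  have hneg : ∀ y ∈ Set.Ico x z, (potential s N E S).eval y < 0 := fun y hy => by
    rcases hy.1.eq_or_lt with h1 | h1
    · rwa [← h1]
    · exact potential_neg_of_lt hs hE hx0 hx h1 hy.2 hz
  rcases h with h | ⟨h1, h2⟩
  · obtain ⟨y0, hy0, hmax⟩ := isCompact_Icc.exists_isMaxOn ⟨x, ⟨le_rfl, hxz.le⟩⟩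
      ((potential s N E S).continuous.continuousOn (s := Set.Icc x z))
    have hneg' : (potential s N E S).eval y0 < 0 := by
      rcases hy0.2.eq_or_lt with h1 | h1
      · rwa [h1]
      · exact hneg y0 ⟨hy0.1, h1⟩
    refine ⟨-(potential s N E S).eval y0 / (z - x), div_pos (by linarith) (by linarith),
      fun y hy => (hmax hy).trans ?_⟩
    rw [div_mul_eq_mul_div, ← neg_div, le_div_iff₀ (by linarith)]
    have : z - y ≤ z - x := by linarith [hy.1]
    nlinarith
  · have hcw : Continuous fun x => (potential s N E S).derivative.eval z +
        (x - z) * potTail s N E S z x := by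
      unfold potTail
      fun_prop
    obtain ⟨y0, hy0, hmin⟩ := isCompact_Icc.exists_isMinOn ⟨x, ⟨le_rfl, hxz.le⟩⟩
      (hcw.continuousOn (s := Set.Icc x z))
    have ht : ∀ y, (potential s N E S).eval y = -(((potential s N E S).derivative.eval z +
        (y - z) * potTail s N E S z y) * (z - y)) := fun y => by
      rw [potential_taylor s N E S z y, h1]
      ring
    refine ⟨(potential s N E S).derivative.eval z + (y0 - z) * potTail s N E S z y0, ?_,
      fun y hy => ?_⟩
    rotate_left
    · rw [ht y]
      have := hmin hy
      have h3 : 0 ≤ z - y := by linarith [hy.2]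
      have := mul_le_mul_of_nonneg_right this h3
      simpa using this
    · rcases hy0.2.eq_or_lt with h3 | h3
      · rw [h3]
        simpa using h2
      · have := hneg y0 ⟨hy0.1, h3⟩
        rw [ht y0] at this
        have h4 : 0 < ((potential s N E S).derivative.eval z + (y0 - z) * potTail s N E S z y0) *
            (z - y0) := by linarith
        exact (pos_iff_pos_of_mul_pos h4).2 (by linarith)


/-! ### The time evolution of `F` -/

/-- A function whose derivative is eventually at most `-m < 0` tends to `-∞`. -/
theorem tendsto_atBot_of_deriv_le {g g' : ℝ → ℝ} {m : ℝ} (hm : 0 < m)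
    (h : ∀ᶠ t in atTop, HasDerivAt g (g' t) t ∧ g' t ≤ -m) : Tendsto g atTop atBot := by
  obtain ⟨t1, ht1⟩ := eventually_atTop.1 h
  have hle : ∀ t ≥ t1, g t ≤ g t1 + -m * (t - t1) := fun t ht => by
    have h1 := (convex_Ici t1).image_sub_le_mul_sub_of_deriv_le (f := g) (C := -m)
      (fun τ hτ => (ht1 τ hτ).1.continuousAt.continuousWithinAt)
      (fun τ hτ => (ht1 τ (interior_subset hτ)).1.differentiableAt.differentiableWithinAt)
      (fun τ hτ => by
        rw [(ht1 τ (interior_subset hτ)).1.deriv]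
        exact (ht1 τ (interior_subset hτ)).2) t1 Set.self_mem_Ici t ht ht
    linarith
  refine tendsto_atBot_mono' _ (eventually_atTop.2 ⟨t1, hle⟩) ?_
  refine tendsto_atBot_add_const_left _ _ ?_
  exact (tendsto_atTop_add_const_right _ _ tendsto_id).const_mul_atTop_of_neg (by linarith)

theorem tendsto_atTop_of_le_deriv {g g' : ℝ → ℝ} {m : ℝ} (hm : 0 < m)
    (h : ∀ᶠ t in atTop, HasDerivAt g (g' t) t ∧ m ≤ g' t) : Tendsto g atTop atTop := by
  have := tendsto_atBot_of_deriv_le (g := fun t => -g t) (g' := fun t => -g' t) hm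
    (h.mono fun t ht => ⟨ht.1.neg, by linarith [ht.2]⟩)
  simpa using tendsto_neg_atBot_iff.1 this

namespace IsCoveringFlow

variable {s N E S : ℝ} {χ : ℝ → ℝ} {b d q : ℝ → ℂ}

theorem number_nonneg_of_energy_eq_zero (h : IsCoveringFlow s N 0 S χ b d q) : 0 ≤ N := by
  have := h.norm_b_sq 0
  rw [mul_zero, sub_zero] at this
  rw [← this]
  positivity

theorem energy_lt (hs : 1 < s) (h : IsCoveringFlow s N E S χ b d q) (hE : 0 < E) {t : ℝ}
    (ht : ‖q t‖ ^ 2 < FCrit s) : E < ECrit s N := by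
  have h1 := h.norm_b_sq t
  have h0 : 0 < s - 1 := by linarith
  have hF : 0 ≤ ‖q t‖ ^ 2 := by positivity
  have h2 : 0 ≤ ‖b t‖ ^ 2 := by positivity
  rw [FCrit, lt_div_iff₀ h0] at ht
  generalize ‖q t‖ ^ 2 = F at *
  have h3 : (s - 1) / (2 * s) < (2 - (s - 1) * F) / (2 * (F + 1)) := by
    rw [div_lt_div_iff₀ (by linarith) (by linarith)]
    nlinarith
  have h4 := mul_lt_mul_of_pos_right h3 hE
  have h5 : (s - 1) / (2 * s) * E < N := by linarith
  rw [div_mul_eq_mul_div, div_lt_iff₀ (by linarith)] at h5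
  rw [ECrit, lt_div_iff₀ h0]
  linarith

theorem energy_le (hs : 1 < s) (h : IsCoveringFlow s N E S χ b d q) {t : ℝ}
    (ht : ‖q t‖ ^ 2 < FCrit s) : E ≤ ECrit s N := by
  rcases h.energy_nonneg.eq_or_lt with h1 | h1
  · subst h1
    have := h.number_nonneg_of_energy_eq_zero
    have h0 : 0 < s - 1 := by linarith
    unfold ECrit
    positivity
  · exact (h.energy_lt hs h1 ht).le

theorem hasDerivAt_F (h : IsCoveringFlow s N E S χ b d q) {t : ℝ}
    (ht : ‖q t‖ ^ 2 ≤ FCrit s + 1) :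
    HasDerivAt (fun τ => ‖q τ‖ ^ 2) (smoothVelocity s (b t) (d t) (q t)) t := by
  have := h.flow.hasDerivAt_F t
  rwa [h.cutoff t ht, one_mul] at this

theorem hasDerivAt_velocity (hs : 1 < s) (h : IsCoveringFlow s N E S χ b d q) {t : ℝ}
    (ht : ‖q t‖ ^ 2 ≤ FCrit s + 1) :
    HasDerivAt (fun τ => smoothVelocity s (b τ) (d τ) (q τ))
      (-(potential s N E S).derivative.eval (‖q t‖ ^ 2) / 2) t := by
  have := h.flow.hasDerivAt_velocity hs t (h.number t) (h.energy t) (h.S_eq t)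
  rwa [h.cutoff t ht, one_mul] at this

theorem continuous_velocity (hs : 1 < s) (h : IsCoveringFlow s N E S χ b d q) :
    Continuous fun t => smoothVelocity s (b t) (d t) (q t) :=
  continuous_iff_continuousAt.2 fun t =>
    (h.flow.hasDerivAt_velocity hs t (h.number t) (h.energy t) (h.S_eq t)).continuousAt

theorem potential_nonpos (hs : 1 < s) (h : IsCoveringFlow s N E S χ b d q) (t : ℝ) :
    (potential s N E S).eval (‖q t‖ ^ 2) ≤ 0 := by
  nlinarith [h.velocity_sq hs t, sq_nonneg (smoothVelocity s (b t) (d t) (q t))]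

/-- If `F` increases at some time and stays below `F_c`, then `(F_c - F) ^ (1 / 2)` decreases at a
uniform rate, which is impossible. -/
theorem not_velocity_pos (hs : 1 < s) (h : IsCoveringFlow s N E S χ b d q) (hE : 0 < E)
    (hV : (potential s N E S).eval (FCrit s) < 0 ∨ ((potential s N E S).eval (FCrit s) = 0 ∧
      0 < (potential s N E S).derivative.eval (FCrit s))) {t₁ : ℝ}
    (hlt : ∀ t ≥ t₁, ‖q t‖ ^ 2 < FCrit s) : smoothVelocity s (b t₁) (d t₁) (q t₁) ≤ 0 := by
  by_contra! hpos
  have hVt := h.velocity_sq hs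
  have hneg : (potential s N E S).eval (‖q t₁‖ ^ 2) < 0 := by nlinarith [hVt t₁]
  obtain ⟨δ, hδ, hle⟩ := exists_potential_le hs hE (by positivity) hneg (hlt t₁ le_rfl) hV
  have hder : ∀ t ≥ t₁, HasDerivAt (fun τ => ‖q τ‖ ^ 2) (smoothVelocity s (b t) (d t) (q t)) t :=
    fun t ht => h.hasDerivAt_F (by linarith [hlt t ht])
  have hmono : ∀ t ≥ t₁, (∀ τ ∈ Set.Ioo t₁ t, 0 < smoothVelocity s (b τ) (d τ) (q τ)) →
      ‖q t₁‖ ^ 2 ≤ ‖q t‖ ^ 2 := fun t ht hτ => by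
    refine monotoneOn_of_deriv_nonneg (convex_Icc t₁ t) h.continuous_F.continuousOn
      (fun τ hτ' => ?_) (fun τ hτ' => ?_) ⟨le_rfl, ht⟩ ⟨ht, le_rfl⟩ ht
    · rw [interior_Icc] at hτ'
      exact (hder τ hτ'.1.le).differentiableAt.differentiableWithinAt
    · rw [interior_Icc] at hτ'
      rw [(hder τ hτ'.1.le).deriv]
      exact (hτ τ hτ').le
  have hU : ∀ t ≥ t₁, 0 < smoothVelocity s (b t) (d t) (q t) := by
    intro t ht
    by_contra! hcon
    -- the first time after `t₁` at which the velocity is not positive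
    obtain ⟨τ, ⟨⟨hτ0, hτ1⟩, hτ⟩, hmin⟩ :=
      (isCompact_Icc.inter_right (isClosed_le (h.continuous_velocity hs) continuous_const)).exists_isLeast
        (s := Set.Icc t₁ t ∩ {τ | smoothVelocity s (b τ) (d τ) (q τ) ≤ 0}) ⟨t, ⟨ht, le_rfl⟩, hcon⟩
    rw [Set.mem_ofPred_eq] at hτ
    have hlt' : t₁ < τ := by
      rcases hτ0.eq_or_lt with h1 | h1
      · rw [← h1] at hτ
        linarith
      · exact h1
    have hpos' : ∀ σ ∈ Set.Ico t₁ τ, 0 < smoothVelocity s (b σ) (d σ) (q σ) := fun σ hσ => by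
      by_contra! hc
      exact absurd (hmin ⟨⟨hσ.1, hσ.2.le.trans hτ1⟩, hc⟩) (not_le.2 hσ.2)
    have h1 := hmono τ hτ0 fun σ hσ => hpos' σ ⟨hσ.1.le, hσ.2⟩
    have h2 := hle _ ⟨h1, (hlt τ hτ0).le⟩
    have h3 : 0 < δ * (FCrit s - ‖q τ‖ ^ 2) := mul_pos hδ (by linarith [hlt τ hτ0])
    have h4 : 0 ≤ smoothVelocity s (b τ) (d τ) (q τ) := by
      have hne : (𝓝[Set.Ico t₁ τ] τ).NeBot := by
        rw [← mem_closure_iff_nhdsWithin_neBot, closure_Ico hlt'.ne]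
        exact ⟨hτ0, le_rfl⟩
      exact ge_of_tendsto ((h.continuous_velocity hs).continuousWithinAt (s := Set.Ico t₁ τ))
        (eventually_mem_nhdsWithin.mono fun σ hσ => (hpos' σ hσ).le)
    have h5 := hVt τ
    rw [le_antisymm hτ h4] at h5
    linarith
  have hw : Tendsto (fun t => √(FCrit s - ‖q t‖ ^ 2)) atTop atBot := by
    refine tendsto_atBot_of_deriv_le (m := √δ / 2)
      (g' := fun t => -smoothVelocity s (b t) (d t) (q t) / (2 * √(FCrit s - ‖q t‖ ^ 2)))
      (by positivity) (eventually_atTop.2 ⟨t₁, fun t ht => ?_⟩)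
    have h1 : 0 < FCrit s - ‖q t‖ ^ 2 := by linarith [hlt t ht]
    refine ⟨((hder t ht).const_sub (FCrit s)).sqrt h1.ne', ?_⟩
    have h2 := Real.sqrt_pos.2 h1
    have h3 := hle _ ⟨hmono t ht fun σ hσ => hU σ hσ.1.le, (hlt t ht).le⟩
    have h4 : √δ * √(FCrit s - ‖q t‖ ^ 2) ≤ smoothVelocity s (b t) (d t) (q t) := by
      rw [← Real.sqrt_mul hδ.le]
      refine Real.sqrt_le_iff.2 ⟨(hU t ht).le, ?_⟩
      linarith [hVt t]
    rw [div_le_iff₀ (by positivity)]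
    linarith
  obtain ⟨t, ht⟩ := (hw.eventually_lt_atBot 0).exists
  exact absurd (Real.sqrt_nonneg _) (not_le.2 ht)

/-- If `F` never increases, then it converges to a double root of the potential. -/
theorem exists_double_root (hs : 1 < s) (h : IsCoveringFlow s N E S χ b d q) {t₁ : ℝ}
    (hlt : ∀ t ≥ t₁, ‖q t‖ ^ 2 < FCrit s)
    (hU : ∀ t ≥ t₁, smoothVelocity s (b t) (d t) (q t) ≤ 0) :
    ∃ f, 0 ≤ f ∧ f < FCrit s ∧ (potential s N E S).eval f = 0 ∧
      (potential s N E S).derivative.eval f = 0 := by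
  have hder : ∀ t ≥ t₁, HasDerivAt (fun τ => ‖q τ‖ ^ 2) (smoothVelocity s (b t) (d t) (q t)) t :=
    fun t ht => h.hasDerivAt_F (by linarith [hlt t ht])
  have hanti : AntitoneOn (fun τ => ‖q τ‖ ^ 2) (Set.Ici t₁) := by
    refine antitoneOn_of_deriv_nonpos (convex_Ici t₁) h.continuous_F.continuousOn
      (fun τ hτ' => ?_) (fun τ hτ' => ?_)
    · exact (hder τ (interior_subset hτ')).differentiableAt.differentiableWithinAt
    · rw [(hder τ (interior_subset hτ')).deriv]
      exact hU τ (interior_subset hτ')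
  have hanti' : Antitone fun t => ‖q (max t t₁)‖ ^ 2 := fun x y hxy =>
    hanti (Set.mem_Ici.2 (le_max_right _ _)) (Set.mem_Ici.2 (le_max_right _ _))
      (max_le_max_right _ hxy)
  have hbdd : BddBelow (Set.range fun t => ‖q (max t t₁)‖ ^ 2) :=
    ⟨0, by rintro _ ⟨t, rfl⟩; positivity⟩
  have hF' := tendsto_atTop_ciInf hanti' hbdd
  set f := ⨅ t, ‖q (max t t₁)‖ ^ 2
  have hF : Tendsto (fun t => ‖q t‖ ^ 2) atTop (𝓝 f) :=
    hF'.congr' ((eventually_ge_atTop t₁).mono fun t ht => by simp only [max_eq_left ht])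
  have hf0 : 0 ≤ f := ge_of_tendsto' hF fun t => by positivity
  have hf1 : f < FCrit s := by
    refine lt_of_le_of_lt (le_of_tendsto hF ((eventually_ge_atTop t₁).mono fun t ht =>
      hanti Set.self_mem_Ici ht ht)) (hlt t₁ le_rfl)
  have hnbot : ¬ Tendsto (fun t => ‖q t‖ ^ 2) atTop atBot := fun hb => by
    obtain ⟨t, ht⟩ := (hb.eventually_lt_atBot 0).exists
    exact absurd (by positivity : 0 ≤ ‖q t‖ ^ 2) (not_le.2 ht)
  have hVlim := ((potential s N E S).continuous.tendsto f).comp hF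
  have hV'lim := ((potential s N E S).derivative.continuous.tendsto f).comp hF
  have hV0 : (potential s N E S).eval f = 0 := by
    by_contra hne
    have hneg : (potential s N E S).eval f < 0 := lt_of_le_of_ne
      (le_of_tendsto' hVlim fun t => h.potential_nonpos hs t) hne
    obtain ⟨m, hm1, hm2⟩ := exists_between hneg
    refine hnbot (tendsto_atBot_of_deriv_le
      (g' := fun t => smoothVelocity s (b t) (d t) (q t)) (m := √(-m)) (Real.sqrt_pos.2 (by linarith)) ?_)
    filter_upwards [hVlim.eventually_lt_const hm1, eventually_ge_atTop t₁] with t h1 h2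
    refine ⟨hder t h2, ?_⟩
    rw [le_neg]
    refine Real.sqrt_le_iff.2 ⟨by linarith [hU t h2], ?_⟩
    have := h.velocity_sq hs t
    rw [Function.comp_apply] at h1
    nlinarith
  refine ⟨f, hf0, hf1, hV0, ?_⟩
  have hUder : ∀ t ≥ t₁, HasDerivAt (fun τ => smoothVelocity s (b τ) (d τ) (q τ))
      (-(potential s N E S).derivative.eval (‖q t‖ ^ 2) / 2) t := fun t ht =>
    h.hasDerivAt_velocity hs (by linarith [hlt t ht])
  by_contra hne
  rcases lt_or_gt_of_ne hne with hneg | hpos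
  · obtain ⟨m, hm1, hm2⟩ := exists_between hneg
    have := tendsto_atTop_of_le_deriv (m := -m / 2)
      (g := fun τ => smoothVelocity s (b τ) (d τ) (q τ))
      (g' := fun t => -(potential s N E S).derivative.eval (‖q t‖ ^ 2) / 2) (by linarith) (by
        filter_upwards [hV'lim.eventually_lt_const hm1, eventually_ge_atTop t₁] with t h1 h2
        refine ⟨hUder t h2, ?_⟩
        rw [Function.comp_apply] at h1
        linarith)
    obtain ⟨t, ht1, ht2⟩ := ((this.eventually_gt_atTop 0).and (eventually_ge_atTop t₁)).exists
    exact absurd (hU t ht2) (not_le.2 ht1)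
  · obtain ⟨m, hm1, hm2⟩ := exists_between hpos
    have := tendsto_atBot_of_deriv_le (m := m / 2)
      (g := fun τ => smoothVelocity s (b τ) (d τ) (q τ))
      (g' := fun t => -(potential s N E S).derivative.eval (‖q t‖ ^ 2) / 2) (by linarith) (by
        filter_upwards [hV'lim.eventually_const_lt hm2, eventually_ge_atTop t₁] with t h1 h2
        refine ⟨hUder t h2, ?_⟩
        rw [Function.comp_apply] at h1
        linarith)
    refine hnbot (tendsto_atBot_of_deriv_le
      (g' := fun t => smoothVelocity s (b t) (d t) (q t)) one_pos ?_)
    filter_upwards [this.eventually_le_atBot (-1), eventually_ge_atTop t₁] with t h1 h2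
    exact ⟨hder t h2, h1⟩

/-- If the potential is negative at `F_c`, or vanishes there and increases, then `F` reaches `F_c`
in finite time. -/
theorem exists_first_time (hs : 1 < s) (h : IsCoveringFlow s N E S χ b d q) (hE : 0 < E)
    (hV : (potential s N E S).eval (FCrit s) < 0 ∨ ((potential s N E S).eval (FCrit s) = 0 ∧
      0 < (potential s N E S).derivative.eval (FCrit s))) (h0 : ‖q 0‖ ^ 2 < FCrit s) :
    ∃ T, 0 < T ∧ ‖q T‖ ^ 2 = FCrit s ∧ ∀ t ∈ Set.Ico 0 T, ‖q t‖ ^ 2 < FCrit s := by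
  have hex : ∃ t ≥ 0, FCrit s ≤ ‖q t‖ ^ 2 := by
    by_contra! hlt
    obtain ⟨f, hf0, hf1, hf2, hf3⟩ := h.exists_double_root hs hlt fun t ht =>
      h.not_velocity_pos hs hE hV fun τ hτ => hlt τ (ht.trans hτ)
    have hz : (potential s N E S).eval (FCrit s) ≤ 0 := by
      rcases hV with h | h
      exacts [h.le, h.1.le]
    exact not_double_root hs hE hf0 hf1 hz hf2 hf3
  obtain ⟨t, ht0, ht⟩ := hex
  obtain ⟨T, ⟨⟨hT0, hT1⟩, hT⟩, hmin⟩ :=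
    (isCompact_Icc.inter_right (isClosed_le continuous_const h.continuous_F)).exists_isLeast
      (s := Set.Icc 0 t ∩ {τ | FCrit s ≤ ‖q τ‖ ^ 2}) ⟨t, ⟨ht0, le_rfl⟩, ht⟩
  rw [Set.mem_ofPred_eq] at hT
  have hTpos : 0 < T := by
    rcases hT0.eq_or_lt with h1 | h1
    · rw [← h1] at hT
      linarith
    · exact h1
  have hlt : ∀ τ ∈ Set.Ico 0 T, ‖q τ‖ ^ 2 < FCrit s := fun τ hτ => by
    by_contra! hc
    exact absurd (hmin ⟨⟨hτ.1, hτ.2.le.trans hT1⟩, hc⟩) (not_le.2 hτ.2)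
  refine ⟨T, hTpos, le_antisymm ?_ hT, hlt⟩
  have hne : (𝓝[Set.Ico 0 T] T).NeBot := by
    rw [← mem_closure_iff_nhdsWithin_neBot, closure_Ico hTpos.ne]
    exact ⟨hT0, le_rfl⟩
  exact le_of_tendsto (h.continuous_F.continuousWithinAt (s := Set.Ico 0 T))
    (eventually_mem_nhdsWithin.mono fun σ hσ => (hlt σ hσ).le)

/-- If the potential is positive immediately below `F_c`, then `F` stays away from `F_c`. -/
theorem exists_bound (hs : 1 < s) (h : IsCoveringFlow s N E S χ b d q)
    (hV : 0 < E → 0 < (potential s N E S).eval (FCrit s) ∨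
      ((potential s N E S).eval (FCrit s) = 0 ∧
        (potential s N E S).derivative.eval (FCrit s) ≤ 0)) (h0 : ‖q 0‖ ^ 2 < FCrit s) :
    ∃ M < FCrit s, ∀ t, 0 ≤ t → ‖q t‖ ^ 2 ≤ M := by
  rcases h.energy_nonneg.eq_or_lt with h1 | h1
  · subst h1
    exact ⟨_, h0, fun t _ => (h.F_eq_of_energy_eq_zero t 0).le⟩
  · obtain ⟨ε, hε, hpos⟩ := exists_potential_pos hs h1 (FCrit_pos hs) (hV h1)
    obtain ⟨M, hM1, hM2⟩ := exists_between (show max (FCrit s - ε) (‖q 0‖ ^ 2) < FCrit s from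
      max_lt (by linarith) h0)
    have hM3 := (le_max_left _ _).trans_lt hM1
    have hM4 := (le_max_right _ _).trans_lt hM1
    refine ⟨M, hM2, fun t ht => ?_⟩
    by_contra! hcon
    obtain ⟨τ, _, hτ⟩ := intermediate_value_Icc ht h.continuous_F.continuousOn
      (show M ∈ Set.Icc (‖q 0‖ ^ 2) (‖q t‖ ^ 2) from ⟨hM4.le, hcon.le⟩)
    have h2 := hpos M ⟨hM3, hM2⟩
    have h3 := h.potential_nonpos hs τ
    simp only at hτ
    rw [hτ] at h3
    linarith

end IsCoveringFlow


/-! ### Power series at the boundary of the disc of convergence -/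

/-- Abel's comparison principle: if `a n ~ K * c n` and the series `∑ c n * r ^ n` diverges as
`r → 1`, then `∑ a n * r ^ n ~ K * ∑ c n * r ^ n`. -/
theorem tendsto_tsum_div_tsum {a c : ℕ → ℝ} {K : ℝ} (hc : ∀ n, 0 < c n)
    (hac : Tendsto (fun n => a n / c n) atTop (𝓝 K))
    (hsum : ∀ r ∈ Set.Ico (0 : ℝ) 1, Summable fun n => c n * r ^ n)
    (htop : Tendsto (fun r : ℝ => ∑' n, c n * r ^ n) (𝓝[<] 1) atTop) :
    Tendsto (fun r : ℝ => (∑' n, a n * r ^ n) / ∑' n, c n * r ^ n) (𝓝[<] 1) (𝓝 K) := by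
  rw [Metric.tendsto_nhds]
  intro ε hε
  obtain ⟨n0, hn0⟩ := eventually_atTop.1 ((Metric.tendsto_nhds.1 hac) (ε / 2) (by linarith))
  have hd : ∀ n, |a n - K * c n| ≤
      ε / 2 * c n + if n ∈ Finset.range n0 then |a n - K * c n| else 0 := fun n => by
    split_ifs with h
    · have := hc n
      nlinarith
    · have h1 := hn0 n (by simpa using h)
      rw [Real.dist_eq, div_sub' (hc n).ne', abs_div, abs_of_pos (hc n),
        div_lt_iff₀ (hc n), mul_comm (c n) K] at h1
      linarith
  set B := ∑ n ∈ Finset.range n0, |a n - K * c n|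
  have hr0 : ∀ᶠ r : ℝ in 𝓝[<] 1, r ∈ Set.Ico (0 : ℝ) 1 :=
    Ico_mem_nhdsLT one_pos
  filter_upwards [hr0, htop.eventually_gt_atTop (2 * B / ε), htop.eventually_gt_atTop 0]
    with r hr hB hpos
  set φ := ∑' n, c n * r ^ n
  have hφ : HasSum (fun n => c n * r ^ n) φ := (hsum r hr).hasSum
  have hfin : HasSum (fun n => if n ∈ Finset.range n0 then |a n - K * c n| else 0) B := by
    have h := hasSum_sum_of_ne_finset_zero (s := Finset.range n0)
      (L := SummationFilter.unconditional ℕ)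
      (f := fun n => if n ∈ Finset.range n0 then |a n - K * c n| else 0) fun n hn => if_neg hn
    rwa [Finset.sum_congr rfl fun n hn => if_pos hn] at h
  have hbound : ∀ n, ‖(a n - K * c n) * r ^ n‖ ≤ ε / 2 * (c n * r ^ n) +
      if n ∈ Finset.range n0 then |a n - K * c n| else 0 := fun n => by
    have h1 : 0 ≤ r ^ n := pow_nonneg hr.1 n
    have h2 : r ^ n ≤ 1 := pow_le_one₀ hr.1 hr.2.le
    rw [norm_mul, Real.norm_eq_abs, Real.norm_of_nonneg h1]
    refine (mul_le_mul_of_nonneg_right (hd n) h1).trans ?_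
    have h3 : 0 ≤ if n ∈ Finset.range n0 then |a n - K * c n| else 0 := by positivity
    nlinarith
  have hS := (hφ.mul_left (ε / 2)).add hfin
  have hdsum : Summable fun n => (a n - K * c n) * r ^ n := hS.summable.of_norm_bounded hbound
  have hle := tsum_of_norm_bounded hS hbound
  have hA : ∑' n, a n * r ^ n = (∑' n, (a n - K * c n) * r ^ n) + K * φ := by
    rw [← hφ.tsum_eq, ← tsum_mul_left, ← hdsum.tsum_add (hφ.summable.mul_left K)]
    exact tsum_congr fun n => by ring
  rw [Real.dist_eq, hA, add_div, mul_div_cancel_right₀ _ hpos.ne', add_sub_cancel_right, abs_div,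
    abs_of_pos hpos, div_lt_iff₀ hpos]
  rw [Real.norm_eq_abs] at hle
  rw [div_lt_iff₀ hε] at hB
  linarith

/-- The coefficients of the binomial series of `(1 - r) ^ (-γ)`. -/
theorem hasSum_binomial {γ r : ℝ} (hr : r ∈ Set.Ico (0 : ℝ) 1) :
    HasSum (fun n : ℕ => (∏ j ∈ Finset.range n, (γ + j)) / n.factorial * r ^ n)
      ((1 - r) ^ (-γ)) := by
  have h := (Real.one_div_one_sub_rpow_hasFPowerSeriesOnBall_zero γ).hasSum (y := r) (by
    simp only [Metric.mem_eball, edist_zero_right]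
    rw [← ofReal_norm, Real.norm_of_nonneg hr.1]
    exact ENNReal.ofReal_lt_one.2 hr.2)
  rw [zero_add, one_div, ← Real.rpow_neg (by linarith [hr.2])] at h
  convert! h using 2 with n
  rw [FormalMultilinearSeries.ofScalars_apply_eq, smul_eq_mul, ← Ring.multichoose_eq]
  congr 1
  have h1 := Ring.factorial_nsmul_multichoose_eq_ascPochhammer γ n
  have h2 : (ascPochhammer ℝ n).eval γ = ∏ j ∈ Finset.range n, (γ + j) := by
    induction n with
    | zero => simp
    | succ n ih =>
      rw [ascPochhammer_succ_eval, ih (Ring.factorial_nsmul_multichoose_eq_ascPochhammer γ n),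
        Finset.prod_range_succ]
  rw [Polynomial.ascPochhammer_smeval_eq_eval, h2, nsmul_eq_mul] at h1
  rw [← h1]
  field_simp

theorem tendsto_rpow_div_binomial {γ : ℝ} (hγ : 0 < γ) :
    Tendsto (fun n : ℕ => ((n : ℝ) + 1) ^ (γ - 1) /
      ((∏ j ∈ Finset.range n, (γ + j)) / n.factorial)) atTop (𝓝 (Real.Gamma γ)) := by
  have h1 : Tendsto (fun n : ℕ => (n : ℝ) / (n + 1)) atTop (𝓝 1) :=
    tendsto_natCast_div_add_atTop 1
  have h2 : Tendsto (fun n : ℕ => 1 + γ * (n : ℝ)⁻¹) atTop (𝓝 1) := by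
    simpa using (tendsto_inv_atTop_nhds_zero_nat.const_mul γ).const_add 1
  have h3 := ((h1.rpow_const (p := 1 - γ) (Or.inl one_ne_zero)).mul h2).mul
    (Real.GammaSeq_tendsto_Gamma γ)
  rw [Real.one_rpow, one_mul, one_mul] at h3
  refine h3.congr' ((eventually_gt_atTop 0).mono fun n hn => ?_)
  have hn' : (0 : ℝ) < n := by exact_mod_cast hn
  have hP : 0 < ∏ j ∈ Finset.range n, (γ + j) := Finset.prod_pos fun j _ => by positivity
  rw [Real.GammaSeq, Finset.prod_range_succ, Real.div_rpow hn'.le (by positivity),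
    show ((n : ℝ) + 1) ^ (1 - γ) = (((n : ℝ) + 1) ^ (γ - 1))⁻¹ by
      rw [← Real.rpow_neg (by positivity), neg_sub],
    show (n : ℝ) ^ (1 - γ) = n / (n : ℝ) ^ γ by rw [Real.rpow_sub hn', Real.rpow_one]]
  have h4 : 0 < ((n : ℝ) + 1) ^ (γ - 1) := by positivity
  have h5 : 0 < (n : ℝ) ^ γ := by positivity
  have h6 : (0 : ℝ) < n.factorial := by positivity
  revert hP h4 h5 h6
  beta_reduce
  generalize ((n : ℝ) + 1) ^ (γ - 1) = u
  generalize (n : ℝ) ^ γ = v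
  generalize (n.factorial : ℝ) = w
  generalize ∏ j ∈ Finset.range n, (γ + (j : ℝ)) = P
  intro hP h4 h5 h6
  have h7 : γ + n ≠ 0 := by positivity
  field_simp
  ring

theorem tendsto_one_sub_rpow_neg_atTop {γ : ℝ} (hγ : 0 < γ) :
    Tendsto (fun r : ℝ => (1 - r) ^ (-γ)) (𝓝[<] 1) atTop := by
  refine (tendsto_rpow_neg_nhdsGT_zero (neg_lt_zero.2 hγ)).comp ?_
  refine tendsto_nhdsWithin_iff.2 ⟨?_, eventually_mem_nhdsWithin.mono fun r hr => by
    simpa using hr⟩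
  have : Tendsto (fun r : ℝ => 1 - r) (𝓝 1) (𝓝 (1 - 1)) := tendsto_id.const_sub 1
  rw [sub_self] at this
  exact this.mono_left nhdsWithin_le_nhds

/-- A power series whose coefficients are asymptotic to `K * n ^ (γ - 1)` with `γ > 0` is asymptotic
to `K * Γ(γ) * (1 - r) ^ (-γ)` as `r → 1`. -/
theorem tendsto_tsum_div_rpow {a : ℕ → ℝ} {K γ : ℝ} (hγ : 0 < γ)
    (ha : Tendsto (fun n : ℕ => a n / ((n : ℝ) + 1) ^ (γ - 1)) atTop (𝓝 K)) :
    Tendsto (fun r : ℝ => (∑' n, a n * r ^ n) / (1 - r) ^ (-γ)) (𝓝[<] 1)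
      (𝓝 (K * Real.Gamma γ)) := by
  have hr0 : ∀ᶠ r : ℝ in 𝓝[<] 1, r ∈ Set.Ico (0 : ℝ) 1 := Ico_mem_nhdsLT one_pos
  refine (tendsto_tsum_div_tsum (a := a)
    (c := fun n => (∏ j ∈ Finset.range n, (γ + j)) / n.factorial)
    (fun n => div_pos (Finset.prod_pos fun j _ => by positivity) (by positivity)) ?_
    (fun r hr => (hasSum_binomial hr).summable)
    ((tendsto_one_sub_rpow_neg_atTop hγ).congr'
      (hr0.mono fun r hr => (hasSum_binomial hr).tsum_eq.symm))).congr'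
    (hr0.mono fun r hr => by rw [(hasSum_binomial hr).tsum_eq])
  refine (ha.mul (tendsto_rpow_div_binomial hγ)).congr fun n => ?_
  have : (0 : ℝ) < ((n : ℝ) + 1) ^ (γ - 1) := by positivity
  field_simp

/-- A power series whose coefficients are asymptotic to `K / n` is asymptotic to
`-K * log (1 - r)` as `r → 1`. -/
theorem tendsto_tsum_div_log {a : ℕ → ℝ} {K : ℝ}
    (ha : Tendsto (fun n : ℕ => a n * ((n : ℝ) + 1)) atTop (𝓝 K)) :
    Tendsto (fun r : ℝ => (∑' n, a n * r ^ n) / -Real.log (1 - r)) (𝓝[<] 1) (𝓝 K) := by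
  have hr0 : ∀ᶠ r : ℝ in 𝓝[<] 1, r ∈ Set.Ioo (0 : ℝ) 1 := Ioo_mem_nhdsLT one_pos
  have hsum : ∀ r ∈ Set.Ioo (0 : ℝ) 1,
      HasSum (fun n : ℕ => 1 / ((n : ℝ) + 1) * r ^ n) (-Real.log (1 - r) / r) := fun r hr => by
    refine hasSum_of_eq ((Real.hasSum_pow_div_log_of_abs_lt_one (x := r)
      (by rw [abs_of_pos hr.1]; exact hr.2)).div_const r) (fun n => ?_) rfl
    have := hr.1
    field_simp
    ring
  have hid : Tendsto (fun r : ℝ => r) (𝓝[<] 1) (𝓝 1) := tendsto_id.mono_left nhdsWithin_le_nhds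
  have hlog : Tendsto (fun r : ℝ => -Real.log (1 - r) / r) (𝓝[<] 1) atTop := by
    have h1 : Tendsto (fun r : ℝ => 1 - r) (𝓝[<] 1) (𝓝[>] 0) := by
      refine tendsto_nhdsWithin_iff.2 ⟨by simpa using hid.const_sub 1,
        eventually_mem_nhdsWithin.mono fun r hr => by simpa using hr⟩
    have h2 := tendsto_neg_atBot_atTop.comp (Real.tendsto_log_nhdsGT_zero.comp h1)
    exact (h2.atTop_mul_pos one_pos (by simpa using hid.inv₀ one_ne_zero)).congr fun r => by
      simp [div_eq_mul_inv]
  have h := tendsto_tsum_div_tsum (a := a) (c := fun n => 1 / ((n : ℝ) + 1)) (K := K)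
    (fun n => by positivity) (ha.congr fun n => by field_simp) (fun r hr => by
      rcases hr.1.eq_or_lt with h0 | h0
      · rw [← h0]
        exact (summable_of_ne_finset_zero (s := {0}) fun n hn => by
          rw [Finset.mem_singleton] at hn
          rw [zero_pow hn, mul_zero])
      · exact (hsum r ⟨h0, hr.2⟩).summable)
    (hlog.congr' (hr0.mono fun r hr => (hsum r hr).tsum_eq.symm))
  have h' := h.div hid one_ne_zero
  rw [div_one] at h'
  refine h'.congr' (hr0.mono fun r hr => ?_)
  simp only [Pi.div_apply]
  rw [(hsum r hr).tsum_eq]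
  have h1 : r ≠ 0 := hr.1.ne'
  have h2 : Real.log (1 - r) ≠ 0 := (Real.log_neg (by linarith [hr.2]) (by linarith [hr.1])).ne
  field_simp

/-! ### The Sobolev sums near the critical point -/

section

variable {s : ℝ}

theorem tendsto_gSeq_sq_mul (hs : 1 < s) :
    Tendsto (fun n : ℕ => gSeq s n ^ 2 * xCrit s ^ n * (n : ℝ) ^ (5 / 2 : ℝ)) atTop
      (𝓝 (growthConst s * (2 / (s - 1)))) := by
  have h0 : 0 < s - 1 := by linarith
  have h1 : Tendsto (fun n : ℕ => (n : ℝ) / ((s - 1) / 2 * n + 1)) atTop (𝓝 (2 / (s - 1))) := by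
    have h2 : Tendsto (fun n : ℕ => (s - 1) / 2 + (n : ℝ)⁻¹) atTop (𝓝 ((s - 1) / 2)) := by
      simpa using tendsto_inv_atTop_nhds_zero_nat.const_add ((s - 1) / 2)
    have h3 := h2.inv₀ (by positivity)
    rw [inv_div] at h3
    refine h3.congr' ((eventually_gt_atTop 0).mono fun n hn => ?_)
    have : (0 : ℝ) < n := by exact_mod_cast hn
    field_simp
  refine ((tendsto_fussCatalan_mul hs).mul h1).congr fun n => ?_
  rw [gSeq_sq hs, show (5 / 2 : ℝ) = 3 / 2 + 1 by norm_num]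
  rcases n.eq_zero_or_pos with rfl | hn
  · simp [Real.zero_rpow (show (3 / 2 + 1 : ℝ) ≠ 0 by norm_num)]
  rw [Real.rpow_add_one (by positivity)]
  ring

/-- The coefficients of the Sobolev sum, as a power series in `|p| ^ 2 / x_c`. -/
theorem tendsto_sobolevCoeff (hs : 1 < s) (ξ : ℝ) :
    Tendsto (fun n : ℕ => ((n : ℝ) + 2) ^ (2 * ξ) * (gSeq s (n + 1) ^ 2 * xCrit s ^ n) /
      ((n : ℝ) + 1) ^ (2 * ξ - 5 / 2)) atTop
      (𝓝 (growthConst s * (2 / (s - 1)) / xCrit s)) := by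
  have h1 := (tendsto_gSeq_sq_mul hs).comp (tendsto_add_atTop_nat 1)
  have h2 : Tendsto (fun n : ℕ => ((n : ℝ) + 2) / (n + 1)) atTop (𝓝 1) := by
    have := (tendsto_one_div_add_atTop_nhds_zero_nat (𝕜 := ℝ)).const_add 1
    rw [add_zero] at this
    refine this.congr fun n => ?_
    field_simp
    ring
  have h3 := ((h2.rpow_const (p := 2 * ξ) (Or.inl one_ne_zero)).mul h1).div_const (xCrit s)
  rw [Real.one_rpow, one_mul] at h3
  refine h3.congr fun n => ?_
  have hx := xCrit_pos hs
  rw [Function.comp_apply, Real.div_rpow (by positivity) (by positivity), pow_succ (xCrit s),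
    Real.rpow_sub (by positivity)]
  push_cast
  have h5 : (0 : ℝ) < ((n : ℝ) + 1) ^ (2 * ξ) := by positivity
  have h6 : (0 : ℝ) < ((n : ℝ) + 1) ^ (5 / 2 : ℝ) := by positivity
  field_simp

theorem summable_sobolevCoeff (hs : 1 < s) {ξ : ℝ} (hξ : ξ < 3 / 4) :
    Summable fun n : ℕ => ((n : ℝ) + 2) ^ (2 * ξ) * (gSeq s (n + 1) ^ 2 * xCrit s ^ n) := by
  have h1 : Summable fun n : ℕ => ((n : ℝ) + 1) ^ (2 * ξ - 5 / 2) := by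
    have := (summable_nat_add_iff 1).2 (Real.summable_nat_rpow.2
      (show 2 * ξ - 5 / 2 < -1 by linarith))
    simpa using this
  refine summable_of_isBigO_nat h1 ?_
  exact (isBigO_of_div_tendsto_nhds (Eventually.of_forall fun n hn => absurd hn (by positivity)) _
    (tendsto_sobolevCoeff hs ξ))

/-- The part of the Sobolev sum on the manifold that depends on `|p| ^ 2`. -/
noncomputable def sobolevSeries (s ξ x : ℝ) : ℝ :=
  ∑' n : ℕ, ((n : ℝ) + 2) ^ (2 * ξ) * (gSeq s (n + 1) ^ 2 * x ^ n)

theorem sobolevSeries_eq (hs : 1 < s) (ξ x : ℝ) :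
    sobolevSeries s ξ x = ∑' n : ℕ,
      ((n : ℝ) + 2) ^ (2 * ξ) * (gSeq s (n + 1) ^ 2 * xCrit s ^ n) * (x / xCrit s) ^ n := by
  refine tsum_congr fun n => ?_
  have := xCrit_pos hs
  rw [div_pow]
  field_simp

theorem sobolevSeries_le (hs : 1 < s) {ξ x : ℝ} (hξ : ξ < 3 / 4) (h0 : 0 ≤ x) (hx : x ≤ xCrit s) :
    sobolevSeries s ξ x ≤ sobolevSeries s ξ (xCrit s) := by
  have hle : ∀ n : ℕ, ((n : ℝ) + 2) ^ (2 * ξ) * (gSeq s (n + 1) ^ 2 * x ^ n) ≤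
      ((n : ℝ) + 2) ^ (2 * ξ) * (gSeq s (n + 1) ^ 2 * xCrit s ^ n) := fun n => by gcongr
  exact (Summable.of_nonneg_of_le (fun n => by positivity) hle
    (summable_sobolevCoeff hs hξ)).tsum_le_tsum hle (summable_sobolevCoeff hs hξ)

theorem tendsto_div_xCrit (hs : 1 < s) :
    Tendsto (fun x => x / xCrit s) (𝓝[<] xCrit s) (𝓝[<] 1) := by
  have hx := xCrit_pos hs
  refine tendsto_nhdsWithin_iff.2 ⟨?_, eventually_mem_nhdsWithin.mono fun r hr => by
    rw [Set.mem_Iio] at hr ⊢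
    rwa [div_lt_one hx]⟩
  have : Tendsto (fun x => x / xCrit s) (𝓝 (xCrit s)) (𝓝 (xCrit s / xCrit s)) :=
    tendsto_id.div_const _
  rw [div_self hx.ne'] at this
  exact this.mono_left nhdsWithin_le_nhds

theorem tendsto_sobolevSeries_div_rpow (hs : 1 < s) {ξ : ℝ} (hξ : 3 / 4 < ξ) :
    ∃ K, 0 < K ∧ Tendsto (fun x => sobolevSeries s ξ x / (1 - x / xCrit s) ^ (3 / 2 - 2 * ξ))
      (𝓝[<] xCrit s) (𝓝 K) := by
  have h0 : 0 < s - 1 := by linarith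
  have hγ : 0 < 2 * ξ - 3 / 2 := by linarith
  refine ⟨growthConst s * (2 / (s - 1)) / xCrit s * Real.Gamma (2 * ξ - 3 / 2), ?_, ?_⟩
  · have := growthConst_pos hs
    have := xCrit_pos hs
    have := Real.Gamma_pos_of_pos hγ
    positivity
  · have h := (tendsto_tsum_div_rpow (a := fun n : ℕ => ((n : ℝ) + 2) ^ (2 * ξ) *
      (gSeq s (n + 1) ^ 2 * xCrit s ^ n)) hγ (by
        rw [show 2 * ξ - 3 / 2 - 1 = 2 * ξ - 5 / 2 by ring]
        exact tendsto_sobolevCoeff hs ξ)).comp (tendsto_div_xCrit hs)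
    refine h.congr fun x => ?_
    rw [Function.comp_apply, ← sobolevSeries_eq hs, neg_sub]

theorem tendsto_sobolevSeries_div_log (hs : 1 < s) :
    ∃ K, 0 < K ∧ Tendsto (fun x => sobolevSeries s (3 / 4) x / -Real.log (1 - x / xCrit s))
      (𝓝[<] xCrit s) (𝓝 K) := by
  have h0 : 0 < s - 1 := by linarith
  refine ⟨growthConst s * (2 / (s - 1)) / xCrit s, ?_, ?_⟩
  · have := growthConst_pos hs
    have := xCrit_pos hs
    positivity
  · have h := (tendsto_tsum_div_log (a := fun n : ℕ => ((n : ℝ) + 2) ^ (2 * (3 / 4 : ℝ)) *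
      (gSeq s (n + 1) ^ 2 * xCrit s ^ n)) ((tendsto_sobolevCoeff hs (3 / 4)).congr fun n => by
        rw [show (2 * (3 / 4) - 5 / 2 : ℝ) = -1 by norm_num, Real.rpow_neg_one, div_inv_eq_mul])).comp
      (tendsto_div_xCrit hs)
    refine h.congr fun x => ?_
    rw [Function.comp_apply, ← sobolevSeries_eq hs]

end


/-! ### Expansions at the critical point -/

/-- Second-order expansion at a point where the derivative is differentiable. -/
theorem isLittleO_taylor_two {F U : ℝ → ℝ} {T W : ℝ} (hF : ∀ᶠ t in 𝓝 T, HasDerivAt F (U t) t)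
    (hU : HasDerivAt U W T) :
    (fun t => F t - (F T + U T * (t - T) + W / 2 * (t - T) ^ 2)) =o[𝓝 T] fun t => (t - T) ^ 2 := by
  rw [isLittleO_iff]
  intro ε hε
  have h1 := (isLittleO_iff.1 hU.isLittleO) hε
  obtain ⟨δ, hδ, hball⟩ := Metric.eventually_nhds_iff_ball.1 (hF.and h1)
  refine Metric.eventually_nhds_iff_ball.2 ⟨δ, hδ, fun t ht => ?_⟩
  have hsub : segment ℝ T t ⊆ Metric.ball T δ :=
    (convex_ball T δ).segment_subset (Metric.mem_ball_self hδ) ht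
  have hdist : ∀ x ∈ segment ℝ T t, |x - T| ≤ |t - T| := fun x hx => by
    rw [segment_eq_uIcc] at hx
    exact Set.abs_sub_left_of_mem_uIcc hx
  have h2 := (convex_segment T t).norm_image_sub_le_of_norm_hasDerivWithin_le
    (f := fun t => F t - (F T + U T * (t - T) + W / 2 * (t - T) ^ 2))
    (f' := fun t => U t - U T - (t - T) * W) (C := ε * |t - T|) (fun x hx => ?_) (fun x hx => ?_)
    (left_mem_segment ℝ T t) (right_mem_segment ℝ T t)
  · rw [norm_pow, Real.norm_eq_abs (t - T), pow_two (|t - T|), ← mul_assoc]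
    simpa using h2
  · have hi := (hasDerivAt_id x).sub_const T
    refine ((hball x (hsub hx)).1.sub (((hi.const_mul (U T)).const_add (F T)).add
      ((hi.pow 2).const_mul (W / 2)))).hasDerivWithinAt.congr_deriv ?_
    simp only [id]
    push_cast
    ring
  · have := (hball x (hsub hx)).2
    rw [smul_eq_mul, Real.norm_eq_abs (x - T)] at this
    exact this.trans (mul_le_mul_of_nonneg_left (hdist x hx) hε.le)

/-- At the critical point `x` has a nondegenerate maximum as a function of `F`. -/
theorem tendsto_one_sub_invF_div {s : ℝ} (hs : 1 < s) :
    ∃ κ, 0 < κ ∧ Tendsto (fun y => (1 - invF s y / xCrit s) / (FCrit s - y) ^ 2)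
      (𝓝[<] FCrit s) (𝓝 κ) := by
  have h0 : 0 < s - 1 := by linarith
  have hF := FCrit_pos hs
  have hx := xCrit_pos hs
  have hG : 0 < (1 + FCrit s) ^ (s + 1) := Real.rpow_pos_of_pos (by linarith) _
  have hcrit : 1 - (s - 1) * FCrit s = 0 := by
    rw [FCrit]
    field_simp
    ring
  have hU : HasDerivAt (fun y => (1 - (s - 1) * y) / (1 + y) ^ (s + 1))
      (-(s - 1) / (1 + FCrit s) ^ (s + 1)) (FCrit s) := by
    have h1 := ((hasDerivAt_id (FCrit s)).const_mul (s - 1)).const_sub 1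
    have h2 := ((hasDerivAt_id (FCrit s)).const_add 1).rpow_const (p := s + 1)
      (Or.inl (by simp only [id]; linarith))
    refine (h1.div h2 (by simpa using hG.ne')).congr_deriv ?_
    simp only [id, hcrit, zero_mul, sub_zero]
    field_simp
  have h := isLittleO_taylor_two (F := invF s) (T := FCrit s)
    ((lt_mem_nhds (show -1 < FCrit s by linarith)).mono fun y hy => hasDerivAt_invF s hy) hU
  rw [hcrit, zero_div, invF_FCrit hs] at h
  refine ⟨(s - 1) / (1 + FCrit s) ^ (s + 1) / 2 / xCrit s, by positivity, ?_⟩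
  have h3 := ((h.mono (nhdsWithin_le_nhds (s := Set.Iio (FCrit s)))).tendsto_div_nhds_zero.neg.add_const
    ((s - 1) / (1 + FCrit s) ^ (s + 1) / 2)).div_const (xCrit s)
  rw [neg_zero, zero_add] at h3
  refine h3.congr' (eventually_mem_nhdsWithin.mono fun y hy => ?_)
  have h4 : FCrit s - y ≠ 0 := by
    rw [Set.mem_Iio] at hy
    linarith
  have h5 : y - FCrit s ≠ 0 := by
    rw [Set.mem_Iio] at hy
    linarith
  beta_reduce
  rw [show (FCrit s - y) ^ 2 = (y - FCrit s) ^ 2 by ring]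
  field_simp
  ring

/-! ### Cascades -/

theorem cascadeCondition_iff {s : ℝ} (hs : 1 < s) {N E : ℝ} (S : ℝ) (hE : 0 ≤ E)
    (hEc : E ≤ ECrit s N) : CascadeCondition s N E S ↔
      (potential s N E S).eval (FCrit s) < 0 ∨ ((potential s N E S).eval (FCrit s) = 0 ∧
        0 < (potential s N E S).derivative.eval (FCrit s)) := by
  have h := potential_sign hs N E S hE hEc
  rw [CascadeCondition, EndpointCondition, h.1, h.2]

/-- Without energy `V` is the square of `potR`, which is nonnegative and has no simple roots. -/
theorem energy_pos_of_potential {s : ℝ} (hs : 1 < s) {N E S : ℝ} (hE : 0 ≤ E)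
    (hV : (potential s N E S).eval (FCrit s) < 0 ∨ ((potential s N E S).eval (FCrit s) = 0 ∧
      0 < (potential s N E S).derivative.eval (FCrit s))) : 0 < E := by
  rcases hE.eq_or_lt with h | h
  · subst h
    rw [potential_eval hs, potential_derivative_eval hs, potL, potL'] at hV
    simp only [mul_zero, zero_mul, sub_zero] at hV
    rcases hV with h1 | ⟨h1, h2⟩
    · exact absurd h1 (not_lt.2 (sq_nonneg _))
    · rw [pow_eq_zero_iff two_ne_zero] at h1
      rw [h1] at h2
      simp at h2
  · exact h

theorem number_pos {s : ℝ} (hs : 1 < s) {N E : ℝ} (hE : 0 < E) (hEc : E < ECrit s N) : 0 < N := by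
  have h0 : 0 < s - 1 := by linarith
  have h1 := hE.trans hEc
  rw [ECrit] at h1
  by_contra! hN
  exact absurd h1 (not_lt.2 (div_nonpos_of_nonpos_of_nonneg (by nlinarith) h0.le))

/-- The spectrum at the time of the cascade has the power law `n ^ (-5 / 2)`. -/
theorem limitSpectrum_isEquivalent {s : ℝ} (hs : 1 < s) {N E : ℝ} (hE : 0 < E)
    (hEc : E < ECrit s N) : (fun n : ℕ => limitSpectrum s N E n) ~[atTop] fun n : ℕ =>
      (s + 1) / (2 * s) * E * √(ECrit s N / (Real.pi * N)) * (n : ℝ) ^ (-(5 / 2) : ℝ) := by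
  have h0 : 0 < s - 1 := by linarith
  have hs0 : 0 < s := by linarith
  have hN := number_pos hs hE hEc
  have hpi := Real.pi_pos
  have hr : √(ECrit s N / (Real.pi * N)) = 2 * √(s / (2 * Real.pi * (s - 1))) := by
    rw [show ECrit s N / (Real.pi * N) = 2 ^ 2 * (s / (2 * Real.pi * (s - 1))) by
      rw [ECrit]
      field_simp, Real.sqrt_mul (by norm_num), Real.sqrt_sq (by norm_num)]
  have hpos : 0 < (s + 1) / (2 * s) * E * √(ECrit s N / (Real.pi * N)) := by
    rw [hr]
    positivity
  have hlim := (tendsto_gSeq_sq_mul hs).const_mul ((s ^ 2 - 1) * N * (E / ECrit s N))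
  have hval : (s ^ 2 - 1) * N * (E / ECrit s N) * (growthConst s * (2 / (s - 1))) =
      (s + 1) / (2 * s) * E * √(ECrit s N / (Real.pi * N)) := by
    rw [hr, growthConst, ECrit]
    field_simp
    ring
  rw [hval] at hlim
  refine (isEquivalent_iff_tendsto_one ((eventually_gt_atTop 0).mono fun n hn => ?_)).2 ?_
  · have : (0 : ℝ) < n := by exact_mod_cast hn
    positivity
  · have := hlim.div_const ((s + 1) / (2 * s) * E * √(ECrit s N / (Real.pi * N)))
    rw [div_self hpos.ne'] at this
    refine this.congr' ((eventually_gt_atTop 0).mono fun n hn => ?_)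
    have hn' : (0 : ℝ) < n := by exact_mod_cast hn
    have h3 : 0 < (n : ℝ) ^ (5 / 2 : ℝ) := by positivity
    simp only [Pi.div_apply, limitSpectrum]
    rw [Real.rpow_neg hn'.le]
    field_simp

namespace IsCoveringFlow

variable {s N E S T : ℝ} {χ : ℝ → ℝ} {b d q : ℝ → ℂ}

/-- The solution given by the desingularized flow is maximal up to the first time `T` at which
`F = F_c`: a strong solution living longer would coincide with it below `T` and reach `F_c`. -/
theorem isMaximalSolution (hs : 1 < s) (h : IsCoveringFlow s N E S χ b d q) (hT0 : 0 < T)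
    (hT : ‖q T‖ ^ 2 = FCrit s) (hlt : ∀ t ∈ Set.Ico 0 T, ‖q t‖ ^ 2 < FCrit s) :
    IsMaximalSolution s (manifoldState s (b 0) (toC s (d 0) (q 0)) (toP s (q 0))) T
      (fun t => manifoldState s (b t) (toC s (d t) (q t)) (toP s (q t))) := by
  refine ⟨hT0, h.isStrongSolutionOn hs hlt, rfl, fun T' β hT' hβ hβ0 => ?_⟩
  have hT0' : (0 : ℝ) ∈ Set.Ico 0 T' := ⟨le_rfl, hT'⟩
  have hle : T' ≤ T := by
    by_contra! hcon
    exact (h.lt_of_isStrongSolutionOn hs Set.ordConnected_Ico hβ hT0' hβ0 (hlt 0 ⟨le_rfl, hT0⟩)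
      ⟨hT0.le, hcon⟩).ne hT
  exact ⟨hle, fun t ht => hβ.eq_of_eq hs Set.ordConnected_Ico
    (h.isStrongSolutionOn hs fun τ hτ => hlt τ ⟨hτ.1, hτ.2.trans_le hle⟩) hT0' hβ0 ht⟩

/-- At the first arrival at `F_c` the velocity is the nonnegative square root of `-V(F_c)`. -/
theorem velocity_eq_sqrt (hs : 1 < s) (h : IsCoveringFlow s N E S χ b d q) (hT0 : 0 < T)
    (hT : ‖q T‖ ^ 2 = FCrit s) (hlt : ∀ t ∈ Set.Ico 0 T, ‖q t‖ ^ 2 < FCrit s) :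
    smoothVelocity s (b T) (d T) (q T) = √(-(potential s N E S).eval (FCrit s)) := by
  have h1 := h.hasDerivAt_F (t := T) (by rw [hT]; linarith)
  have h2 : 0 ≤ smoothVelocity s (b T) (d T) (q T) := by
    have h3 := h1.tendsto_slope.mono_left (nhdsWithin_mono T
      (fun x (hx : x ∈ Set.Iio T) => (ne_of_lt hx : x ≠ T)))
    refine ge_of_tendsto h3 ?_
    filter_upwards [Ico_mem_nhdsLT hT0] with t ht
    rw [slope_def_field]
    exact div_nonneg_of_nonpos (by have := hlt t ht; linarith) (by linarith [ht.2])
  have h4 := h.velocity_sq hs T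
  rw [hT] at h4
  rw [show -(potential s N E S).eval (FCrit s) = smoothVelocity s (b T) (d T) (q T) ^ 2 by linarith,
    Real.sqrt_sq h2]

/-- The expansion of `F` at the time of the cascade. The desingularized flow passes through `F_c`, so
that it is Taylor's formula for a smooth function. -/
theorem expansion (hs : 1 < s) (h : IsCoveringFlow s N E S χ b d q) (hT0 : 0 < T)
    (hT : ‖q T‖ ^ 2 = FCrit s) (hlt : ∀ t ∈ Set.Ico 0 T, ‖q t‖ ^ 2 < FCrit s) :
    (fun t => ‖q t‖ ^ 2 - (FCrit s - √(-(potential s N E S).eval (FCrit s)) * (T - t) -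
      (potential s N E S).derivative.eval (FCrit s) * (T - t) ^ 2 / 4)) =o[𝓝[<] T]
    fun t => (T - t) ^ 2 := by
  have h1 : ∀ᶠ t in 𝓝 T, HasDerivAt (fun τ => ‖q τ‖ ^ 2)
      (smoothVelocity s (b t) (d t) (q t)) t := by
    filter_upwards [h.continuous_F.continuousAt.eventually_lt_const
      (show ‖q T‖ ^ 2 < FCrit s + 1 by rw [hT]; linarith)] with t ht
    exact h.hasDerivAt_F ht.le
  have h2 := isLittleO_taylor_two h1 (h.hasDerivAt_velocity hs (by rw [hT]; linarith))
  refine (h2.mono nhdsWithin_le_nhds).congr (fun t => ?_) fun t => by ring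
  rw [h.velocity_eq_sqrt hs hT0 hT hlt, hT]
  ring

theorem tendsto_gap_interior (hs : 1 < s) (h : IsCoveringFlow s N E S χ b d q) (hT0 : 0 < T)
    (hT : ‖q T‖ ^ 2 = FCrit s) (hlt : ∀ t ∈ Set.Ico 0 T, ‖q t‖ ^ 2 < FCrit s)
    (hV : (potential s N E S).eval (FCrit s) < 0) :
    ∃ κ, 0 < κ ∧ Tendsto (fun t => (FCrit s - ‖q t‖ ^ 2) / (T - t) ^ 1) (𝓝[<] T) (𝓝 κ) := by
  have h1 := h.hasDerivAt_F (t := T) (by rw [hT]; linarith)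
  rw [h.velocity_eq_sqrt hs hT0 hT hlt] at h1
  refine ⟨_, Real.sqrt_pos.2 (neg_pos.2 hV), (h1.tendsto_slope.mono_left (nhdsWithin_mono T
      (fun x (hx : x ∈ Set.Iio T) => (ne_of_lt hx : x ≠ T)))).congr fun t => ?_⟩
  rw [slope_def_field, hT, pow_one, ← neg_sub, ← neg_sub T t, neg_div_neg_eq]

theorem tendsto_gap_endpoint (hs : 1 < s) (h : IsCoveringFlow s N E S χ b d q) (hT0 : 0 < T)
    (hT : ‖q T‖ ^ 2 = FCrit s) (hlt : ∀ t ∈ Set.Ico 0 T, ‖q t‖ ^ 2 < FCrit s)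
    (hV : (potential s N E S).eval (FCrit s) = 0)
    (hV' : 0 < (potential s N E S).derivative.eval (FCrit s)) :
    ∃ κ, 0 < κ ∧ Tendsto (fun t => (FCrit s - ‖q t‖ ^ 2) / (T - t) ^ 2) (𝓝[<] T) (𝓝 κ) := by
  have h1 := (h.expansion hs hT0 hT hlt).tendsto_div_nhds_zero.const_sub
    ((potential s N E S).derivative.eval (FCrit s) / 4)
  rw [sub_zero] at h1
  refine ⟨_, by positivity, h1.congr' (eventually_mem_nhdsWithin.mono fun t ht => ?_)⟩
  have h2 : T - t ≠ 0 := by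
    rw [Set.mem_Iio] at ht
    linarith
  rw [hV, neg_zero, Real.sqrt_zero]
  field_simp
  ring

theorem tendsto_F (h : IsCoveringFlow s N E S χ b d q) (hT0 : 0 < T)
    (hT : ‖q T‖ ^ 2 = FCrit s) (hlt : ∀ t ∈ Set.Ico 0 T, ‖q t‖ ^ 2 < FCrit s) :
    Tendsto (fun t => ‖q t‖ ^ 2) (𝓝[<] T) (𝓝[<] FCrit s) := by
  refine tendsto_nhdsWithin_iff.2 ⟨?_, ?_⟩
  · rw [← hT]
    exact h.continuous_F.continuousAt.tendsto.mono_left nhdsWithin_le_nhds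
  · filter_upwards [Ico_mem_nhdsLT hT0] with t ht using hlt t ht

theorem tendsto_x (hs : 1 < s) (h : IsCoveringFlow s N E S χ b d q) (hT0 : 0 < T)
    (hT : ‖q T‖ ^ 2 = FCrit s) (hlt : ∀ t ∈ Set.Ico 0 T, ‖q t‖ ^ 2 < FCrit s) :
    Tendsto (fun t => ‖toP s (q t)‖ ^ 2) (𝓝[<] T) (𝓝[<] xCrit s) := by
  refine tendsto_nhdsWithin_iff.2 ⟨?_, ?_⟩
  · rw [← invF_FCrit hs, ← hT, ← norm_toP_sq]
    exact (h.continuous_toP.norm.pow 2).continuousAt.tendsto.mono_left nhdsWithin_le_nhds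
  · filter_upwards [Ico_mem_nhdsLT hT0] with t ht using norm_toP_sq_lt hs (hlt t ht)

theorem tendsto_one_sub_x (hs : 1 < s) (h : IsCoveringFlow s N E S χ b d q) (hT0 : 0 < T)
    (hT : ‖q T‖ ^ 2 = FCrit s) (hlt : ∀ t ∈ Set.Ico 0 T, ‖q t‖ ^ 2 < FCrit s) {m : ℕ} {κ : ℝ}
    (hκ : 0 < κ) (hgap : Tendsto (fun t => (FCrit s - ‖q t‖ ^ 2) / (T - t) ^ m) (𝓝[<] T) (𝓝 κ)) :
    ∃ κ', 0 < κ' ∧ Tendsto (fun t => (1 - ‖toP s (q t)‖ ^ 2 / xCrit s) / (T - t) ^ (2 * m))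
      (𝓝[<] T) (𝓝 κ') := by
  obtain ⟨k, hk, hk'⟩ := tendsto_one_sub_invF_div hs
  have h1 := (hk'.comp (h.tendsto_F hT0 hT hlt)).mul (hgap.pow 2)
  refine ⟨_, by positivity, h1.congr' ?_⟩
  filter_upwards [Ico_mem_nhdsLT hT0] with t ht
  have h2 : FCrit s - ‖q t‖ ^ 2 ≠ 0 := by
    have := hlt t ht
    linarith
  have h3 : T - t ≠ 0 := by linarith [ht.2]
  rw [Function.comp_apply, norm_toP_sq, div_pow, ← pow_mul, mul_comm m 2]
  field_simp

/-- The limit of `|b| ^ 2` at the time of the cascade. -/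
theorem norm_b_sq_of_eq (hs : 1 < s) (h : IsCoveringFlow s N E S χ b d q) (hN : 0 < N)
    (hT : ‖q T‖ ^ 2 = FCrit s) : ‖b T‖ ^ 2 = N * (1 - E / ECrit s N) := by
  have h0 : s - 1 ≠ 0 := by linarith
  have hs0 : s ≠ 0 := by linarith
  rw [h.norm_b_sq, hT, FCrit_add_one hs, FCrit, ECrit]
  field_simp
  ring

theorem norm_c_sq_pos (hs : 1 < s) (h : IsCoveringFlow s N E S χ b d q) (hE : 0 < E) (t : ℝ) :
    0 < ‖toC s (d t) (q t)‖ ^ 2 := by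
  rw [h.norm_c_sq hs]
  have : 0 < s + 1 := by linarith
  have : 0 < (‖q t‖ ^ 2 + 1) ^ (s + 1) := Real.rpow_pos_of_pos (by positivity) _
  positivity

theorem tendsto_mode_succ (hs : 1 < s) (h : IsCoveringFlow s N E S χ b d q) (hN : 0 < N)
    (hT : ‖q T‖ ^ 2 = FCrit s) (n : ℕ) : Tendsto (fun t => ‖manifoldState s (b t)
      (toC s (d t) (q t)) (toP s (q t)) (n + 1)‖ ^ 2) (𝓝[<] T)
      (𝓝 (limitSpectrum s N E (n + 1))) := by
  have h0 : 0 < s - 1 := by linarith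
  have h1 : Continuous fun t => ‖manifoldState s (b t) (toC s (d t) (q t)) (toP s (q t)) (n + 1)‖ ^ 2 :=
    (((continuous_const.mul h.continuous_toC).mul (h.continuous_toP.pow n)).norm.pow 2)
  have h2 := h1.continuousAt (x := T) |>.tendsto.mono_left (nhdsWithin_le_nhds (s := Set.Iio T))
  convert! h2 using 2
  have hF := FCrit_pos hs
  have hG := Real.rpow_pos_of_pos (show 0 < 1 + FCrit s by linarith) s
  have hG1 : (1 + FCrit s) ^ (s + 1) = (1 + FCrit s) ^ s * (s / (s - 1)) := by
    rw [Real.rpow_add_one (by linarith), add_comm, FCrit_add_one hs]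
  rw [norm_manifoldState_succ_sq, h.norm_c_sq hs, norm_toP_sq, hT, invF_FCrit hs, limitSpectrum,
    ← invF_FCrit hs, invF, add_comm (FCrit s), hG1, ECrit]
  rw [show FCrit s / (1 + FCrit s) ^ s = 1 / (s - 1) / (1 + FCrit s) ^ s by rw [FCrit]]
  generalize (1 + FCrit s) ^ s = G at hG
  rw [pow_succ (1 / (s - 1) / G)]
  field_simp
  ring

theorem sobolev_eq (hs : 1 < s) {t : ℝ} (ht : ‖q t‖ ^ 2 < FCrit s) (ξ : ℝ) :
    sobolev ξ (manifoldState s (b t) (toC s (d t) (q t)) (toP s (q t))) =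
      ‖b t‖ ^ 2 + ‖toC s (d t) (q t)‖ ^ 2 * sobolevSeries s ξ (‖toP s (q t)‖ ^ 2) :=
  sobolev_manifoldState hs ξ _ _ _ (norm_toP_sq_lt hs ht)

theorem tendsto_sub_nhdsGT (T : ℝ) : Tendsto (fun t => T - t) (𝓝[<] T) (𝓝[>] 0) := by
  have h1 : Tendsto (fun t : ℝ => T - t) (𝓝[<] T) (𝓝 (T - T)) :=
    (tendsto_id.const_sub T).mono_left nhdsWithin_le_nhds
  rw [sub_self] at h1
  exact tendsto_nhdsWithin_iff.2 ⟨h1, eventually_mem_nhdsWithin.mono fun r hr => by simpa using hr⟩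

/-- The growth of the Sobolev sums, when `F_c - F` is of the order of `(T - t) ^ m`. -/
theorem tendsto_sobolev (hs : 1 < s) (h : IsCoveringFlow s N E S χ b d q) (hE : 0 < E)
    (hT0 : 0 < T) (hT : ‖q T‖ ^ 2 = FCrit s) (hlt : ∀ t ∈ Set.Ico 0 T, ‖q t‖ ^ 2 < FCrit s)
    {m : ℕ} (hm : 0 < m) {κ : ℝ} (hκ : 0 < κ)
    (hgap : Tendsto (fun t => (FCrit s - ‖q t‖ ^ 2) / (T - t) ^ m) (𝓝[<] T) (𝓝 κ)) {ξ : ℝ}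
    (hξ : 3 / 4 < ξ) : ∃ C, 0 < C ∧ Tendsto (fun t =>
      sobolev ξ (manifoldState s (b t) (toC s (d t) (q t)) (toP s (q t))) /
        (T - t) ^ ((m : ℝ) * (3 - 4 * ξ))) (𝓝[<] T) (𝓝 C) := by
  obtain ⟨κ', hκ', h1⟩ := h.tendsto_one_sub_x hs hT0 hT hlt hκ hgap
  obtain ⟨K, hK, h2⟩ := tendsto_sobolevSeries_div_rpow hs hξ
  have h3 := h2.comp (h.tendsto_x hs hT0 hT hlt)
  have hm' : (0 : ℝ) < m := by exact_mod_cast hm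
  have hb : Tendsto (fun t => ‖b t‖ ^ 2 * (T - t) ^ ((m : ℝ) * (4 * ξ - 3))) (𝓝[<] T) (𝓝 0) := by
    have h4 : Tendsto (fun t => ‖b t‖ ^ 2) (𝓝[<] T) (𝓝 (‖b T‖ ^ 2)) :=
      (h.continuous_b.norm.pow 2).continuousAt.tendsto.mono_left nhdsWithin_le_nhds
    have he : 0 < (m : ℝ) * (4 * ξ - 3) := mul_pos hm' (by linarith)
    have h5 := ((tendsto_sub_nhdsGT T).mono_right nhdsWithin_le_nhds).rpow_const
      (p := (m : ℝ) * (4 * ξ - 3)) (Or.inr he.le)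
    rw [Real.zero_rpow he.ne'] at h5
    simpa using h4.mul h5
  have hc : Tendsto (fun t => ‖toC s (d t) (q t)‖ ^ 2) (𝓝[<] T) (𝓝 (‖toC s (d T) (q T)‖ ^ 2)) :=
    (h.continuous_toC.norm.pow 2).continuousAt.tendsto.mono_left nhdsWithin_le_nhds
  have h6 := hb.add ((hc.mul h3).mul (h1.rpow_const (p := 3 / 2 - 2 * ξ) (Or.inl hκ'.ne')))
  have hcpos := h.norm_c_sq_pos hs hE T
  refine ⟨0 + ‖toC s (d T) (q T)‖ ^ 2 * K * κ' ^ (3 / 2 - 2 * ξ), ?_, h6.congr' ?_⟩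
  · have := Real.rpow_pos_of_pos hκ' (3 / 2 - 2 * ξ)
    positivity
  · filter_upwards [Ico_mem_nhdsLT hT0] with t ht
    have hTt : 0 < T - t := by linarith [ht.2]
    have hxpos : 0 < 1 - ‖toP s (q t)‖ ^ 2 / xCrit s := by
      rw [sub_pos, div_lt_one (xCrit_pos hs)]
      exact norm_toP_sq_lt hs (hlt t ht)
    rw [sobolev_eq hs (hlt t ht), Function.comp_apply, Real.div_rpow hxpos.le (by positivity),
      ← Real.rpow_natCast (T - t) (2 * m), ← Real.rpow_mul hTt.le,
      show (m : ℝ) * (4 * ξ - 3) = -((m : ℝ) * (3 - 4 * ξ)) by ring, Real.rpow_neg hTt.le,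
      show ((2 * m : ℕ) : ℝ) * (3 / 2 - 2 * ξ) = (m : ℝ) * (3 - 4 * ξ) by push_cast; ring]
    have h7 := Real.rpow_pos_of_pos hTt ((m : ℝ) * (3 - 4 * ξ))
    have h8 := Real.rpow_pos_of_pos hxpos (3 / 2 - 2 * ξ)
    generalize (T - t) ^ ((m : ℝ) * (3 - 4 * ξ)) = u at h7
    generalize (1 - ‖toP s (q t)‖ ^ 2 / xCrit s) ^ (3 / 2 - 2 * ξ) = v at h8
    field_simp

/-- The logarithmic growth of the critical Sobolev sum. -/
theorem tendsto_sobolev_log (hs : 1 < s) (h : IsCoveringFlow s N E S χ b d q) (hE : 0 < E)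
    (hT0 : 0 < T) (hT : ‖q T‖ ^ 2 = FCrit s) (hlt : ∀ t ∈ Set.Ico 0 T, ‖q t‖ ^ 2 < FCrit s)
    {m : ℕ} (hm : 0 < m) {κ : ℝ} (hκ : 0 < κ)
    (hgap : Tendsto (fun t => (FCrit s - ‖q t‖ ^ 2) / (T - t) ^ m) (𝓝[<] T) (𝓝 κ)) :
    ∃ C, 0 < C ∧ Tendsto (fun t =>
      sobolev (3 / 4) (manifoldState s (b t) (toC s (d t) (q t)) (toP s (q t))) /
        Real.log (1 / (T - t))) (𝓝[<] T) (𝓝 C) := by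
  obtain ⟨κ', hκ', h1⟩ := h.tendsto_one_sub_x hs hT0 hT hlt hκ hgap
  obtain ⟨K, hK, h2⟩ := tendsto_sobolevSeries_div_log hs
  have h3 := h2.comp (h.tendsto_x hs hT0 hT hlt)
  have hm' : (0 : ℝ) < m := by exact_mod_cast hm
  have hlog : Tendsto (fun t => (Real.log (1 / (T - t)))⁻¹) (𝓝[<] T) (𝓝 0) := by
    refine tendsto_inv_atTop_zero.comp ((tendsto_neg_atBot_atTop.comp
      (Real.tendsto_log_nhdsGT_zero.comp (tendsto_sub_nhdsGT T))).congr fun t => ?_)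
    rw [one_div, Real.log_inv]
    rfl
  have hb : Tendsto (fun t => ‖b t‖ ^ 2 * (Real.log (1 / (T - t)))⁻¹) (𝓝[<] T) (𝓝 0) := by
    have h4 : Tendsto (fun t => ‖b t‖ ^ 2) (𝓝[<] T) (𝓝 (‖b T‖ ^ 2)) :=
      (h.continuous_b.norm.pow 2).continuousAt.tendsto.mono_left nhdsWithin_le_nhds
    simpa using h4.mul hlog
  have hc : Tendsto (fun t => ‖toC s (d t) (q t)‖ ^ 2) (𝓝[<] T) (𝓝 (‖toC s (d T) (q T)‖ ^ 2)) :=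
    (h.continuous_toC.norm.pow 2).continuousAt.tendsto.mono_left nhdsWithin_le_nhds
  have hr : Tendsto (fun t => -(Real.log ((1 - ‖toP s (q t)‖ ^ 2 / xCrit s) / (T - t) ^ (2 * m)) *
      (Real.log (1 / (T - t)))⁻¹) + 2 * m) (𝓝[<] T) (𝓝 (2 * m)) := by
    simpa using ((h1.log hκ'.ne').mul hlog).neg.add_const (2 * (m : ℝ))
  have h6 := hb.add ((hc.mul h3).mul hr)
  have hcpos := h.norm_c_sq_pos hs hE T
  refine ⟨0 + ‖toC s (d T) (q T)‖ ^ 2 * K * (2 * m), by positivity, h6.congr' ?_⟩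
  have hne : ∀ᶠ t in 𝓝[<] T, T - t < 1 := ((tendsto_sub_nhdsGT T).mono_right
    nhdsWithin_le_nhds).eventually_lt_const one_pos
  have hx0 : ∀ᶠ t in 𝓝[<] T, 0 < ‖toP s (q t)‖ ^ 2 := ((h.tendsto_x hs hT0 hT hlt).mono_right
    nhdsWithin_le_nhds).eventually_const_lt (xCrit_pos hs)
  filter_upwards [Ico_mem_nhdsLT hT0, hne, hx0] with t ht ht1 hx0
  have hTt : 0 < T - t := by linarith [ht.2]
  have hxc := xCrit_pos hs
  have hxpos : 0 < 1 - ‖toP s (q t)‖ ^ 2 / xCrit s := by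
    rw [sub_pos, div_lt_one hxc]
    exact norm_toP_sq_lt hs (hlt t ht)
  have hxlt : 1 - ‖toP s (q t)‖ ^ 2 / xCrit s < 1 := by
    have : 0 < ‖toP s (q t)‖ ^ 2 / xCrit s := by positivity
    linarith
  have e1 := (Real.log_neg hTt ht1).ne
  have e2 := (Real.log_neg hxpos hxlt).ne
  rw [sobolev_eq hs (hlt t ht), Function.comp_apply, Real.log_div hxpos.ne' (by positivity),
    Real.log_pow, one_div, Real.log_inv]
  push_cast
  generalize Real.log (T - t) = u at e1
  generalize Real.log (1 - ‖toP s (q t)‖ ^ 2 / xCrit s) = v at e2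
  field_simp
  ring

/-- A trajectory that reaches `F_c` is a cascade. -/
theorem isCascade (hs : 1 < s) (h : IsCoveringFlow s N E S χ b d q) (hT0 : 0 < T)
    (hT : ‖q T‖ ^ 2 = FCrit s) (hlt : ∀ t ∈ Set.Ico 0 T, ‖q t‖ ^ 2 < FCrit s)
    (hV : (potential s N E S).eval (FCrit s) < 0 ∨ ((potential s N E S).eval (FCrit s) = 0 ∧
      0 < (potential s N E S).derivative.eval (FCrit s))) :
    IsCascade s N E S T (fun t => manifoldState s (b t) (toC s (d t) (q t)) (toP s (q t)))
      (fun t => toP s (q t)) := by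
  have hE := energy_pos_of_potential hs h.energy_nonneg hV
  have hEc := h.energy_lt hs hE (hlt 0 ⟨le_rfl, hT0⟩)
  have hN := number_pos hs hE hEc
  have hbig : (fun t => bigF s (toP s (q t))) =ᶠ[𝓝[<] T] fun t => ‖q t‖ ^ 2 := by
    filter_upwards [Ico_mem_nhdsLT hT0] with t ht using bigF_toP hs (hlt t ht).le
  have hsign := potential_sign hs N E S h.energy_nonneg hEc.le
  refine ⟨hE, hEc, ((h.tendsto_F hT0 hT hlt).mono_right nhdsWithin_le_nhds).congr' hbig.symm,
    (h.tendsto_x hs hT0 hT hlt).mono_right nhdsWithin_le_nhds, ?_, ?_, ?_,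
    limitSpectrum_isEquivalent hs hE hEc, fun t ht ξ => summable_sobolevTerm hs ξ _ _ _
      (norm_toP_sq_lt hs (hlt t ht)), fun ξ hξ => ?_, fun hS ξ hξ => ?_, fun hS ξ hξ => ?_, ?_⟩
  · refine (h.expansion hs hT0 hT hlt).congr' (hbig.mono fun t ht => ?_) EventuallyEq.rfl
    beta_reduce at ht ⊢
    rw [ht]
  · rw [← h.norm_b_sq_of_eq hs hN hT]
    exact (h.continuous_b.norm.pow 2).continuousAt.tendsto.mono_left nhdsWithin_le_nhds
  · rintro (_ | n) hn
    · exact absurd hn (by norm_num)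
    · exact h.tendsto_mode_succ hs hN hT n
  · obtain ⟨B, hB⟩ := isCompact_Icc.exists_bound_of_continuousOn (s := Set.Icc 0 T)
      (h.continuous_b.norm.pow 2).continuousOn
    obtain ⟨C, hC⟩ := isCompact_Icc.exists_bound_of_continuousOn (s := Set.Icc 0 T)
      (h.continuous_toC.norm.pow 2).continuousOn
    refine ⟨B + C * sobolevSeries s ξ (xCrit s), fun t ht => ?_⟩
    rw [sobolev_eq hs (hlt t ht)]
    have h1 : ‖b t‖ ^ 2 ≤ B := (le_abs_self _).trans (hB t ⟨ht.1, ht.2.le⟩)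
    have h2 : ‖toC s (d t) (q t)‖ ^ 2 ≤ C := (le_abs_self _).trans (hC t ⟨ht.1, ht.2.le⟩)
    have h3 := sobolevSeries_le hs hξ (by positivity : 0 ≤ ‖toP s (q t)‖ ^ 2)
      (norm_toP_sq_lt hs (hlt t ht)).le
    have h4 : 0 ≤ sobolevSeries s ξ (‖toP s (q t)‖ ^ 2) := tsum_nonneg fun n => by positivity
    have h5 : 0 ≤ C := le_trans (by positivity) h2
    have h6 := mul_le_mul h2 h3 h4 h5
    linarith
  · obtain ⟨κ, hκ, hgap⟩ := h.tendsto_gap_interior hs hT0 hT hlt (hsign.2.2 hS)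
    simpa using h.tendsto_sobolev hs hE hT0 hT hlt one_pos hκ hgap hξ
  · obtain ⟨κ, hκ, hgap⟩ := h.tendsto_gap_endpoint hs hT0 hT hlt (hsign.1.2 hS.1) hS.2
    have := h.tendsto_sobolev hs hE hT0 hT hlt two_pos hκ hgap hξ
    rwa [show ((2 : ℕ) : ℝ) * (3 - 4 * ξ) = 6 - 8 * ξ by push_cast; ring] at this
  · rcases hV with hV | ⟨hV, hV'⟩
    · obtain ⟨κ, hκ, hgap⟩ := h.tendsto_gap_interior hs hT0 hT hlt hV
      exact h.tendsto_sobolev_log hs hE hT0 hT hlt one_pos hκ hgap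
    · obtain ⟨κ, hκ, hgap⟩ := h.tendsto_gap_endpoint hs hT0 hT hlt hV hV'
      exact h.tendsto_sobolev_log hs hE hT0 hT hlt two_pos hκ hgap

theorem isGlobalSolution (hs : 1 < s) (h : IsCoveringFlow s N E S χ b d q)
    (hlt : ∀ t, 0 ≤ t → ‖q t‖ ^ 2 < FCrit s) :
    IsGlobalSolution s (manifoldState s (b 0) (toC s (d 0) (q 0)) (toP s (q 0)))
      (fun t => manifoldState s (b t) (toC s (d t) (q t)) (toP s (q t))) :=
  ⟨h.isStrongSolutionOn hs fun t ht => hlt t ht, rfl, fun _ _ hT' hβ hβ0 _ ht =>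
    hβ.eq_of_eq hs Set.ordConnected_Ico (h.isStrongSolutionOn hs fun τ hτ => hlt τ hτ.1)
      ⟨le_rfl, hT'⟩ hβ0 ht⟩

theorem sobolev_bounded (hs : 1 < s) (h : IsCoveringFlow s N E S χ b d q) {M : ℝ}
    (hM : M < FCrit s) (hle : ∀ t, 0 ≤ t → ‖q t‖ ^ 2 ≤ M) (ξ : ℝ) :
    ∃ R : ℝ, ∀ t : ℝ, 0 ≤ t →
      Summable (sobolevTerm ξ (manifoldState s (b t) (toC s (d t) (q t)) (toP s (q t)))) ∧
      sobolev ξ (manifoldState s (b t) (toC s (d t) (q t)) (toP s (q t))) ≤ R := by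
  have hE := h.energy_nonneg
  have hM0 : 0 ≤ M := le_trans (by positivity) (hle 0 le_rfl)
  have hs1 : 0 < s + 1 := by linarith
  have h0 : 0 < s - 1 := by linarith
  refine ⟨_, fun t ht => ⟨summable_sobolevTerm hs ξ _ _ _ (norm_toP_sq_lt hs ((hle t ht).trans_lt hM)),
    sobolev_manifoldState_le hs ξ (B := N) (C := (s + 1) / 2 * E) (x := invF s M) ?_ ?_ ?_
      (invF_lt_xCrit hs hM0 hM)⟩⟩
  · have hF : (s - 1) * ‖q t‖ ^ 2 < 1 := by
      have := (hle t ht).trans_lt hM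
      rwa [FCrit, lt_div_iff₀ h0, mul_comm] at this
    rw [h.norm_b_sq]
    have : 0 ≤ (2 - (s - 1) * ‖q t‖ ^ 2) / (2 * (‖q t‖ ^ 2 + 1)) * E :=
      mul_nonneg (div_nonneg (by linarith) (by positivity)) hE
    linarith
  · rw [h.norm_c_sq hs]
    refine mul_le_mul_of_nonneg_right (div_le_div_of_nonneg_left hs1.le two_pos ?_) hE
    have : 1 ≤ (‖q t‖ ^ 2 + 1) ^ (s + 1) :=
      Real.one_le_rpow (by linarith [sq_nonneg ‖q t‖]) hs1.le
    linarith
  · rw [norm_toP_sq]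
    exact (invF_strictMonoOn hs).monotoneOn ⟨by positivity, (hle t ht).trans hM.le⟩
      ⟨hM0, hM.le⟩ (hle t ht)

end IsCoveringFlow

/-- The dichotomy between cascades in finite time and global solutions with bounded Sobolev sums. -/
theorem cascade_dichotomy {s : ℝ} (hs : 1 < s) (b₀ c₀ p₀ : ℂ) (N E S : ℝ)
    (hp : ‖p₀‖ ^ 2 < xCrit s) (hN : N = particleNumber (manifoldState s b₀ c₀ p₀))
    (hE : E = energy (manifoldState s b₀ c₀ p₀)) (hS : S = quantityS s N E b₀ c₀ p₀) :
    (CascadeCondition s N E S → ∃ (T : ℝ) (α : ℝ → ℕ → ℂ) (b c p : ℝ → ℂ),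
        IsMaximalSolution s (manifoldState s b₀ c₀ p₀) T α ∧
        ReducedDynamics s N E S (Set.Ico 0 T) α b c p ∧ IsCascade s N E S T α p) ∧
    (¬ CascadeCondition s N E S → ∃ (α : ℝ → ℕ → ℂ) (b c p : ℝ → ℂ),
        IsGlobalSolution s (manifoldState s b₀ c₀ p₀) α ∧
        ReducedDynamics s N E S (Set.Ici 0) α b c p ∧
        (∃ M : ℝ, M < FCrit s ∧ ∀ t : ℝ, 0 ≤ t → bigF s (p t) ≤ M) ∧
        ∀ ξ : ℝ, ∃ R : ℝ, ∀ t : ℝ, 0 ≤ t →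
          Summable (sobolevTerm ξ (α t)) ∧ sobolev ξ (α t) ≤ R) := by
  rw [particleNumber_manifoldState hs _ _ hp.le] at hN
  rw [energy_manifoldState hs _ _ hp.le] at hE
  obtain ⟨χ, b, d, q, h, hb, hc, hpq, hq⟩ :=
    exists_coveringFlow hs 0 b₀ c₀ hp hN.symm hE.symm hS.symm
  have hiff := cascadeCondition_iff hs S h.energy_nonneg (h.energy_le hs hq)
  rw [hiff, ← hb, ← hc, ← hpq]
  refine ⟨fun hV => ?_, fun hV => ?_⟩
  · obtain ⟨T, hT0, hT, hlt⟩ := h.exists_first_time hs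
      (energy_pos_of_potential hs h.energy_nonneg hV) hV hq
    exact ⟨T, _, b, _, _, h.isMaximalSolution hs hT0 hT hlt,
      h.reducedDynamics hs hlt fun _ _ => rfl, h.isCascade hs hT0 hT hlt hV⟩
  · obtain ⟨M, hM, hle⟩ := h.exists_bound hs (fun _ => by
      rcases lt_trichotomy ((potential s N E S).eval (FCrit s)) 0 with h1 | h1 | h1
      · exact absurd (Or.inl h1) hV
      · exact Or.inr ⟨h1, not_lt.1 fun h2 => hV (Or.inr ⟨h1, h2⟩)⟩
      · exact Or.inl h1) hq
    have hlt : ∀ t, 0 ≤ t → ‖q t‖ ^ 2 < FCrit s := fun t ht => (hle t ht).trans_lt hM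
    exact ⟨_, b, _, _, h.isGlobalSolution hs hlt,
      h.reducedDynamics hs (fun t ht => hlt t ht) fun _ _ => rfl,
      ⟨M, hM, fun t ht => by rw [bigF_toP hs (hlt t ht).le]; exact hle t ht⟩,
      h.sobolev_bounded hs hM hle⟩


/-! ### Explicit functions of time -/

theorem eq_of_hasDerivAt_zero_Icc {V : Type*} [NormedAddCommGroup V] [NormedSpace ℝ V] {f : ℝ → V}
    {T : ℝ} (h : ∀ t ∈ Set.Icc 0 T, HasDerivAt f 0 t) : ∀ t ∈ Set.Icc 0 T, f t = f 0 :=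
  constant_of_has_deriv_right_zero (fun t ht => (h t ht).continuousAt.continuousWithinAt)
    fun t ht => (h t ⟨ht.1, ht.2.le⟩).hasDerivWithinAt

/-- The phase of a complex function is determined by the imaginary part of its logarithmic
derivative. -/
theorem eq_norm_mul_exp {z : ℝ → ℂ} {ρ ψ φ : ℝ → ℝ} {T : ℝ}
    (hz : ∀ t ∈ Set.Icc 0 T, HasDerivAt z ((ρ t + ψ t * Complex.I) * z t) t)
    (hφ : ∀ t ∈ Set.Icc 0 T, HasDerivAt φ (ψ t) t) (hne : ∀ t ∈ Set.Icc 0 T, z t ≠ 0)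
    (h0 : z 0 = ‖z 0‖ * Complex.exp (φ 0 * Complex.I)) :
    ∀ t ∈ Set.Icc 0 T, z t = ‖z t‖ * Complex.exp (φ t * Complex.I) := by
  intro t ht
  have hconst := eq_of_hasDerivAt_zero_Icc
    (f := fun t => z t * Complex.exp (-(φ t * Complex.I)) * ((‖z t‖⁻¹ : ℝ) : ℂ)) (fun τ hτ => ?_) t ht
  · have hn := norm_ne_zero_iff.2 (hne t ht)
    have hn0 := norm_ne_zero_iff.2 (hne 0 ⟨le_rfl, ht.1.trans ht.2⟩)
    have h1 : z 0 * Complex.exp (-(φ 0 * Complex.I)) * ((‖z 0‖⁻¹ : ℝ) : ℂ) = 1 := by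
      nth_rw 1 [h0]
      rw [mul_assoc (‖z 0‖ : ℂ), ← Complex.exp_add, add_neg_cancel, Complex.exp_zero, mul_one,
        ← Complex.ofReal_mul, mul_inv_cancel₀ hn0, Complex.ofReal_one]
    simp only [h1] at hconst
    have h2 : Complex.exp (-(φ t * Complex.I)) * Complex.exp (φ t * Complex.I) = 1 := by
      rw [← Complex.exp_add, neg_add_cancel, Complex.exp_zero]
    have h3 : (‖z t‖ : ℂ) * ((‖z t‖⁻¹ : ℝ) : ℂ) = 1 := by
      rw [← Complex.ofReal_mul, mul_inv_cancel₀ hn, Complex.ofReal_one]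
    linear_combination (‖z t‖ * Complex.exp (φ t * Complex.I)) * hconst -
      z t * (‖z t‖ : ℂ) * ((‖z t‖⁻¹ : ℝ) : ℂ) * h2 - z t * h3
  · have hn := norm_pos_iff.2 (hne τ hτ)
    have h1 : HasDerivAt (fun t => ‖z t‖ ^ 2) (2 * (ρ τ * ‖z τ‖ ^ 2)) τ := by
      refine (hz τ hτ).norm_sq.congr_deriv ?_
      rw [Complex.inner, ← Complex.normSq_eq_norm_sq, Complex.normSq_apply]
      simp [Complex.mul_re, Complex.mul_im]
      ring
    have h2 : HasDerivAt (fun t => ‖z t‖) (ρ τ * ‖z τ‖) τ := by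
      have := h1.sqrt (by positivity)
      simp only [Real.sqrt_sq (norm_nonneg _)] at this
      refine this.congr_deriv ?_
      field_simp
    have h3 := (h2.inv hn.ne').ofReal_comp
    have h4 := (((hφ τ hτ).ofReal_comp.mul_const Complex.I).neg).cexp
    refine (((hz τ hτ).mul h4).mul h3).congr_deriv ?_
    have hn' : (‖z τ‖ : ℂ) ≠ 0 := by exact_mod_cast hn.ne'
    simp only [Pi.mul_apply, Pi.neg_apply, Pi.inv_apply]
    push_cast
    field_simp
    ring

theorem eq_norm_mul_exp_of_nonneg {z e : ℂ} {r : ℝ} (hr : 0 ≤ r) (hz : z = ‖z‖ * e) :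
    (r : ℂ) * z = ‖(r : ℂ) * z‖ * e := by
  rw [norm_mul, Complex.norm_real, Real.norm_of_nonneg hr]
  push_cast
  nth_rw 1 [hz]
  ring

/-- The phase of `i * (1 + i * x)`. -/
theorem eq_norm_mul_exp_arctan {w : ℂ} {x : ℝ} (hw : 0 ≤ w.im) (h : w.re = -(x * w.im)) :
    w = ‖w‖ * Complex.exp ((Real.pi / 2 + Real.arctan x : ℝ) * Complex.I) := by
  have h0 : 0 < √(1 + x ^ 2) := Real.sqrt_pos.2 (by positivity)
  have hn : ‖w‖ = w.im * √(1 + x ^ 2) := by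
    rw [Complex.norm_eq_sqrt_sq_add_sq, h, show (-(x * w.im)) ^ 2 + w.im ^ 2 =
      w.im ^ 2 * (1 + x ^ 2) by ring, Real.sqrt_mul (by positivity), Real.sqrt_sq hw]
  rw [hn, Complex.exp_mul_I, ← Complex.ofReal_cos, ← Complex.ofReal_sin, add_comm (Real.pi / 2),
    Real.cos_add_pi_div_two, Real.sin_add_pi_div_two, Real.cos_arctan, Real.sin_arctan]
  apply Complex.ext
  · simp [h]
    field_simp
  · simp
    field_simp

theorem sqrt_three_fifths : √(3 / 5 : ℝ) = 3 / √15 := by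
  rw [show (3 / 5 : ℝ) = 3 ^ 2 / 15 by norm_num, Real.sqrt_div (by norm_num),
    Real.sqrt_sq (by norm_num)]

theorem sqrt_seven_fifteenths : √(7 / 15 : ℝ) = √7 / √15 := Real.sqrt_div (by norm_num) _

theorem hasDerivAt_tanh_mul (Ω t : ℝ) :
    HasDerivAt (fun t => Real.tanh (Ω * t)) (Ω / Real.cosh (Ω * t) ^ 2) t := by
  have h0 := Real.cosh_pos (Ω * t)
  have hi := (hasDerivAt_id t).const_mul Ω
  have h1 := hi.sinh.div hi.cosh h0.ne'
  have e : (fun t => Real.tanh (Ω * t)) = fun t => Real.sinh (Ω * t) / Real.cosh (Ω * t) :=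
    funext fun t => Real.tanh_eq_sinh_div_cosh _
  rw [e]
  refine h1.congr_deriv ?_
  have h2 := Real.cosh_sq (Ω * t)
  simp only [id]
  field_simp
  linear_combination Ω * h2

theorem hasDerivAt_artanh {x : ℝ} (hx : x ∈ Set.Ioo (-1) 1) :
    HasDerivAt Real.artanh (1 / (1 - x ^ 2)) x := by
  have h1 : 0 < 1 + x := by linarith [hx.1]
  have h2 : 0 < 1 - x := by linarith [hx.2]
  have hi := hasDerivAt_id x
  have h3 := (((hi.const_add 1).div (hi.const_sub 1) h2.ne').log (div_pos h1 h2).ne').const_mul (1 / 2)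
  have he : Real.artanh =ᶠ[𝓝 x] fun y => 1 / 2 * Real.log ((1 + y) / (1 - y)) := by
    filter_upwards [Ioo_mem_nhds hx.1 hx.2] with y hy
    exact Real.artanh_eq_half_log ⟨hy.1.le, hy.2.le⟩
  refine (h3.congr_of_eventuallyEq he).congr_deriv ?_
  have h4 : 1 - x ^ 2 ≠ 0 := by nlinarith
  simp only [id, Pi.div_apply]
  field_simp
  ring

/-- The function differentiated here is the nonlinear term `a` that all three phases share. -/
theorem hasDerivAt_artanh_tanh (Ω t : ℝ) :
    HasDerivAt (fun t => 1 / √7 * Real.artanh (√(7 / 15) * Real.tanh (Ω * t)))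
      (Ω / √15 / (1 + 8 / 15 * Real.sinh (Ω * t) ^ 2)) t := by
  have h7 : 0 < √(7 : ℝ) := by positivity
  have h15 : 0 < √(15 : ℝ) := by positivity
  have hx : √(7 / 15) * Real.tanh (Ω * t) ∈ Set.Ioo (-1 : ℝ) 1 := by
    rw [Set.mem_Ioo, ← abs_lt, abs_mul, abs_of_nonneg (Real.sqrt_nonneg _)]
    have h1 : √(7 / 15 : ℝ) ≤ 1 := Real.sqrt_le_one.2 (by norm_num)
    have h2 := Real.abs_tanh_lt_one (Ω * t)
    nlinarith [abs_nonneg (Real.tanh (Ω * t))]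
  have h := (((hasDerivAt_artanh hx).comp t ((hasDerivAt_tanh_mul Ω t).const_mul (√(7 / 15)))).const_mul
    (1 / √7))
  refine h.congr_deriv ?_
  have hc := Real.cosh_pos (Ω * t)
  have hcs := Real.cosh_sq (Ω * t)
  rw [Real.tanh_eq_sinh_div_cosh, mul_pow, Real.sq_sqrt (by norm_num : (0 : ℝ) ≤ 7 / 15), div_pow,
    hcs, sqrt_seven_fifteenths]
  have h1 : 0 < Real.sinh (Ω * t) ^ 2 + 1 := by positivity
  have h2 : 1 - 7 / 15 * (Real.sinh (Ω * t) ^ 2 / (Real.sinh (Ω * t) ^ 2 + 1)) =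
      (1 + 8 / 15 * Real.sinh (Ω * t) ^ 2) / (Real.sinh (Ω * t) ^ 2 + 1) := by
    field_simp
    ring
  rw [h2]
  field_simp

theorem hasDerivAt_arctan_tanh (Ω t : ℝ) :
    HasDerivAt (fun t => Real.arctan (√(3 / 5) * Real.tanh (Ω * t)))
      (3 / √15 * Ω / (1 + 8 / 5 * Real.sinh (Ω * t) ^ 2)) t := by
  have h15 : 0 < √(15 : ℝ) := by positivity
  refine ((hasDerivAt_tanh_mul Ω t).const_mul (√(3 / 5))).arctan.congr_deriv ?_
  have hc := Real.cosh_pos (Ω * t)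
  have hcs := Real.cosh_sq (Ω * t)
  rw [Real.tanh_eq_sinh_div_cosh, mul_pow, Real.sq_sqrt (by norm_num : (0 : ℝ) ≤ 3 / 5), div_pow,
    hcs, sqrt_three_fifths]
  have h1 : 0 < Real.sinh (Ω * t) ^ 2 + 1 := by positivity
  have h2 : 1 + 3 / 5 * (Real.sinh (Ω * t) ^ 2 / (Real.sinh (Ω * t) ^ 2 + 1)) =
      (1 + 8 / 5 * Real.sinh (Ω * t) ^ 2) / (Real.sinh (Ω * t) ^ 2 + 1) := by
    field_simp
    ring
  rw [h2]
  field_simp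

/-- The solution of the linear equation `F'' = 2 Ω ^ 2 (8 / 15 + 2 F)` that starts at rest at `0`. -/
theorem eq_sinh_of_hasDerivAt {F U : ℝ → ℝ} {Ω T : ℝ} (hΩ : 0 < Ω)
    (hF : ∀ t ∈ Set.Icc 0 T, HasDerivAt F (U t) t)
    (hU : ∀ t ∈ Set.Icc 0 T, HasDerivAt U (2 * Ω ^ 2 * (8 / 15 + 2 * F t)) t)
    (hF0 : F 0 = 0) (hU0 : U 0 = 0) : ∀ t ∈ Set.Icc 0 T,
      F t = 8 / 15 * Real.sinh (Ω * t) ^ 2 ∧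
      U t = 16 / 15 * Ω * (Real.sinh (Ω * t) * Real.cosh (Ω * t)) := by
  intro t ht
  have hs : ∀ τ, HasDerivAt (fun t => Real.sinh (Ω * t)) (Ω * Real.cosh (Ω * τ)) τ := fun τ => by
    refine (((hasDerivAt_id τ).const_mul Ω).sinh).congr_deriv ?_
    simp only [id]
    ring
  have hc : ∀ τ, HasDerivAt (fun t => Real.cosh (Ω * t)) (Ω * Real.sinh (Ω * τ)) τ := fun τ => by
    refine (((hasDerivAt_id τ).const_mul Ω).cosh).congr_deriv ?_
    simp only [id]
    ring
  have key : ∀ c : ℝ, c ^ 2 = 1 → U t - 16 / 15 * Ω * (Real.sinh (Ω * t) * Real.cosh (Ω * t)) +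
      2 * c * Ω * (F t - 8 / 15 * Real.sinh (Ω * t) ^ 2) = 0 := fun c hc1 => by
    have h := eq_of_hasDerivAt_zero_Icc (f := fun t =>
      (U t - 16 / 15 * Ω * (Real.sinh (Ω * t) * Real.cosh (Ω * t)) +
      2 * c * Ω * (F t - 8 / 15 * Real.sinh (Ω * t) ^ 2)) * Real.exp (-(2 * c * Ω * t)))
      (fun τ hτ => ?_) t ht
    · simp only [hF0, hU0, mul_zero, Real.sinh_zero, zero_mul, sub_zero] at h
      norm_num at h
      exact h
    · have h1 := ((hU τ hτ).sub (((hs τ).mul (hc τ)).const_mul (16 / 15 * Ω))).add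
        (((hF τ hτ).sub (((hs τ).pow 2).const_mul (8 / 15))).const_mul (2 * c * Ω))
      have h2 := (((hasDerivAt_id τ).const_mul (2 * c * Ω)).neg).exp
      refine (h1.mul h2).congr_deriv ?_
      have hcs := Real.cosh_sq (Ω * τ)
      simp only [Pi.mul_apply, Pi.add_apply, Pi.sub_apply, Pi.neg_apply, Pi.pow_apply, id]
      push_cast
      generalize Real.exp (-(2 * c * Ω * τ)) = e
      linear_combination (-(4 * Ω ^ 2 * e * (F τ - 8 / 15 * Real.sinh (Ω * τ) ^ 2))) * hc1 -
        (16 / 15 * Ω ^ 2 * e) * hcs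
  have h1 := key 1 (by norm_num)
  have h2 := key (-1) (by norm_num)
  have h3 : Ω * (F t - 8 / 15 * Real.sinh (Ω * t) ^ 2) = 0 := by linarith
  have h4 := (mul_eq_zero.1 h3).resolve_left hΩ.ne'
  exact ⟨by linarith, by nlinarith⟩


/-! ### The explicit solution -/

theorem rateΩ_eq (s N : ℝ) : rateΩ s N = √15 / 2 * ((s + 1) / (s + 5) * N) := by
  rw [rateΩ, mul_div_mul_comm, mul_assoc]

theorem sqrt_three_fifths_mul_rateΩ (s N : ℝ) :
    √(3 / 5) * rateΩ s N = 3 / 2 * ((s + 1) / (s + 5) * N) := by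
  have : 0 < √(15 : ℝ) := by positivity
  rw [rateΩ_eq, sqrt_three_fifths]
  field_simp

theorem hasDerivAt_phaseC (s N t : ℝ) {ν F : ℝ} (hν : (s + 1) / (s + 5) * N = ν)
    (hF : F = 8 / 15 * Real.sinh (rateΩ s N * t) ^ 2) :
    HasDerivAt (fun t => phaseC s N t) (-((s + 1) * ν * ((1 + 3 / 2 * F) / (1 + F)))) t := by
  have h15 : 0 < √(15 : ℝ) := by positivity
  have h := ((hasDerivAt_id t).const_mul (-√(3 / 5) * (s + 1) * rateΩ s N)).add
    ((hasDerivAt_artanh_tanh (rateΩ s N) t).const_mul (s + 1))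
  refine (h.congr_of_eventuallyEq (Eventually.of_forall fun τ => ?_)).congr_deriv ?_
  · simp only [phaseC, Pi.add_apply, id]
    ring
  · have h1 := sqrt_three_fifths_mul_rateΩ s N
    rw [hν] at h1
    have hF0 : 0 ≤ F := by rw [hF]; positivity
    rw [show -√(3 / 5) * (s + 1) * rateΩ s N = -(s + 1) * (√(3 / 5) * rateΩ s N) by ring, h1, ← hF,
      rateΩ_eq, hν]
    field_simp
    ring

/-- The derivative of the phase of `b`, written as a rational function of `F`. -/
theorem hasDerivAt_phaseB (s N t : ℝ) {ν F : ℝ} (hν : (s + 1) / (s + 5) * N = ν)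
    (hF : F = 8 / 15 * Real.sinh (rateΩ s N * t) ^ 2) : HasDerivAt (fun t => phaseB s N t)
      (-(ν * (5 + 15 * F + 9 * F ^ 2) / ((1 + F) * (1 + 3 * F)))) t := by
  have h15 : 0 < √(15 : ℝ) := by positivity
  have h := (((hasDerivAt_id t).const_mul (-2 * √(3 / 5) * rateΩ s N)).sub
    (hasDerivAt_artanh_tanh (rateΩ s N) t)).sub (hasDerivAt_arctan_tanh (rateΩ s N) t)
  refine (h.congr_of_eventuallyEq (Eventually.of_forall fun τ => ?_)).congr_deriv ?_
  · simp only [phaseB, Pi.sub_apply, id]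
  · have h1 := sqrt_three_fifths_mul_rateΩ s N
    rw [hν] at h1
    have hF0 : 0 ≤ F := by rw [hF]; positivity
    have h2 : 1 + 8 / 5 * Real.sinh (rateΩ s N * t) ^ 2 = 1 + 3 * F := by rw [hF]; ring
    rw [mul_assoc (-2 : ℝ), h1, h2, ← hF, rateΩ_eq, hν]
    field_simp
    ring

theorem phaseP_eq (s N t : ℝ) : phaseP s N t = -(Real.pi / 2 +
    Real.arctan (√(3 / 5) * Real.tanh (rateΩ s N * t)) + phaseB s N t - phaseC s N t) := by
  rw [phaseP, phaseB, phaseC]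
  ring

theorem phaseB_zero (s N : ℝ) : phaseB s N 0 = 0 := by simp [phaseB]

theorem phaseC_zero (s N : ℝ) : phaseC s N 0 = 0 := by simp [phaseC]

theorem explicit_potR {s : ℝ} (hs : 1 < s) {N E S : ℝ} (hE : E = 4 / (5 + s) * N)
    (hS : S = 2 * N * ((s - 1) * (2 + s) / (5 + s))) (F : ℝ) :
    potR s N E S F = -(3 * ((s + 1) / (s + 5) * N) * F) := by
  have h1 : s + 1 ≠ 0 := by linarith
  have h2 : s + 5 ≠ 0 := by linarith
  have h3 : 5 + s ≠ 0 := by linarith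
  rw [potR, hE, hS]
  field_simp
  ring

/-- For the two-mode data `V` degenerates to a quadratic polynomial. -/
theorem explicit_potential {s : ℝ} (hs : 1 < s) {N E S : ℝ} (hE : E = 4 / (5 + s) * N)
    (hS : S = 2 * N * ((s - 1) * (2 + s) / (5 + s))) (F : ℝ) :
    (potential s N E S).eval F = -4 * rateΩ s N ^ 2 * (8 / 15 + F) * F := by
  have h2 : s + 5 ≠ 0 := by linarith
  have h3 : 5 + s ≠ 0 := by linarith
  rw [potential_eval hs, explicit_potR hs hE hS, potL, hE, rateΩ_eq, mul_pow, div_pow,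
    Real.sq_sqrt (by norm_num)]
  field_simp
  ring

theorem explicit_potential_derivative {s : ℝ} (hs : 1 < s) {N E S : ℝ} (hE : E = 4 / (5 + s) * N)
    (hS : S = 2 * N * ((s - 1) * (2 + s) / (5 + s))) (F : ℝ) :
    (potential s N E S).derivative.eval F = -4 * rateΩ s N ^ 2 * (8 / 15 + 2 * F) := by
  have h := (potential s N E S).hasDerivAt F
  rw [show (fun x => (potential s N E S).eval x) = fun F => -4 * rateΩ s N ^ 2 * (8 / 15 + F) * F from
    funext (explicit_potential hs hE hS)] at h
  refine h.unique ((((hasDerivAt_id F).const_add (8 / 15)).const_mul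
    (-4 * rateΩ s N ^ 2)).mul (hasDerivAt_id F) |>.congr_deriv ?_)
  simp only [id]
  ring

theorem explicit_mem_Ioo {s : ℝ} (hs : 1 < s) {N E S : ℝ} (hN : 0 < N) (hE : E = 4 / (5 + s) * N)
    (hS : S = 2 * N * ((s - 1) * (2 + s) / (5 + s))) :
    (potential s N E S).eval (FCrit s) < 0 ∧ S ∈ Set.Ioo (SMinus s N E) (SPlus s N E) := by
  have h0 : 0 < s - 1 := by linarith
  have hF := FCrit_pos hs
  have hΩ : 0 < rateΩ s N := by
    rw [rateΩ]
    positivity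
  have hV : (potential s N E S).eval (FCrit s) < 0 := by
    rw [explicit_potential hs hE hS]
    have : 0 < 4 * rateΩ s N ^ 2 * (8 / 15 + FCrit s) * FCrit s := by positivity
    linarith
  have hE0 : 0 ≤ E := by
    rw [hE]
    positivity
  refine ⟨hV, (potential_sign hs N E S hE0 ?_).2.1 hV⟩
  rw [ECrit, hE, le_div_iff₀ h0, div_mul_eq_mul_div, div_mul_eq_mul_div, div_le_iff₀ (by linarith)]
  have : 0 < N * (2 * s ^ 2 + 6 * s + 4) := by positivity
  linarith

theorem gSeq_one_sq {s : ℝ} (hs : 1 < s) : gSeq s 1 ^ 2 = 2 / (s + 1) := by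
  have hA : fussCatalan s 1 = 1 := by
    have h1 : Real.Gamma (s + 1) ≠ 0 := (Real.Gamma_pos_of_pos (by linarith)).ne'
    rw [fussCatalan, Nat.cast_one, mul_one, mul_one, show s - 1 + 2 = s + 1 by ring,
      show (1 : ℝ) + 1 = 2 by norm_num, Real.Gamma_two, mul_one, div_self h1]
  have h2 : s + 1 ≠ 0 := by linarith
  rw [gSeq_sq hs, hA, Nat.cast_one]
  have h3 : (s - 1) / 2 * 1 + 1 = (s + 1) / 2 := by ring
  rw [h3, one_div_div]

namespace IsCoveringFlow

variable {s N E S T : ℝ} {χ : ℝ → ℝ} {b d q : ℝ → ℂ}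

/-- The motion of `F` for the two-mode initial data. -/
theorem explicit_F (hs : 1 < s) (h : IsCoveringFlow s N E S χ b d q) (hN : 0 < N)
    (hE : E = 4 / (5 + s) * N) (hS : S = 2 * N * ((s - 1) * (2 + s) / (5 + s))) (hq0 : q 0 = 0)
    (hle : ∀ t ∈ Set.Icc 0 T, ‖q t‖ ^ 2 ≤ FCrit s) : ∀ t ∈ Set.Icc 0 T,
      ‖q t‖ ^ 2 = 8 / 15 * Real.sinh (rateΩ s N * t) ^ 2 ∧
      smoothVelocity s (b t) (d t) (q t) =
        16 / 15 * rateΩ s N * (Real.sinh (rateΩ s N * t) * Real.cosh (rateΩ s N * t)) := by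
  have hΩ : 0 < rateΩ s N := by
    rw [rateΩ]
    have : 0 < s + 5 := by linarith
    positivity
  refine eq_sinh_of_hasDerivAt (F := fun t => ‖q t‖ ^ 2)
    (U := fun t => smoothVelocity s (b t) (d t) (q t)) hΩ
    (fun t ht => h.hasDerivAt_F (by linarith [hle t ht])) (fun t ht => ?_) (by simp [hq0])
    (by simp [smoothVelocity, phaseProd, hq0])
  refine (h.hasDerivAt_velocity hs (by linarith [hle t ht])).congr_deriv ?_
  rw [explicit_potential_derivative hs hE hS]
  ring

theorem explicit_norm_b_sq (hs : 1 < s) (h : IsCoveringFlow s N E S χ b d q)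
    (hE : E = 4 / (5 + s) * N) (t : ℝ) : ‖b t‖ ^ 2 =
      (s + 1) / (s + 5) * N * (1 + 3 * ‖q t‖ ^ 2) / (1 + ‖q t‖ ^ 2) := by
  have h2 : s + 5 ≠ 0 := by linarith
  have h3 : 5 + s ≠ 0 := by linarith
  rw [h.norm_b_sq, hE, add_comm (‖q t‖ ^ 2)]
  field_simp
  ring

theorem re_phaseProd (hs : 1 < s) (h : IsCoveringFlow s N E S χ b d q) (t : ℝ) :
    scaleK s * damp (q t) * (phaseProd (b t) (d t) (q t)).re =
      potR s N E S (‖q t‖ ^ 2) / (2 * (1 + ‖q t‖ ^ 2)) := by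
  have h1 := potR_smooth hs (b t) (d t) (q t)
  rw [h.energy t, h.number t, h.S_eq t] at h1
  rw [h1]
  field_simp

theorem im_phaseProd (t : ℝ) : scaleK s * damp (q t) * (phaseProd (b t) (d t) (q t)).im =
      smoothVelocity s (b t) (d t) (q t) / (2 * (1 + ‖q t‖ ^ 2)) := by
  rw [smoothVelocity]
  field_simp

/-- The modulus of `d` is constant and its logarithmic derivative is a function of `F`. The phase of `c`
is that of `d`. -/
theorem explicit_phase_d (hs : 1 < s) (h : IsCoveringFlow s N E S χ b d q) (hN : 0 < N)
    (hE : E = 4 / (5 + s) * N) (hS : S = 2 * N * ((s - 1) * (2 + s) / (5 + s))) (hq0 : q 0 = 0)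
    (hle : ∀ t ∈ Set.Icc 0 T, ‖q t‖ ^ 2 ≤ FCrit s) (hd0 : d 0 = ‖d 0‖) :
    ∀ t ∈ Set.Icc 0 T, d t = ‖d t‖ * Complex.exp (phaseC s N t * Complex.I) := by
  have hF := h.explicit_F hs hN hE hS hq0 hle
  refine eq_norm_mul_exp (ρ := fun _ => 0) (φ := phaseC s N) (ψ := fun t => -((s + 1) *
    ((s + 1) / (s + 5) * N) * ((1 + 3 / 2 * ‖q t‖ ^ 2) / (1 + ‖q t‖ ^ 2)))) (fun t ht => ?_)
    (fun t ht => hasDerivAt_phaseC s N t rfl (hF t ht).1) (fun t ht h0 => ?_) ?_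
  · refine (h.flow.deriv_d t).congr_deriv ?_
    have h1 : ‖b t‖ ^ 2 + scaleK s * damp (q t) * (phaseProd (b t) (d t) (q t)).re =
        (s + 1) / (s + 5) * N * ((1 + 3 / 2 * ‖q t‖ ^ 2) / (1 + ‖q t‖ ^ 2)) := by
      rw [h.explicit_norm_b_sq hs hE, h.re_phaseProd hs, explicit_potR hs hE hS]
      have h2 : s + 5 ≠ 0 := by linarith
      field_simp
      ring
    rw [h.cutoff t (by linarith [hle t ht]), smoothD, h1, mul_assoc (s + 1) ((s + 1) / (s + 5) * N)]
    push_cast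
    ring
  · have h1 := h.energy t
    rw [h0, norm_zero, hE] at h1
    have : 0 < 4 / (5 + s) * N := by
      have : 0 < 5 + s := by linarith
      positivity
    rw [← h1] at this
    norm_num at this
  · rw [phaseC_zero]
    simpa using hd0

theorem explicit_b_ne_zero (hs : 1 < s) (h : IsCoveringFlow s N E S χ b d q) (hN : 0 < N)
    (hE : E = 4 / (5 + s) * N) (t : ℝ) : b t ≠ 0 := by
  intro h0
  have h1 := h.explicit_norm_b_sq hs hE t
  rw [h0, norm_zero] at h1
  have : 0 < (s + 1) / (s + 5) * N * (1 + 3 * ‖q t‖ ^ 2) / (1 + ‖q t‖ ^ 2) := by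
    have : 0 < s + 5 := by linarith
    have : 0 < s + 1 := by linarith
    positivity
  rw [← h1] at this
  norm_num at this

/-- The logarithmic derivative of `b` has a real part, as `|b|` varies, and an imaginary part that is a
function of `F`. -/
theorem explicit_phase_b (hs : 1 < s) (h : IsCoveringFlow s N E S χ b d q) (hN : 0 < N)
    (hE : E = 4 / (5 + s) * N) (hS : S = 2 * N * ((s - 1) * (2 + s) / (5 + s))) (hq0 : q 0 = 0)
    (hle : ∀ t ∈ Set.Icc 0 T, ‖q t‖ ^ 2 ≤ FCrit s) (hb0 : b 0 = ‖b 0‖) :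
    ∀ t ∈ Set.Icc 0 T, b t = ‖b t‖ * Complex.exp (phaseB s N t * Complex.I) := by
  have hF := h.explicit_F hs hN hE hS hq0 hle
  refine eq_norm_mul_exp (ρ := fun t => smoothVelocity s (b t) (d t) (q t) /
      ((1 + ‖q t‖ ^ 2) * (1 + 3 * ‖q t‖ ^ 2))) (φ := phaseB s N) (ψ := fun t =>
      -((s + 1) / (s + 5) * N * (5 + 15 * ‖q t‖ ^ 2 + 9 * (‖q t‖ ^ 2) ^ 2) /
        ((1 + ‖q t‖ ^ 2) * (1 + 3 * ‖q t‖ ^ 2)))) (fun t ht => ?_)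
    (fun t ht => hasDerivAt_phaseB s N t rfl (hF t ht).1)
    (fun t _ => h.explicit_b_ne_zero hs hN hE t) ?_
  · refine (h.flow.deriv_b t).congr_deriv ?_
    have hs5 : 0 < s + 5 := by linarith
    have hs1 : 0 < s + 1 := by linarith
    have hX := h.explicit_norm_b_sq hs hE t
    have hre := h.re_phaseProd hs t
    have him := im_phaseProd (s := s) (b := b) (d := d) (q := q) t
    rw [explicit_potR hs hE hS] at hre
    set Y := scaleK s ^ 2 * damp (q t) ^ 2 * ‖d t‖ ^ 2 with hY
    have hYv : Y = 2 * ((s + 1) / (s + 5) * N) / (1 + ‖q t‖ ^ 2) := by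
      have h2 := damp_sq (q t)
      have hd2 : damp (q t) ^ 2 = 1 / (1 + ‖q t‖ ^ 2) := by
        rw [eq_div_iff (by positivity), h2]
      rw [hY, scaleK_sq hs, hd2, h.energy t, hE, add_comm 5 s]
      field_simp
      ring
    set u := scaleK s * damp (q t) * (phaseProd (b t) (d t) (q t)).re with hu
    set v := scaleK s * damp (q t) * (phaseProd (b t) (d t) (q t)).im with hv
    set ν := (s + 1) / (s + 5) * N
    have hν : 0 < ν := by positivity
    -- the product of the field with `|b| ^ 2` contains the cross term as a multiple of `b`
    have hfield : ((‖b t‖ ^ 2 : ℝ) : ℂ) * smoothB s (b t) (d t) (q t) =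
        ((‖b t‖ ^ 2 * (‖b t‖ ^ 2 + 2 * Y) + Y * u : ℝ) + (Y * v : ℝ) * Complex.I) * b t := by
      have h1 : ((phaseProd (b t) (d t) (q t)).re : ℂ) +
          (phaseProd (b t) (d t) (q t)).im * Complex.I =
          (starRingEnd ℂ) (b t) * d t * (starRingEnd ℂ) (q t) := Complex.re_add_im _
      rw [smoothB, hu, hv, hY]
      generalize (phaseProd (b t) (d t) (q t)).re = x at h1
      generalize (phaseProd (b t) (d t) (q t)).im = y at h1
      have h2 := Complex.conj_mul' (b t)
      push_cast
      linear_combination (-(scaleK s ^ 3 * damp (q t) ^ 3 * ‖d t‖ ^ 2 * b t : ℂ)) * h1 -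
        (scaleK s ^ 3 * damp (q t) ^ 3 * ‖d t‖ ^ 2 * d t * (starRingEnd ℂ) (q t) : ℂ) * h2
    have hX0 : ((‖b t‖ ^ 2 : ℝ) : ℂ) ≠ 0 := by
      have := norm_ne_zero_iff.2 (h.explicit_b_ne_zero hs hN hE t)
      exact_mod_cast pow_ne_zero 2 this
    have e1 : ‖b t‖ ^ 2 * (smoothVelocity s (b t) (d t) (q t) /
        ((1 + ‖q t‖ ^ 2) * (1 + 3 * ‖q t‖ ^ 2))) = Y * v := by
      rw [hX, hYv, him]
      field_simp
    have e2 : ‖b t‖ ^ 2 * (-(ν * (5 + 15 * ‖q t‖ ^ 2 + 9 * (‖q t‖ ^ 2) ^ 2) /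
        ((1 + ‖q t‖ ^ 2) * (1 + 3 * ‖q t‖ ^ 2)))) = -(‖b t‖ ^ 2 * (‖b t‖ ^ 2 + 2 * Y) + Y * u) := by
      rw [hX, hYv, hre]
      field_simp
      ring
    rw [h.cutoff t (by linarith [hle t ht])]
    refine mul_left_cancel₀ hX0 ?_
    have e1' := congrArg (fun x : ℝ => (x : ℂ)) e1
    have e2' := congrArg (fun x : ℝ => (x : ℂ)) e2
    simp only [Complex.ofReal_mul (‖b t‖ ^ 2), Complex.ofReal_neg] at e1' e2' ⊢
    rw [Complex.ofReal_one]
    have hI := Complex.I_mul_I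
    linear_combination (-Complex.I) * hfield - b t * e1' - (Complex.I * b t) * e2' -
      ((Y * v : ℝ) * b t) * hI
  · rw [phaseB_zero]
    simpa using hb0

/-- The phase of `q`, and so that of `p`, is read off from those of `b` and `d` and from the argument of
`conj b d conj q`, whose real and imaginary parts are known. At `t = 0`, where `q` vanishes, the
statement is trivial. -/
theorem explicit_phase_q (hs : 1 < s) (h : IsCoveringFlow s N E S χ b d q) (hN : 0 < N)
    (hE : E = 4 / (5 + s) * N) (hS : S = 2 * N * ((s - 1) * (2 + s) / (5 + s))) (hq0 : q 0 = 0)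
    (hle : ∀ t ∈ Set.Icc 0 T, ‖q t‖ ^ 2 ≤ FCrit s) (hb0 : b 0 = ‖b 0‖) (hd0 : d 0 = ‖d 0‖) :
    ∀ t ∈ Set.Icc 0 T, q t = ‖q t‖ * Complex.exp (phaseP s N t * Complex.I) := by
  intro t ht
  have hs5 : 0 < s + 5 := by linarith
  have hs1 : 0 < s + 1 := by linarith
  have hΩ : 0 < rateΩ s N := by
    rw [rateΩ]
    positivity
  obtain ⟨hF, hU⟩ := h.explicit_F hs hN hE hS hq0 hle t ht
  have hb := h.explicit_phase_b hs hN hE hS hq0 hle hb0 t ht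
  have hd := h.explicit_phase_d hs hN hE hS hq0 hle hd0 t ht
  have hre := h.re_phaseProd hs t
  have him := im_phaseProd (s := s) (b := b) (d := d) (q := q) t
  rw [explicit_potR hs hE hS] at hre
  have hκ := mul_pos (scaleK_pos hs) (damp_pos (q t))
  have hsinh : 0 ≤ Real.sinh (rateΩ s N * t) := Real.sinh_nonneg_iff.2 (by
    have := ht.1
    positivity)
  have hcosh := Real.cosh_pos (rateΩ s N * t)
  have hν := sqrt_three_fifths_mul_rateΩ s N
  generalize (s + 1) / (s + 5) * N = ν at hre hν
  -- the phase of the cross term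
  have hω := eq_norm_mul_exp_arctan (w := phaseProd (b t) (d t) (q t))
    (x := √(3 / 5) * Real.tanh (rateΩ s N * t)) (by
      refine nonneg_of_mul_nonneg_right (him.symm ▸ ?_) hκ
      rw [hU]
      positivity) (by
      refine mul_left_cancel₀ hκ.ne' ?_
      rw [hre, mul_neg, mul_left_comm (scaleK s * damp (q t)), him, hU, hF, Real.tanh_eq_sinh_div_cosh]
      field_simp
      linear_combination 16 * Real.sinh (rateΩ s N * t) ^ 2 * hν)
  have hb0' := norm_ne_zero_iff.2 (h.explicit_b_ne_zero hs hN hE t)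
  have hd0' : ‖d t‖ ≠ 0 := by
    intro h0
    have h1 := h.energy t
    rw [h0, hE] at h1
    have : 0 < 4 / (5 + s) * N := by
      have : 0 < 5 + s := by linarith
      positivity
    rw [← h1] at this
    norm_num at this
  have hn : ‖phaseProd (b t) (d t) (q t)‖ = ‖b t‖ * ‖d t‖ * ‖q t‖ := by
    simp [phaseProd]
  rw [hn] at hω
  have hexp : ∀ x : ℝ, (starRingEnd ℂ) (Complex.exp (x * Complex.I)) =
      Complex.exp (-(x * Complex.I)) := fun x => by
    rw [← Complex.exp_conj, map_mul, Complex.conj_ofReal, Complex.conj_I, mul_neg]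
  have hinv : ∀ z : ℂ, Complex.exp (-z) * Complex.exp z = 1 := fun z => by
    rw [← Complex.exp_add, neg_add_cancel, Complex.exp_zero]
  have hconj : (starRingEnd ℂ) (q t) = ‖q t‖ * Complex.exp (-(phaseP s N t * Complex.I)) := by
    have hbc : (starRingEnd ℂ) (b t) = ‖b t‖ * Complex.exp (-(phaseB s N t * Complex.I)) := by
      nth_rw 1 [hb]
      rw [map_mul, Complex.conj_ofReal, hexp]
    rw [phaseProd, hbc] at hω
    nth_rw 1 [hd] at hω
    have e : Complex.exp (-(phaseP s N t * Complex.I)) =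
        Complex.exp ((Real.pi / 2 + Real.arctan (√(3 / 5) * Real.tanh (rateΩ s N * t)) : ℝ) *
          Complex.I) * Complex.exp (phaseB s N t * Complex.I) *
          Complex.exp (-(phaseC s N t * Complex.I)) := by
      rw [← Complex.exp_add, ← Complex.exp_add, phaseP_eq]
      congr 1
      push_cast
      ring
    rw [e]
    have hbd : (‖b t‖ : ℂ) * ‖d t‖ ≠ 0 := by exact_mod_cast mul_ne_zero hb0' hd0'
    refine mul_left_cancel₀ hbd ?_
    have i1 := hinv (phaseB s N t * Complex.I)
    have i2 := hinv (phaseC s N t * Complex.I)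
    simp only [Complex.ofReal_mul] at hω
    linear_combination (Complex.exp (phaseB s N t * Complex.I) *
      Complex.exp (-(phaseC s N t * Complex.I))) * hω - ‖b t‖ * ‖d t‖ * (starRingEnd ℂ) (q t) *
      (Complex.exp (-(phaseC s N t * Complex.I)) * Complex.exp (phaseC s N t * Complex.I) * i1 + i2)
  have := congrArg (starRingEnd ℂ) hconj
  rw [Complex.conj_conj, map_mul, Complex.conj_ofReal, ← Complex.exp_conj, map_neg, map_mul,
    Complex.conj_ofReal, Complex.conj_I, mul_neg, neg_neg] at this
  exact this

end IsCoveringFlow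

/-- The explicit cascade that starts from two-mode initial data. -/
theorem explicit_cascade {s : ℝ} (hs : 1 < s) (N E S : ℝ) (hN : 0 < N) (hE : E = 4 / (5 + s) * N)
    (hS : S = 2 * N * ((s - 1) * (2 + s) / (5 + s))) :
    ∃ (α : ℝ → ℕ → ℂ) (b c p : ℝ → ℂ),
      IsMaximalSolution s (twoModeData s N) (explicitT s N) α ∧
      ReducedDynamics s N E S (Set.Ico 0 (explicitT s N)) α b c p ∧
      IsCascade s N E S (explicitT s N) α p ∧
      ∀ t ∈ Set.Ico 0 (explicitT s N),
        bigF s (p t) = 8 / 15 * Real.sinh (rateΩ s N * t) ^ 2 ∧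
        b t = ‖b t‖ * Complex.exp (phaseB s N t * Complex.I) ∧
        c t = ‖c t‖ * Complex.exp (phaseC s N t * Complex.I) ∧
        p t = ‖p t‖ * Complex.exp (phaseP s N t * Complex.I) := by
  have hs5 : 0 < s + 5 := by linarith
  have hs5' : 0 < 5 + s := by linarith
  have hs1 : 0 < s + 1 := by linarith
  have hΩ : 0 < rateΩ s N := by
    rw [rateΩ]
    positivity
  have hE0 : 0 < E := by
    rw [hE]
    positivity
  obtain ⟨b₀, hb₀⟩ : ∃ b₀ : ℝ, b₀ = √((s + 1) / (s + 5) * N) := ⟨_, rfl⟩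
  obtain ⟨c₀, hc₀⟩ : ∃ c₀ : ℝ, c₀ = √(4 * N / (s + 5)) / gSeq s 1 := ⟨_, rfl⟩
  have hb₀0 : 0 ≤ b₀ := by rw [hb₀]; positivity
  have hc₀0 : 0 ≤ c₀ := by
    have := gSeq_pos hs 1
    rw [hc₀]
    positivity
  have hb₀2 : ‖(b₀ : ℂ)‖ ^ 2 = (s + 1) / (s + 5) * N := by
    rw [Complex.norm_real, Real.norm_eq_abs, sq_abs, hb₀, Real.sq_sqrt (by positivity)]
  have hc₀2 : ‖(c₀ : ℂ)‖ ^ 2 = (s + 1) / 2 * E := by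
    rw [Complex.norm_real, Real.norm_eq_abs, sq_abs, hc₀, div_pow, Real.sq_sqrt (by positivity),
      gSeq_one_sq hs, hE, add_comm 5 s]
    field_simp
  have hdata : manifoldState s b₀ c₀ 0 = twoModeData s N := by
    funext n
    rcases n with _ | _ | n
    · simp [manifoldState, twoModeData, hb₀]
    · have := gSeq_pos hs 1
      have h1 : (gSeq s 1 : ℂ) ≠ 0 := by exact_mod_cast this.ne'
      simp only [manifoldState, twoModeData, zero_add, pow_zero, mul_one, hc₀]
      push_cast
      rw [mul_div_cancel₀ _ h1]
    · simp [manifoldState, twoModeData]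
  have hF0 : bigF s 0 = 0 := by simp [bigF, genF_zero]
  have hmN : manifoldNumber s b₀ c₀ 0 = N := by
    rw [manifoldNumber, hF0, hb₀2, hc₀2, hE, add_zero, Real.one_rpow, mul_zero, sub_zero,
      add_comm 5 s]
    field_simp
    ring
  have hmE : manifoldEnergy s c₀ 0 = E := by
    rw [manifoldEnergy, hF0, hc₀2, add_zero, Real.one_rpow]
    field_simp
  have hmS : quantityS s N E b₀ c₀ 0 = S := by
    rw [quantityS, hF0, hE, hS]
    simp
    field_simp
    ring
  obtain ⟨χ, b, d, q, h, hb, hc, hpq, hq⟩ := exists_coveringFlow hs 0 b₀ c₀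
    (show ‖(0 : ℂ)‖ ^ 2 < xCrit s by simpa using xCrit_pos hs) hmN hmE hmS
  have hq0 : q 0 = 0 := by
    rw [toP] at hpq
    refine (mul_eq_zero.1 hpq).resolve_left ?_
    exact_mod_cast (Real.rpow_pos_of_pos (damp_pos (q 0)) s).ne'
  have hb0 : b 0 = ‖b 0‖ := by
    rw [hb, Complex.norm_real, Real.norm_of_nonneg hb₀0]
  have hd0 : d 0 = ‖d 0‖ := by
    have h1 : d 0 = ((scaleK s)⁻¹ * c₀ : ℝ) := by
      have h2 : (scaleK s : ℂ) ≠ 0 := by exact_mod_cast (scaleK_pos hs).ne'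
      have h3 : damp 0 = 1 := by simp [damp]
      rw [toC, hq0, h3, Real.one_rpow, mul_one, mul_one] at hc
      rw [Complex.ofReal_mul, ← hc, Complex.ofReal_inv, inv_mul_cancel_left₀ h2]
    have h4 : 0 ≤ (scaleK s)⁻¹ * c₀ := by
      have := scaleK_pos hs
      positivity
    rw [h1, Complex.norm_real, Real.norm_of_nonneg h4]
  have hV := (explicit_mem_Ioo hs hN hE hS).1
  obtain ⟨T, hT0, hT, hlt⟩ := h.exists_first_time hs hE0 (Or.inl hV) hq
  have hle : ∀ t ∈ Set.Icc 0 T, ‖q t‖ ^ 2 ≤ FCrit s := fun t ht => by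
    rcases ht.2.eq_or_lt with h1 | h1
    · rw [h1, hT]
    · exact (hlt t ⟨ht.1, h1⟩).le
  have hF := h.explicit_F hs hN hE hS hq0 hle
  have hTe : T = explicitT s N := by
    have h1 := (hF T ⟨hT0.le, le_rfl⟩).1
    rw [hT] at h1
    have h2 : 0 ≤ Real.sinh (rateΩ s N * T) := Real.sinh_nonneg_iff.2 (by positivity)
    rw [explicitT, h1, show 15 / 8 * (8 / 15 * Real.sinh (rateΩ s N * T) ^ 2) =
      Real.sinh (rateΩ s N * T) ^ 2 by ring, Real.sqrt_sq h2, Real.arsinh_sinh]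
    field_simp
  have hinit := h.isMaximalSolution hs hT0 hT hlt
  rw [hb, hc, hpq, hdata] at hinit
  rw [← hTe]
  refine ⟨_, b, _, _, hinit, h.reducedDynamics hs hlt fun _ _ => rfl,
    h.isCascade hs hT0 hT hlt (Or.inl hV), fun t ht => ?_⟩
  have ht' : t ∈ Set.Icc 0 T := ⟨ht.1, ht.2.le⟩
  have hδ := damp_pos (q t)
  have hδ' := Real.rpow_pos_of_pos hδ s
  have hκ := scaleK_pos hs
  exact ⟨by rw [bigF_toP hs (hle t ht'), (hF t ht').1],
    h.explicit_phase_b hs hN hE hS hq0 hle hb0 t ht',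
    eq_norm_mul_exp_of_nonneg (by positivity) (h.explicit_phase_d hs hN hE hS hq0 hle hd0 t ht'),
    eq_norm_mul_exp_of_nonneg (by positivity)
      (h.explicit_phase_q hs hN hE hS hq0 hle hb0 hd0 t ht')⟩

end YHamiltonian

theorem mainTheorem2 (s : ℝ) (hs : 1 < s) :
    -- the critical value of the generating function
    YHamiltonian.genF s (YHamiltonian.xCrit s) = YHamiltonian.FCrit s ∧
    -- the manifold is invariant, and the dynamics in it is reduced to the motion of `F` in `V`
    (∀ (I : Set ℝ) (t₀ : ℝ) (α : ℝ → ℕ → ℂ) (b₀ c₀ p₀ : ℂ), I.OrdConnected → t₀ ∈ I →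
      YHamiltonian.IsStrongSolutionOn s α I → ‖p₀‖ ^ 2 < YHamiltonian.xCrit s →
      α t₀ = YHamiltonian.manifoldState s b₀ c₀ p₀ →
      ∃ b c p : ℝ → ℂ, b t₀ = b₀ ∧ c t₀ = c₀ ∧ p t₀ = p₀ ∧
        YHamiltonian.ReducedDynamics s
          (YHamiltonian.particleNumber (α t₀)) (YHamiltonian.energy (α t₀))
          (YHamiltonian.quantityS s (YHamiltonian.particleNumber (α t₀))
            (YHamiltonian.energy (α t₀)) b₀ c₀ p₀) I α b c p) ∧
    -- conversely, solutions of the reduced equations give solutions of the full system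
    (∀ (I : Set ℝ) (N E : ℝ) (b c p : ℝ → ℂ),
      (∀ t ∈ I, ‖p t‖ ^ 2 < YHamiltonian.xCrit s ∧
        YHamiltonian.particleNumber (YHamiltonian.manifoldState s (b t) (c t) (p t)) = N ∧
        YHamiltonian.energy (YHamiltonian.manifoldState s (b t) (c t) (p t)) = E) →
      YHamiltonian.ReducedEquations s N E I b c p →
      YHamiltonian.IsStrongSolutionOn s
        (fun t => YHamiltonian.manifoldState s (b t) (c t) (p t)) I) ∧
    -- the sign of `V(F_c)`
    (∀ N E S : ℝ, 0 ≤ E → E ≤ YHamiltonian.ECrit s N →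
      ((YHamiltonian.potential s N E S).eval (YHamiltonian.FCrit s) = 0 ↔
        S = YHamiltonian.SMinus s N E ∨ S = YHamiltonian.SPlus s N E) ∧
      ((YHamiltonian.potential s N E S).eval (YHamiltonian.FCrit s) < 0 ↔
        S ∈ Set.Ioo (YHamiltonian.SMinus s N E) (YHamiltonian.SPlus s N E))) ∧
    -- cascades in finite time, and their absence outside the stated range of `S`
    (∀ (b₀ c₀ p₀ : ℂ) (N E S : ℝ), ‖p₀‖ ^ 2 < YHamiltonian.xCrit s →
      N = YHamiltonian.particleNumber (YHamiltonian.manifoldState s b₀ c₀ p₀) →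
      E = YHamiltonian.energy (YHamiltonian.manifoldState s b₀ c₀ p₀) →
      S = YHamiltonian.quantityS s N E b₀ c₀ p₀ →
      (YHamiltonian.CascadeCondition s N E S →
        ∃ (T : ℝ) (α : ℝ → ℕ → ℂ) (b c p : ℝ → ℂ),
          YHamiltonian.IsMaximalSolution s (YHamiltonian.manifoldState s b₀ c₀ p₀) T α ∧
          YHamiltonian.ReducedDynamics s N E S (Set.Ico 0 T) α b c p ∧
          YHamiltonian.IsCascade s N E S T α p) ∧
      (¬ YHamiltonian.CascadeCondition s N E S →
        ∃ (α : ℝ → ℕ → ℂ) (b c p : ℝ → ℂ),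
          YHamiltonian.IsGlobalSolution s (YHamiltonian.manifoldState s b₀ c₀ p₀) α ∧
          YHamiltonian.ReducedDynamics s N E S (Set.Ici 0) α b c p ∧
          (∃ M : ℝ, M < YHamiltonian.FCrit s ∧ ∀ t : ℝ, 0 ≤ t → YHamiltonian.bigF s (p t) ≤ M) ∧
          ∀ ξ : ℝ, ∃ R : ℝ, ∀ t : ℝ, 0 ≤ t →
            Summable (YHamiltonian.sobolevTerm ξ (α t)) ∧ YHamiltonian.sobolev ξ (α t) ≤ R)) ∧
    -- the explicit solution for two-mode initial data
    (∀ N E S : ℝ, 0 < N → E = 4 / (5 + s) * N →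
      S = 2 * N * ((s - 1) * (2 + s) / (5 + s)) →
      (∀ F : ℝ, (YHamiltonian.potential s N E S).eval F =
        -4 * YHamiltonian.rateΩ s N ^ 2 * (8 / 15 + F) * F) ∧
      S ∈ Set.Ioo (YHamiltonian.SMinus s N E) (YHamiltonian.SPlus s N E) ∧
      ∃ (α : ℝ → ℕ → ℂ) (b c p : ℝ → ℂ),
        YHamiltonian.IsMaximalSolution s (YHamiltonian.twoModeData s N)
          (YHamiltonian.explicitT s N) α ∧
        YHamiltonian.ReducedDynamics s N E S (Set.Ico 0 (YHamiltonian.explicitT s N)) α b c p ∧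
        YHamiltonian.IsCascade s N E S (YHamiltonian.explicitT s N) α p ∧
        ∀ t ∈ Set.Ico 0 (YHamiltonian.explicitT s N),
          YHamiltonian.bigF s (p t) = 8 / 15 * Real.sinh (YHamiltonian.rateΩ s N * t) ^ 2 ∧
          b t = ‖b t‖ * Complex.exp (YHamiltonian.phaseB s N t * Complex.I) ∧
          c t = ‖c t‖ * Complex.exp (YHamiltonian.phaseC s N t * Complex.I) ∧
          p t = ‖p t‖ * Complex.exp (YHamiltonian.phaseP s N t * Complex.I)) := by
  refine ⟨YHamiltonian.genF_xCrit hs, YHamiltonian.exists_reducedDynamics hs,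
    YHamiltonian.isStrongSolutionOn_of_reducedEquations hs, YHamiltonian.potential_sign hs,
    YHamiltonian.cascade_dichotomy hs, fun N E S hN hE hS => ?_⟩
  exact ⟨YHamiltonian.explicit_potential hs hE hS, (YHamiltonian.explicit_mem_Ioo hs hN hE hS).2,
    YHamiltonian.explicit_cascade hs N E S hN hE hS⟩
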